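/- Let $\eta=\frac{1+\sqrt{-7}}{2}$, and let $\chi$ be the Hecke character of $\mathbb{Q}(\sqrt{-7})$ given by $\chi((a+b\eta))=\epsilon_{a,b}(a+b\eta)$ with $\epsilon_{a,b}=\left(\frac{a^3-2a^2b-ab^2+b^3}{7}\right)$ (Legendre symbol). For $n\ge 1$ let $L(s,\chi^{4n-3})$ be the entire continuation of $$\frac12\sum_{(a,b)\in\mathbb{Z}^2\setminus\{(0,0)\}}\frac{\chi((a+b\eta))^{4n-3}}{(a^2+ab+2b^2)^{s+(4n-3)/2}}\qquad(\Re s>1).$$ Let $\chi_{-7}(m)=\left(\frac m7\right)$, $X_n(\alpha)=\left(\frac{7}{2\pi}\right)^{-2\alpha}\frac{\Gamma(2n-1-\alpha)}{\Gamma(2n-1+\alpha)}$, and let $A(\alpha,\gamma)=\prod_p A_p(\alpha,\gamma)$, where $A_p(\alpha,\gamma)$ is $\frac{1-p^{-1-2\gamma}}{1-p^{-1-\alpha-\gamma}}$ times $$\frac{1-p^{-1-2\alpha}}{1-p^{-1-\alpha-\gamma}}\left(-\frac{2}{p^{1+\alpha+\gamma}}+1+\frac1{p^{1+2\gamma}}\right)\sum_{m\ge0}\frac1{p^{(1+2\alpha)m}}\quad\text{if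 }p\equiv1,2,4\bmod 7,$$ $$\frac{1+p^{-1-2\alpha}}{1+p^{-1-\alpha-\gamma}}\left(1+\frac1{p^{1+2\gamma}}\right)\sum_{m\ge0}\frac{(-1)^m}{p^{(1+2\alpha)m}}\quad\text{if }p\equiv3,5,6\bmod 7,$$ and times $1$ if $p=7$. Write $A'(r,r)=\frac{d}{d\alpha}A(\alpha,\gamma)\big|_{\alpha=\gamma=r}$, and put $$R(\alpha,\gamma)=\frac{\zeta(1+2\gamma)L(1+2\alpha,\chi_{-7})}{\zeta(1+\alpha+\gamma)L(1+\alpha+\gamma,\chi_{-7})}A(\alpha,\gamma),$$ with $1/\zeta(1)=0$. **Ratios conjecture (with parameter $a$).** For all $\varepsilon>0$ and $c>0$, as $N\to\infty$, $$\sum_{n=1}^N\frac{L(\frac12+\alpha,\chi^{4n-3})}{L(\frac12+\gamma,\chi^{4n-3})}=\sum_{n=1}^N\bigl(R(\alpha,\gamma)+X_n(\alpha)R(-\alpha,\gamma)\bigr)+O_{\varepsilon,c}(N^{1/2+\varepsilon}),$$ uniformly for $a<\Re\alpha<\frac14$, $\frac{c}{\log N}\le\Re\gamma<\frac14$ and $|\Im\alpha|,|\Im\gamma|\le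 N^{1-\varepsilon}$. **Theorem.** Assume the ratios conjecture for some $a\in[-\frac14,0]$ ($a=-\frac14$ is the full range). Let $f$ be even and holomorphic in the strip $|\Im z|<2$ and real on the real line, and suppose that for each $\sigma<2$ we have $f(x+iy)\ll_\sigma 1/(1+x^2)$ for all real $x$ and $|y|\le\sigma$. (1) Let $\gamma_n$ run, with multiplicity, over the (possibly complex) numbers such that $\frac12+i\gamma_n$ is a nontrivial zero of $L(s,\chi^{4n-3})$. Then $\sum_{\gamma_n}f(\gamma_n)$ converges absolutely, the integrand below is integrable over $\mathbb{R}$, and for every $\varepsilon>0$ $$\frac1N\sum_{n=1}^N\sum_{\gamma_n}f(\gamma_n)=\frac1{2\pi N}\int_{-\infty}^\infty f(t)\sum_{n=1}^N\Bigl(2\log\frac7{2\pi}+\frac{\Gamma'}{\Gamma}(2n-1+it)+\frac{\Gamma'}{\Gamma}(2n-1-it)$$ $$+2\Bigl(-\frac{\zeta'(1+2it)}{\zeta(1+2it)}+\frac{L'(1+2it,\chi_{-7})}{L(1+2it,\chi_{-7})}+A'(it,it)-X_n(it)\frac{\zeta(1+2it)L(1-2it,\chi_{-7})}{L(1,\chi_{-7})}A(-it,it)\Bigr)\Bigr)dt+O(N^{-1/2+\varepsilon}),$$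 with an implied constant that depends only on $f$ and $\varepsilon$. (2) Let $\gamma_n$ run, with multiplicity, over the real numbers such that $\frac12+i\gamma_n$ is a zero of $L(s,\chi^{4n-3})$. Then, for $N\ge2$, the inner sums below converge absolutely, and, with no restriction on the support of the Fourier transform of $f$, $$\lim_{N\to\infty}\frac1N\sum_{n=1}^N\sum_{\gamma_n}f\!\left(\frac{\gamma_n\log N}{\pi}\right)=\int_{-\infty}^\infty f(y)\left(1+\frac{\sin2\pi y}{2\pi y}\right)dy.$$ -/

import Mathlib

open Complex Filter Asymptotics MeasureTheory

instance factPrimeSeven : Fact (Nat.Prime 7) := ⟨by norm_num⟩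

namespace HeckeFamily

noncomputable section

/-! ### The Hecke characters of `ℚ(√-7)` and their `L`-functions -/

/-- `η = (1 + √-7) / 2`; the ring of integers of `ℚ(√-7)` is `{a + b η : a, b ∈ ℤ}`. -/
def eta : ℂ := (1 + Complex.I * (Real.sqrt 7 : ℂ)) / 2

/-- The norm of `a + b η`. -/
def normForm (v : ℤ × ℤ) : ℤ := v.1 ^ 2 + v.1 * v.2 + 2 * v.2 ^ 2

/-- The sign `ε_{a,b}`, which is `0` if `a + b η` is not prime to `√-7`. -/
def epsSign (v : ℤ × ℤ) : ℤ :=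
  legendreSym 7 (v.1 ^ 3 - 2 * v.1 ^ 2 * v.2 - v.1 * v.2 ^ 2 + v.2 ^ 3)

/-- The value `χ((a + b η)) = ε_{a,b} (a + b η)` of the Hecke character at a principal ideal. -/
def heckeChar (v : ℤ × ℤ) : ℂ := (epsSign v : ℂ) * ((v.1 : ℂ) + (v.2 : ℂ) * eta)

/-- The Dirichlet series of `L(s, χ^k)` in the analytic normalisation (center `1/2`), absolutely
convergent for `1 < re s`. Each ideal has two generators, hence the factor `1 / 2`; for `1 ≤ k` the
term at `(0, 0)` vanishes. -/
def heckeSeries (k : ℕ) (s : ℂ) : ℂ :=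
  (1 / 2) * ∑' v : ℤ × ℤ, heckeChar v ^ k / ((normForm v : ℂ) ^ (s + (k : ℂ) / 2))

/-- `F` is the entire continuation of the Dirichlet series of `L(s, χ^k)`. -/
def IsHeckeContinuation (k : ℕ) (F : ℂ → ℂ) : Prop :=
  Differentiable ℂ F ∧ ∀ s : ℂ, 1 < s.re → F s = heckeSeries k s

open Classical in
/-- `L(s, χ^k)`: the analytic continuation of the Dirichlet series to the whole plane. -/
def heckeL (k : ℕ) : ℂ → ℂ :=
  if h : ∃ F : ℂ → ℂ, IsHeckeContinuation k F then h.choose else heckeSeries k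

/-- The continuation is unique, so `heckeL k` is equal to any entire continuation of the series. -/
theorem heckeL_eq {k : ℕ} {F : ℂ → ℂ} (hF : IsHeckeContinuation k F) : heckeL k = F := by
  have h : ∃ F : ℂ → ℂ, IsHeckeContinuation k F := ⟨F, hF⟩
  have hc : IsHeckeContinuation k (heckeL k) := by
    unfold heckeL
    rw [dif_pos h]
    exact h.choose_spec
  have hopen : IsOpen {s : ℂ | 1 < s.re} := isOpen_lt continuous_const Complex.continuous_re
  have hev : heckeL k =ᶠ[nhds (2 : ℂ)] F := by
    filter_upwards [hopen.mem_nhds (show (1 : ℝ) < (2 : ℂ).re by norm_num)] with s hs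
    rw [hc.2 s hs, hF.2 s hs]
  exact AnalyticOnNhd.eq_of_eventuallyEq
    (fun z _ => hc.1.analyticAt z) (fun z _ => hF.1.analyticAt z) hev

/-- The `n`-th member `L(s, χ^{4n-3})` of the family, for `1 ≤ n`. -/
def familyL (n : ℕ) : ℂ → ℂ := heckeL (4 * n - 3)

/-! ### The main terms -/

/-- The character `χ_{-7}(n) = (n / 7)`. -/
def chiNegSeven : DirichletCharacter ℂ 7 :=
  (quadraticChar (ZMod 7)).ringHomComp (Int.castRingHom ℂ)

/-- `L(s, χ_{-7})`. -/
def dirichletL (s : ℂ) : ℂ := DirichletCharacter.LFunction chiNegSeven s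

/-- The meromorphic function `1 / ζ(s)`, with its value `0` at the pole `s = 1` of `ζ`. -/
def zetaInv (s : ℂ) : ℂ := if s = 1 then 0 else (riemannZeta s)⁻¹

/-- The local factor of `A(α, γ)` at the prime `p`. -/
def arithLocal (p : ℕ) (α γ : ℂ) : ℂ :=
  (1 - (p : ℂ) ^ (-(1 + 2 * γ))) / (1 - (p : ℂ) ^ (-(1 + α + γ))) *
    (if p % 7 = 1 ∨ p % 7 = 2 ∨ p % 7 = 4 then
      (1 - (p : ℂ) ^ (-(1 + 2 * α))) / (1 - (p : ℂ) ^ (-(1 + α + γ))) *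
        (-2 * (p : ℂ) ^ (-(1 + α + γ)) * (∑' m : ℕ, (p : ℂ) ^ (-((1 + 2 * α) * m))) +
          (1 + (p : ℂ) ^ (-(1 + 2 * γ))) * ∑' m : ℕ, (p : ℂ) ^ (-((1 + 2 * α) * m)))
    else if p % 7 = 3 ∨ p % 7 = 5 ∨ p % 7 = 6 then
      (1 + (p : ℂ) ^ (-(1 + 2 * α))) / (1 + (p : ℂ) ^ (-(1 + α + γ))) *
        ((1 + (p : ℂ) ^ (-(1 + 2 * γ))) *
          ∑' m : ℕ, (-1 : ℂ) ^ m * (p : ℂ) ^ (-((1 + 2 * α) * m)))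
    else 1)

/-- The arithmetic factor `A(α, γ)`, a convergent Euler product. -/
def arithA (α γ : ℂ) : ℂ := ∏' p : Nat.Primes, arithLocal p α γ

/-- `A'(r, r)`: the derivative of `A(α, γ)` with respect to `α` at `α = γ = r`. -/
def arithADiag (r : ℂ) : ℂ := deriv (fun α : ℂ => arithA α r) r

/-- The factor `X_{4n-3}(1/2 + α)` of the functional equation of `L(s, χ^{4n-3})`. -/
def gammaRatio (n : ℕ) (α : ℂ) : ℂ :=
  ((7 / (2 * Real.pi) : ℝ) : ℂ) ^ (-2 * α) *
    (Complex.Gamma (2 * n - 1 - α) / Complex.Gamma (2 * n - 1 + α))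

/-- The first main term of the averaged ratio; the second one has `-α` in place of `α`. -/
def ratioMain (α γ : ℂ) : ℂ :=
  riemannZeta (1 + 2 * γ) * dirichletL (1 + 2 * α) * zetaInv (1 + α + γ) /
    dirichletL (1 + α + γ) * arithA α γ

/-- The ratios conjecture for the family, for `a < re α < 1/4`, `1 / log N ≪ re γ < 1/4` and
`im α, im γ ≪ N^{1-ε}`. The implied constant in the error term depends only on `ε` and on the
implied constant `c` in the lower bound for `re γ`. -/
def RatiosConjecture (a : ℝ) : Prop :=
  ∀ ε : ℝ, 0 < ε → ∀ c : ℝ, 0 < c → ∃ C : ℝ, ∃ N₀ : ℕ, ∀ N : ℕ, N₀ ≤ N → ∀ α γ : ℂ,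
    a < α.re → α.re < 1 / 4 → c / Real.log N ≤ γ.re → γ.re < 1 / 4 →
    |α.im| ≤ (N : ℝ) ^ (1 - ε) → |γ.im| ≤ (N : ℝ) ^ (1 - ε) →
    ‖(∑ n ∈ Finset.Icc 1 N, familyL n (1 / 2 + α) / familyL n (1 / 2 + γ)) -
        ∑ n ∈ Finset.Icc 1 N, (ratioMain α γ + gammaRatio n α * ratioMain (-α) γ)‖
      ≤ C * (N : ℝ) ^ (1 / 2 + ε)

/-- The function of `t` that stands next to `f(t)` in the `n`-th term of the one-level density. -/
def densityTerm (n : ℕ) (t : ℝ) : ℂ :=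
  2 * Real.log (7 / (2 * Real.pi)) +
    Complex.digamma (2 * n - 1 + Complex.I * t) + Complex.digamma (2 * n - 1 - Complex.I * t) +
    2 * (-(deriv riemannZeta (1 + 2 * Complex.I * t) / riemannZeta (1 + 2 * Complex.I * t)) +
      deriv dirichletL (1 + 2 * Complex.I * t) / dirichletL (1 + 2 * Complex.I * t) +
      arithADiag (Complex.I * t) -
      gammaRatio n (Complex.I * t) *
        (riemannZeta (1 + 2 * Complex.I * t) * dirichletL (1 - 2 * Complex.I * t) /
          dirichletL 1) * arithA (-(Complex.I * t)) (Complex.I * t))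

/-! ### Zeros -/

/-- The `γ` such that `1/2 + iγ` is a nontrivial zero of `L(s, χ^{4n-3})`, that is, a zero with
`0 ≤ re s ≤ 1` (there are none on the boundary, and the trivial zeros have `re s < 0`). They are complex numbers, real if and only if the zero is on the critical line. -/
def ordinates (n : ℕ) : Set ℂ :=
  {γ : ℂ | |γ.im| ≤ 1 / 2 ∧ familyL n (1 / 2 + Complex.I * γ) = 0}

/-- The real ordinates: those of the zeros on the critical line. -/
def realOrdinates (n : ℕ) : Set ℝ := {γ : ℝ | (γ : ℂ) ∈ ordinates n}

/-- The multiplicity of the zero `1/2 + iγ`. -/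
def zeroMult (n : ℕ) (γ : ℂ) : ℕ := analyticOrderNatAt (familyL n) (1 / 2 + Complex.I * γ)

end

end HeckeFamily

namespace HeckeFamily

open scoped Real
open Real (exp_le_exp mul_rpow rpow_le_rpow rpow_natCast rpow_sub rpow_neg rpow_le_rpow_of_nonpos
  rpow_le_rpow_of_exponent_le rpow_add norm_eq_abs rpow_two rpow_one pi_ne_zero pi_pos sqrt_sq
  sq_sqrt exp_pos zero_rpow rpow_mul rpow_nonneg log_le_rpow_div pi_gt_three Gamma_pos_of_pos
  log_nonneg log_le_log one_le_rpow rpow_zero pi_lt_d2 tendsto_log_atTop)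
open Finset (prod_ne_zero_iff mem_insert sum_congr sum_mul sum_map sum_sub_distrib mul_sum
  sum_add_distrib Icc mem_Icc sum_const range sum_range_succ)
open Set (mem_ofPred_eq Ioi)
open Nat (succ_pos card_Icc Primes succ_ne_zero)
open Metric (ball isOpen_ball mem_ball closedBall mem_closedBall)
open Function (comp_apply Embedding Injective)
open DirichletCharacter (LFunction_eq_LSeries LFunction differentiableAt_LFunction
  LFunctionTrivChar LFunctionTrivChar₁ LFunction_modOne_eq)
open Summable (of_nonneg_of_le of_norm_bounded tsum_finsetSum)
local notation "ln" => Real.log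
local notation "ordAt" => analyticOrderNatAt

noncomputable section

lemma isOpen_lt_re (a : ℝ) : IsOpen {z : ℂ | a < z.re} := isOpen_lt continuous_const continuous_re

/-! ### The logarithmic derivative of an even entire function of order less than two -/

lemma exists_eq_pow_mul_of_analyticOrderAt {f : ℂ → ℂ} (hf : Differentiable ℂ f) (ρ : ℂ) (n : ℕ)
    (hn : analyticOrderAt f ρ = n) :
    ∃ g : ℂ → ℂ, Differentiable ℂ g ∧ (∀ z, f z = (z - ρ) ^ n * g z) ∧ g ρ ≠ 0 := by
  obtain ⟨g, hg, hg0, hge⟩ := (hf.analyticAt ρ).analyticOrderAt_eq_natCast.1 hn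
  set G := Function.update (fun z => f z / (z - ρ) ^ n) ρ (g ρ) with hG
  have h0 : ∀ z, z ≠ ρ → (z - ρ) ^ n ≠ 0 := fun z h => pow_ne_zero _ (sub_ne_zero.2 h)
  have h1 : ∀ z, z ≠ ρ → G z = f z / (z - ρ) ^ n := fun z h => by simp [hG, h]
  have hGρ : G ρ = g ρ := by simp [hG]
  refine ⟨G, fun z => ?_, fun z => ?_, by rwa [hGρ]⟩ <;> rcases eq_or_ne z ρ with rfl | h
  · refine hg.differentiableAt.congr_of_eventuallyEq ?_
    filter_upwards [hge] with w hw
    rcases eq_or_ne w z with rfl | h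
    · exact hGρ
    · rw [h1 w h, hw, smul_eq_mul, mul_div_cancel_left₀ _ (h0 w h)]
  · refine ((hf z).fun_div (by fun_prop : DifferentiableAt ℂ (fun z => (z - ρ) ^ n) z)
      (h0 z h)).congr_of_eventuallyEq ?_
    filter_upwards [isOpen_ne.mem_nhds h] with w hw using h1 w hw
  · rw [hGρ]; exact hge.self_of_nhds
  · rw [h1 z h, mul_div_cancel₀ _ (h0 z h)]

lemma analyticOrderAt_ne_top_of_entire {f : ℂ → ℂ} (hf : Differentiable ℂ f) {z₀ : ℂ}
    (h0 : f z₀ ≠ 0) (ρ : ℂ) : analyticOrderAt f ρ ≠ ⊤ := fun h =>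
  h0 (congrFun (AnalyticOnNhd.eq_of_eventuallyEq (g := fun _ => 0) (fun z _ => hf.analyticAt z)
    (fun z _ => analyticAt_const) (analyticOrderAt_eq_top.1 h)) z₀)

lemma exists_eq_prod_mul_of_entire {f : ℂ → ℂ} (hf : Differentiable ℂ f) {z₀ : ℂ}
    (h0 : f z₀ ≠ 0) (S : Finset ℂ) :
    ∃ g : ℂ → ℂ, Differentiable ℂ g ∧
      (∀ z, f z = (∏ ρ ∈ S, (z - ρ) ^ ordAt f ρ) * g z) ∧ ∀ ρ ∈ S, g ρ ≠ 0 := by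
  classical
  induction S using Finset.induction_on with
  | empty => exact ⟨f, hf, by simp, by simp⟩
  | insert a S ha ih =>
    obtain ⟨g, hg, hge, hgS⟩ := ih
    have hg0 : g z₀ ≠ 0 := fun h => h0 (by rw [hge, h, mul_zero])
    have hP : AnalyticAt ℂ (fun z => ∏ ρ ∈ S, (z - ρ) ^ ordAt f ρ) a := by
      apply Differentiable.analyticAt
      fun_prop
    have hPa : (∏ ρ ∈ S, (a - ρ) ^ ordAt f ρ) ≠ 0 := by
      rw [prod_ne_zero_iff]
      intro ρ hρ
      refine pow_ne_zero _ (sub_ne_zero.2 ?_)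
      rintro rfl
      exact ha hρ
    have hord : analyticOrderAt f a = analyticOrderAt g a := by
      have h1 : f = (fun z => ∏ ρ ∈ S, (z - ρ) ^ ordAt f ρ) * g := funext hge
      conv_lhs => rw [h1]
      rw [analyticOrderAt_mul hP (hg.analyticAt a), hP.analyticOrderAt_eq_zero.2 hPa, zero_add]
    have hfin := analyticOrderAt_ne_top_of_entire hf h0 a
    have hn : analyticOrderAt g a = (ordAt f a : ℕ) := by
      rw [← hord, analyticOrderNatAt, ENat.natCast_toNat hfin]
    obtain ⟨g', hg', hge', hga⟩ := exists_eq_pow_mul_of_analyticOrderAt hg a _ hn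
    refine ⟨g', hg', fun z => ?_, fun ρ hρ => ?_⟩
    · rw [Finset.prod_insert ha, hge z, hge' z]; ring
    · rcases mem_insert.1 hρ with rfl | hρ
      · exact hga
      · intro h
        exact hgS ρ hρ (by rw [hge', h, mul_zero])

/-- The zeros of a nonzero entire function in a closed ball. -/
lemma finite_zeros_closedBall {f : ℂ → ℂ} (hf : Differentiable ℂ f) {z₀ : ℂ}
    (h0 : f z₀ ≠ 0) (R : ℝ) : {ρ : ℂ | f ρ = 0 ∧ ‖ρ‖ ≤ R}.Finite := by
  by_contra hinf
  obtain ⟨x, -, hx⟩ := Set.Infinite.exists_accPt_of_subset_isCompact hinf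
    (isCompact_closedBall (0 : ℂ) R) fun ρ hρ => by simpa using hρ.2
  exact h0 (congrFun (AnalyticOnNhd.eq_of_frequently_eq (g := fun _ => 0)
    (fun z _ => hf.analyticAt z) (fun z _ => analyticAt_const)
    ((accPt_iff_frequently_nhdsNE.1 hx).mono fun z hz => hz.1)) z₀)

lemma deriv_logDeriv_bound_of_nonvanishing {g : ℂ → ℂ} (hg : Differentiable ℂ g) {z₀ : ℂ}
    {r M : ℝ} (hr : 0 < r) (hM : 0 < M) (hne : ∀ z ∈ ball z₀ r, g z ≠ 0)
    (hbd : ∀ z ∈ ball z₀ r, ‖g z‖ ≤ Real.exp M * ‖g z₀‖) :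
    ∀ z ∈ ball z₀ (r / 8), ‖deriv (logDeriv g) z‖ ≤ 256 * M / r ^ 2 := by
  have hld : DifferentiableOn ℂ (logDeriv g) (ball z₀ r) := fun z hz =>
    ((hg.analyticAt z).deriv.differentiableAt.div (hg z) (hne z hz)).differentiableWithinAt
  obtain ⟨H, hH0, hH⟩ := hld.isExactOn_ball.with_val_at z₀ 0
  have hz₀ : z₀ ∈ ball z₀ r := Metric.mem_ball_self hr
  have hexp : ∀ z ∈ ball z₀ r, g z = g z₀ * exp (H z) := by
    have hc : ∀ z ∈ ball z₀ r, HasDerivAt (fun z => g z * exp (-H z)) 0 z := by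
      intro z hz
      refine ((hg z).hasDerivAt.mul ((hH z hz).neg.cexp)).congr_deriv ?_
      simp only [logDeriv_apply]
      field_simp [hne z hz]
      ring
    intro z hz
    have := (convex_ball z₀ r).is_const_of_fderivWithin_eq_zero (𝕜 := ℂ)
      (f := fun z => g z * exp (-H z))
      (fun z hz => (hc z hz).differentiableAt.differentiableWithinAt)
      (fun z hz => by
        rw [fderivWithin_of_isOpen isOpen_ball hz]
        ext; simp [(hc z hz).deriv]) hz hz₀
    simp only [hH0, neg_zero, exp_zero, mul_one] at this
    rw [← this, mul_assoc, ← exp_add]; simp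
  have hmem : ∀ w ∈ ball (0 : ℂ) r, w + z₀ ∈ ball z₀ r := fun w hw => by
    simpa [dist_eq_norm] using hw
  have hHbd : ∀ z, ‖z - z₀‖ ≤ r / 2 → ‖H z‖ ≤ 2 * M := by
    intro z hz
    have := borelCaratheodory_zero (f := fun w => H (w + z₀)) (R := r) (z := z - z₀) hM
      (fun w hw => ((hH _ (hmem w hw)).differentiableAt.comp w
        (by fun_prop)).differentiableWithinAt)
      (fun w hw => by
        have h1 := hbd _ (hmem w hw)
        rw [hexp _ (hmem w hw), norm_mul, mul_comm] at h1
        have h2 := le_of_mul_le_mul_right h1 (norm_pos_iff.2 (hne z₀ hz₀))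
        rw [norm_exp] at h2; exact exp_le_exp.1 h2) hr (by simpa using (by linarith : ‖z - z₀‖ < r))
      (by simpa using hH0)
    rw [sub_add_cancel] at this
    refine this.trans ((div_le_iff₀ (by linarith)).2 ?_)
    nlinarith
  intro z hz
  rw [mem_ball, dist_eq_norm] at hz
  have hsub : ∀ w ∈ closedBall z (r / 8), ‖w - z₀‖ ≤ r / 4 := fun w hw => by
    rw [mem_closedBall, dist_eq_norm] at hw; linarith [norm_sub_le_norm_sub_add_norm_sub w z z₀]
  have h1 : deriv (logDeriv g) z = iteratedDeriv 2 H z := by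
    rw [iteratedDeriv_succ, iteratedDeriv_one]
    refine EventuallyEq.deriv_eq ?_
    filter_upwards [isOpen_ball.mem_nhds (show z ∈ ball z₀ r by
      rw [mem_ball, dist_eq_norm]; linarith)] with w hw using (hH w hw).deriv.symm
  have h2 := norm_iteratedDeriv_le_of_forall_mem_sphere_norm_le (f := H) (c := z) (R := r / 8)
    (C := 2 * M) 2 (by positivity) (DifferentiableOn.diffContOnCl fun w hw =>
      (hH w (by
        have := hsub w (Metric.closure_ball_subset_closedBall hw)
        rw [mem_ball, dist_eq_norm]; linarith)).differentiableAt.differentiableWithinAt)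
    fun w hw => hHbd w ((hsub w (Metric.sphere_subset_closedBall hw)).trans (by linarith))
  rw [h1]
  refine h2.trans (le_of_eq ?_)
  rw [Nat.factorial_two]; field_simp; norm_num

lemma analyticOrderAt_neg_of_even {f : ℂ → ℂ}
    (heven : ∀ z, f (-z) = f z) (ρ : ℂ) : analyticOrderAt f (-ρ) = analyticOrderAt f ρ := by
  have h1 : f = f ∘ (fun z : ℂ => -z) := by ext z; simp [heven]
  conv_rhs => rw [h1]
  have hder : deriv (fun z : ℂ => -z) ρ ≠ 0 := by simp
  rw [analyticOrderAt_comp_of_deriv_ne_zero (by fun_prop) hder]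

lemma logDeriv_eq_sum_add {f g : ℂ → ℂ} (hg : Differentiable ℂ g) {S : Finset ℂ} {m : ℂ → ℕ}
    (hfg : ∀ z, f z = (∏ ρ ∈ S, (z - ρ) ^ m ρ) * g z) {z : ℂ} (hz : f z ≠ 0) :
    logDeriv f z = ∑ ρ ∈ S, (m ρ : ℂ) * (z - ρ)⁻¹ + logDeriv g z := by
  have h1 : f = fun z => (∏ ρ ∈ S, (z - ρ) ^ m ρ) * g z := funext hfg
  have hz' := hz
  rw [hfg z] at hz
  have hP := left_ne_zero_of_mul hz
  conv_lhs => rw [h1]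
  rw [logDeriv_mul z hP (right_ne_zero_of_mul hz) (by fun_prop) (hg z)]
  congr 1
  rw [prod_ne_zero_iff] at hP
  have hprod := logDeriv_prod (s := S) (f := fun ρ z => (z - ρ) ^ m ρ) (x := z) hP
    (by intro i hi; fun_prop)
  rw [hprod]
  refine sum_congr rfl fun ρ hρ => ?_
  have : logDeriv (fun z : ℂ => (z - ρ) ^ m ρ) z = m ρ * logDeriv (fun z : ℂ => z - ρ) z :=
    logDeriv_fun_pow (f := fun z : ℂ => z - ρ) (by fun_prop) (m ρ)
  rw [this, logDeriv_apply]; simp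

/-- An even entire function of order less than two, with zeros in the strip `|re z| ≤ 1 / 2`. -/
structure EvenEntire (f : ℂ → ℂ) : Prop where
  diff : Differentiable ℂ f
  even : ∀ z, f (-z) = f z
  growth : ∃ A : ℝ, ∀ z, ‖f z‖ ≤ Real.exp (A * (1 + ‖z‖) ^ (3 / 2 : ℝ))
  strip : ∀ ρ, f ρ = 0 → |ρ.re| ≤ 1 / 2

variable {f : ℂ → ℂ}

lemma EvenEntire.ne_zero (hf : EvenEntire f) {z : ℂ} (hz : 1 / 2 < z.re) : f z ≠ 0 := fun h =>
  ((hf.strip z h).trans_lt (hz.trans_le (le_abs_self _))).false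

lemma EvenEntire.two_ne_zero (hf : EvenEntire f) : f 2 ≠ 0 := hf.ne_zero (by norm_num)

/-- The zeros of `f` of norm at most `R`. -/
def EvenEntire.zeros (hf : EvenEntire f) (R : ℝ) : Finset ℂ :=
  (finite_zeros_closedBall hf.diff hf.two_ne_zero R).toFinset

lemma EvenEntire.mem_zeros (hf : EvenEntire f) {R : ℝ} {ρ : ℂ} :
    ρ ∈ hf.zeros R ↔ f ρ = 0 ∧ ‖ρ‖ ≤ R := by
  simp [EvenEntire.zeros]

lemma EvenEntire.sum_zeros_neg (hf : EvenEntire f) (R : ℝ) (g : ℂ → ℂ) :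
    ∑ ρ ∈ hf.zeros R, (ordAt f ρ : ℂ) * g (-ρ) =
      ∑ ρ ∈ hf.zeros R, (ordAt f ρ : ℂ) * g ρ := by
  have h : ∀ ρ ∈ hf.zeros R, -ρ ∈ hf.zeros R := fun ρ hρ => by
    simpa [hf.mem_zeros, hf.even] using hρ
  refine Finset.sum_nbij' (fun ρ => -ρ) (fun ρ => -ρ) h h (by simp) (by simp) fun ρ _ => ?_
  simp only [analyticOrderNatAt, analyticOrderAt_neg_of_even hf.even]

lemma EvenEntire.tendsto_sum_zeros (hf : EvenEntire f) {z : ℂ} (hz : f z ≠ 0) :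
    Tendsto (fun R : ℝ => ∑ ρ ∈ hf.zeros R, (ordAt f ρ : ℂ) * (z - ρ)⁻¹) atTop
      (nhds (logDeriv f z)) := by
  obtain ⟨A, hgrow⟩ := hf.growth
  have h0 := hf.two_ne_zero
  rw [tendsto_iff_norm_sub_tendsto_zero]
  set K : ℝ := |A| + |ln ‖f 2‖| + 1 with hK
  have key : ∀ᶠ R : ℝ in atTop, ‖(∑ ρ ∈ hf.zeros R, (ordAt f ρ : ℂ) * (z - ρ)⁻¹) - logDeriv f z‖ ≤
        1024 * K * 4 ^ (3 / 2 : ℝ) * ‖z‖ * R ^ (-(1 / 2) : ℝ) := by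
    filter_upwards [eventually_gt_atTop (16 * (‖z‖ + 2))] with R hR
    have hz0 := norm_nonneg z
    have hR0 : 0 < R := by linarith
    have h2 : ‖(2 : ℂ)‖ = 2 := by simp
    set B := K * (4 * R) ^ (3 / 2 : ℝ) with hB
    have hBpos : 0 < B := by positivity
    obtain ⟨g, hg, hfg, hgS⟩ := exists_eq_prod_mul_of_entire hf.diff h0 (hf.zeros R)
    have hnear : ∀ w ∈ ball (2 : ℂ) (R / 2), ‖w‖ ≤ R := fun w hw => by
      rw [mem_ball, dist_eq_norm] at hw; linarith [norm_sub_norm_le w 2]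
    have hgne : ∀ w ∈ ball (2 : ℂ) (R / 2), g w ≠ 0 := fun w hw h =>
      hgS w (hf.mem_zeros.2 ⟨by rw [hfg, h, mul_zero], hnear w hw⟩) h
    have hbd : ∀ w ∈ ball (2 : ℂ) (R / 2), ‖g w‖ ≤ Real.exp B * ‖g 2‖ := by
      intro w hw
      refine norm_le_of_forall_mem_frontier_norm_le (U := ball 0 (3 * R))
        Metric.isBounded_ball hg.diffContOnCl (fun w hw => ?_) (subset_closure (by
          rw [mem_ball_zero_iff]; linarith [hnear w hw]))
      rw [frontier_ball _ (by positivity), mem_sphere_zero_iff_norm] at hw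
      have hP : ‖∏ ρ ∈ hf.zeros R, (2 - ρ) ^ ordAt f ρ‖ ≤
          ‖∏ ρ ∈ hf.zeros R, (w - ρ) ^ ordAt f ρ‖ := by
        rw [norm_prod, norm_prod]
        refine Finset.prod_le_prod (fun _ _ => norm_nonneg _) fun ρ hρ => ?_
        rw [norm_pow, norm_pow]
        refine pow_le_pow_left₀ (norm_nonneg _) ?_ _
        linarith [(hf.mem_zeros.1 hρ).2, norm_sub_norm_le w ρ, norm_sub_le 2 ρ]
      have h1 : ‖f w‖ ≤ Real.exp B * ‖f 2‖ := by
        refine (hgrow w).trans ?_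
        rw [← Real.exp_log (norm_pos_iff.2 h0), ← Real.exp_add, exp_le_exp, hw]
        have h3 : A * (1 + 3 * R) ^ (3 / 2 : ℝ) ≤ |A| * (4 * R) ^ (3 / 2 : ℝ) := by
          gcongr
          · exact le_abs_self A
          · linarith
        have h4 : 1 ≤ (4 * R) ^ (3 / 2 : ℝ) := one_le_rpow (by linarith) (by norm_num)
        rw [hB, hK]
        nlinarith [neg_abs_le (ln ‖f 2‖), abs_nonneg (ln ‖f 2‖)]
      have hf2 := hfg 2
      rw [hfg w, hf2, norm_mul, norm_mul] at h1
      refine le_of_mul_le_mul_left ((mul_le_mul_of_nonneg_right hP (norm_nonneg _)).trans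
        (h1.trans_eq (by ring))) (norm_pos_iff.2 fun h => h0 (by rw [hf2, h, zero_mul]))
    have hder := deriv_logDeriv_bound_of_nonvanishing hg (by positivity) hBpos hgne hbd
    have hmv := (convex_ball 2 (R / 2 / 8)).norm_image_sub_le_of_norm_deriv_le (f := logDeriv g)
      (fun w hw => (hg.analyticAt w).deriv.differentiableAt.div (hg w)
        (hgne w (Metric.ball_subset_ball (by linarith) hw))) hder
      (x := -z) (y := z) (by rw [mem_ball, dist_eq_norm]; linarith [norm_sub_le (-z) 2, norm_neg z])
      (by rw [mem_ball, dist_eq_norm]; linarith [norm_sub_le z 2])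
    have e1 := logDeriv_eq_sum_add hg hfg hz
    have e2 := logDeriv_eq_sum_add hg hfg (z := -z) (by rwa [hf.even])
    have hodd : logDeriv f (-z) = -logDeriv f z := by
      have h := deriv_comp_neg f z
      rw [funext hf.even] at h; rw [logDeriv_apply, logDeriv_apply, hf.even, h, neg_div, neg_neg]
    have hsodd : ∑ ρ ∈ hf.zeros R, (ordAt f ρ : ℂ) * (-z - ρ)⁻¹ =
        -∑ ρ ∈ hf.zeros R, (ordAt f ρ : ℂ) * (z - ρ)⁻¹ := by
      rw [← hf.sum_zeros_neg, ← Finset.sum_neg_distrib]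
      refine sum_congr rfl fun ρ _ => ?_
      rw [← mul_neg, ← inv_neg]
      congr 2; ring
    rw [hodd, hsodd] at e2
    rw [show z - -z = 2 * z by ring, norm_mul, h2] at hmv
    rw [show (∑ ρ ∈ hf.zeros R, (ordAt f ρ : ℂ) * (z - ρ)⁻¹) - logDeriv f z =
      -(1 / 2) * (logDeriv g z - logDeriv g (-z)) by
        linear_combination (-1 / 2) * e1 + (1 / 2) * e2, norm_mul]
    have e3 : R ^ (-(1 / 2) : ℝ) = R ^ (3 / 2 : ℝ) / R ^ 2 := by
      rw [← rpow_natCast, ← rpow_sub hR0]; norm_num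
    calc _ ≤ ‖(-(1 / 2) : ℂ)‖ * (256 * B / (R / 2) ^ 2 * (2 * ‖z‖)) := by gcongr
      _ = _ := by
        rw [hB, e3, mul_rpow (by norm_num) hR0.le, norm_neg, norm_div, h2, norm_one]
        field_simp; ring
  refine squeeze_zero' (Eventually.of_forall fun _ => norm_nonneg _) key ?_
  simpa using (tendsto_rpow_neg_atTop (by norm_num : (0 : ℝ) < 1 / 2)).const_mul
    (1024 * K * 4 ^ (3 / 2 : ℝ) * ‖z‖)

/-! ### Sums over the zeros of an even entire function with zeros in a strip -/

/-- The zeros of an entire function. -/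
def zeroSet (f : ℂ → ℂ) : Set ℂ := {ρ | f ρ = 0}

variable {f : ℂ → ℂ}

lemma EvenEntire.sum_inv_sq_le (hf : EvenEntire f) {z : ℂ} (hz : 1 / 2 < z.re)
    (S : Finset ℂ) (hS : ∀ ρ ∈ S, f ρ = 0) :
    ∑ ρ ∈ S, (ordAt f ρ : ℝ) * (1 / ‖z - ρ‖ ^ 2) ≤
      (logDeriv f z).re / (z.re - 1 / 2) := by
  have hz' : 0 < z.re - 1 / 2 := by linarith
  rw [le_div_iff₀ hz', sum_mul]
  refine ge_of_tendsto ((continuous_re.tendsto _).comp (hf.tendsto_sum_zeros (hf.ne_zero hz))) ?_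
  filter_upwards [eventually_ge_atTop (∑ ρ ∈ S, ‖ρ‖)] with R hR
  simp only [comp_apply, re_sum]
  refine (Finset.sum_le_sum_of_subset_of_nonneg (t := hf.zeros R) (fun ρ hρ => hf.mem_zeros.2
    ⟨hS ρ hρ, (Finset.single_le_sum (f := fun ρ : ℂ => ‖ρ‖) (fun _ _ => norm_nonneg _) hρ).trans
      hR⟩) fun _ _ _ => by positivity).trans (Finset.sum_le_sum fun ρ hρ => ?_)
  have h1 := (abs_le.1 (hf.strip ρ (hf.mem_zeros.1 hρ).1)).2
  rw [← ofReal_natCast, re_ofReal_mul, mul_assoc, inv_re, normSq_eq_norm_sq, sub_re,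
    one_div_mul_eq_div]
  gcongr

/-- Comparison of the logarithmic derivative at two points, the first of which keeps a
distance `d` from the zeros. -/
lemma EvenEntire.norm_logDeriv_le_of_dist (hf : EvenEntire f) {z w : ℂ} (hz : 1 / 2 < z.re)
    {d : ℝ} (hd : 0 < d) (hw : ∀ ρ, f ρ = 0 → d ≤ ‖w - ρ‖) :
    ‖logDeriv f w‖ ≤ ‖logDeriv f z‖ +
      ‖z - w‖ * (1 + ‖z - w‖ / d) * ((logDeriv f z).re / (z.re - 1 / 2)) := by
  have hfz := hf.ne_zero hz
  have hfw : f w ≠ 0 := fun h => by have := hw w h; simp at this; linarith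
  set D := ‖z - w‖ with hD
  rw [← sub_le_iff_le_add']
  refine (norm_sub_norm_le _ _).trans (le_of_tendsto ((hf.tendsto_sum_zeros hfw).sub
    (hf.tendsto_sum_zeros hfz)).norm (Eventually.of_forall fun R => ?_))
  rw [← sum_sub_distrib]
  refine (norm_sum_le_of_le _ (n := fun ρ => D * (1 + D / d) * ((ordAt f ρ : ℝ) *
    (1 / ‖z - ρ‖ ^ 2))) fun ρ hρ => ?_).trans ?_
  · have hρ0 := (hf.mem_zeros.1 hρ).1
    have hb := hw ρ hρ0
    have hpos : 0 < ‖w - ρ‖ := by linarith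
    have hpos' : 0 < ‖z - ρ‖ := norm_pos_iff.2 fun h => hfz (by rwa [sub_eq_zero.1 h])
    have e : (ordAt f ρ : ℂ) * (w - ρ)⁻¹ - (ordAt f ρ : ℂ) * (z - ρ)⁻¹
        = (ordAt f ρ : ℂ) * ((z - w) / ((w - ρ) * (z - ρ))) := by
      have := norm_pos_iff.1 hpos
      have := norm_pos_iff.1 hpos'
      field_simp; ring
    rw [e, norm_mul, norm_div, norm_mul, ← hD, norm_natCast, mul_left_comm]
    gcongr
    rw [mul_one_div, div_le_div_iff₀ (by positivity) (by positivity)]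
    have hb2 : ‖z - ρ‖ ≤ (1 + D / d) * ‖w - ρ‖ := by
      have : D ≤ D / d * ‖w - ρ‖ := by rw [div_mul_eq_mul_div, le_div_iff₀ hd]; gcongr
      linarith [norm_sub_le_norm_sub_add_norm_sub z w ρ]
    calc D * ‖z - ρ‖ ^ 2 = D * ‖z - ρ‖ * ‖z - ρ‖ := by ring
      _ ≤ D * ‖z - ρ‖ * ((1 + D / d) * ‖w - ρ‖) := by gcongr
      _ = _ := by ring
  · rw [← mul_sum]
    gcongr
    exact hf.sum_inv_sq_le hz _ fun ρ hρ => (hf.mem_zeros.1 hρ).1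

/-- The zeros are summable with an exponent larger than `1`, once the logarithmic derivative grows
slowly on a vertical line. -/
lemma EvenEntire.summable_zeros_rpow (hf : EvenEntire f) {K : ℝ}
    (hK : ∀ t : ℝ, ‖logDeriv f (1 + I * t)‖ ≤ K * (1 + |t|) ^ (1 / 8 : ℝ)) :
    Summable fun ρ : zeroSet f => (ordAt f ρ : ℝ) * (1 + ‖(ρ : ℂ)‖) ^ (-(5 / 4) : ℝ) := by
  have hint : Integrable fun t : ℝ => (1 + ‖t‖) ^ (-(9 / 8) : ℝ) :=
    integrable_one_add_norm (by norm_num)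
  have hne : ∀ (ρ : zeroSet f) (t : ℝ), (1 + I * (t : ℂ)) - ρ ≠ 0 := fun ρ t h =>
    hf.ne_zero (z := 1 + I * t) (by simp; norm_num) (by rw [sub_eq_zero.1 h]; exact ρ.2)
  set F : zeroSet f → ℝ → ℝ := fun ρ t => (ordAt f ρ : ℝ) *
    ((1 + |t|) ^ (-(5 / 4) : ℝ) * (1 / ‖(1 + I * (t : ℂ)) - ρ‖ ^ 2)) with hF
  have hF0 : ∀ ρ t, 0 ≤ F ρ t := fun ρ t => by positivity
  have hFc : ∀ ρ, Continuous (F ρ) := fun ρ =>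
    continuous_const.mul ((Continuous.rpow_const (by fun_prop) fun t =>
      Or.inl (by positivity)).mul (continuous_const.div (by fun_prop) fun t => by
        have := hne ρ t; positivity))
  have hlow : ∀ ρ : zeroSet f, ∀ t ∈ Set.Icc (ρ : ℂ).im ((ρ : ℂ).im + 1),
      (ordAt f ρ : ℝ) * ((1 / 16) * (1 + ‖(ρ : ℂ)‖) ^ (-(5 / 4) : ℝ)) ≤ F ρ t := by
    intro ρ t ht
    have h2 := abs_le.1 (hf.strip ρ ρ.2)
    have h3 : ‖(1 + I * (t : ℂ)) - ρ‖ ^ 2 ≤ 4 := by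
      rw [← normSq_eq_norm_sq, normSq_apply]
      simp only [sub_re, add_re, one_re, mul_re, I_re, ofReal_re, I_im, ofReal_im, sub_im, add_im,
        one_im, mul_im]
      nlinarith [ht.1, ht.2]
    have h4 : 1 + |t| ≤ 2 * (1 + ‖(ρ : ℂ)‖) := by
      have h5 : |t| ≤ |(ρ : ℂ).im| + 1 := abs_le.2
        ⟨by linarith [neg_abs_le (ρ : ℂ).im, ht.1], by linarith [le_abs_self (ρ : ℂ).im, ht.2]⟩
      linarith [norm_nonneg (ρ : ℂ), abs_im_le_norm (ρ : ℂ)]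
    have h5 := rpow_le_rpow_of_nonpos (by positivity) h4 (show -(5 / 4 : ℝ) ≤ 0 by norm_num)
    rw [mul_rpow (by norm_num) (by positivity)] at h5
    have h6 : (1 / 4 : ℝ) ≤ (2 : ℝ) ^ (-(5 / 4) : ℝ) := by
      calc (1 / 4 : ℝ) = (2 : ℝ) ^ (-2 : ℝ) := by rw [rpow_neg (by norm_num)]; norm_num
        _ ≤ _ := rpow_le_rpow_of_exponent_le (by norm_num) (by norm_num)
    have h7 : (1 / 4 : ℝ) ≤ 1 / ‖(1 + I * (t : ℂ)) - ρ‖ ^ 2 :=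
      one_div_le_one_div_of_le (by have := hne ρ t; positivity) h3
    refine mul_le_mul_of_nonneg_left ?_ (Nat.cast_nonneg _)
    calc _ = (1 / 4 * (1 + ‖(ρ : ℂ)‖) ^ (-(5 / 4) : ℝ)) * (1 / 4) := by ring
      _ ≤ _ := mul_le_mul (le_trans (by gcongr) h5) h7 (by norm_num) (by positivity)
  have hup : ∀ (S : Finset (zeroSet f)) (t : ℝ), ∑ ρ ∈ S, F ρ t ≤
      2 * K * (1 + ‖t‖) ^ (-(9 / 8) : ℝ) := by
    intro S t
    have hre : (1 + I * (t : ℂ)).re = 1 := by simp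
    have h1 := hf.sum_inv_sq_le (z := 1 + I * (t : ℂ)) (by rw [hre]; norm_num)
      (S.map (Embedding.subtype _)) fun ρ hρ => (by
        obtain ⟨a, -, rfl⟩ := Finset.mem_map.1 hρ
        exact a.2)
    rw [hre, sum_map, le_div_iff₀ (by norm_num)] at h1
    simp only [Embedding.subtype_apply] at h1
    have e : (1 + ‖t‖) ^ (-(9 / 8) : ℝ) = (1 + |t|) ^ (1 / 8 : ℝ) * (1 + |t|) ^ (-(5 / 4) : ℝ) := by
      rw [← rpow_add (by positivity), norm_eq_abs]; norm_num
    simp only [hF, mul_left_comm _ ((1 + |t|) ^ (-(5 / 4) : ℝ))]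
    rw [← mul_sum, e, mul_comm, ← mul_assoc]
    exact mul_le_mul_of_nonneg_right (by linarith [h1, (re_le_norm _).trans (hK t)]) (by positivity)
  have hFint : ∀ S : Finset (zeroSet f), Integrable fun t => ∑ ρ ∈ S, F ρ t := fun S =>
    (hint.const_mul (2 * K)).mono' (continuous_finsetSum _ fun ρ _ => hFc ρ).aestronglyMeasurable
      (Eventually.of_forall fun t => by
        rw [Real.norm_of_nonneg (Finset.sum_nonneg fun ρ _ => hF0 ρ t)]; exact hup S t)
  have hρint : ∀ ρ, Integrable (F ρ) := fun ρ => by simpa using hFint {ρ}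
  have hlowint : ∀ ρ : zeroSet f, (ordAt f ρ : ℝ) *
      (1 + ‖(ρ : ℂ)‖) ^ (-(5 / 4) : ℝ) ≤ 16 * ∫ t, F ρ t := by
    intro ρ
    have h1 := setIntegral_le_integral (s := Set.Icc (ρ : ℂ).im ((ρ : ℂ).im + 1)) (hρint ρ)
      (Eventually.of_forall (hF0 ρ))
    have h2 := setIntegral_mono_on (μ := volume) continuous_const.integrableOn_Icc
      (hρint ρ).integrableOn measurableSet_Icc (hlow ρ)
    simp at h2
    linarith
  refine summable_of_sum_le (c := 16 * ∫ t : ℝ, 2 * K * (1 + ‖t‖) ^ (-(9 / 8) : ℝ))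
    (fun ρ => by positivity) fun S => (Finset.sum_le_sum fun ρ _ => hlowint ρ).trans ?_
  rw [← mul_sum, ← integral_finsetSum _ fun ρ _ => hρint ρ]
  gcongr 16 * ?_
  exact integral_mono (hFint S) (hint.const_mul _) (hup S)

/-- The partial fraction expansion of the logarithmic derivative of an even entire function. -/
lemma EvenEntire.hasSum_logDeriv (hf : EvenEntire f) {z : ℂ} (hz : f z ≠ 0)
    (hs : Summable fun ρ : zeroSet f => (ordAt f ρ : ℂ) * (z / (z ^ 2 - ρ ^ 2))) :
    HasSum (fun ρ : zeroSet f => (ordAt f ρ : ℂ) * (z / (z ^ 2 - ρ ^ 2)))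
      (logDeriv f z) := by
  classical
  obtain ⟨a, ha⟩ := hs
  have hT : Tendsto (fun R : ℝ => (hf.zeros R).subtype (· ∈ zeroSet f)) atTop atTop := by
    refine tendsto_atTop_finset_of_monotone (fun R R' h ρ hρ => ?_) fun ρ => ⟨‖(ρ : ℂ)‖, ?_⟩ <;>
      simp only [Finset.mem_subtype, hf.mem_zeros] at *
    exacts [⟨hρ.1, hρ.2.trans h⟩, ⟨ρ.2, le_rfl⟩]
  rw [tendsto_nhds_unique (hf.tendsto_sum_zeros hz) ((ha.comp hT).congr fun R => ?_)]
  · exact ha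
  rw [comp_apply, Finset.sum_subtype_of_mem (p := (· ∈ zeroSet f)) (fun ρ : ℂ =>
    (ordAt f ρ : ℂ) * (z / (z ^ 2 - ρ ^ 2))) fun ρ hρ => (hf.mem_zeros.1 hρ).1]
  have hneg := hf.sum_zeros_neg R fun ρ => (z - ρ)⁻¹
  rw [show ∑ ρ ∈ hf.zeros R, (ordAt f ρ : ℂ) * (z - ρ)⁻¹ = ∑ ρ ∈ hf.zeros R,
    (1 / 2) * ((ordAt f ρ : ℂ) * (z - ρ)⁻¹ +
      (ordAt f ρ : ℂ) * (z - -ρ)⁻¹) by rw [← mul_sum, sum_add_distrib, hneg]; ring]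
  refine sum_congr rfl fun ρ hρ => ?_
  have hfρ := (hf.mem_zeros.1 hρ).1
  have hm : z - ρ ≠ 0 := fun h => hz (by rwa [sub_eq_zero.1 h])
  have hp : z - -ρ ≠ 0 := fun h => hz (by rwa [sub_eq_zero.1 h, hf.even])
  rw [show z ^ 2 - ρ ^ 2 = (z - ρ) * (z - -ρ) by ring]
  field_simp; ring

/-! ### Shifting vertical lines of integration -/

lemma integrable_of_continuous_of_decay {h : ℝ → ℂ} (hc : Continuous h) {C T r : ℝ}
    (hr : 1 < r) (hb : ∀ t : ℝ, T ≤ |t| → ‖h t‖ ≤ C * (1 + |t|) ^ (-r)) : Integrable h := by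
  have hint : Integrable fun t : ℝ => C * (1 + ‖t‖) ^ (-r) :=
    (integrable_one_add_norm (by simpa using hr)).const_mul C
  refine hc.locallyIntegrable.integrable_of_isBigO_cocompact ?_ (hint.integrableAtFilter _)
  refine IsBigO.of_bound 1 ?_
  have : ∀ᶠ t : ℝ in cocompact ℝ, T ≤ |t| := by
    have := tendsto_norm_cocompact_atTop (E := ℝ)
    exact this.eventually_ge_atTop T
  filter_upwards [this] with t ht
  rw [one_mul]
  exact (hb t ht).trans ((le_abs_self _).trans (le_of_eq (by simp [norm_eq_abs])))

lemma continuous_line {F : ℂ → ℂ} {a b σ : ℝ} (hσ : σ ∈ Set.Icc a b)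
    (hc : ContinuousOn F {z | a ≤ z.re ∧ z.re ≤ b}) : Continuous fun t : ℝ => F (σ + I * t) := by
  refine hc.comp_continuous (by fun_prop) fun t => ?_
  simpa using hσ

lemma integral_line_eq {F : ℂ → ℂ} {a b : ℝ} (hab : a ≤ b)
    (hc : ContinuousOn F {z | a ≤ z.re ∧ z.re ≤ b})
    (hd : DifferentiableOn ℂ F {z | a < z.re ∧ z.re < b}) {C T r : ℝ} (hr : 1 < r)
    (hb : ∀ z : ℂ, a ≤ z.re → z.re ≤ b → T ≤ |z.im| → ‖F z‖ ≤ C * (1 + |z.im|) ^ (-r)) :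
    ∫ t : ℝ, F (a + I * t) = ∫ t : ℝ, F (b + I * t) := by
  have hrect : ∀ S : ℝ, 0 < S → (∫ t in -S..S, F (b + I * t)) - (∫ t in -S..S, F (a + I * t)) =
      I * ((∫ x in a..b, F (x + (-S : ℝ) * I)) - ∫ x in a..b, F (x + (S : ℝ) * I)) := by
    intro S hS
    have h := integral_boundary_rect_eq_zero_of_continuousOn_of_differentiableOn F
      (a + (-S : ℝ) * I) (b + (S : ℝ) * I)
      (hc.mono (by
        intro z hz
        rw [mem_reProdIm] at hz
        simp only [add_re, ofReal_re, mul_re, I_re, mul_zero, ofReal_im, I_im, mul_one, sub_self,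
          add_zero, Set.uIcc_of_le hab] at hz
        exact hz.1))
      (hd.mono (by
        intro z hz
        rw [mem_reProdIm] at hz
        simp only [add_re, ofReal_re, mul_re, I_re, mul_zero, ofReal_im, I_im, mul_one, sub_self,
          add_zero, min_eq_left hab, max_eq_right hab] at hz
        exact hz.1))
    simp only [add_re, ofReal_re, mul_re, I_re, mul_zero, ofReal_im, I_im, mul_one, sub_self,
      add_zero, add_im, mul_im, zero_add, smul_eq_mul] at h
    have e : ∀ c : ℝ, (∫ y in -S..S, F (c + y * I)) = ∫ t in -S..S, F (c + I * t) :=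
      fun c => by simp only [mul_comm I]
    rw [e, e] at h
    linear_combination (-I) * h + ((∫ t in -S..S, F (b + I * t)) -
      (∫ t in -S..S, F (a + I * t))) * I_sq
  have hia : Integrable fun t : ℝ => F (a + I * t) := by
    refine integrable_of_continuous_of_decay (continuous_line ⟨le_rfl, hab⟩ hc) hr
      (C := C) (T := T) fun t ht => ?_
    have := hb (a + I * t) (by simp) (by simpa using hab) (by simpa using ht)
    simpa using this
  have hib : Integrable fun t : ℝ => F (b + I * t) := by
    refine integrable_of_continuous_of_decay (continuous_line ⟨hab, le_rfl⟩ hc) hr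
      (C := C) (T := T) fun t ht => ?_
    have := hb (b + I * t) (by simpa using hab) (by simp) (by simpa using ht)
    simpa using this
  have hla := intervalIntegral_tendsto_integral hia tendsto_neg_atTop_atBot tendsto_id
  have hlb := intervalIntegral_tendsto_integral hib tendsto_neg_atTop_atBot tendsto_id
  have hl := hlb.sub hla
  have hz : Tendsto (fun S : ℝ => I * ((∫ x in a..b, F (x + (-S : ℝ) * I)) -
      ∫ x in a..b, F (x + (S : ℝ) * I))) atTop (nhds 0) := by
    have hdec : Tendsto (fun S : ℝ => 2 * (C * (1 + S) ^ (-r) * |b - a|)) atTop (nhds 0) := by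
      have h1 : Tendsto (fun S : ℝ => (1 + S) ^ (-r)) atTop (nhds 0) :=
        (tendsto_rpow_neg_atTop (by linarith)).comp (tendsto_atTop_add_const_left _ 1 tendsto_id)
      simpa using ((h1.const_mul C).mul_const |b - a|).const_mul 2
    refine squeeze_zero_norm' ?_ hdec
    filter_upwards [eventually_ge_atTop T, eventually_ge_atTop 0] with S hS hS0
    have hh : ∀ ε : ℝ, |ε| = S → ‖∫ x in a..b, F (x + (ε : ℝ) * I)‖ ≤
        C * (1 + S) ^ (-r) * |b - a| := by
      intro ε hε
      refine intervalIntegral.norm_integral_le_of_norm_le_const fun x hx => ?_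
      rw [Set.uIoc_of_le hab] at hx
      have := hb (x + (ε : ℝ) * I) (by simpa using hx.1.le) (by simpa using hx.2)
        (by simpa [hε] using hS)
      simpa [hε] using this
    rw [norm_mul, norm_I, one_mul]
    refine (norm_sub_le _ _).trans ?_
    have h1 := hh (-S) (by rw [abs_neg, abs_of_nonneg hS0])
    have h2 := hh S (abs_of_nonneg hS0)
    linarith
  have hl' : Tendsto (fun S : ℝ => (∫ t in -S..S, F (b + I * t)) - (∫ t in -S..S, F (a + I * t)))
      atTop (nhds 0) := by
    refine hz.congr' ?_
    filter_upwards [eventually_gt_atTop 0] with S hS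
    exact (hrect S hS).symm
  have := tendsto_nhds_unique hl' hl
  exact (sub_eq_zero.1 this.symm).symm

lemma one_add_abs_im_le {z p : ℂ} {d : ℝ} (hd : 0 < d) (h : d ≤ ‖z - p‖) :
    1 + |z.im| ≤ ((1 + |p.im|) / d + 1) * ‖z - p‖ := by
  have h1 : |z.im - p.im| ≤ ‖z - p‖ := by simpa using abs_im_le_norm (z - p)
  have h2 : |z.im| ≤ |p.im| + |z.im - p.im| := by
    have := abs_add_le p.im (z.im - p.im); simpa using this
  have h3 : 1 + |p.im| ≤ (1 + |p.im|) / d * ‖z - p‖ := by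
    calc 1 + |p.im| = (1 + |p.im|) / d * d := by field_simp
      _ ≤ _ := by gcongr
  linarith

lemma norm_inv_sub_le {z p : ℂ} {d : ℝ} (hd : 0 < d) (h : d ≤ ‖z - p‖) :
    ‖(z - p)⁻¹‖ ≤ ((1 + |p.im|) / d + 1) * (1 + |z.im|)⁻¹ := by
  have := one_add_abs_im_le hd h
  have hp : 0 < ‖z - p‖ := by linarith
  rw [norm_inv, ← div_eq_mul_inv, inv_eq_one_div, div_le_div_iff₀ hp (by positivity)]; linarith

lemma norm_inv_sub_inv_le {z p q : ℂ} {d d' : ℝ} (hd : 0 < d) (h : d ≤ ‖z - p‖) (hd' : 0 < d')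
    (h' : d' ≤ ‖z - q‖) : ‖(z - p)⁻¹ - (z - q)⁻¹‖ ≤
      ‖p - q‖ * (((1 + |p.im|) / d + 1) * ((1 + |q.im|) / d' + 1)) * (1 + |z.im|) ^ (-(2 : ℝ)) := by
  have e : (z - p)⁻¹ - (z - q)⁻¹ = (p - q) * ((z - p)⁻¹ * (z - q)⁻¹) := by
    have h1 : z - p ≠ 0 := norm_pos_iff.1 (hd.trans_le h)
    have h2 : z - q ≠ 0 := norm_pos_iff.1 (hd'.trans_le h')
    field_simp; ring
  rw [e, norm_mul, norm_mul]
  refine (mul_le_mul_of_nonneg_left (mul_le_mul (norm_inv_sub_le hd h) (norm_inv_sub_le hd' h')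
    (norm_nonneg _) (by positivity)) (norm_nonneg _)).trans (le_of_eq ?_)
  rw [rpow_neg (by positivity), rpow_two, ← inv_pow]; ring

lemma integral_lorentz {x : ℝ} (hx : x ≠ 0) (y : ℝ) :
    Integrable (fun t : ℝ => 1 / (x ^ 2 + (t - y) ^ 2)) ∧
      ∫ t : ℝ, 1 / (x ^ 2 + (t - y) ^ 2) = π / |x| := by
  have e : (fun t : ℝ => 1 / (x ^ 2 + (t - y) ^ 2)) =
      fun t : ℝ => (fun s : ℝ => (x ^ 2)⁻¹ * (1 + (s / x) ^ 2)⁻¹) (t - y) := by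
    ext t; field_simp
  have h1 : Integrable fun s : ℝ => (x ^ 2)⁻¹ * (1 + (s / x) ^ 2)⁻¹ :=
    (integrable_inv_one_add_sq.comp_div hx).const_mul _
  rw [e]
  refine ⟨h1.comp_sub_right y, ?_⟩
  rw [integral_sub_right_eq_self (fun s : ℝ => (x ^ 2)⁻¹ * (1 + (s / x) ^ 2)⁻¹) y,
    integral_const_mul, Measure.integral_comp_div (fun s : ℝ => (1 + s ^ 2)⁻¹) x,
    integral_univ_inv_one_add_sq, smul_eq_mul, ← sq_abs x]
  field_simp

lemma line_sub_ne_zero {σ : ℝ} {p : ℂ} (hp : p.re ≠ σ) (t : ℝ) : (σ : ℂ) + I * t - p ≠ 0 := by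
  intro h
  have := congrArg re h
  simp at this
  exact hp (by linarith)

lemma abs_re_sub_le_norm_line {σ : ℝ} {p : ℂ} (t : ℝ) :
    |σ - p.re| ≤ ‖(σ : ℂ) + I * t - p‖ := by
  have := abs_re_le_norm ((σ : ℂ) + I * t - p)
  simpa using this

lemma integrable_inv_sub_inv {σ : ℝ} {p q : ℂ} (hp : p.re ≠ σ) (hq : q.re ≠ σ) :
    Integrable fun t : ℝ => ((σ : ℂ) + I * t - p)⁻¹ - ((σ : ℂ) + I * t - q)⁻¹ := by
  refine integrable_of_continuous_of_decay (r := 2) (T := 0)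
    (((by fun_prop : Continuous fun t : ℝ => (σ : ℂ) + I * t - p).inv₀ (line_sub_ne_zero hp)).sub
      ((by fun_prop : Continuous fun t : ℝ => (σ : ℂ) + I * t - q).inv₀ (line_sub_ne_zero hq)))
    (by norm_num)
    (C := ‖p - q‖ * (((1 + |p.im|) / |σ - p.re| + 1) * ((1 + |q.im|) / |σ - q.re| + 1)))
    fun t _ => ?_
  simpa using norm_inv_sub_inv_le (abs_pos.2 (sub_ne_zero.2 hp.symm)) (abs_re_sub_le_norm_line t)
    (abs_pos.2 (sub_ne_zero.2 hq.symm)) (abs_re_sub_le_norm_line t)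

lemma integral_inv_sub_inv {σ : ℝ} {p q : ℂ} (hp : p.re ≠ σ) (hq : q.re ≠ σ) (hpq : q.im = p.im) :
    ∫ t : ℝ, (((σ : ℂ) + I * t - p)⁻¹ - ((σ : ℂ) + I * t - q)⁻¹) =
      π * ((σ - p.re) / |σ - p.re| - (σ - q.re) / |σ - q.re| : ℝ) := by
  have hi := integrable_inv_sub_inv hp hq
  obtain ⟨ip, vp⟩ := integral_lorentz (sub_ne_zero.2 hp.symm) p.im
  obtain ⟨iq, vq⟩ := integral_lorentz (sub_ne_zero.2 hq.symm) p.im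
  have h := integral_add hi (hi.comp_sub_left (2 * p.im))
  rw [integral_sub_left_eq_self (fun t : ℝ => ((σ : ℂ) + I * t - p)⁻¹ - ((σ : ℂ) + I * t - q)⁻¹)
    volume] at h
  have e : ∀ p' : ℂ, p'.re ≠ σ → p'.im = p.im → ∀ t : ℝ, ((σ : ℂ) + I * t - p')⁻¹ +
      ((σ : ℂ) + I * (2 * p.im - t : ℝ) - p')⁻¹ =
      (2 * ((σ - p'.re) * (1 / ((σ - p'.re) ^ 2 + (t - p.im) ^ 2))) : ℝ) := by
    intro p' hp' hi t
    have e1 : (σ : ℂ) + I * t - p' = ⟨σ - p'.re, t - p.im⟩ := by apply Complex.ext <;> simp [hi]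
    have e2 : (σ : ℂ) + I * (2 * p.im - t : ℝ) - p' = ⟨σ - p'.re, -(t - p.im)⟩ := by
      apply Complex.ext <;> simp [hi]; ring
    rw [e1, e2]
    apply Complex.ext
    · simp only [add_re, inv_re, normSq_mk, ofReal_re, ← sq, neg_sq]; ring
    · simp only [add_im, inv_im, normSq_mk, ofReal_im, ← sq, neg_sq]; ring
  rw [integral_congr_ae (g := fun t : ℝ =>
    ((2 * ((σ - p.re) * (1 / ((σ - p.re) ^ 2 + (t - p.im) ^ 2))) -
      2 * ((σ - q.re) * (1 / ((σ - q.re) ^ 2 + (t - p.im) ^ 2))) : ℝ) : ℂ))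
    (Eventually.of_forall fun t => by
      have h1 := e p hp rfl t
      have h2 := e q hq hpq t
      push_cast at h1 h2 ⊢
      linear_combination h1 - h2), integral_complex_ofReal,
    integral_sub ((ip.const_mul _).const_mul _) ((iq.const_mul _).const_mul _)] at h
  simp only [integral_const_mul, vp, vq] at h
  push_cast at h ⊢
  linear_combination -h / 2

/-! ### Cauchy's formula in a strip for even functions -/

lemma integral_odd_eq_zero {h : ℝ → ℂ} (hodd : ∀ t, h (-t) = -h t) : ∫ t, h t = 0 := by
  have h1 := integral_neg_eq_self h volume
  simp only [hodd, integral_neg] at h1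
  have : (2 : ℂ) * ∫ t, h t = 0 := by linear_combination -h1
  simpa using this

lemma sq_sub_sq_ne_zero_of_re {α ρ : ℂ} (h1 : α.re ≠ ρ.re) (h2 : α.re ≠ -ρ.re) :
    α ^ 2 - ρ ^ 2 ≠ 0 := by
  rw [show α ^ 2 - ρ ^ 2 = (α - ρ) * (α + ρ) by ring]
  refine mul_ne_zero (fun h => h1 ?_) fun h => h2 ?_
  · rw [sub_eq_zero.1 h]
  · rw [eq_neg_of_add_eq_zero_left h, neg_re]

lemma one_div_one_add_sq_le (y : ℝ) : 1 / (1 + y ^ 2) ≤ 2 * (1 + |y|) ^ (-(2 : ℝ)) := by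
  rw [rpow_neg (by positivity), rpow_two, ← div_eq_mul_inv,
    div_le_div_iff₀ (by positivity) (by positivity)]
  nlinarith [sq_abs y, sq_nonneg (1 - |y|)]

lemma decay_of_div_one_add_sq {x : ℂ} {C y : ℝ} (h : ‖x‖ ≤ C / (1 + y ^ 2)) :
    ‖x‖ ≤ 2 * C * (1 + |y|) ^ (-(2 : ℝ)) := by
  have hC : 0 ≤ C := by
    have h0 := (norm_nonneg x).trans h
    by_contra hC
    push Not at hC
    have := div_neg_of_neg_of_pos hC (show 0 < 1 + y ^ 2 by positivity)
    linarith
  calc ‖x‖ ≤ C * (1 / (1 + y ^ 2)) := by rw [mul_one_div]; exact h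
    _ ≤ C * (2 * (1 + |y|) ^ (-(2 : ℝ))) := by gcongr; exact one_div_one_add_sq_le y
    _ = _ := by ring

lemma two_mul_integral_kernel {g E : ℂ → ℂ} {σ σ₀ C : ℝ} {w ρ q : ℂ} (hσ : 0 < σ) (hσ₀ : σ < σ₀)
    (hg : DifferentiableOn ℂ g {z | |z.re| < σ₀}) (heven : ∀ z : ℂ, |z.re| < σ₀ → g (-z) = g z)
    (hb : ∀ z : ℂ, |z.re| ≤ σ → ‖g z‖ ≤ C / (1 + z.im ^ 2)) (hρ : |ρ.re| ≠ σ) (hq : q.re ≤ -σ₀)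
    (hqρ : q.im = ρ.im) (hE : DifferentiableOn ℂ E {z | |z.re| < σ₀})
    (heq : ∀ z : ℂ, z ≠ ρ → E z = g z * (z - ρ)⁻¹ - w * ((z - ρ)⁻¹ - (z - q)⁻¹)) :
    2 * ∫ t : ℝ, g (σ + I * t) * (((σ : ℂ) + I * t) / (((σ : ℂ) + I * t) ^ 2 - ρ ^ 2)) =
      w * (π * ((σ - ρ.re) / |σ - ρ.re| - (-σ - ρ.re) / |-σ - ρ.re| : ℝ)) := by
  have him : ∀ z p : ℂ, |p.im| + 1 ≤ |z.im| → 1 ≤ ‖z - p‖ := fun z p h => by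
    have := abs_im_le_norm (z - p)
    rw [sub_im] at this; linarith [abs_sub_abs_le_abs_sub z.im p.im]
  have hgb : ∀ z : ℂ, |z.re| ≤ σ → |ρ.im| + 1 ≤ |z.im| →
      ‖g z * (z - ρ)⁻¹‖ ≤ 2 * C * (1 + |z.im|) ^ (-(2 : ℝ)) := fun z hz h => by
    rw [norm_mul, norm_inv]
    exact (mul_le_of_le_one_right (norm_nonneg _) (inv_le_one_of_one_le₀ (him z ρ h))).trans
      (decay_of_div_one_add_sq (hb z hz))
  have hkey : ∀ τ : ℝ, |τ| = σ → Integrable (fun t : ℝ => g (τ + I * t) * ((τ : ℂ) + I * t - ρ)⁻¹) ∧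
      ∫ t : ℝ, E (τ + I * t) = (∫ t : ℝ, g (τ + I * t) * ((τ : ℂ) + I * t - ρ)⁻¹) -
        w * (π * ((τ - ρ.re) / |τ - ρ.re| - 1 : ℝ)) := by
    intro τ hτ
    have hτρ : ρ.re ≠ τ := fun h => hρ (by rw [h, hτ])
    have hτq : 0 < τ - q.re := by linarith [neg_abs_le τ]
    have hi : Integrable fun t : ℝ => g (τ + I * t) * ((τ : ℂ) + I * t - ρ)⁻¹ := by
      refine integrable_of_continuous_of_decay (r := 2) (T := |ρ.im| + 1) ((hg.continuousOn
        |>.comp_continuous (by fun_prop) fun t => by simpa [hτ]).mul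
        ((by fun_prop : Continuous fun t : ℝ => (τ : ℂ) + I * t - ρ).inv₀ (line_sub_ne_zero hτρ)))
        (by norm_num) (C := 2 * C) fun t ht => ?_
      simpa using hgb (τ + I * t) (by simp [hτ]) (by simpa using ht)
    have hj := integrable_inv_sub_inv hτρ (sub_pos.1 hτq).ne
    refine ⟨hi, ?_⟩
    have hv := integral_inv_sub_inv hτρ (sub_pos.1 hτq).ne hqρ
    rw [abs_of_pos hτq, div_self hτq.ne'] at hv
    rw [← hv, ← integral_const_mul, ← integral_sub hi (hj.const_mul w)]
    exact integral_congr_ae (Eventually.of_forall fun t =>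
      heq _ (sub_ne_zero.1 (line_sub_ne_zero hτρ t)))
  obtain ⟨i1, v1⟩ := hkey σ (abs_of_pos hσ)
  obtain ⟨i2, v2⟩ := hkey (-σ) (by rw [abs_neg, abs_of_pos hσ])
  have hshift := integral_line_eq (F := E) (a := -σ) (b := σ) (by linarith)
    (hE.continuousOn.mono fun z hz => (abs_le.2 hz).trans_lt hσ₀)
    (hE.mono fun z hz => (abs_lt.2 hz).trans hσ₀) (r := 2) (T := |ρ.im| + 1) (by norm_num)
    (C := 2 * C + ‖w‖ * (‖ρ - q‖ * (((1 + |ρ.im|) / 1 + 1) * ((1 + |q.im|) / 1 + 1))))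
    fun z h1 h2 hT => (by
      rw [heq z (fun h => by rw [h] at hT; linarith)]
      refine (norm_sub_le _ _).trans ((add_le_add (hgb z (abs_le.2 ⟨h1, h2⟩) hT) ?_).trans
        (add_mul _ _ _).ge)
      rw [norm_mul, mul_assoc]
      exact mul_le_mul_of_nonneg_left (norm_inv_sub_inv_le one_pos (him z ρ hT) one_pos
        (him z q (by rwa [hqρ]))) (norm_nonneg w))
  rw [v1, v2] at hshift
  have hneg := integral_neg_eq_self
    (fun t : ℝ => g ((-σ : ℝ) + I * t) * (((-σ : ℝ) : ℂ) + I * t - ρ)⁻¹) volume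
  have e : ∀ t : ℝ, g ((-σ : ℝ) + I * (-t : ℝ)) * (((-σ : ℝ) : ℂ) + I * (-t : ℝ) - ρ)⁻¹ =
      g (σ + I * t) * ((σ : ℂ) + I * t - ρ)⁻¹ -
      2 * (g (σ + I * t) * (((σ : ℂ) + I * t) / (((σ : ℂ) + I * t) ^ 2 - ρ ^ 2))) := fun t => by
    have h1 := line_sub_ne_zero (σ := σ) (p := ρ) (fun h => hρ (by rw [h, abs_of_pos hσ])) t
    have h2 := line_sub_ne_zero (σ := σ) (p := -ρ) (fun h => hρ (by
      rw [← abs_neg, ← neg_re, h, abs_of_pos hσ])) t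
    rw [show ((-σ : ℝ) : ℂ) + I * (-t : ℝ) = -(σ + I * t) by push_cast; ring,
      heven _ (by simpa [abs_of_pos hσ]), show -((σ : ℂ) + I * t) - ρ = -(σ + I * t - -ρ) by ring,
      show ((σ : ℂ) + I * t) ^ 2 - ρ ^ 2 = (σ + I * t - ρ) * (σ + I * t - -ρ) by ring]
    field_simp; ring
  simp only [e] at hneg
  have i3 : Integrable fun t : ℝ => 2 * (g (σ + I * t) *
      (((σ : ℂ) + I * t) / (((σ : ℂ) + I * t) ^ 2 - ρ ^ 2))) :=
    (i1.sub i2.comp_neg).congr (Eventually.of_forall fun t => by simp only [Pi.sub_apply, e]; ring)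
  rw [integral_sub i1 i3, integral_const_mul] at hneg
  push_cast at hneg hshift ⊢
  linear_combination -hneg - hshift

lemma integral_kernel_of_gt {g : ℂ → ℂ} {σ σ₀ : ℝ} (hσ : 0 < σ) (hσ₀ : σ < σ₀)
    (hg : DifferentiableOn ℂ g {z | |z.re| < σ₀}) (heven : ∀ z : ℂ, |z.re| < σ₀ → g (-z) = g z)
    {C : ℝ} (hb : ∀ z : ℂ, |z.re| ≤ σ → ‖g z‖ ≤ C / (1 + z.im ^ 2)) {ρ : ℂ} (hρ : σ < |ρ.re|) :
    ∫ t : ℝ, g (σ + I * t) * (((σ : ℂ) + I * t) / (((σ : ℂ) + I * t) ^ 2 - ρ ^ 2)) = 0 := by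
  have hs : ∀ z : ℂ, |z.re| < min σ₀ |ρ.re| → |z.re| < σ₀ := fun z hz => hz.trans_le (min_le_left _ _)
  have h := two_mul_integral_kernel (E := fun z => g z * (z - ρ)⁻¹) (w := 0)
    (q := ⟨-min σ₀ |ρ.re|, ρ.im⟩) hσ (lt_min hσ₀ hρ) (hg.mono hs) (fun z hz => heven z (hs z hz)) hb
    hρ.ne' le_rfl rfl ((hg.mono hs).mul (DifferentiableOn.inv (by fun_prop) fun z hz h => by
      rw [sub_eq_zero.1 h] at hz
      exact (lt_min_iff.1 (show |ρ.re| < _ from hz)).2.false)) fun z _ => by ring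
  simpa using h

lemma integral_kernel_of_lt {g : ℂ → ℂ} {σ σ₀ : ℝ} (hσ : 0 < σ) (hσ₀ : σ < σ₀)
    (hg : DifferentiableOn ℂ g {z | |z.re| < σ₀}) (heven : ∀ z : ℂ, |z.re| < σ₀ → g (-z) = g z)
    {C : ℝ} (hb : ∀ z : ℂ, |z.re| ≤ σ → ‖g z‖ ≤ C / (1 + z.im ^ 2)) {ρ : ℂ} (hρ : |ρ.re| < σ) :
    ∫ t : ℝ, g (σ + I * t) * (((σ : ℂ) + I * t) / (((σ : ℂ) + I * t) ^ 2 - ρ ^ 2)) =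
      π * g ρ := by
  have hopen : IsOpen {z : ℂ | |z.re| < σ₀} :=
    isOpen_lt (continuous_abs.comp continuous_re) continuous_const
  have h := two_mul_integral_kernel (E := fun z => dslope g ρ z + g ρ * (z - ⟨-σ₀, ρ.im⟩)⁻¹)
    (w := g ρ) (q := ⟨-σ₀, ρ.im⟩) hσ hσ₀ hg heven hb hρ.ne le_rfl rfl
    (((differentiableOn_dslope (hopen.mem_nhds (hρ.trans hσ₀))).2 hg).add
      ((DifferentiableOn.inv (by fun_prop) fun z hz h => by
        rw [sub_eq_zero.1 h] at hz
        exact absurd (neg_abs_le (-σ₀)) (by simpa using hz)).const_mul _)) fun z hz => by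
      rw [dslope_of_ne _ hz, slope_def_field]; ring
  have hρ' := abs_lt.1 hρ
  rw [abs_of_pos (by linarith), div_self (by linarith), abs_of_neg (by linarith), div_neg,
    div_self (by linarith)] at h
  push_cast at h
  linear_combination h / 2

/-! ### The explicit formula for even entire functions -/

lemma kernel_bound_aux {σ d t : ℝ} (hσ : 0 < σ) (hσ2 : σ ≤ 2) (hd : 0 < d) {ρ : ℂ}
    (hρ : |ρ.re| ≤ 1 / 2) (h1 : d ≤ |σ - ρ.re|) (h2 : d ≤ |σ + ρ.re|)
    (hle : ‖(σ : ℂ) + I * t - ρ‖ ≤ ‖(σ : ℂ) + I * t + ρ‖) :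
    ‖((σ : ℂ) + I * t) / (((σ : ℂ) + I * t) ^ 2 - ρ ^ 2)‖ ≤
      8 * (1 / d + 1) ^ 2 * (1 + ‖ρ‖) ^ (-(5 / 4) : ℝ) * (1 + |t|) ^ (5 / 4 : ℝ) *
        (1 + |t - ρ.im|) ^ (-(3 / 4) : ℝ) := by
  set α : ℂ := (σ : ℂ) + I * t with hα
  have hre : α.re = σ := by simp [hα]
  have him : α.im = t := by simp [hα]
  set Q := 1 / d + 1 with hQ
  have hb : d ≤ ‖α - ρ‖ := h1.trans (abs_re_sub_le_norm_line t)
  have hb' : d ≤ ‖α + ρ‖ := h2.trans (by simpa [hre] using abs_re_le_norm (α + ρ))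
  have hscale : ∀ x y : ℝ, d ≤ y → x ≤ y → 1 + x ≤ Q * y := by
    intro x y hy hx
    have : 1 ≤ 1 / d * y := by rwa [div_mul_eq_mul_div, one_mul, one_le_div hd]
    rw [hQ]; linarith
  have hB : 1 + |t - ρ.im| ≤ Q * ‖α - ρ‖ := hscale _ _ hb (by
    simpa [him] using abs_im_le_norm (α - ρ))
  have hG : 1 + ‖ρ‖ ≤ Q * ‖α + ρ‖ := hscale _ _ hb' (by
    have := norm_sub_le (α + ρ) (α - ρ)
    rw [show α + ρ - (α - ρ) = 2 * ρ by ring, norm_mul, norm_ofNat] at this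
    linarith)
  have hX : ‖α‖ ≤ 2 * (1 + |t|) := by
    have : ‖α‖ ≤ |σ| + |t| := by simpa [hre, him] using norm_le_abs_re_add_abs_im α
    rw [abs_of_pos hσ] at this; linarith [abs_nonneg t]
  set X := 1 + |t| with hXd
  set B := 1 + |t - ρ.im| with hBd
  set G := 1 + ‖ρ‖ with hGd
  have hX1 : 0 < X := by positivity
  have hB1 : 0 < B := by positivity
  have hG1 : 0 < G := by positivity
  have hGXB : G ≤ 2 * (X * B) := by
    have h4 : |ρ.im| ≤ |t| + |t - ρ.im| := by simpa using abs_sub t (t - ρ.im)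
    rw [hGd, hXd, hBd]
    nlinarith [abs_nonneg t, abs_nonneg (t - ρ.im), norm_le_abs_re_add_abs_im ρ,
      mul_nonneg (abs_nonneg t) (abs_nonneg (t - ρ.im))]
  have hG14 : G ^ (1 / 4 : ℝ) ≤ 2 * (X ^ (1 / 4 : ℝ) * B ^ (1 / 4 : ℝ)) := by
    rw [← mul_rpow hX1.le hB1.le]
    refine (rpow_le_rpow hG1.le hGXB (by norm_num)).trans ?_
    rw [mul_rpow (by norm_num) (by positivity)]
    gcongr
    exact (rpow_le_rpow_of_exponent_le (y := 1 / 4) (z := 1) (by norm_num)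
      (by norm_num)).trans_eq (rpow_one 2)
  have hbpos : 0 < ‖α - ρ‖ := by linarith
  have hb'pos : 0 < ‖α + ρ‖ := by linarith
  rw [show α ^ 2 - ρ ^ 2 = (α - ρ) * (α + ρ) by ring, norm_div, norm_mul]
  have eX : X ^ (5 / 4 : ℝ) = X * X ^ (1 / 4 : ℝ) := by
    nth_rewrite 2 [← rpow_one X]; rw [← rpow_add hX1]; norm_num
  have eB : B ^ (-(3 / 4) : ℝ) = B⁻¹ * B ^ (1 / 4 : ℝ) := by
    rw [← Real.rpow_neg_one, ← rpow_add hB1]; norm_num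
  have eG : G⁻¹ = G ^ (-(5 / 4) : ℝ) * G ^ (1 / 4 : ℝ) := by
    rw [← Real.rpow_neg_one, ← rpow_add hG1]; norm_num
  calc ‖α‖ / (‖α - ρ‖ * ‖α + ρ‖) ≤ 2 * X * Q ^ 2 / (B * G) := by
        rw [div_le_div_iff₀ (by positivity) (by positivity)]
        calc ‖α‖ * (B * G) ≤ (2 * X) * ((Q * ‖α - ρ‖) * (Q * ‖α + ρ‖)) := by gcongr
          _ = _ := by ring
    _ = 2 * X * Q ^ 2 * B⁻¹ * (G ^ (-(5 / 4) : ℝ) * G ^ (1 / 4 : ℝ)) := by rw [← eG]; field_simp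
    _ ≤ 2 * X * Q ^ 2 * B⁻¹ * (G ^ (-(5 / 4) : ℝ) * (2 * (X ^ (1 / 4 : ℝ) * B ^ (1 / 4 : ℝ)))) := by
        gcongr
    _ = 4 * Q ^ 2 * G ^ (-(5 / 4) : ℝ) * X ^ (5 / 4 : ℝ) * B ^ (-(3 / 4) : ℝ) := by
        rw [eX, eB]; ring
    _ ≤ _ := by gcongr; norm_num

lemma kernel_bound {σ d t : ℝ} (hσ : 0 < σ) (hσ2 : σ ≤ 2) (hd : 0 < d) {ρ : ℂ}
    (hρ : |ρ.re| ≤ 1 / 2) (h1 : d ≤ |σ - ρ.re|) (h2 : d ≤ |σ + ρ.re|) :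
    ‖((σ : ℂ) + I * t) / (((σ : ℂ) + I * t) ^ 2 - ρ ^ 2)‖ ≤
      8 * (1 / d + 1) ^ 2 * (1 + ‖ρ‖) ^ (-(5 / 4) : ℝ) * (1 + |t|) ^ (5 / 4 : ℝ) *
        ((1 + |t - ρ.im|) ^ (-(3 / 4) : ℝ) + (1 + |t + ρ.im|) ^ (-(3 / 4) : ℝ)) := by
  rcases le_total ‖(σ : ℂ) + I * t - ρ‖ ‖(σ : ℂ) + I * t + ρ‖ with h | h
  · refine (kernel_bound_aux hσ hσ2 hd hρ h1 h2 h).trans ?_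
    gcongr
    simp only [le_add_iff_nonneg_right]; positivity
  · have := kernel_bound_aux (ρ := -ρ) (t := t) hσ hσ2 hd (by simpa using hρ) (by simpa using h2)
      (by simpa [sub_eq_add_neg] using h1) (by simpa [sub_eq_add_neg] using h)
    rw [neg_sq, norm_neg, neg_im, sub_neg_eq_add] at this
    refine this.trans ?_
    gcongr
    simp only [le_add_iff_nonneg_left]; positivity

lemma hasSum_of_eq {ι E : Type*} [AddCommMonoid E] [TopologicalSpace E] {f g : ι → E} {a : E}
    (hf : HasSum f a) (h : ∀ i, f i = g i) : HasSum g a :=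
  funext h ▸ hf

lemma countable_zeroSet {f : ℂ → ℂ} (hf : Differentiable ℂ f) {z₀ : ℂ} (h0 : f z₀ ≠ 0) :
    Countable (zeroSet f) := by
  have : zeroSet f = ⋃ n : ℕ, {ρ : ℂ | f ρ = 0 ∧ ‖ρ‖ ≤ n} := by
    ext ρ
    simp only [zeroSet, mem_ofPred_eq, Set.mem_iUnion]
    exact ⟨fun h => ⟨⌈‖ρ‖⌉₊, h, Nat.le_ceil _⟩, fun ⟨_, h, _⟩ => h⟩
  rw [Set.countable_coe_iff, this]
  exact Set.countable_iUnion fun n => (finite_zeros_closedBall hf h0 n).countable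

lemma EvenEntire.hasSum_explicit_formula {f : ℂ → ℂ} (hf : EvenEntire f)
    (hs : Summable fun ρ : zeroSet f => (ordAt f ρ : ℝ) * (1 + ‖(ρ : ℂ)‖) ^ (-(5 / 4) : ℝ))
    {g : ℂ → ℂ} {σ σ₀ d : ℝ} (hσ : 0 < σ) (hσ2 : σ ≤ 2) (hσ₀ : σ < σ₀) (hd : 0 < d)
    (hdist : ∀ ρ, f ρ = 0 → d ≤ |σ - ρ.re|)
    (hg : DifferentiableOn ℂ g {z | |z.re| < σ₀})
    (hgeven : ∀ z : ℂ, |z.re| < σ₀ → g (-z) = g z)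
    {C : ℝ} (hb : ∀ z : ℂ, |z.re| ≤ σ → ‖g z‖ ≤ C / (1 + z.im ^ 2)) :
    HasSum (fun ρ : zeroSet f => (ordAt f ρ : ℂ) * if |(ρ : ℂ).re| < σ then g ρ else 0)
      ((1 / π) * ∫ t : ℝ, g (σ + I * t) * logDeriv f (σ + I * t)) := by
  have := countable_zeroSet hf.diff hf.two_ne_zero
  have hdist' : ∀ ρ, f ρ = 0 → d ≤ |σ + ρ.re| := fun ρ hρ => by
    simpa using hdist (-ρ) (by rwa [hf.even])
  have hne1 : ∀ ρ, f ρ = 0 → σ ≠ ρ.re ∧ σ ≠ -ρ.re := fun ρ hρ =>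
    ⟨fun h => by have := hdist ρ hρ; rw [h, sub_self, abs_zero] at this; linarith,
      fun h => by have := hdist' ρ hρ; rw [h, neg_add_cancel, abs_zero] at this; linarith⟩
  have hne : ∀ ρ : zeroSet f, ∀ t : ℝ, ((σ : ℂ) + I * t) ^ 2 - (ρ : ℂ) ^ 2 ≠ 0 := fun ρ t =>
    sq_sub_sq_ne_zero_of_re (by simpa using (hne1 ρ ρ.2).1) (by simpa using (hne1 ρ ρ.2).2)
  have hfne : ∀ t : ℝ, f ((σ : ℂ) + I * t) ≠ 0 := fun t h => (hne1 _ h).1 (by simp)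
  set F : zeroSet f → ℝ → ℂ := fun ρ t => (ordAt f ρ : ℂ) * (g (σ + I * t) *
    (((σ : ℂ) + I * t) / (((σ : ℂ) + I * t) ^ 2 - (ρ : ℂ) ^ 2))) with hF
  have hcg : Continuous fun t : ℝ => g (σ + I * t) :=
    hg.continuousOn.comp_continuous (by fun_prop) fun t => by simpa [abs_of_pos hσ]
  have hFc : ∀ ρ, Continuous (F ρ) := fun ρ =>
    continuous_const.mul (hcg.mul (Continuous.div (by fun_prop) (by fun_prop) (hne ρ)))
  have hC : 0 ≤ C := by simpa using (norm_nonneg _).trans (hb 0 (by simpa using hσ.le))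
  -- the integrable majorant
  set M : ℝ → ℝ → ℝ := fun y t => (1 + |t|) ^ (-(3 / 2) : ℝ) + (1 + |t - y|) ^ (-(3 / 2) : ℝ)
    with hM
  have hJ : Integrable fun t : ℝ => (1 + |t|) ^ (-(3 / 2) : ℝ) := by
    simpa only [norm_eq_abs] using
      integrable_one_add_norm (E := ℝ) (μ := volume) (r := 3 / 2) (by norm_num)
  set J := ∫ t : ℝ, (1 + |t|) ^ (-(3 / 2) : ℝ) with hJdef
  have hMint : ∀ y : ℝ, Integrable (M y) := fun y => hJ.add (hJ.comp_sub_right y)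
  have hMv : ∀ y : ℝ, ∫ t, M y t = 2 * J := fun y => by
    simp only [hM]
    rw [integral_add hJ (hJ.comp_sub_right y),
      integral_sub_right_eq_self (fun t : ℝ => (1 + |t|) ^ (-(3 / 2) : ℝ)) y]
    ring
  set W : ℝ := 2 * C * (8 * (1 / d + 1) ^ 2) with hW
  have hpt : ∀ ρ : zeroSet f, ∀ t : ℝ, ‖F ρ t‖ ≤
      (ordAt f ρ : ℝ) * (1 + ‖(ρ : ℂ)‖) ^ (-(5 / 4) : ℝ) *
        (W * (M (ρ : ℂ).im t + M (-(ρ : ℂ).im) t)) := by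
    intro ρ t
    have h1 := decay_of_div_one_add_sq (hb (σ + I * t) (by simp [abs_of_pos hσ]))
    rw [show ((σ : ℂ) + I * t).im = t by simp] at h1
    have h2 := kernel_bound (t := t) hσ hσ2 hd (hf.strip ρ ρ.2) (hdist ρ ρ.2) (hdist' ρ ρ.2)
    have hmix : ∀ y : ℝ, (1 + |t|) ^ (-(2 : ℝ)) * (1 + |t|) ^ (5 / 4 : ℝ) *
        (1 + |t - y|) ^ (-(3 / 4) : ℝ) ≤ M y t := by
      intro y
      have e1 : ∀ x : ℝ, (1 + |x|) ^ (-(3 / 2) : ℝ) = ((1 + |x|) ^ (-(3 / 4) : ℝ)) ^ 2 :=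
        fun x => by rw [← rpow_natCast, ← rpow_mul (by positivity)]; norm_num
      simp only [hM]
      rw [← rpow_add (by positivity), e1, e1, show (-2 : ℝ) + 5 / 4 = -(3 / 4) by norm_num]
      nlinarith [sq_nonneg ((1 + |t|) ^ (-(3 / 4) : ℝ) - (1 + |t - y|) ^ (-(3 / 4) : ℝ)),
        sq_nonneg ((1 + |t|) ^ (-(3 / 4) : ℝ)), sq_nonneg ((1 + |t - y|) ^ (-(3 / 4) : ℝ))]
    have m1 := hmix (ρ : ℂ).im
    have m2 := hmix (-(ρ : ℂ).im)
    rw [sub_neg_eq_add] at m2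
    simp only [hF]; rw [norm_mul, norm_mul, Complex.norm_natCast, mul_assoc]
    refine mul_le_mul_of_nonneg_left ?_ (Nat.cast_nonneg _)
    calc _ ≤ (2 * C * (1 + |t|) ^ (-(2 : ℝ))) * _ :=
          mul_le_mul h1 h2 (norm_nonneg _) ((norm_nonneg _).trans h1)
      _ = (1 + ‖(ρ : ℂ)‖) ^ (-(5 / 4) : ℝ) * (W * ((1 + |t|) ^ (-(2 : ℝ)) *
            (1 + |t|) ^ (5 / 4 : ℝ) * (1 + |t - (ρ : ℂ).im|) ^ (-(3 / 4) : ℝ) +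
            (1 + |t|) ^ (-(2 : ℝ)) * (1 + |t|) ^ (5 / 4 : ℝ) *
            (1 + |t + (ρ : ℂ).im|) ^ (-(3 / 4) : ℝ))) := by rw [hW]; ring
      _ ≤ _ := by gcongr
  have hmajint : ∀ ρ : zeroSet f, Integrable fun t =>
      (ordAt f ρ : ℝ) * (1 + ‖(ρ : ℂ)‖) ^ (-(5 / 4) : ℝ) *
        (W * (M (ρ : ℂ).im t + M (-(ρ : ℂ).im) t)) := fun ρ =>
    (((hMint _).add (hMint _)).const_mul W).const_mul _
  have hFint : ∀ ρ, Integrable (F ρ) := fun ρ =>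
    (hmajint ρ).mono' (hFc ρ).aestronglyMeasurable (Eventually.of_forall (hpt ρ))
  have hFsum : Summable fun ρ => ∫ t, ‖F ρ t‖ := by
    refine of_nonneg_of_le (fun ρ => integral_nonneg fun t => norm_nonneg _) (fun ρ => ?_)
      (hs.mul_right (W * (4 * J)))
    refine (integral_mono (hFint ρ).norm (hmajint ρ) (hpt ρ)).trans (le_of_eq ?_)
    rw [integral_const_mul, integral_const_mul, integral_add (hMint _) (hMint _), hMv, hMv]; ring
  have hser : ∀ t : ℝ, g (σ + I * t) * logDeriv f (σ + I * t) = ∑' ρ, F ρ t := by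
    intro t
    have hsum : Summable fun ρ : zeroSet f => (ordAt f ρ : ℂ) *
        (((σ : ℂ) + I * t) / (((σ : ℂ) + I * t) ^ 2 - (ρ : ℂ) ^ 2)) := by
      refine of_norm_bounded (hs.mul_right (8 * (1 / d + 1) ^ 2 *
        (1 + |t|) ^ (5 / 4 : ℝ) * (1 + 1))) fun ρ => ?_
      have hle1 : ∀ y : ℝ, (1 + |y|) ^ (-(3 / 4) : ℝ) ≤ 1 := fun y =>
        Real.rpow_le_one_of_one_le_of_nonpos (by linarith [abs_nonneg y]) (by norm_num)
      rw [norm_mul, Complex.norm_natCast, mul_assoc]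
      refine mul_le_mul_of_nonneg_left ((kernel_bound (t := t) hσ hσ2 hd (hf.strip ρ ρ.2)
        (hdist ρ ρ.2) (hdist' ρ ρ.2)).trans ((mul_le_mul_of_nonneg_left
          (add_le_add (hle1 _) (hle1 _)) (by positivity)).trans_eq (by ring))) (Nat.cast_nonneg _)
    rw [← (hf.hasSum_logDeriv (hfne t) hsum).tsum_eq, ← tsum_mul_left]
    exact tsum_congr fun ρ => by simp only [hF]; ring
  simp only [hser]
  refine hasSum_of_eq ((hasSum_integral_of_summable_integral_norm hFint hFsum).mul_left
    (1 / (π : ℂ))) fun ρ => ?_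
  simp only [hF]; rw [integral_const_mul]
  split_ifs with h
  · rw [integral_kernel_of_lt hσ hσ₀ hg hgeven hb h]
    field_simp [ofReal_ne_zero.2 pi_ne_zero]
  · rw [integral_kernel_of_gt hσ hσ₀ hg hgeven hb (lt_of_le_of_ne (not_lt.1 h) fun heq => ?_)]
    · ring
    rcases abs_choice (ρ : ℂ).re with h3 | h3
    exacts [(hne1 ρ ρ.2).1 (heq.trans h3), (hne1 ρ ρ.2).2 (heq.trans h3)]

/-! ### The theta functions of the family -/

lemma gaussian_eq_jacobi {T : ℝ} (w : ℂ) (σ : ℝ) (m : ℤ) :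
    cexp (w * (m + σ) - π * T * (m + σ) ^ 2) = cexp (w * σ - π * T * σ ^ 2) *
      jacobiTheta₂_term m ((w - 2 * π * T * σ) / (2 * π * I)) (I * T) := by
  have hπ : (π : ℂ) ≠ 0 := ofReal_ne_zero.2 pi_ne_zero
  rw [jacobiTheta₂_term, ← exp_add]
  congr 1; field_simp
  linear_combination (-(π : ℂ) * m ^ 2 * T) * I_sq

lemma gaussian_dual_eq_jacobi {T : ℝ} (hT : 0 < T) (w : ℂ) (σ : ℝ) (n : ℤ) :
    cexp (2 * π * I * n * σ + (w - 2 * π * I * n) ^ 2 / (4 * π * T)) =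
      cexp (w * σ - π * T * σ ^ 2) *
      (cexp (-π * I * ((w - 2 * π * T * σ) / (2 * π * I)) ^ 2 / (I * T)) *
      jacobiTheta₂_term n ((w - 2 * π * T * σ) / (2 * π * I) / (I * T))
        (-1 / (I * T))) := by
  have hπ : (π : ℂ) ≠ 0 := ofReal_ne_zero.2 pi_ne_zero
  have hT' : (T : ℂ) ≠ 0 := ofReal_ne_zero.2 hT.ne'
  rw [jacobiTheta₂_term, ← exp_add, ← exp_add]
  congr 1
  have h4 : I ^ 3 = -I := by rw [pow_succ, I_sq]; ring
  have h5 : I ^ 4 = 1 := I_pow_four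
  field_simp; ring_nf
  simp only [h4, h5, I_sq]; ring

lemma summable_norm_gaussian {T : ℝ} (hT : 0 < T) (w : ℂ) (σ : ℝ) :
    Summable fun m : ℤ => ‖cexp (w * (m + σ) - π * T * (m + σ) ^ 2)‖ := by
  simp_rw [gaussian_eq_jacobi]
  refine (Summable.mul_left _ ((summable_jacobiTheta₂_term_iff _ _).2 ?_)).norm
  simpa using hT

lemma summable_norm_gaussian_dual {T : ℝ} (hT : 0 < T) (w : ℂ) (σ : ℝ) :
    Summable fun n : ℤ => ‖cexp (2 * π * I * n * σ + (w - 2 * π * I * n) ^ 2 / (4 * π * T))‖ := by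
  simp_rw [gaussian_dual_eq_jacobi hT]
  refine (Summable.mul_left _ (Summable.mul_left _
    ((summable_jacobiTheta₂_term_iff _ _).2 ?_))).norm
  have : (-1 / (I * T) : ℂ) = ((1 / T : ℝ) : ℂ) * I := by
    have hT' : (T : ℂ) ≠ 0 := ofReal_ne_zero.2 hT.ne'
    push_cast; field_simp; rw [I_sq]
  rw [this]; simpa using hT

lemma tsum_gaussian {T : ℝ} (hT : 0 < T) (w : ℂ) (σ : ℝ) :
    ∑' m : ℤ, cexp (w * (m + σ) - π * T * (m + σ) ^ 2) = (√T : ℂ)⁻¹ *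
      ∑' n : ℤ, cexp (2 * π * I * n * σ +
        (w - 2 * π * I * n) ^ 2 / (4 * π * T)) := by
  simp_rw [gaussian_eq_jacobi, gaussian_dual_eq_jacobi hT, tsum_mul_left]
  have h1 := jacobiTheta₂_functional_equation ((w - 2 * π * T * σ) / (2 * π * I)) (I * T)
  have h2 : (-I * (I * T) : ℂ) ^ (1 / 2 : ℂ) = (√T : ℂ) := by
    rw [show -I * (I * T) = (T : ℂ) by linear_combination (-(T : ℂ)) * I_sq, Real.sqrt_eq_rpow,
      ofReal_cpow hT.le]
    norm_num
  rw [h2] at h1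
  simp only [jacobiTheta₂] at h1; rw [h1]; ring

lemma legendreSym_seven (n : ℤ) : legendreSym 7 n =
    if n % 7 = 0 then 0 else if n % 7 = 1 ∨ n % 7 = 2 ∨ n % 7 = 4 then 1 else -1 := by
  rw [legendreSym.mod]
  have h1 : 0 ≤ n % 7 := Int.emod_nonneg _ (by norm_num)
  have h2 : n % 7 < 7 := Int.emod_lt_of_pos _ (by norm_num)
  change legendreSym 7 (n % 7) = _
  generalize n % 7 = j at *
  interval_cases j <;> decide

lemma epsSign_eq (v : ℤ × ℤ) : epsSign v = legendreSym 7 (2 * v.1 + v.2) := by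
  obtain ⟨a, b⟩ := v
  simp only [epsSign]
  have h : ((a ^ 3 - 2 * a ^ 2 * b - a * b ^ 2 + b ^ 3 : ℤ) : ZMod 7) = ((2 * a + b) ^ 3 : ℤ) := by
    rw [← sub_eq_zero, ← Int.cast_sub, ZMod.intCast_zmod_eq_zero_iff_dvd]
    exact ⟨-a ^ 3 - 2 * a ^ 2 * b - a * b ^ 2, by push_cast; ring⟩
  have h2 : legendreSym 7 ((2 * a + b) ^ 3) = legendreSym 7 (2 * a + b) := by
    rw [legendreSym_seven, legendreSym_seven]
    have : (2 * a + b) ^ 3 % 7 = ((2 * a + b) % 7) ^ 3 % 7 := ((Int.mod_modEq (2 * a + b) 7).pow 3).symm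
    rw [this]
    have h1 : 0 ≤ (2 * a + b) % 7 := Int.emod_nonneg _ (by norm_num)
    have h2 : (2 * a + b) % 7 < 7 := Int.emod_lt_of_pos _ (by norm_num)
    generalize (2 * a + b) % 7 = j at *
    interval_cases j <;> decide
  rw [← h2]
  simp only [legendreSym]; rw [h]

lemma gauss_sum_seven : let ζ := cexp (2 * π * I / 7)
    ζ + ζ ^ 2 + ζ ^ 4 - ζ ^ 3 - ζ ^ 5 - ζ ^ 6 = I * √7 := by
  intro ζ
  have h7 : ζ ^ 7 = 1 := by
    rw [← exp_nat_mul]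
    rw [show ((7 : ℕ) : ℂ) * (2 * π * I / 7) = 2 * π * I by push_cast; ring]
    exact exp_two_pi_mul_I
  have him : ∀ j : ℕ, (ζ ^ j).im = Real.sin (2 * j * π / 7) := by
    intro j
    rw [← exp_nat_mul, show (j : ℂ) * (2 * π * I / 7) =
      ((2 * j * π / 7 : ℝ) : ℂ) * I by push_cast; ring, exp_ofReal_mul_I_im]
  have hre : ∀ j : ℕ, (ζ ^ j).re = Real.cos (2 * j * π / 7) := by
    intro j
    rw [← exp_nat_mul, show (j : ℂ) * (2 * π * I / 7) =
      ((2 * j * π / 7 : ℝ) : ℂ) * I by push_cast; ring, exp_ofReal_mul_I_re]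
  have hconj : ∀ i j : ℕ, i + j = 7 → (ζ ^ j).im = -(ζ ^ i).im ∧ (ζ ^ j).re = (ζ ^ i).re := by
    intro i j hij
    have hj : (j : ℝ) = 7 - i := by rw [eq_sub_iff_add_eq, add_comm]; exact_mod_cast hij
    have e : 2 * (j : ℝ) * π / 7 = 2 * π - 2 * i * π / 7 := by rw [hj]; ring
    rw [him, him, hre, hre, e]
    exact ⟨Real.sin_two_pi_sub _, Real.cos_two_pi_sub _⟩
  set S := ζ + ζ ^ 2 + ζ ^ 4 - ζ ^ 3 - ζ ^ 5 - ζ ^ 6 with hS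
  have hne : ζ - 1 ≠ 0 := by
    intro h
    have h1 := him 1
    rw [pow_one, sub_eq_zero.1 h] at h1
    have : 0 < Real.sin (2 * (1 : ℕ) * π / 7) :=
      Real.sin_pos_of_pos_of_lt_pi (by positivity) (by push_cast; linarith [pi_pos])
    rw [← h1] at this; simp at this
  have hsum : 1 + ζ + ζ ^ 2 + ζ ^ 3 + ζ ^ 4 + ζ ^ 5 + ζ ^ 6 = 0 := by
    have : (ζ - 1) * (1 + ζ + ζ ^ 2 + ζ ^ 3 + ζ ^ 4 + ζ ^ 5 + ζ ^ 6) = 0 := by linear_combination h7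
    exact (mul_eq_zero.1 this).resolve_left hne
  have hSq : S ^ 2 = -7 := by
    have h8 : ζ ^ 8 = ζ := by linear_combination ζ * h7
    have h9 : ζ ^ 9 = ζ ^ 2 := by linear_combination ζ ^ 2 * h7
    have h10 : ζ ^ 10 = ζ ^ 3 := by linear_combination ζ ^ 3 * h7
    have h11 : ζ ^ 11 = ζ ^ 4 := by linear_combination ζ ^ 4 * h7
    have h12 : ζ ^ 12 = ζ ^ 5 := by linear_combination ζ ^ 5 * h7
    rw [hS]; ring_nf
    simp only [h7, h8, h10, h11, h12]
    linear_combination hsum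
  have hSre : S.re = 0 := by
    have h1 := (hconj 1 6 rfl).2
    have h2 := (hconj 2 5 rfl).2
    have h3 := (hconj 4 3 rfl).2
    simp only [hS, sub_re, add_re]
    rw [h1, h2, h3, pow_one]; ring
  have hSim : 0 < S.im := by
    have h1 := (hconj 1 6 rfl).1
    have h2 := (hconj 2 5 rfl).1
    have h3 := (hconj 4 3 rfl).1
    have e : S.im = 2 * ((ζ ^ 1).im + (ζ ^ 2).im + (ζ ^ 4).im) := by
      simp only [hS, sub_im, add_im]
      rw [h1, h2, h3, pow_one]; ring
    rw [e, him, him, him]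
    have e4 : Real.sin (2 * (4 : ℕ) * π / 7) = -Real.sin (π / 7) := by
      rw [show 2 * ((4 : ℕ) : ℝ) * π / 7 = π / 7 + π by push_cast; ring, Real.sin_add_pi]
    have e2 : 0 < Real.sin (2 * (2 : ℕ) * π / 7) :=
      Real.sin_pos_of_pos_of_lt_pi (by positivity) (by push_cast; linarith [pi_pos])
    have e1 : Real.sin (π / 7) < Real.sin (2 * (1 : ℕ) * π / 7) :=
      Real.sin_lt_sin_of_lt_of_le_pi_div_two (by linarith [pi_pos])
        (by push_cast; linarith [pi_pos]) (by push_cast; linarith [pi_pos])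
    rw [e4]; linarith
  have hval : S = I * S.im := by apply Complex.ext <;> simp [hSre]
  have h49 : S.im ^ 2 = 7 := by
    rw [hval, mul_pow, I_sq] at hSq
    have : ((S.im ^ 2 : ℝ) : ℂ) = (7 : ℝ) := by push_cast; linear_combination -hSq
    exact_mod_cast this
  rw [hval, ← h49, sqrt_sq hSim.le]

lemma gauss_sum_legendre (s : Fin 2) (n : ℤ) :
    ∑ r : Fin 7, (legendreSym 7 (2 * (r : ℕ) + (s : ℕ)) : ℂ) *
      cexp (2 * π * I * n * (((2 * (r : ℕ) + (s : ℕ) : ℝ) / 14 : ℝ) : ℂ)) =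
    cexp (2 * π * I * n * (((s : ℕ) : ℝ) / 2 : ℝ)) * (legendreSym 7 n * (I * √7)) := by
  set ζ := cexp (2 * π * I / 7) with hζ
  have hg := gauss_sum_seven
  simp only [← hζ] at hg
  have h7 : ζ ^ 7 = 1 := by
    rw [← exp_nat_mul]
    rw [show ((7 : ℕ) : ℂ) * (2 * π * I / 7) = 2 * π * I by push_cast; ring]
    exact exp_two_pi_mul_I
  obtain ⟨q, j, hj, hn⟩ : ∃ q : ℤ, ∃ j : ℕ, j < 7 ∧ n = 7 * q + j :=
    ⟨n / 7, (n % 7).toNat, by omega, by omega⟩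
  set x := ζ ^ j with hx
  have hx' : cexp (2 * π * I * n / 7) = x := by
    rw [hn, hx, ← exp_nat_mul]
    rw [show 2 * π * I * ((7 * q + j : ℤ) : ℂ) / 7 =
      q * (2 * π * I) + j * (2 * π * I / 7) by push_cast; ring, exp_add,
      exp_int_mul_two_pi_mul_I, one_mul]
  have hx7 : x ^ 7 = 1 := by rw [hx, ← pow_mul, mul_comm, pow_mul, h7, one_pow]
  have hleg : x + x ^ 2 + x ^ 4 - x ^ 3 - x ^ 5 - x ^ 6 = legendreSym 7 n * (I * √7) := by
    rw [← hg, legendreSym_seven]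
    have hmod : n % 7 = j := by omega
    rw [hmod, hx]
    interval_cases j
    all_goals norm_num
    all_goals ring_nf
    all_goals first
      | done
      | (have h8 : ζ ^ 8 = ζ := by linear_combination ζ * h7
         have h9 : ζ ^ 9 = ζ ^ 2 := by linear_combination ζ ^ 2 * h7
         have h10 : ζ ^ 10 = ζ ^ 3 := by linear_combination ζ ^ 3 * h7
         have h12 : ζ ^ 12 = ζ ^ 5 := by linear_combination ζ ^ 5 * h7
         have h15 : ζ ^ 15 = ζ := by linear_combination ζ * (ζ ^ 7 + 1) * h7
         have h16 : ζ ^ 16 = ζ ^ 2 := by linear_combination ζ ^ 2 * (ζ ^ 7 + 1) * h7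
         have h18 : ζ ^ 18 = ζ ^ 4 := by linear_combination ζ ^ 4 * (ζ ^ 7 + 1) * h7
         have h20 : ζ ^ 20 = ζ ^ 6 := by linear_combination ζ ^ 6 * (ζ ^ 7 + 1) * h7
         have h24 : ζ ^ 24 = ζ ^ 3 := by linear_combination ζ ^ 3 * (ζ ^ 14 + ζ ^ 7 + 1) * h7
         have h25 : ζ ^ 25 = ζ ^ 4 := by linear_combination ζ ^ 4 * (ζ ^ 14 + ζ ^ 7 + 1) * h7
         have h30 : ζ ^ 30 = ζ ^ 2 := by
           linear_combination ζ ^ 2 * (ζ ^ 21 + ζ ^ 14 + ζ ^ 7 + 1) * h7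
         have h36 : ζ ^ 36 = ζ := by
           linear_combination ζ * (ζ ^ 28 + ζ ^ 21 + ζ ^ 14 + ζ ^ 7 + 1) * h7
         simp only [h8, h9, h10, h12, h15, h16, h18, h20, h24, h25, h30, h36]
         ring)
  have hpow : ∀ r : ℕ, cexp (2 * π * I * n * r / 7) = x ^ r := by
    intro r; rw [← hx', ← exp_nat_mul]
    congr 1; ring
  have hL : ∀ m : ℤ, ((legendreSym 7 m : ℤ) : ℂ) =
    if m % 7 = 0 then 0 else if m % 7 = 1 ∨ m % 7 = 2 ∨ m % 7 = 4 then 1 else -1 := by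
    intro m; rw [legendreSym_seven]; split_ifs <;> simp
  rw [← hleg]
  fin_cases s
  · have hterm : ∀ r : ℕ, cexp (2 * π * I * n * (((2 * r + (0 : ℕ) : ℝ) / 14 : ℝ) : ℂ)) =
        x ^ r := by
      intro r
      rw [← hpow]; congr 1; push_cast; ring
    simp only [Fin.isValue, Fin.coe_ofNat_eq_mod, Nat.zero_mod, hterm, Fin.sum_univ_succ, hL]
    norm_num; ring
  · have hterm : ∀ r : ℕ, cexp (2 * π * I * n * (((2 * r + (1 : ℕ) : ℝ) / 14 : ℝ) : ℂ)) =
        cexp (2 * π * I * n * (((1 : ℕ) : ℝ) / 2 : ℝ)) * (x ^ (r + 4)) := by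
      intro r; rw [← hpow, ← exp_add]
      have : cexp (2 * π * I * n * (((2 * r + (1 : ℕ) : ℝ) / 14 : ℝ) : ℂ)) =
        cexp (2 * π * I * n * (((2 * r + (1 : ℕ) : ℝ) / 14 : ℝ) : ℂ)) *
          cexp (n * (2 * π * I)) := by
        rw [exp_int_mul_two_pi_mul_I, mul_one]
      rw [this, ← exp_add]
      congr 1; push_cast; ring
    simp only [Fin.isValue, Fin.coe_ofNat_eq_mod, hterm, Fin.sum_univ_succ, hL]; norm_num
    have h8 : x ^ 8 = x := by linear_combination x * hx7
    have h9 : x ^ 9 = x ^ 2 := by linear_combination x ^ 2 * hx7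
    have h10 : x ^ 10 = x ^ 3 := by linear_combination x ^ 3 * hx7
    rw [h8, h9, h10]; ring

/-- The generating function of the theta series of the family. -/
def thetaGen (u : ℂ) (t : ℝ) : ℂ := ∑' v : ℤ × ℤ, (epsSign v : ℂ) *
    cexp (u * (v.1 + v.2 * eta) - 2 * π * normForm v * t / 7)

/-- Coordinates `(l + s/2) + (m + s/2) √-7` on the ring of integers. -/
def halfCoord : Fin 2 × (ℤ × ℤ) ≃ ℤ × ℤ where
  toFun p := (p.2.1 - p.2.2, 2 * p.2.2 + (p.1 : ℕ))
  invFun v := (if v.2 % 2 = 0 then 0 else 1, (v.1 + v.2 / 2, v.2 / 2))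
  left_inv := by
    rintro ⟨s, l, m⟩
    fin_cases s
    · simp
    · have h1 : (2 * m + 1) % 2 = 1 := by omega
      have h2 : (2 * m + 1) / 2 = m := by omega
      simp [h1, h2]
  right_inv := by
    rintro ⟨a, b⟩
    by_cases h : b % 2 = 0
    · simp [h]; omega
    · simp [h]; omega

lemma sqrt_seven_sq : ((√7 : ℝ) : ℂ) ^ 2 = 7 := by
  rw [← ofReal_pow, sq_sqrt (by norm_num)]; norm_num

lemma exp_halfCoord (u : ℂ) (t : ℝ) (s : Fin 2) (l m : ℤ) :
    cexp (u * (((halfCoord (s, (l, m))).1 : ℂ) + (halfCoord (s, (l, m))).2 * eta) -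
      2 * π * normForm (halfCoord (s, (l, m))) * t / 7) =
    cexp (u * (l + (((s : ℕ) : ℝ) / 2 : ℝ)) -
        π * (2 * t / 7 : ℝ) * (l + (((s : ℕ) : ℝ) / 2 : ℝ)) ^ 2) *
      cexp ((I * √7 * u) * (m + (((s : ℕ) : ℝ) / 2 : ℝ)) -
        π * (2 * t : ℝ) * (m + (((s : ℕ) : ℝ) / 2 : ℝ)) ^ 2) := by
  rw [← exp_add]
  congr 1
  simp only [halfCoord, normForm, eta, Equiv.coe_fn_mk]; push_cast; ring

lemma norm_epsSign_le (v : ℤ × ℤ) : ‖((epsSign v : ℤ) : ℂ)‖ ≤ 1 := by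
  rw [epsSign_eq, legendreSym_seven]; split_ifs <;> simp

lemma norm_legendreSym_le (n : ℤ) : ‖((legendreSym 7 n : ℤ) : ℂ)‖ ≤ 1 := by
  rw [legendreSym_seven]; split_ifs <;> simp

lemma tsum_int_mod_seven {a : ℤ → ℂ} (ha : Summable a) :
    ∑' l, a l = ∑ r : Fin 7, ∑' m : ℤ, a (m * 7 + (r : ℕ)) := by
  have h1 : Summable (a ∘ ((Equiv.prodComm (Fin 7) ℤ).trans (Int.divModEquiv 7).symm)) :=
    (Equiv.summable_iff _).2 ha
  rw [← ((Equiv.prodComm (Fin 7) ℤ).trans (Int.divModEquiv 7).symm).tsum_eq a]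
  have h2 := h1.tsum_prod
  exact h2.trans (tsum_fintype _)

lemma tsum_halfCoord {F : ℤ × ℤ → ℂ} (hF : Summable F) :
    ∑' v, F v = ∑ s : Fin 2, ∑' p : ℤ × ℤ, F (halfCoord (s, p)) := by
  have h1 : Summable (F ∘ halfCoord) := (Equiv.summable_iff _).2 hF
  rw [← halfCoord.tsum_eq F]
  have h2 := h1.tsum_prod
  exact h2.trans (tsum_fintype _)

/-- The sign `e(s n / 2)`. -/
def halfTurn (s : Fin 2) (n : ℤ) : ℂ := cexp (2 * π * I * n * (((s : ℕ) : ℝ) / 2 : ℝ))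

/-- The Gaussian dual to the first coordinate. -/
def dualFst (u : ℂ) (t : ℝ) (n : ℤ) : ℂ :=
  cexp ((7 * u - 2 * π * I * n) ^ 2 / (4 * π * (14 * t : ℝ)))

/-- The Gaussian dual to the second coordinate. -/
def dualSnd (u : ℂ) (t : ℝ) (n : ℤ) : ℂ :=
  cexp ((I * √7 * u - 2 * π * I * n) ^ 2 / (4 * π * (2 * t : ℝ)))

lemma norm_halfTurn (s : Fin 2) (n : ℤ) : ‖halfTurn s n‖ = 1 := by
  rw [halfTurn, show 2 * π * I * n * ((((s : ℕ) : ℝ) / 2 : ℝ) : ℂ) =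
    ((2 * π * n * (((s : ℕ) : ℝ) / 2) : ℝ) : ℂ) * I by push_cast; ring,
    norm_exp_ofReal_mul_I]

lemma sum_halfTurn (n n' : ℤ) :
    ∑ s : Fin 2, halfTurn s n * halfTurn s n' = if (n + n') % 2 = 0 then 2 else 0 := by
  have h0 : ∀ n, halfTurn 0 n = 1 := fun n => by simp [halfTurn]
  have h1 : halfTurn 1 n * halfTurn 1 n' = cexp (π * I * (n + n' : ℤ)) := by
    simp only [halfTurn]; rw [← exp_add]
    congr 1
    have : ((((1 : Fin 2) : ℕ) : ℝ) / 2 : ℝ) = 1 / 2 := by norm_num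
    rw [this]; push_cast; ring
  rw [Fin.sum_univ_two, h0, h0, h1]
  split_ifs with h
  · obtain ⟨q, hq⟩ : ∃ q, n + n' = 2 * q := ⟨(n + n') / 2, by omega⟩
    rw [hq, show π * I * ((2 * q : ℤ) : ℂ) = q * (2 * π * I) by push_cast; ring,
      exp_int_mul_two_pi_mul_I]
    norm_num
  · obtain ⟨q, hq⟩ : ∃ q, n + n' = 2 * q + 1 := ⟨(n + n') / 2, by omega⟩
    rw [hq, show π * I * ((2 * q + 1 : ℤ) : ℂ) = q * (2 * π * I) + π * I by
      push_cast; ring, exp_add, exp_int_mul_two_pi_mul_I, exp_pi_mul_I]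
    norm_num

lemma tsum_legendre_gaussian (u : ℂ) {t : ℝ} (ht : 0 < t) (s : Fin 2) :
    ∑' l : ℤ, (legendreSym 7 (2 * l + (s : ℕ)) : ℂ) * cexp (u * (l + (((s : ℕ) : ℝ) / 2 : ℝ)) -
        π * (2 * t / 7 : ℝ) * (l + (((s : ℕ) : ℝ) / 2 : ℝ)) ^ 2) =
    (√(14 * t) : ℂ)⁻¹ * ∑' n : ℤ,
      halfTurn s n * (legendreSym 7 n * (I * √7)) * dualFst u t n := by
  have hsum : Summable fun l : ℤ => (legendreSym 7 (2 * l + (s : ℕ)) : ℂ) *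
      cexp (u * (l + (((s : ℕ) : ℝ) / 2 : ℝ)) -
        π * (2 * t / 7 : ℝ) * (l + (((s : ℕ) : ℝ) / 2 : ℝ)) ^ 2) := by
    refine of_norm_bounded
      (summable_norm_gaussian (T := 2 * t / 7) (by positivity) u (((s : ℕ) : ℝ) / 2)) fun l => ?_
    rw [norm_mul]; exact mul_le_of_le_one_left (norm_nonneg _) (norm_legendreSym_le _)
  have h14 : 0 < 14 * t := by positivity
  rw [tsum_int_mod_seven hsum]
  have hterm : ∀ (r : Fin 7) (m : ℤ), (legendreSym 7 (2 * (m * 7 + ((r : ℕ) : ℤ)) + (s : ℕ)) : ℂ) *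
      cexp (u * ((m * 7 + ((r : ℕ) : ℤ) : ℤ) + (((s : ℕ) : ℝ) / 2 : ℝ)) -
        π * (2 * t / 7 : ℝ) * ((m * 7 + ((r : ℕ) : ℤ) : ℤ) + (((s : ℕ) : ℝ) / 2 : ℝ)) ^ 2) =
      (legendreSym 7 (2 * (r : ℕ) + (s : ℕ)) : ℂ) *
        cexp ((7 * u) * (m + ((2 * (r : ℕ) + (s : ℕ) : ℝ) / 14 : ℝ)) -
          π * (14 * t : ℝ) * (m + ((2 * (r : ℕ) + (s : ℕ) : ℝ) / 14 : ℝ)) ^ 2) := by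
    intro r m
    congr 1
    · rw [legendreSym_seven, legendreSym_seven]
      rw [show (2 * (m * 7 + ((r : ℕ) : ℤ)) + ((s : ℕ) : ℤ)) % 7 =
        (2 * ((r : ℕ) : ℤ) + ((s : ℕ) : ℤ)) % 7 by omega]
    · congr 1
      push_cast; ring
  have hdual : ∀ r : Fin 7, Summable fun n : ℤ =>
      (legendreSym 7 (2 * (r : ℕ) + (s : ℕ)) : ℂ) *
      cexp (2 * π * I * n * ((2 * (r : ℕ) + (s : ℕ) : ℝ) / 14 : ℝ) +
      (7 * u - 2 * π * I * n) ^ 2 / (4 * π * (14 * t : ℝ))) := fun r =>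
    (summable_norm_gaussian_dual h14 (7 * u) _).of_norm.mul_left _
  have hr : ∀ r : Fin 7, ∑' m : ℤ, (legendreSym 7 (2 * (m * 7 + ((r : ℕ) : ℤ)) + (s : ℕ)) : ℂ) *
      cexp (u * ((m * 7 + ((r : ℕ) : ℤ) : ℤ) + (((s : ℕ) : ℝ) / 2 : ℝ)) -
        π * (2 * t / 7 : ℝ) * ((m * 7 + ((r : ℕ) : ℤ) : ℤ) + (((s : ℕ) : ℝ) / 2 : ℝ)) ^ 2) =
      (√(14 * t) : ℂ)⁻¹ * ∑' n : ℤ, (legendreSym 7 (2 * (r : ℕ) + (s : ℕ)) : ℂ) *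
      cexp (2 * π * I * n * ((2 * (r : ℕ) + (s : ℕ) : ℝ) / 14 : ℝ) +
      (7 * u - 2 * π * I * n) ^ 2 / (4 * π * (14 * t : ℝ))) := by
    intro r; rw [tsum_congr (hterm r), tsum_mul_left, tsum_gaussian h14, tsum_mul_left]; ring
  rw [sum_congr rfl fun r _ => hr r, ← mul_sum, ← tsum_finsetSum fun r _ => hdual r]
  congr 1
  refine tsum_congr fun n => ?_
  rw [halfTurn, ← gauss_sum_legendre, sum_mul, dualFst]
  refine sum_congr rfl fun r _ => ?_
  rw [exp_add, ← mul_assoc]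

lemma summable_norm_exp_normForm (u : ℂ) {t : ℝ} (ht : 0 < t) :
    Summable fun v : ℤ × ℤ => ‖cexp (u * (v.1 + v.2 * eta) - 2 * π * normForm v * t / 7)‖ := by
  rw [← halfCoord.summable_iff]
  have h0 : ∀ s : Fin 2, Summable fun p : ℤ × ℤ =>
      ((fun v : ℤ × ℤ => ‖cexp (u * (v.1 + v.2 * eta) - 2 * π * normForm v * t / 7)‖) ∘
        halfCoord) (s, p) := by
    intro s
    have h1 := summable_norm_gaussian (T := 2 * t / 7) (by positivity) u (((s : ℕ) : ℝ) / 2)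
    have h2 := summable_norm_gaussian (T := 2 * t) (by positivity) (I * √7 * u)
      (((s : ℕ) : ℝ) / 2)
    have := h1.mul_of_nonneg h2 (fun _ => norm_nonneg _) (fun _ => norm_nonneg _)
    refine this.congr fun p => ?_
    obtain ⟨l, m⟩ := p
    simp only [comp_apply]; rw [exp_halfCoord, norm_mul]
  exact (summable_prod_of_nonneg (fun p => norm_nonneg _)).2 ⟨h0, (hasSum_fintype _).summable⟩

lemma summable_thetaGen (u : ℂ) {t : ℝ} (ht : 0 < t) : Summable fun v : ℤ × ℤ => (epsSign v : ℂ) *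
      cexp (u * (v.1 + v.2 * eta) - 2 * π * normForm v * t / 7) :=
  of_norm_bounded (summable_norm_exp_normForm u ht) fun v => by
    rw [norm_mul]; exact mul_le_of_le_one_left (norm_nonneg _) (norm_epsSign_le _)

lemma summable_norm_dualFst (u : ℂ) {t : ℝ} (ht : 0 < t) (s : Fin 2) :
    Summable fun n : ℤ => ‖halfTurn s n * (legendreSym 7 n * (I * √7)) * dualFst u t n‖ := by
  have h : Summable fun n => ‖dualFst u t n‖ := by
    refine (summable_norm_gaussian_dual (T := 14 * t) (by positivity) (7 * u) 0).congr fun n => ?_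
    simp [dualFst]
  refine of_nonneg_of_le (fun _ => norm_nonneg _) (fun n => ?_) (h.mul_left (√7))
  rw [norm_mul, norm_mul, norm_halfTurn, one_mul, norm_mul, norm_mul, norm_I, one_mul, norm_real,
    Real.norm_of_nonneg (Real.sqrt_nonneg 7)]
  refine mul_le_mul_of_nonneg_right ?_ (norm_nonneg _)
  exact mul_le_of_le_one_left (Real.sqrt_nonneg _) (norm_legendreSym_le _)

lemma summable_norm_dualSnd (u : ℂ) {t : ℝ} (ht : 0 < t) (s : Fin 2) :
    Summable fun n : ℤ => ‖halfTurn s n * dualSnd u t n‖ := by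
  refine (summable_norm_gaussian_dual (T := 2 * t) (by positivity) (I * √7 * u) 0).congr
    fun n => ?_
  rw [norm_mul, norm_halfTurn, one_mul]; simp [dualSnd]

lemma tsum_gaussian_snd (u : ℂ) {t : ℝ} (ht : 0 < t) (s : Fin 2) :
    ∑' m : ℤ, cexp ((I * √7 * u) * (m + (((s : ℕ) : ℝ) / 2 : ℝ)) -
        π * (2 * t : ℝ) * (m + (((s : ℕ) : ℝ) / 2 : ℝ)) ^ 2) =
      (√(2 * t) : ℂ)⁻¹ * ∑' n : ℤ, halfTurn s n * dualSnd u t n := by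
  rw [tsum_gaussian (by positivity)]
  congr 1
  refine tsum_congr fun n => ?_
  rw [exp_add, halfTurn, dualSnd]

lemma tsum_thetaGen_slice (u : ℂ) {t : ℝ} (ht : 0 < t) (s : Fin 2) :
    ∑' p : ℤ × ℤ, (epsSign (halfCoord (s, p)) : ℂ) *
      cexp (u * ((halfCoord (s, p)).1 + (halfCoord (s, p)).2 * eta) -
        2 * π * normForm (halfCoord (s, p)) * t / 7) =
    ((√(14 * t) : ℂ)⁻¹ * (√(2 * t) : ℂ)⁻¹) *
      ∑' p : ℤ × ℤ, (halfTurn s p.1 * (legendreSym 7 p.1 * (I * √7)) * dualFst u t p.1) *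
        (halfTurn s p.2 * dualSnd u t p.2) := by
  have hA := summable_norm_gaussian (T := 2 * t / 7) (by positivity) u (((s : ℕ) : ℝ) / 2)
  have hA' : Summable fun l : ℤ => ‖(legendreSym 7 (2 * l + (s : ℕ)) : ℂ) *
    cexp (u * (l + (((s : ℕ) : ℝ) / 2 : ℝ)) -
      π * (2 * t / 7 : ℝ) * (l + (((s : ℕ) : ℝ) / 2 : ℝ)) ^ 2)‖ := by
    refine of_nonneg_of_le (fun _ => norm_nonneg _) (fun l => ?_) hA
    rw [norm_mul]; exact mul_le_of_le_one_left (norm_nonneg _) (norm_legendreSym_le _)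
  have hB := summable_norm_gaussian (T := 2 * t) (by positivity) (I * √7 * u)
    (((s : ℕ) : ℝ) / 2)
  rw [← tsum_mul_tsum_of_summable_norm (summable_norm_dualFst u ht s)
    (summable_norm_dualSnd u ht s), mul_mul_mul_comm, ← tsum_legendre_gaussian u ht s,
    ← tsum_gaussian_snd u ht s, tsum_mul_tsum_of_summable_norm hA' hB]
  refine tsum_congr fun p => ?_
  obtain ⟨l, m⟩ := p
  rw [exp_halfCoord, ← mul_assoc, epsSign_eq]
  have : 2 * (halfCoord (s, (l, m))).1 + (halfCoord (s, (l, m))).2 = 2 * l + (s : ℕ) := by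
    simp only [halfCoord, Equiv.coe_fn_mk]; ring
  rw [this]

lemma dualFst_mul_dualSnd (u : ℂ) {t : ℝ} (ht : 0 < t) (v : ℤ × ℤ) :
    dualFst u t (2 * v.1 + v.2) * dualSnd u t v.2 = cexp (-I * u / t * (v.1 + v.2 * eta) -
        2 * π * normForm v * ((1 / t : ℝ) : ℂ) / 7) := by
  have ht' : (t : ℂ) ≠ 0 := ofReal_ne_zero.2 ht.ne'
  have hπ : (π : ℂ) ≠ 0 := ofReal_ne_zero.2 pi_ne_zero
  simp only [dualFst, dualSnd, eta, normForm]; rw [← exp_add]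
  congr 1
  have h7 := sqrt_seven_sq
  generalize ((√7 : ℝ) : ℂ) = r at *
  push_cast; field_simp
  have h4 : I ^ 2 = -1 := I_sq
  ring_nf
  simp only [h4, h7]; ring

lemma sqrt_prefactor {t : ℝ} (ht : 0 < t) :
    (√(14 * t) : ℂ)⁻¹ * (√(2 * t) : ℂ)⁻¹ * (I * √7) * 2 = I / t := by
  have ht' : (t : ℂ) ≠ 0 := ofReal_ne_zero.2 ht.ne'
  have h1 : √(14 * t) * √(2 * t) = √7 * (2 * t) := by
    rw [show 14 * t = 7 * (2 * t) by ring, Real.sqrt_mul (by norm_num), mul_assoc,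
      Real.mul_self_sqrt (by positivity)]
  have h2 : ((√(14 * t) : ℝ) : ℂ) * √(2 * t) = √7 * (2 * t) := by exact_mod_cast h1
  have h7 : ((√7 : ℝ) : ℂ) ≠ 0 := ofReal_ne_zero.2 (by positivity)
  rw [← mul_inv, h2]; field_simp

lemma thetaGen_inv (u : ℂ) {t : ℝ} (ht : 0 < t) :
    thetaGen u t = (I / t) * thetaGen (-I * u / t) (1 / t) := by
  have hdsum : ∀ s : Fin 2, Summable fun p : ℤ × ℤ =>
      (halfTurn s p.1 * (legendreSym 7 p.1 * (I * √7)) * dualFst u t p.1) *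
        (halfTurn s p.2 * dualSnd u t p.2) := fun s =>
    summable_mul_of_summable_norm
      (f := fun n => halfTurn s n * (legendreSym 7 n * (I * √7)) * dualFst u t n)
      (g := fun n => halfTurn s n * dualSnd u t n)
      (summable_norm_dualFst u ht s) (summable_norm_dualSnd u ht s)
  rw [thetaGen, tsum_halfCoord (summable_thetaGen u ht),
    sum_congr rfl fun s _ => tsum_thetaGen_slice u ht s, ← mul_sum,
    ← tsum_finsetSum (fun s _ => hdsum s)]
  have hinj : Injective fun v : ℤ × ℤ => (2 * v.1 + v.2, v.2) := by
    rintro ⟨a, b⟩ ⟨c, d⟩ h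
    simp only [Prod.mk.injEq] at h ⊢; omega
  have hval : ∀ p : ℤ × ℤ, (∑ s : Fin 2, (halfTurn s p.1 *
      (legendreSym 7 p.1 * (I * √7)) * dualFst u t p.1) *
        (halfTurn s p.2 * dualSnd u t p.2)) = (if (p.1 + p.2) % 2 = 0 then 2 else 0) *
        ((legendreSym 7 p.1 * (I * √7)) * dualFst u t p.1 * dualSnd u t p.2) := by
    intro p; rw [← sum_halfTurn, sum_mul]
    refine sum_congr rfl fun s _ => ?_
    ring
  rw [tsum_congr hval, ← hinj.tsum_eq, thetaGen, ← tsum_mul_left, ← tsum_mul_left]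
  · refine tsum_congr fun v => ?_
    have hmod : (2 * v.1 + v.2 + v.2) % 2 = 0 := by omega
    simp only [hmod, if_true]; rw [epsSign_eq, ← sqrt_prefactor ht, ← dualFst_mul_dualSnd u ht]
    ring
  · intro p hp
    by_contra hcon
    apply hp
    have : ¬ (p.1 + p.2) % 2 = 0 := by
      intro h
      exact hcon ⟨((p.1 - p.2) / 2, p.2), Prod.ext (show 2 * ((p.1 - p.2) / 2) + p.2 = p.1 by omega) rfl⟩
    simp [this]

/-- The algebraic integer `a + b η`. -/
def alg (v : ℤ × ℤ) : ℂ := v.1 + v.2 * eta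

lemma heckeChar_eq (v : ℤ × ℤ) : heckeChar v = epsSign v * alg v := rfl

lemma alg_re (v : ℤ × ℤ) : (alg v).re = v.1 + v.2 / 2 := by simp [alg, eta]; ring

lemma alg_im (v : ℤ × ℤ) : (alg v).im = v.2 * √7 / 2 := by simp [alg, eta]; ring

lemma normForm_eq_norm_sq (v : ℤ × ℤ) : (normForm v : ℝ) = ‖alg v‖ ^ 2 := by
  rw [← normSq_eq_norm_sq, normSq_apply, alg_re, alg_im, normForm]
  have : √7 * √7 = 7 := Real.mul_self_sqrt (by norm_num)
  push_cast
  linear_combination (-(v.2 : ℝ) ^ 2 / 4) * this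

lemma one_le_normForm {v : ℤ × ℤ} (h : v ≠ 0) : 1 ≤ normForm v := by
  obtain ⟨a, b⟩ := v
  simp only [normForm]
  by_contra hcon
  have h0 : a ^ 2 + a * b + 2 * b ^ 2 ≤ 0 := by omega
  have hb : b = 0 := by nlinarith [sq_nonneg (2 * a + b), sq_nonneg b]
  subst hb
  have ha : a = 0 := by nlinarith [sq_nonneg a]
  subst ha
  exact h rfl

lemma norm_heckeChar_le (v : ℤ × ℤ) : ‖heckeChar v‖ ≤ ‖alg v‖ := by
  rw [heckeChar_eq, norm_mul]; exact mul_le_of_le_one_left (norm_nonneg _) (norm_epsSign_le _)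

lemma epsSign_pow (v : ℤ × ℤ) {k : ℕ} (hk : Odd k) : epsSign v ^ k = epsSign v := by
  rw [epsSign_eq, legendreSym_seven]
  split_ifs
  · exact zero_pow hk.pos.ne'
  · exact one_pow k
  · exact hk.neg_one_pow

/-- The exponent `2 π N / 7`. -/
def thetaExp (v : ℤ × ℤ) : ℝ := 2 * π * normForm v / 7

lemma thetaExp_ge {v : ℤ × ℤ} (h : v ≠ 0) : 2 * π / 7 ≤ thetaExp v := by
  have : (1 : ℝ) ≤ normForm v := mod_cast one_le_normForm h
  rw [thetaExp]
  have := pi_pos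
  rw [div_le_div_iff_of_pos_right (by norm_num)]; nlinarith

lemma summable_exp_norm_alg (c : ℝ) {t : ℝ} (ht : 0 < t) :
    Summable fun v : ℤ × ℤ => Real.exp (c * ‖alg v‖) * Real.exp (-thetaExp v * t) := by
  have key : ∀ x y : ℝ, ∀ v : ℤ × ℤ,
      ‖cexp (((x : ℂ) + y * I) * (v.1 + v.2 * eta) - 2 * π * normForm v * t / 7)‖ =
        Real.exp (x * (alg v).re - y * (alg v).im) * Real.exp (-thetaExp v * t) := by
    intro x y v; rw [norm_exp, ← Real.exp_add, ← alg]
    congr 1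
    have : (2 * π * normForm v * t / 7 : ℂ) = ((thetaExp v * t : ℝ) : ℂ) := by
      rw [thetaExp]; push_cast; ring
    rw [this, sub_re, ofReal_re, mul_re]; simp
    ring
  have hs := fun x y : ℝ => (summable_norm_exp_normForm ((x : ℂ) + y * I) ht).congr (key x y)
  refine of_nonneg_of_le (fun v => by positivity) (fun v => ?_)
    ((((hs |c| |c|).add (hs |c| (-|c|))).add (hs (-|c|) |c|)).add (hs (-|c|) (-|c|)))
  have h1 : c * ‖alg v‖ ≤ |c| * |(alg v).re| + |c| * |(alg v).im| := by
    rw [← mul_add]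
    exact (mul_le_mul_of_nonneg_right (le_abs_self c) (norm_nonneg _)).trans
      (mul_le_mul_of_nonneg_left (norm_le_abs_re_add_abs_im _) (abs_nonneg _))
  simp only [← add_mul]
  refine mul_le_mul_of_nonneg_right ((exp_le_exp.2 h1).trans ?_) (exp_pos _).le
  rcases abs_cases (alg v).re with ⟨e1, _⟩ | ⟨e1, _⟩ <;>
  rcases abs_cases (alg v).im with ⟨e2, _⟩ | ⟨e2, _⟩ <;> rw [e1, e2]
  · have : |c| * (alg v).re + |c| * (alg v).im = |c| * (alg v).re - -|c| * (alg v).im := by ring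
    rw [this]
    linarith [exp_pos (|c| * (alg v).re - |c| * (alg v).im),
      exp_pos (-|c| * (alg v).re - |c| * (alg v).im),
      exp_pos (-|c| * (alg v).re - -|c| * (alg v).im)]
  · have : |c| * (alg v).re + |c| * -(alg v).im = |c| * (alg v).re - |c| * (alg v).im := by ring
    rw [this]
    linarith [exp_pos (|c| * (alg v).re - -|c| * (alg v).im),
      exp_pos (-|c| * (alg v).re - |c| * (alg v).im),
      exp_pos (-|c| * (alg v).re - -|c| * (alg v).im)]
  · have : |c| * -(alg v).re + |c| * (alg v).im = -|c| * (alg v).re - -|c| * (alg v).im := by ring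
    rw [this]
    linarith [exp_pos (|c| * (alg v).re - -|c| * (alg v).im),
      exp_pos (-|c| * (alg v).re - |c| * (alg v).im),
      exp_pos (|c| * (alg v).re - |c| * (alg v).im)]
  · have : |c| * -(alg v).re + |c| * -(alg v).im = -|c| * (alg v).re - |c| * (alg v).im := by ring
    rw [this]
    linarith [exp_pos (|c| * (alg v).re - -|c| * (alg v).im),
      exp_pos (|c| * (alg v).re - |c| * (alg v).im),
      exp_pos (-|c| * (alg v).re - -|c| * (alg v).im)]

lemma summable_pow_alg (k : ℕ) {t : ℝ} (ht : 0 < t) :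
    Summable fun v : ℤ × ℤ => ‖alg v‖ ^ k * Real.exp (-thetaExp v * t) := by
  refine of_nonneg_of_le (fun v => by positivity) (fun v => ?_)
    ((summable_exp_norm_alg 1 ht).mul_left (k.factorial : ℝ))
  rw [one_mul, ← mul_assoc]
  refine mul_le_mul_of_nonneg_right ?_ (exp_pos _).le
  have := Real.pow_div_factorial_le_exp ‖alg v‖ (norm_nonneg _) k
  rwa [div_le_iff₀ (by positivity), mul_comm] at this

lemma eq_of_hasSum_pow {c d : ℕ → ℂ} {g : ℂ → ℂ} (h1 : ∀ u, HasSum (fun k => c k * u ^ k) (g u))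
    (h2 : ∀ u, HasSum (fun k => d k * u ^ k) (g u)) : c = d := by
  have key : ∀ c : ℕ → ℂ, (∀ u, HasSum (fun k => c k * u ^ k) (g u)) →
      HasFPowerSeriesAt g (FormalMultilinearSeries.ofScalars ℂ c) 0 := by
    intro c h; rw [hasFPowerSeriesAt_iff]
    refine Eventually.of_forall fun z => ?_
    simp only [FormalMultilinearSeries.coeff_ofScalars, smul_eq_mul, zero_add]
    simpa only [mul_comm] using h z
  have := (key c h1).eq_formalMultilinearSeries (key d h2)
  ext k
  have h3 := congrArg (fun p => p.coeff k) this
  simpa only [FormalMultilinearSeries.coeff_ofScalars] using h3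

/-- The moments of the theta series. -/
def thetaMoment (k : ℕ) (t : ℝ) : ℂ :=
  ∑' v : ℤ × ℤ, (epsSign v : ℂ) * alg v ^ k * (Real.exp (-thetaExp v * t) : ℂ)

lemma hasSum_thetaGen (u : ℂ) {t : ℝ} (ht : 0 < t) :
    HasSum (fun k : ℕ => thetaMoment k t / k.factorial * u ^ k) (thetaGen u t) := by
  set F : (ℤ × ℤ) × ℕ → ℂ := fun p => (epsSign p.1 : ℂ) * (Real.exp (-thetaExp p.1 * t) : ℂ) *
    ((u * alg p.1) ^ p.2 / p.2.factorial) with hF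
  have hexp : ∀ v, HasSum (fun k => F (v, k)) ((epsSign v : ℂ) *
      cexp (u * (v.1 + v.2 * eta) - 2 * π * normForm v * t / 7)) := by
    intro v
    have := (NormedSpace.exp_series_hasSum_exp' (𝕂 := ℂ) (u * alg v)).mul_left
      ((epsSign v : ℂ) * (Real.exp (-thetaExp v * t) : ℂ))
    rw [← exp_eq_exp_ℂ] at this
    have e1 : cexp (u * (v.1 + v.2 * eta) - 2 * π * normForm v * t / 7) =
        (Real.exp (-thetaExp v * t) : ℂ) * cexp (u * alg v) := by
      rw [ofReal_exp, ← exp_add, thetaExp, alg]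
      congr 1
      push_cast; ring
    rw [e1, ← mul_assoc]
    refine hasSum_of_eq this fun k => ?_
    simp only [hF, smul_eq_mul]; ring
  have hS : Summable F := by
    refine Summable.of_norm ((summable_prod_of_nonneg fun _ => norm_nonneg _).2 ⟨fun v => ?_, ?_⟩)
    · simp only [hF, norm_mul, norm_div, norm_pow]
      refine Summable.mul_left _ ?_
      refine (Real.summable_pow_div_factorial (‖u‖ * ‖alg v‖)).congr fun k => ?_
      simp
    · refine of_nonneg_of_le (fun v => tsum_nonneg fun k => norm_nonneg _) (fun v => ?_)
        (summable_exp_norm_alg ‖u‖ ht)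
      have h1 : HasSum (fun k => ‖F (v, k)‖) (‖(epsSign v : ℂ)‖ * Real.exp (-thetaExp v * t) *
          Real.exp (‖u‖ * ‖alg v‖)) := by
        have := (NormedSpace.exp_series_hasSum_exp' (𝕂 := ℝ) (‖u‖ * ‖alg v‖)).mul_left
          (‖(epsSign v : ℂ)‖ * Real.exp (-thetaExp v * t))
        rw [← Real.exp_eq_exp_ℝ] at this
        refine hasSum_of_eq this fun k => ?_
        simp only [hF, norm_mul, norm_div, norm_pow, norm_real, smul_eq_mul, Complex.norm_natCast,
          Real.norm_of_nonneg (exp_pos _).le]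
        ring
      rw [h1.tsum_eq, mul_comm (Real.exp (‖u‖ * _))]
      refine mul_le_mul_of_nonneg_right ?_ (exp_pos _).le
      exact mul_le_of_le_one_left (exp_pos _).le (norm_epsSign_le _)
  have hval : ∑' p, F p = thetaGen u t := by
    rw [hS.tsum_prod, thetaGen]
    exact tsum_congr fun v => (hexp v).tsum_eq
  have hS' : Summable fun p : ℕ × (ℤ × ℤ) => F p.swap := hS.prod_symm
  have hval' : ∑' p : ℕ × (ℤ × ℤ), F p.swap = thetaGen u t := by
    rw [← hval]; exact (Equiv.prodComm ℕ (ℤ × ℤ)).tsum_eq F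
  rw [← hval']
  refine hS'.hasSum.prod_fiberwise fun k => ?_
  have h2 := (hS'.prod_factor k).hasSum
  have e : thetaMoment k t / k.factorial * u ^ k = ∑' v : ℤ × ℤ, F (v, k) := by
    rw [thetaMoment, ← tsum_div_const, ← tsum_mul_right]
    refine tsum_congr fun v => ?_
    simp only [hF, mul_pow]; ring
  rw [e]; exact h2

lemma thetaMoment_inv (k : ℕ) {t : ℝ} (ht : 0 < t) :
    thetaMoment k t = (I / t) * (-I / t) ^ k * thetaMoment k (1 / t) := by
  have h1 := fun u => hasSum_thetaGen u ht
  have h2 : ∀ u, HasSum (fun k : ℕ => (I / t) * (-I / t) ^ k * thetaMoment k (1 / t) /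
      k.factorial * u ^ k) (thetaGen u t) := by
    intro u; rw [thetaGen_inv u ht]
    have := (hasSum_thetaGen (-I * u / t) (one_div_pos.2 ht)).mul_left (I / (t : ℂ))
    refine hasSum_of_eq this fun k => ?_
    rw [show -I * u / (t : ℂ) = (-I / t) * u by ring, mul_pow]
    ring
  have := congrFun (eq_of_hasSum_pow h1 h2) k
  have hk : (k.factorial : ℂ) ≠ 0 := mod_cast k.factorial_ne_zero
  rwa [div_left_inj' hk] at this

/-- The theta function attached to `χ^k`. -/
def theta (k : ℕ) (t : ℝ) : ℂ :=
  ∑' v : ℤ × ℤ, 1 / 2 * heckeChar v ^ k * (Real.exp (-thetaExp v * t) : ℂ)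

lemma norm_theta_term_le (k : ℕ) (v : ℤ × ℤ) (t : ℝ) :
    ‖1 / 2 * heckeChar v ^ k * (Real.exp (-thetaExp v * t) : ℂ)‖ ≤
      ‖alg v‖ ^ k * Real.exp (-thetaExp v * t) := by
  rw [norm_mul, norm_real, Real.norm_of_nonneg (exp_pos _).le, norm_mul, norm_pow]
  refine mul_le_mul_of_nonneg_right ?_ (exp_pos _).le
  have : ‖(1 / 2 : ℂ)‖ = 1 / 2 := by norm_num
  rw [this]
  have h1 : ‖heckeChar v‖ ^ k ≤ ‖alg v‖ ^ k := by gcongr; exact norm_heckeChar_le v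
  have : 0 ≤ ‖heckeChar v‖ ^ k := by positivity
  linarith

lemma hasSum_theta (k : ℕ) {t : ℝ} (ht : 0 < t) :
    HasSum (fun v : ℤ × ℤ => 1 / 2 * heckeChar v ^ k * (Real.exp (-thetaExp v * t) : ℂ))
      (theta k t) :=
  (of_norm_bounded (summable_pow_alg k ht) fun v => norm_theta_term_le k v t).hasSum

lemma theta_eq_moment {k : ℕ} (hk : Odd k) (t : ℝ) : theta k t = 1 / 2 * thetaMoment k t := by
  rw [theta, thetaMoment, ← tsum_mul_left]
  refine tsum_congr fun v => ?_
  rw [heckeChar_eq, mul_pow]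
  have : (epsSign v : ℂ) ^ k = epsSign v := mod_cast epsSign_pow v hk
  rw [this]; ring

lemma theta_inv {k : ℕ} (hk : k % 4 = 1) {t : ℝ} (ht : 0 < t) :
    theta k (1 / t) = (t : ℂ) ^ (k + 1) * theta k t := by
  have ht' : (t : ℂ) ≠ 0 := ofReal_ne_zero.2 ht.ne'
  have hodd : Odd k := Nat.odd_iff.2 (by omega)
  have h1 := thetaMoment_inv k ht
  have h2 : I * (-I) ^ k = 1 := by
    rw [← Nat.div_add_mod k 4, hk, pow_add, pow_mul]
    have : (-I) ^ 4 = 1 := by rw [neg_pow, I_pow_four]; norm_num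
    rw [this, one_pow, one_mul, pow_one]
    linear_combination -I_sq
  rw [theta_eq_moment hodd, theta_eq_moment hodd, h1, div_pow, pow_succ]; field_simp
  linear_combination (-thetaMoment k (1 / t)) * h2

lemma continuousOn_theta (k : ℕ) : ContinuousOn (theta k) (Ioi 0) := by
  have key : ∀ t₀ > 0, ContinuousOn (theta k) (Set.Ici t₀) := by
    intro t₀ ht₀
    refine continuousOn_tsum (fun v => by fun_prop) (summable_pow_alg k ht₀) fun v t ht => ?_
    refine (norm_theta_term_le k v t).trans ?_
    refine mul_le_mul_of_nonneg_left (exp_le_exp.2 ?_) (by positivity)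
    have h0 : 0 ≤ thetaExp v := by rw [thetaExp, normForm_eq_norm_sq]; positivity
    have : t₀ ≤ t := ht
    nlinarith
  intro t ht
  have ht' : 0 < t := ht
  exact ((key (t / 2) (by positivity)).continuousAt
    (Ici_mem_nhds (by linarith))).continuousWithinAt

lemma exists_norm_theta_le (k : ℕ) (hk : k ≠ 0) :
    ∃ C : ℝ, 0 ≤ C ∧ ∀ t : ℝ, 1 ≤ t → ‖theta k t‖ ≤ C * Real.exp (-(2 * π / 7) * t) := by
  have hs := summable_pow_alg k (t := 1) one_pos
  refine ⟨(∑' v : ℤ × ℤ, ‖alg v‖ ^ k * Real.exp (-thetaExp v * 1)) * Real.exp (2 * π / 7),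
    mul_nonneg (tsum_nonneg fun v => by positivity) (exp_pos _).le, fun t ht => ?_⟩
  rw [mul_assoc, ← Real.exp_add, ← tsum_mul_right]
  refine tsum_of_norm_bounded ((hs.mul_right _).hasSum) fun v => ?_
  refine (norm_theta_term_le k v t).trans ?_
  by_cases hv : v = 0
  · subst hv
    simp [alg, hk]
  · rw [mul_assoc, ← Real.exp_add]
    refine mul_le_mul_of_nonneg_left (exp_le_exp.2 ?_) (by positivity)
    have := thetaExp_ge hv
    nlinarith

/-- The functional equation of the theta function, packaged for the Mellin transform. -/
def thetaPair (k : ℕ) (hk : k % 4 = 1) : WeakFEPair ℂ where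
  f := theta k
  g := theta k
  k := k + 1
  ε := 1
  f₀ := 0
  g₀ := 0
  hf_int := (continuousOn_theta k).locallyIntegrableOn measurableSet_Ioi
  hg_int := (continuousOn_theta k).locallyIntegrableOn measurableSet_Ioi
  hk := by positivity
  hε := one_ne_zero
  h_feq := by
    intro x hx; rw [theta_inv hk hx, one_mul, smul_eq_mul]
    congr 1
    rw [show ((k : ℝ) + 1) = ((k + 1 : ℕ) : ℝ) by push_cast; ring, rpow_natCast]
    push_cast; rfl
  hf_top := by
    intro r
    obtain ⟨C, hC0, hC⟩ := exists_norm_theta_le k (by omega)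
    simp only [sub_zero]
    refine IsBigO.trans (g := fun t : ℝ => Real.exp (-(2 * π / 7) * t)) ?_
      (isLittleO_exp_neg_mul_rpow_atTop (by positivity) r).isBigO
    refine IsBigO.of_bound C ?_
    filter_upwards [eventually_ge_atTop 1] with t ht
    rw [Real.norm_of_nonneg (exp_pos _).le]; exact hC t ht
  hg_top := by
    intro r
    obtain ⟨C, hC0, hC⟩ := exists_norm_theta_le k (by omega)
    simp only [sub_zero]
    refine IsBigO.trans (g := fun t : ℝ => Real.exp (-(2 * π / 7) * t)) ?_
      (isLittleO_exp_neg_mul_rpow_atTop (by positivity) r).isBigO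
    refine IsBigO.of_bound C ?_
    filter_upwards [eventually_ge_atTop 1] with t ht
    rw [Real.norm_of_nonneg (exp_pos _).le]; exact hC t ht

lemma isStrongFEPair_theta {k : ℕ} (hk : k % 4 = 1) : IsStrongFEPair (thetaPair k hk) := ⟨rfl, rfl⟩

lemma mellinConvergent_theta {k : ℕ} (hk : k % 4 = 1) (s : ℂ) : MellinConvergent (theta k) s :=
  ((isStrongFEPair_theta hk).hasMellin s).1

lemma differentiable_mellin_theta {k : ℕ} (hk : k % 4 = 1) :
    Differentiable ℂ (mellin (theta k)) := by
  have := (isStrongFEPair_theta hk).differentiable_Λ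
  rwa [(isStrongFEPair_theta hk).Λ_eq] at this

lemma mellin_theta_symm {k : ℕ} (hk : k % 4 = 1) (s : ℂ) :
    mellin (theta k) (k + 1 - s) = mellin (theta k) s := by
  have h1 := (thetaPair k hk).functional_equation s
  rw [(isStrongFEPair_theta hk).Λ_eq, (isStrongFEPair_theta hk).symm_Λ_eq] at h1
  have : (((thetaPair k hk).k : ℝ) : ℂ) = k + 1 := by simp [thetaPair]
  rw [this] at h1
  simpa [thetaPair] using h1

/-! ### The analytic continuation of the family -/

lemma norm_alg_ge_abs (v : ℤ × ℤ) : (|(v.1 : ℝ)| / 2 ≤ ‖alg v‖) ∧ (|(v.2 : ℝ)| / 2 ≤ ‖alg v‖) := by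
  have h := normForm_eq_norm_sq v
  simp only [normForm] at h
  push_cast at h
  constructor
  · refine abs_le_of_sq_le_sq' ?_ (norm_nonneg _) |>.2
    rw [div_pow, sq_abs, ← h]
    nlinarith [sq_nonneg ((v.1 : ℝ) + (v.2 : ℝ)), sq_nonneg (v.1 : ℝ), sq_nonneg (v.2 : ℝ),
      sq_nonneg ((v.1 : ℝ) + 2 * (v.2 : ℝ))]
  · refine abs_le_of_sq_le_sq' ?_ (norm_nonneg _) |>.2
    rw [div_pow, sq_abs, ← h]
    nlinarith [sq_nonneg ((v.1 : ℝ) + (v.2 : ℝ)), sq_nonneg (v.1 : ℝ), sq_nonneg (v.2 : ℝ),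
      sq_nonneg (2 * (v.1 : ℝ) + (v.2 : ℝ))]

lemma summable_norm_alg_rpow {r : ℝ} (hr : 2 < r) :
    Summable fun v : ℤ × ℤ => ‖alg v‖ ^ (-r) := by
  rw [← (finTwoArrowEquiv ℤ).summable_iff]
  refine of_nonneg_of_le (fun x => by simp only [comp_apply]; positivity)
    (fun x => ?_)
    ((EisensteinSeries.summable_one_div_norm_rpow hr).mul_left ((2 : ℝ) ^ r))
  simp only [comp_apply]
  by_cases hx : x = 0
  · subst hx
    simp [alg, finTwoArrowEquiv, zero_rpow (by linarith : -r ≠ 0)]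
  have hx' : 0 < ‖x‖ := norm_pos_iff.2 hx
  have hle : ‖x‖ / 2 ≤ ‖alg (finTwoArrowEquiv ℤ x)‖ := by
    obtain ⟨h1, h2⟩ := norm_alg_ge_abs (finTwoArrowEquiv ℤ x)
    have e0 : (finTwoArrowEquiv ℤ x).1 = x 0 := rfl
    have e1 : (finTwoArrowEquiv ℤ x).2 = x 1 := rfl
    rw [e0] at h1
    rw [e1] at h2; rw [div_le_iff₀ two_pos, pi_norm_le_iff_of_nonneg (by positivity)]
    intro i
    fin_cases i
    · simp only [Fin.zero_eta, Int.norm_eq_abs]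
      linarith
    · simp only [Fin.mk_one, Int.norm_eq_abs]
      linarith
  calc ‖alg (finTwoArrowEquiv ℤ x)‖ ^ (-r) ≤ (‖x‖ / 2) ^ (-r) :=
        rpow_le_rpow_of_nonpos (by positivity) hle (by linarith)
    _ = 2 ^ r * ‖x‖ ^ (-r) := by
        rw [Real.div_rpow hx'.le (by norm_num), rpow_neg (by norm_num : (0:ℝ) ≤ 2)]; field_simp

lemma one_le_norm_alg {v : ℤ × ℤ} (h : v ≠ 0) : 1 ≤ ‖alg v‖ := by
  have h1 : (1 : ℝ) ≤ normForm v := mod_cast one_le_normForm h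
  rw [normForm_eq_norm_sq] at h1
  nlinarith [norm_nonneg (alg v)]

lemma norm_normForm_cpow {v : ℤ × ℤ} (hv : v ≠ 0) (s : ℂ) :
    ‖(normForm v : ℂ) ^ s‖ = ‖alg v‖ ^ (2 * s.re) := by
  have h1 := one_le_norm_alg hv
  have : (normForm v : ℂ) = ((‖alg v‖ ^ 2 : ℝ) : ℂ) := by rw [← normForm_eq_norm_sq]; simp
  rw [this, norm_cpow_eq_rpow_re_of_pos (by positivity), ← rpow_natCast, ← rpow_mul (norm_nonneg _)]
  norm_num

lemma alg_zero : alg 0 = 0 := by simp [alg]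

lemma norm_heckeSeries_term_le {k : ℕ} (hk : k ≠ 0) (v : ℤ × ℤ) (s : ℂ) :
    ‖heckeChar v ^ k / (normForm v : ℂ) ^ (s + (k : ℂ) / 2)‖ ≤ ‖alg v‖ ^ (-(2 * s.re)) := by
  by_cases hv : v = 0
  · subst hv
    rw [heckeChar_eq, alg_zero, mul_zero, zero_pow hk, zero_div, norm_zero]
    exact rpow_nonneg le_rfl _
  have h1 := one_le_norm_alg hv
  rw [norm_div, norm_pow, norm_normForm_cpow hv, rpow_neg (norm_nonneg _)]
  have e : 2 * (s + (k : ℂ) / 2).re = (k : ℝ) + 2 * s.re := by simp; ring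
  rw [e, rpow_add (by linarith), rpow_natCast]
  have h2 : ‖heckeChar v‖ ^ k ≤ ‖alg v‖ ^ k := by gcongr; exact norm_heckeChar_le v
  have h3 : 0 < ‖alg v‖ ^ k := by positivity
  have h4 : 0 < ‖alg v‖ ^ (2 * s.re) := by positivity
  rw [div_le_iff₀ (by positivity), ← div_eq_inv_mul, mul_div_assoc, div_self h4.ne', mul_one]
  exact h2

lemma summable_heckeSeries {k : ℕ} (hk : k ≠ 0) {s : ℂ} (hs : 1 < s.re) :
    Summable fun v : ℤ × ℤ => heckeChar v ^ k / (normForm v : ℂ) ^ (s + (k : ℂ) / 2) :=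
  of_norm_bounded (summable_norm_alg_rpow (r := 2 * s.re) (by linarith))
    fun v => norm_heckeSeries_term_le hk v s

lemma thetaExp_cpow (v : ℤ × ℤ) (s : ℂ) :
    ((thetaExp v : ℝ) : ℂ) ^ s = ((2 * π / 7 : ℝ) : ℂ) ^ s * (normForm v : ℂ) ^ s := by
  have : thetaExp v = (2 * π / 7) * (‖alg v‖ ^ 2) := by rw [← normForm_eq_norm_sq, thetaExp]; ring
  have h2 : (normForm v : ℂ) = ((‖alg v‖ ^ 2 : ℝ) : ℂ) := by rw [← normForm_eq_norm_sq]; simp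
  rw [this, ofReal_mul, mul_cpow_ofReal_nonneg (by positivity) (by positivity), h2]

lemma hasSum_mellin_theta {k : ℕ} (hk : k ≠ 0) {s : ℂ} (hs : 1 < s.re) :
    HasSum (fun v : ℤ × ℤ => Gamma (s + (k : ℂ) / 2) * (1 / 2 * heckeChar v ^ k) /
      ((thetaExp v : ℝ) : ℂ) ^ (s + (k : ℂ) / 2)) (mellin (theta k) (s + (k : ℂ) / 2)) := by
  have hre : (s + (k : ℂ) / 2).re = s.re + k / 2 := by simp
  refine hasSum_mellin (fun v => ?_) ?_ (fun t ht => hasSum_theta k ht) ?_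
  · by_cases hv : v = 0
    · subst hv; left; rw [heckeChar_eq, alg_zero, mul_zero, zero_pow hk, mul_zero]
    · right
      have := thetaExp_ge hv
      have := pi_pos
      linarith [div_pos (mul_pos two_pos this) (by norm_num : (0:ℝ) < 7)]
  · rw [hre]; positivity
  · have := (((summable_heckeSeries hk hs).norm.mul_left (1 / 2)).div_const
      (‖((2 * π / 7 : ℝ) : ℂ) ^ (s + (k : ℂ) / 2)‖))
    refine this.congr fun v => ?_
    by_cases hv : v = 0
    · subst hv; simp [heckeChar_eq, alg_zero, hk]
    have hpos : 0 < thetaExp v := by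
      have := thetaExp_ge hv
      have := pi_pos
      linarith [div_pos (mul_pos two_pos this) (by norm_num : (0:ℝ) < 7)]
    rw [← norm_cpow_eq_rpow_re_of_pos hpos, thetaExp_cpow, norm_mul, norm_mul, norm_div,
      show ‖(1 / 2 : ℂ)‖ = 1 / 2 by norm_num]
    field_simp

lemma mellin_theta_eq {k : ℕ} (hk : k ≠ 0) {s : ℂ} (hs : 1 < s.re) :
    mellin (theta k) (s + (k : ℂ) / 2) = Gamma (s + (k : ℂ) / 2) *
      ((2 * π / 7 : ℝ) : ℂ) ^ (-(s + (k : ℂ) / 2)) * heckeSeries k s := by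
  rw [← (hasSum_mellin_theta hk hs).tsum_eq, heckeSeries, ← tsum_mul_left, ← tsum_mul_left]
  refine tsum_congr fun v => ?_
  rw [thetaExp_cpow, cpow_neg]
  simp only [div_eq_mul_inv, mul_inv]; ring

/-- The entire continuation of the Dirichlet series of `L(s, χ^k)`. -/
def heckeCont (k : ℕ) (s : ℂ) : ℂ :=
  ((2 * π / 7 : ℝ) : ℂ) ^ (s + (k : ℂ) / 2) * (Gamma (s + (k : ℂ) / 2))⁻¹ *
    mellin (theta k) (s + (k : ℂ) / 2)

lemma two_pi_div_seven_ne : ((2 * π / 7 : ℝ) : ℂ) ≠ 0 := ofReal_ne_zero.2 (by positivity)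

lemma isHeckeContinuation_heckeCont {k : ℕ} (hk : k % 4 = 1) :
    IsHeckeContinuation k (heckeCont k) := by
  constructor
  · refine Differentiable.mul (Differentiable.mul ?_ ?_) ?_
    · exact (differentiable_id.add_const _).const_cpow (Or.inl two_pi_div_seven_ne)
    · exact differentiable_one_div_Gamma.comp (differentiable_id.add_const _)
    · exact (differentiable_mellin_theta hk).comp (differentiable_id.add_const _)
  · intro s hs
    have hG : Gamma (s + (k : ℂ) / 2) ≠ 0 := by
      refine Gamma_ne_zero_of_re_pos ?_
      have : (s + (k : ℂ) / 2).re = s.re + k / 2 := by simp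
      rw [this]; positivity
    have hp : ((2 * π / 7 : ℝ) : ℂ) ^ (s + (k : ℂ) / 2) ≠ 0 := by
      rw [Ne, cpow_eq_zero_iff]; exact fun h => two_pi_div_seven_ne h.1
    rw [heckeCont, mellin_theta_eq (by omega) hs, cpow_neg]
    generalize Gamma (s + (k : ℂ) / 2) = G at *
    generalize ((2 * π / 7 : ℝ) : ℂ) ^ (s + (k : ℂ) / 2) = P at *
    field_simp

lemma familyL_eq {n : ℕ} (hn : 1 ≤ n) : familyL n = heckeCont (4 * n - 3) :=
  heckeL_eq (isHeckeContinuation_heckeCont (by omega))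

lemma differentiable_familyL {n : ℕ} (hn : 1 ≤ n) : Differentiable ℂ (familyL n) := by
  rw [familyL_eq hn]; exact (isHeckeContinuation_heckeCont (by omega)).1

lemma familyL_eq_series {n : ℕ} (hn : 1 ≤ n) {s : ℂ} (hs : 1 < s.re) :
    familyL n s = heckeSeries (4 * n - 3) s := by
  rw [familyL_eq hn]; exact (isHeckeContinuation_heckeCont (by omega)).2 s hs

/-- The completed `L`-function, as a function of `z = s - 1/2`. -/
def xi (n : ℕ) (z : ℂ) : ℂ := mellin (theta (4 * n - 3)) (2 * n - 1 + z)

lemma differentiable_xi {n : ℕ} (hn : 1 ≤ n) : Differentiable ℂ (xi n) :=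
  (differentiable_mellin_theta (by omega)).comp (differentiable_id.const_add _)

lemma cast_weight {n : ℕ} (hn : 1 ≤ n) : ((4 * n - 3 : ℕ) : ℂ) = 4 * n - 3 := by
  rw [Nat.cast_sub (by omega)]; push_cast; ring

lemma xi_neg {n : ℕ} (hn : 1 ≤ n) (z : ℂ) : xi n (-z) = xi n z := by
  rw [xi, xi, ← mellin_theta_symm (by omega), cast_weight hn]
  congr 1; ring

lemma familyL_eq_xi {n : ℕ} (hn : 1 ≤ n) (z : ℂ) :
    familyL n (1 / 2 + z) = ((2 * π / 7 : ℝ) : ℂ) ^ (2 * n - 1 + z) *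
      (Gamma (2 * n - 1 + z))⁻¹ * xi n z := by
  have : (1 / 2 + z + ((4 * n - 3 : ℕ) : ℂ) / 2) = 2 * n - 1 + z := by rw [cast_weight hn]; ring
  rw [familyL_eq hn, heckeCont, this, xi]

lemma xi_eq_familyL {n : ℕ} (hn : 1 ≤ n) {z : ℂ} (hz : Gamma (2 * n - 1 + z) ≠ 0) :
    xi n z = ((2 * π / 7 : ℝ) : ℂ) ^ (-(2 * n - 1 + z)) *
      Gamma (2 * n - 1 + z) * familyL n (1 / 2 + z) := by
  have hp : ((2 * π / 7 : ℝ) : ℂ) ^ (2 * n - 1 + z : ℂ) ≠ 0 := by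
    rw [Ne, cpow_eq_zero_iff]; exact fun h => two_pi_div_seven_ne h.1
  rw [familyL_eq_xi hn, cpow_neg]; field_simp

lemma norm_Gamma_le {s : ℂ} (hs : 0 < s.re) : ‖Gamma s‖ ≤ Real.Gamma s.re := by
  rw [Gamma_eq_integral hs, GammaIntegral, Real.Gamma_eq_integral hs]
  refine (norm_integral_le_integral_norm _).trans (le_of_eq ?_)
  refine setIntegral_congr_fun measurableSet_Ioi fun t ht => ?_
  rw [norm_mul, norm_real, Real.norm_of_nonneg (exp_pos _).le, norm_cpow_eq_rpow_re_of_pos ht]; simp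

lemma real_Gamma_le {x : ℝ} (hx : 2 ≤ x) :
    Real.Gamma x ≤ Real.exp (2 * (x + 1) ^ (3 / 2 : ℝ)) := by
  have h1 : Real.Gamma x ≤ Real.Gamma (⌈x⌉₊ + 1) := by
    have : x ≤ ⌈x⌉₊ + 1 := (Nat.le_ceil x).trans (by linarith)
    exact Real.Gamma_strictMonoOn_Ici.monotoneOn hx (hx.trans this) this
  have h2 : (⌈x⌉₊ : ℝ) ≤ x + 1 := (Nat.ceil_lt_add_one (by linarith)).le
  rw [Real.Gamma_nat_eq_factorial] at h1
  have h3 : ((⌈x⌉₊).factorial : ℝ) ≤ (⌈x⌉₊ : ℝ) ^ ⌈x⌉₊ := mod_cast Nat.factorial_le_pow _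
  have h4 : (⌈x⌉₊ : ℝ) ^ ⌈x⌉₊ ≤ (x + 1) ^ (x + 1) := by
    calc (⌈x⌉₊ : ℝ) ^ ⌈x⌉₊ ≤ (x + 1) ^ ⌈x⌉₊ := by gcongr
      _ = (x + 1) ^ (⌈x⌉₊ : ℝ) := (rpow_natCast _ _).symm
      _ ≤ (x + 1) ^ (x + 1) := rpow_le_rpow_of_exponent_le (by linarith) h2
  refine (h1.trans (h3.trans h4)).trans ?_
  rw [Real.rpow_def_of_pos (by linarith), exp_le_exp]
  have h5 := log_le_rpow_div (x := x + 1) (ε := 1 / 2) (by linarith) (by norm_num)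
  have h6 : (x + 1) ^ (3 / 2 : ℝ) = (x + 1) ^ (1 / 2 : ℝ) * (x + 1) := by
    nth_rewrite 3 [← rpow_one (x + 1)]
    rw [← rpow_add (by linarith)]; norm_num
  rw [h6]
  have h7 : 0 < x + 1 := by linarith
  nlinarith

lemma norm_mellin_theta_le {k : ℕ} (hk : k ≠ 0) {s : ℂ} (hs : 3 / 2 ≤ s.re) :
    ‖mellin (theta k) (s + (k : ℂ) / 2)‖ ≤ Real.Gamma (s.re + k / 2) *
      (2 : ℝ) ^ (s.re + k / 2) * ∑' v : ℤ × ℤ, ‖alg v‖ ^ (-3 : ℝ) := by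
  have hre : (s + (k : ℂ) / 2).re = s.re + k / 2 := by simp
  have hs1 : 1 < s.re := by linarith
  rw [mellin_theta_eq hk hs1, norm_mul, norm_mul]
  have h1 : ‖heckeSeries k s‖ ≤ ∑' v : ℤ × ℤ, ‖alg v‖ ^ (-3 : ℝ) := by
    rw [heckeSeries, norm_mul]
    have h2 : ‖∑' v : ℤ × ℤ, heckeChar v ^ k / (normForm v : ℂ) ^ (s + (k : ℂ) / 2)‖ ≤
        ∑' v : ℤ × ℤ, ‖alg v‖ ^ (-3 : ℝ) := by
      refine tsum_of_norm_bounded (summable_norm_alg_rpow (by norm_num)).hasSum fun v => ?_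
      refine (norm_heckeSeries_term_le hk v s).trans ?_
      by_cases hv : v = 0
      · subst hv
        rw [alg_zero, norm_zero, zero_rpow (by linarith), zero_rpow (by norm_num)]
      · exact rpow_le_rpow_of_exponent_le (one_le_norm_alg hv) (by linarith)
    have : ‖(1 / 2 : ℂ)‖ = 1 / 2 := by norm_num
    rw [this]
    linarith [norm_nonneg (∑' v : ℤ × ℤ, heckeChar v ^ k / (normForm v : ℂ) ^ (s + (k : ℂ) / 2))]
  have hpos : 0 < s.re + k / 2 := by positivity
  refine mul_le_mul (mul_le_mul ?_ ?_ (norm_nonneg _) ?_) h1 (norm_nonneg _) ?_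
  · rw [← hre]; exact norm_Gamma_le (by rw [hre]; exact hpos)
  · rw [norm_cpow_eq_rpow_re_of_pos (by positivity), neg_re, hre, rpow_neg (by positivity),
      ← Real.inv_rpow (by positivity)]
    refine rpow_le_rpow (by positivity) ?_ hpos.le
    rw [inv_le_comm₀ (by positivity) (by norm_num)]; linarith [pi_gt_three]
  · exact (Gamma_pos_of_pos hpos).le
  · have := Gamma_pos_of_pos hpos
    positivity

lemma norm_mellin_le_add {f : ℝ → ℂ} {a b : ℝ} (ha : MellinConvergent f a)
    (hb : MellinConvergent f b) {s : ℂ} (has : a ≤ s.re) (hsb : s.re ≤ b) :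
    ‖mellin f s‖ ≤ (∫ t : ℝ in Ioi 0, ‖(t : ℂ) ^ ((a : ℂ) - 1) • f t‖) +
      ∫ t : ℝ in Ioi 0, ‖(t : ℂ) ^ ((b : ℂ) - 1) • f t‖ := by
  have ha' := Integrable.norm ha
  have hb' := Integrable.norm hb
  rw [mellin, ← integral_add ha' hb']
  refine norm_integral_le_of_norm_le (ha'.add hb') ?_
  refine (ae_restrict_iff' measurableSet_Ioi).2 (Eventually.of_forall fun t ht => ?_)
  have ht' : (0 : ℝ) < t := ht
  simp only [norm_smul, norm_cpow_eq_rpow_re_of_pos ht']; rw [← add_mul]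
  refine mul_le_mul_of_nonneg_right ?_ (norm_nonneg _)
  simp only [sub_re, ofReal_re, one_re]
  rcases le_total 1 t with h | h
  · have := rpow_le_rpow_of_exponent_le h (by linarith : s.re - 1 ≤ b - 1)
    linarith [rpow_nonneg ht'.le (a - 1)]
  · have := Real.rpow_le_rpow_of_exponent_ge ht' h (by linarith : a - 1 ≤ s.re - 1)
    linarith [rpow_nonneg ht'.le (b - 1)]

lemma xi_growth {n : ℕ} (hn : 1 ≤ n) :
    ∃ A : ℝ, ∀ z, ‖xi n z‖ ≤ Real.exp (A * (1 + ‖z‖) ^ (3 / 2 : ℝ)) := by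
  set S : ℝ := ∑' v : ℤ × ℤ, ‖alg v‖ ^ (-3 : ℝ) with hS
  have hS0 : 0 ≤ S := tsum_nonneg fun v => by positivity
  have hconv := fun x : ℝ => mellinConvergent_theta (k := 4 * n - 3) (by omega) (x : ℂ)
  set B : ℝ := (∫ t : ℝ in Ioi 0, ‖(t : ℂ) ^ (((2 * n - 1 : ℝ) : ℂ) - 1) • theta (4 * n - 3) t‖) +
      ∫ t : ℝ in Ioi 0, ‖(t : ℂ) ^ (((2 * n : ℝ) : ℂ) - 1) • theta (4 * n - 3) t‖ with hB
  have hB0 : 0 ≤ B := add_nonneg (integral_nonneg fun _ => norm_nonneg _)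
    (integral_nonneg fun _ => norm_nonneg _)
  have hn' : (1 : ℝ) ≤ n := mod_cast hn
  set A : ℝ := 2 * (2 * n) ^ (3 / 2 : ℝ) + 2 * n + S + B with hA
  have hpos : ∀ z : ℂ, 0 ≤ z.re → ‖xi n z‖ ≤ Real.exp (A * (1 + ‖z‖) ^ (3 / 2 : ℝ)) := by
    intro z hz
    have hz1 : 1 ≤ 1 + ‖z‖ := by linarith [norm_nonneg z]
    have hR1 : 1 + ‖z‖ ≤ (1 + ‖z‖) ^ (3 / 2 : ℝ) := by
      nth_rewrite 1 [← rpow_one (1 + ‖z‖)]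
      exact rpow_le_rpow_of_exponent_le hz1 (by norm_num)
    set R := (1 + ‖z‖) ^ (3 / 2 : ℝ) with hR
    have hR1' : 1 ≤ R := hz1.trans hR1
    have hn32 : 0 ≤ ((2 * n : ℝ)) ^ (3 / 2 : ℝ) := by positivity
    rcases le_total z.re 1 with h1 | h1
    · have h2 : ‖xi n z‖ ≤ B := by
        refine norm_mellin_le_add (hconv _) (hconv _) ?_ ?_
        · simp [hz]
        · simp; linarith
      refine h2.trans ((by linarith [Real.add_one_le_exp B] : B ≤ Real.exp B).trans ?_)
      rw [exp_le_exp, hA]; nlinarith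
    · have hk : 4 * n - 3 ≠ 0 := by omega
      have hkr : ((4 * n - 3 : ℕ) : ℝ) = 4 * n - 3 := by
        rw [Nat.cast_sub (by omega)]; push_cast; ring
      have h2 := norm_mellin_theta_le hk (s := 1 / 2 + z) (by simp; linarith)
      have e1 : (1 / 2 + z : ℂ) + ((4 * n - 3 : ℕ) : ℂ) / 2 = 2 * n - 1 + z := by
        rw [cast_weight hn]; ring
      have e2 : (1 / 2 + z : ℂ).re + ((4 * n - 3 : ℕ) : ℝ) / 2 = 2 * n - 1 + z.re := by
        rw [hkr]; simp; ring
      rw [e1, e2] at h2; rw [xi]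
      refine h2.trans ?_
      have hzn : z.re ≤ ‖z‖ := re_le_norm z
      have hy : 2 * n - 1 + z.re + 1 ≤ 2 * n * (1 + ‖z‖) := by nlinarith
      have g1 := real_Gamma_le (x := 2 * n - 1 + z.re) (by linarith)
      have g2 : (2 * n - 1 + z.re + 1) ^ (3 / 2 : ℝ) ≤ (2 * n) ^ (3 / 2 : ℝ) * R := by
        rw [hR, ← mul_rpow (by positivity) (by positivity)]
        exact rpow_le_rpow (by linarith) hy (by norm_num)
      have g3 : (2 : ℝ) ^ (2 * n - 1 + z.re) ≤ Real.exp (2 * n * R) := by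
        calc (2 : ℝ) ^ (2 * n - 1 + z.re) ≤ (Real.exp 1) ^ (2 * n - 1 + z.re) :=
              rpow_le_rpow (by norm_num) (by linarith [Real.add_one_le_exp 1]) (by linarith)
          _ = Real.exp (2 * n - 1 + z.re) := by rw [← Real.exp_mul, one_mul]
          _ ≤ Real.exp (2 * n * R) := by rw [exp_le_exp]; nlinarith
      have g4 : S ≤ Real.exp (S * R) := by
        have := Real.add_one_le_exp (S * R)
        nlinarith
      calc Real.Gamma (2 * n - 1 + z.re) * 2 ^ (2 * n - 1 + z.re) * S
          ≤ Real.exp (2 * ((2 * n) ^ (3 / 2 : ℝ) * R)) * Real.exp (2 * n * R) * Real.exp (S * R) := by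
            have := (Gamma_pos_of_pos (by linarith : 0 < 2 * n - 1 + z.re)).le
            have g5 := g1.trans (exp_le_exp.2 (by linarith :
              2 * (2 * n - 1 + z.re + 1) ^ (3 / 2 : ℝ) ≤ 2 * ((2 * n) ^ (3 / 2 : ℝ) * R)))
            gcongr
        _ ≤ Real.exp (A * R) := by
            rw [← Real.exp_add, ← Real.exp_add, exp_le_exp, hA]; nlinarith
  refine ⟨A, fun z => ?_⟩
  rcases le_total 0 z.re with h | h
  · exact hpos z h
  · have := hpos (-z) (by simpa using h)
    rwa [xi_neg hn, norm_neg] at this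

/-! ### Arithmetic of `ℤ[η]` -/

/-- The ring `ℤ[η]`. -/
abbrev QInt := QuadraticAlgebra ℤ (-2) 1

lemma eta_sq : eta ^ 2 = eta - 2 := by
  rw [eta]
  have h := sqrt_seven_sq
  have h2 := I_sq
  generalize ((√7 : ℝ) : ℂ) = r at *
  linear_combination (1 / 4 * I ^ 2) * h + 7 / 4 * h2

/-- The embedding of `ℤ[η]` into `ℂ`. -/
def emb : QInt →+* ℂ where
  toFun x := alg (x.re, x.im)
  map_one' := by simp [alg, QuadraticAlgebra.re_one, QuadraticAlgebra.im_one]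
  map_zero' := by simp [alg]
  map_add' x y := by simp [alg]; ring
  map_mul' x y := by
    simp only [alg, QuadraticAlgebra.re_mul, QuadraticAlgebra.im_mul]; push_cast
    linear_combination (-(x.im : ℂ) * y.im) * eta_sq

lemma emb_apply (x : QInt) : emb x = alg (x.re, x.im) := rfl

lemma norm_eq_normForm (x : QInt) : x.norm = normForm (x.re, x.im) := by
  rw [QuadraticAlgebra.norm_def, normForm]; ring

lemma norm_eq_norm_emb_sq (x : QInt) : ((x.norm : ℤ) : ℝ) = ‖emb x‖ ^ 2 := by
  rw [norm_eq_normForm, normForm_eq_norm_sq, emb_apply]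

lemma QInt.mk_ne_zero {x : QInt} (hx : x ≠ 0) : (x.re, x.im) ≠ (0 : ℤ × ℤ) := by
  intro h
  apply hx
  ext
  · exact congrArg Prod.fst h
  · exact congrArg Prod.snd h

lemma one_le_norm {x : QInt} (hx : x ≠ 0) : 1 ≤ x.norm := by
  rw [norm_eq_normForm]; exact one_le_normForm (QInt.mk_ne_zero hx)

lemma norm_nonneg' (x : QInt) : 0 ≤ x.norm := by
  by_cases h : x = 0
  · simp [h]
  · linarith [one_le_norm h]

lemma one_le_norm_emb {x : QInt} (hx : x ≠ 0) : 1 ≤ ‖emb x‖ := one_le_norm_alg (QInt.mk_ne_zero hx)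

lemma emb_injective : Injective emb := by
  rw [injective_iff_map_eq_zero]
  intro x hx
  by_contra h
  have := one_le_norm_emb h
  rw [hx, norm_zero] at this; linarith

instance : IsDomain QInt := emb_injective.isDomain

lemma exists_near (z : ℂ) : ∃ q : QInt, ‖z - emb q‖ ^ 2 < 1 := by
  have h7 : 0 < √7 := by positivity
  have h7s : √7 ^ 2 = 7 := sq_sqrt (by norm_num)
  set b := round (z.im / (√7 / 2)) with hb
  set a := round (z.re - b / 2) with ha
  refine ⟨⟨a, b⟩, ?_⟩
  have h1 := abs_sub_round (z.im / (√7 / 2))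
  have h2 := abs_sub_round (z.re - b / 2)
  rw [← hb] at h1
  rw [← ha] at h2; rw [← normSq_eq_norm_sq, normSq_apply, sub_re, sub_im, emb_apply, alg_re, alg_im]
  simp only
  have e2 : z.re - ((a : ℝ) + b / 2) = z.re - b / 2 - a := by ring
  have e1 : z.im - b * √7 / 2 = (z.im / (√7 / 2) - b) * (√7 / 2) := by field_simp
  rw [e1, e2]
  have g1 := sq_le_sq' (by linarith [abs_le.1 h1]) (abs_le.1 h1).2
  have g2 := sq_le_sq' (by linarith [abs_le.1 h2]) (abs_le.1 h2).2
  have : (z.im / (√7 / 2) - b) * (√7 / 2) * ((z.im / (√7 / 2) - b) * (√7 / 2)) =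
      (z.im / (√7 / 2) - b) ^ 2 * (7 / 4) := by
    linear_combination ((z.im / (√7 / 2) - b) ^ 2 / 4) * h7s
  rw [this]; nlinarith

lemma exists_quotient (x : QInt) {y : QInt} (hy : y ≠ 0) :
    ∃ q : QInt, (x - y * q).norm.natAbs < y.norm.natAbs := by
  obtain ⟨q, hq⟩ := exists_near (emb x / emb y)
  have hy' : emb y ≠ 0 := (map_ne_zero_iff _ emb_injective).2 hy
  refine ⟨q, Int.natAbs_lt_natAbs_of_nonneg_of_lt (norm_nonneg' _) ?_⟩
  have : ((x - y * q).norm : ℝ) < (y.norm : ℝ) := by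
    rw [norm_eq_norm_emb_sq, norm_eq_norm_emb_sq, map_sub, map_mul]
    have e : emb x - emb y * emb q = emb y * (emb x / emb y - emb q) := by field_simp
    rw [e, norm_mul, mul_pow]
    have : 0 < ‖emb y‖ ^ 2 := by positivity
    nlinarith
  exact_mod_cast this

open Classical in
instance : EuclideanDomain QInt where
  quotient x y := if h : y = 0 then 0 else (exists_quotient x h).choose
  quotient_zero x := by simp
  remainder x y := x - y * (if h : y = 0 then 0 else (exists_quotient x h).choose)
  quotient_mul_add_remainder_eq x y := by ring
  r x y := x.norm.natAbs < y.norm.natAbs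
  r_wellFounded := (measure fun x : QInt => x.norm.natAbs).wf
  remainder_lt x y hy := by
    simp only [hy, dif_neg, not_false_eq_true]; exact (exists_quotient x hy).choose_spec
  mul_left_not_lt x y hy := by
    rw [not_lt, map_mul, Int.natAbs_mul]
    have := one_le_norm hy
    exact Nat.le_mul_of_pos_right _ (by omega)

lemma QInt.eq_one_or_of_isUnit {u : QInt} (hu : IsUnit u) : u = 1 ∨ u = -1 := by
  rw [QuadraticAlgebra.isUnit_iff_norm_isUnit, Int.isUnit_iff] at hu
  have h0 := norm_nonneg' u
  have h1 : u.norm = 1 := by rcases hu with h | h <;> omega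
  rw [norm_eq_normForm, normForm] at h1
  simp only at h1
  have hb : u.im = 0 := by nlinarith [sq_nonneg (2 * u.re + u.im), sq_nonneg u.im]
  rw [hb] at h1
  have ha : u.re = 1 ∨ u.re = -1 := by
    have : (u.re - 1) * (u.re + 1) = 0 := by linarith
    rcases mul_eq_zero.1 this with h | h
    · left; omega
    · right; omega
  rcases ha with ha | ha
  · left; ext <;> simp [ha, hb, QuadraticAlgebra.re_one, QuadraticAlgebra.im_one]
  · right; ext <;> simp [ha, hb, QuadraticAlgebra.re_one, QuadraticAlgebra.im_one]

lemma QInt.eq_or_eq_neg_of_associated {x y : QInt} (h : Associated x y) : y = x ∨ y = -x := by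
  obtain ⟨u, rfl⟩ := h
  rcases QInt.eq_one_or_of_isUnit u.isUnit with h | h
  · left; rw [h, mul_one]
  · right; rw [h, mul_neg, mul_one]

lemma norm_eq_of_associated {x y : QInt} (h : Associated x y) : x.norm = y.norm := by
  rcases QInt.eq_or_eq_neg_of_associated h with rfl | rfl
  · rfl
  · rw [QuadraticAlgebra.norm_neg]

lemma associated_neg (x : QInt) : Associated x (-x) := ⟨-1, by simp⟩

open Classical in
/-- The von Mangoldt function of `ℤ[η]`. -/
def lamR (d : QInt) : ℝ := if h : ∃ p : QInt, ∃ j : ℕ, Prime p ∧ 0 < j ∧ Associated (p ^ j) d then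
    ln (h.choose.norm : ℝ) else 0

lemma lamR_eq {p d : QInt} {j : ℕ} (hp : Prime p) (hj : 0 < j) (h : Associated (p ^ j) d) :
    lamR d = ln (p.norm : ℝ) := by
  have hex : ∃ p : QInt, ∃ j : ℕ, Prime p ∧ 0 < j ∧ Associated (p ^ j) d := ⟨p, j, hp, hj, h⟩
  rw [lamR, dif_pos hex]
  obtain ⟨i, hq, hi, hqi⟩ := hex.choose_spec
  have hdvd : p ∣ hex.choose ^ i := (dvd_pow_self p hj.ne').trans (h.dvd.trans hqi.symm.dvd)
  rw [norm_eq_of_associated (hp.associated_of_dvd hq (hp.dvd_of_dvd_pow hdvd))]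

lemma exists_of_lamR_ne_zero {d : QInt} (h : lamR d ≠ 0) :
    ∃ p : QInt, ∃ j : ℕ, Prime p ∧ 0 < j ∧ Associated (p ^ j) d := by
  by_contra hcon
  exact h (by rw [lamR, dif_neg hcon])

lemma lamR_nonneg (d : QInt) : 0 ≤ lamR d := by
  by_cases h : lamR d = 0
  · rw [h]
  · obtain ⟨p, j, hp, hj, hd⟩ := exists_of_lamR_ne_zero h
    rw [lamR_eq hp hj hd]; exact log_nonneg (mod_cast one_le_norm hp.ne_zero)

lemma lamR_le (d : QInt) : lamR d ≤ ln (d.norm : ℝ) := by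
  by_cases h : lamR d = 0
  · rw [h]
    by_cases hd : d = 0
    · simp [hd]
    · exact log_nonneg (mod_cast one_le_norm hd)
  · obtain ⟨p, j, hp, hj, hd⟩ := exists_of_lamR_ne_zero h
    rw [lamR_eq hp hj hd, ← norm_eq_of_associated hd, map_pow]
    have h1 : (1 : ℝ) ≤ p.norm := mod_cast one_le_norm hp.ne_zero
    push_cast
    refine log_le_log (by linarith) ?_
    exact le_self_pow₀ h1 hj.ne'

open Classical in
lemma hasSum_lamR_divisors {β : QInt} (hβ : β ≠ 0) :
    HasSum (fun d : QInt => if d ∣ β then lamR d else 0) (2 * ln (β.norm : ℝ)) := by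
  induction β using UniqueFactorizationMonoid.induction_on_prime with
  | h₁ => exact absurd rfl hβ
  | h₂ x hx =>
    have h0 : x.norm = 1 := by rcases QInt.eq_one_or_of_isUnit hx with rfl | rfl <;> simp
    have : (fun d : QInt => if d ∣ x then lamR d else 0) = fun _ => 0 := by
      ext d
      split_ifs with hd
      · by_contra hne
        obtain ⟨p, j, hp, hj, hpd⟩ := exists_of_lamR_ne_zero hne
        exact hp.not_isUnit (isUnit_of_dvd_unit ((dvd_pow_self p hj.ne').trans (hpd.dvd.trans hd)) hx)
      · rfl
    rw [this, h0]; simp [hasSum_zero]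
  | h₃ β p hβ0 hp ih =>
    have ih := ih hβ0
    have hfin : FiniteMultiplicity p β := FiniteMultiplicity.of_prime_left hp hβ0
    obtain ⟨γ, hγ, hpγ⟩ := hfin.exists_eq_pow_mul_and_not_dvd
    set m := multiplicity p β with hm
    set P := p ^ (m + 1) with hP
    have hPne : P ≠ -P := by
      intro h
      have h2 : (2 : QInt) * P = 0 := by
        have : P + P = 0 := by nth_rewrite 2 [h]; ring
        linear_combination this
      have h3 : (2 : QInt) ≠ 0 := by
        intro h
        have := congrArg emb h
        rw [map_ofNat, map_zero] at this
        norm_num at this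
      exact pow_ne_zero _ hp.ne_zero ((mul_eq_zero.1 h2).resolve_left h3)
    have hPdvd : P ∣ p * β := ⟨γ, by rw [hγ, hP]; ring⟩
    have hPnd : ¬ P ∣ β := by
      rintro ⟨δ, hδ⟩
      apply hpγ
      have : p ^ m * γ = p ^ m * (p * δ) := by rw [← hγ, hδ, hP]; ring
      exact ⟨δ, mul_left_cancel₀ (pow_ne_zero m hp.ne_zero) this⟩
    have hdelta : HasSum (fun d : QInt => if d = P ∨ d = -P then ln (p.norm : ℝ) else 0)
        (2 * ln (p.norm : ℝ)) := by
      have h1 : HasSum (fun d : QInt => if d = P ∨ d = -P then ln (p.norm : ℝ) else 0)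
          (∑ d ∈ {P, -P}, if d = P ∨ d = -P then ln (p.norm : ℝ) else 0) :=
        hasSum_sum_of_ne_finset_zero (fun d hd => by
          simp only [mem_insert, Finset.mem_singleton] at hd
          rw [if_neg hd])
      rw [Finset.sum_pair hPne, if_pos (Or.inl rfl), if_pos (Or.inr rfl)] at h1
      rwa [two_mul]
    have hval : 2 * ln ((p * β).norm : ℝ) =
        2 * ln (β.norm : ℝ) + 2 * ln (p.norm : ℝ) := by
      have h1 : (0 : ℝ) < p.norm := by
        have := one_le_norm hp.ne_zero
        exact_mod_cast (by omega : 0 < p.norm)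
      have h2 : (0 : ℝ) < β.norm := by
        have := one_le_norm hβ0
        exact_mod_cast (by omega : 0 < β.norm)
      rw [map_mul]; push_cast
      rw [Real.log_mul h1.ne' h2.ne']; ring
    rw [hval]
    refine hasSum_of_eq (ih.add hdelta) fun d => ?_
    by_cases hd : d = P ∨ d = -P
    · have hass : Associated P d := by
        rcases hd with rfl | rfl
        · exact Associated.refl _
        · exact associated_neg _
      rw [if_pos hd, if_pos ((hass.dvd_iff_dvd_left).1 hPdvd),
        if_neg (fun h => hPnd ((hass.dvd_iff_dvd_left).2 h)), lamR_eq hp (succ_pos m) hass,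
        zero_add]
    · rw [if_neg hd, add_zero]
      by_cases h1 : d ∣ β
      · rw [if_pos h1, if_pos (h1.mul_left p)]
      · rw [if_neg h1]
        split_ifs with h2
        · by_contra hne
          obtain ⟨q, i, hq, hi, hqd⟩ := exists_of_lamR_ne_zero (Ne.symm hne)
          by_cases hqp : Associated q p
          · have hpd : Associated (p ^ i) d := (hqp.symm.pow_pow).trans hqd
            have hle : i ≤ m + 1 := by
              by_contra hlt
              have h3 : p ^ (m + 2) ∣ p ^ (m + 1) * γ := by
                have : p * β = p ^ (m + 1) * γ := by rw [hγ]; ring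
                rw [← this]; exact (pow_dvd_pow p (by omega)).trans (hpd.dvd.trans h2)
              rw [pow_succ] at h3
              exact hpγ ((mul_dvd_mul_iff_left (pow_ne_zero (m + 1) hp.ne_zero)).1 h3)
            have hge : m + 1 ≤ i := by
              by_contra hlt
              apply h1
              refine hpd.symm.dvd.trans ((pow_dvd_pow p (by omega : i ≤ m)).trans ?_)
              rw [hγ]; exact dvd_mul_right _ _
            have : i = m + 1 := le_antisymm hle hge
            rw [this] at hpd; exact hd (QInt.eq_or_eq_neg_of_associated hpd)
          · apply h1
            have hnd : ¬ q ∣ p := fun h => hqp (hq.associated_of_dvd hp h)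
            have hcop : IsCoprime (q ^ i) p :=
              IsCoprime.pow_left ((Irreducible.coprime_iff_not_dvd hq.irreducible).2 hnd)
            exact hqd.symm.dvd.trans (hcop.dvd_of_dvd_mul_left (hqd.dvd.trans h2))
        · rfl

/-! ### The logarithmic derivative of the Dirichlet series -/

/-- The pair of coordinates of an element of `ℤ[η]`. -/
def QInt.vec (x : QInt) : ℤ × ℤ := (x.re, x.im)

/-- The terms of the Dirichlet series of `L(s, χ^k)`, indexed by `ℤ[η]`. -/
def hterm (k : ℕ) (s : ℂ) (x : QInt) : ℂ :=
  heckeChar x.vec ^ k / (normForm x.vec : ℂ) ^ (s + (k : ℂ) / 2)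

lemma emb_eq_alg (x : QInt) : emb x = alg x.vec := rfl

lemma epsSign_mul (x y : QInt) : epsSign (x * y).vec = epsSign x.vec * epsSign y.vec := by
  rw [epsSign_eq, epsSign_eq, epsSign_eq, ← legendreSym.mul]
  have h2 : legendreSym 7 2 = 1 := by rw [legendreSym_seven]; rfl
  have h3 : legendreSym 7 (2 * (2 * (x * y).vec.1 + (x * y).vec.2)) =
      legendreSym 7 (2 * (x * y).vec.1 + (x * y).vec.2) := by
    rw [legendreSym.mul, h2, one_mul]
  have h4 : (2 * (2 * (x * y).vec.1 + (x * y).vec.2)) ≡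
      ((2 * x.vec.1 + x.vec.2) * (2 * y.vec.1 + y.vec.2)) [ZMOD 7] := by
    rw [Int.modEq_iff_dvd]
    simp only [QInt.vec, QuadraticAlgebra.re_mul, QuadraticAlgebra.im_mul]
    exact ⟨x.im * y.im, by ring⟩
  rw [← h3, legendreSym_seven, legendreSym_seven, h4]

lemma heckeChar_mul (x y : QInt) : heckeChar (x * y).vec = heckeChar x.vec * heckeChar y.vec := by
  rw [heckeChar_eq, heckeChar_eq, heckeChar_eq, epsSign_mul, ← emb_eq_alg, ← emb_eq_alg,
    ← emb_eq_alg, map_mul]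
  push_cast; ring

lemma normForm_vec (x : QInt) : normForm x.vec = x.norm := (norm_eq_normForm x).symm

lemma hterm_mul (k : ℕ) (s : ℂ) (x y : QInt) :
    hterm k s (x * y) = hterm k s x * hterm k s y := by
  simp only [hterm]
  have h : ((normForm (x * y).vec : ℤ) : ℂ) ^ (s + (k : ℂ) / 2) =
      (normForm x.vec : ℂ) ^ (s + (k : ℂ) / 2) * (normForm y.vec : ℂ) ^ (s + (k : ℂ) / 2) := by
    rw [normForm_vec, normForm_vec, normForm_vec, map_mul]
    have hx : (0 : ℝ) ≤ x.norm := mod_cast norm_nonneg' x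
    have hy : (0 : ℝ) ≤ y.norm := mod_cast norm_nonneg' y
    have := mul_cpow_ofReal_nonneg hx hy (s + (k : ℂ) / 2)
    push_cast at this ⊢
    exact this
  rw [h, heckeChar_mul, mul_pow]; ring

lemma hterm_zero {k : ℕ} (hk : k ≠ 0) (s : ℂ) : hterm k s 0 = 0 := by
  have : (0 : QInt).vec = 0 := rfl
  rw [hterm, this, heckeChar_eq, alg_zero, mul_zero, zero_pow hk, zero_div]

/-- `ℤ[η]` as pairs of integers. -/
def vecEquiv : QInt ≃ ℤ × ℤ := QuadraticAlgebra.equivProd (-2) 1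

lemma norm_hterm_le {k : ℕ} (hk : k ≠ 0) (s : ℂ) (x : QInt) :
    ‖hterm k s x‖ ≤ ‖emb x‖ ^ (-(2 * s.re)) := norm_heckeSeries_term_le hk _ _

lemma summable_norm_emb_rpow {r : ℝ} (hr : 2 < r) : Summable fun x : QInt => ‖emb x‖ ^ (-r) :=
  vecEquiv.summable_iff.2 (summable_norm_alg_rpow hr)

lemma summable_norm_hterm {k : ℕ} (hk : k ≠ 0) {s : ℂ} (hs : 1 < s.re) :
    Summable fun x : QInt => ‖hterm k s x‖ :=
  of_nonneg_of_le (fun _ => norm_nonneg _) (norm_hterm_le hk s)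
    (summable_norm_emb_rpow (by linarith))

lemma heckeSeries_eq_tsum (k : ℕ) (s : ℂ) : heckeSeries k s = 1 / 2 * ∑' x : QInt, hterm k s x := by
  rw [heckeSeries, ← vecEquiv.tsum_eq]; rfl

lemma log_norm_eq (x : QInt) : ln (x.norm : ℝ) = 2 * ln ‖emb x‖ := by
  rw [norm_eq_norm_emb_sq, Real.log_pow]; norm_num

lemma log_norm_nonneg (x : QInt) : 0 ≤ ln (x.norm : ℝ) := (lamR_nonneg x).trans (lamR_le x)

lemma log_norm_le {δ : ℝ} (hδ : 0 < δ) (x : QInt) :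
    ln (x.norm : ℝ) ≤ 2 / δ * ‖emb x‖ ^ δ := by
  rw [log_norm_eq, div_mul_eq_mul_div, mul_div_assoc]
  gcongr
  exact log_le_rpow_div (norm_nonneg _) hδ

lemma log_norm_mul_rpow_le {δ : ℝ} (hδ : 0 < δ) {r : ℝ} (x : QInt) :
    ln (x.norm : ℝ) * ‖emb x‖ ^ (-r) ≤ 2 / δ * ‖emb x‖ ^ (-(r - δ)) := by
  by_cases hx : x = 0
  · subst hx
    rw [QuadraticAlgebra.norm_zero]
    simp only [Int.cast_zero, Real.log_zero, zero_mul]; positivity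
  · have h1 := one_le_norm_emb hx
    rw [show -(r - δ) = δ + -r by ring, rpow_add (by linarith), ← mul_assoc]
    exact mul_le_mul_of_nonneg_right (log_norm_le hδ x) (by positivity)

lemma summable_log_mul_rpow {r : ℝ} (hr : 2 < r) :
    Summable fun x : QInt => ln (x.norm : ℝ) * ‖emb x‖ ^ (-r) :=
  of_nonneg_of_le (fun x => mul_nonneg (log_norm_nonneg x) (by positivity))
    (log_norm_mul_rpow_le (δ := (r - 2) / 2) (by linarith))
    ((summable_norm_emb_rpow (by linarith)).mul_left _)

lemma summable_norm_lamR_hterm {k : ℕ} (hk : k ≠ 0) {s : ℂ} (hs : 1 < s.re) :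
    Summable fun x : QInt => ‖(lamR x : ℂ) * hterm k s x‖ := by
  refine of_nonneg_of_le (fun _ => norm_nonneg _) (fun x => ?_)
    (summable_log_mul_rpow (r := 2 * s.re) (by linarith))
  rw [norm_mul, norm_real, Real.norm_of_nonneg (lamR_nonneg x)]
  exact mul_le_mul (lamR_le x) (norm_hterm_le hk s x) (norm_nonneg _) (log_norm_nonneg x)

/-- The Dirichlet series of `-L'/L`. -/
def lamSeries (k : ℕ) (s : ℂ) : ℂ := 1 / 2 * ∑' x : QInt, (lamR x : ℂ) * hterm k s x

lemma lamR_zero : lamR 0 = 0 := by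
  by_contra h
  obtain ⟨p, j, hp, hj, hd⟩ := exists_of_lamR_ne_zero h
  have := hd.symm.dvd
  exact pow_ne_zero j hp.ne_zero (zero_dvd_iff.1 this)

lemma tsum_lamR_mul_tsum {k : ℕ} (hk : k ≠ 0) {s : ℂ} (hs : 1 < s.re) :
    (∑' x : QInt, (lamR x : ℂ) * hterm k s x) * ∑' x : QInt, hterm k s x =
      ∑' x : QInt, 2 * (ln (x.norm : ℝ) : ℂ) * hterm k s x := by
  classical
  set F : QInt × QInt → ℂ := fun p => (if p.2 ∣ p.1 then (lamR p.2 : ℂ) else 0) * hterm k s p.1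
    with hF
  have hin : ∀ β : QInt, HasSum (fun d => F (β, d)) (2 * (ln (β.norm : ℝ) : ℂ) * hterm k s β) := by
    intro β
    by_cases hβ : β = 0
    · subst hβ
      have : (fun d => F (0, d)) = fun _ => 0 := by ext d; simp only [hF, hterm_zero hk, mul_zero]
      rw [this, hterm_zero hk, mul_zero]; exact hasSum_zero
    · have h1 := (hasSum_lamR_divisors hβ).mapL (ofRealCLM)
      have h2 := h1.mul_right (hterm k s β)
      have e : ofRealCLM (2 * ln (β.norm : ℝ)) = 2 * (ln (β.norm : ℝ) : ℂ) := by simp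
      rw [e] at h2
      refine hasSum_of_eq h2 fun d => ?_
      simp only [hF]
      split_ifs <;> simp
  have hnorm : ∀ β : QInt, HasSum (fun d => ‖F (β, d)‖)
      (2 * ln (β.norm : ℝ) * ‖hterm k s β‖) := by
    intro β
    by_cases hβ : β = 0
    · subst hβ
      have : (fun d => ‖F (0, d)‖) = fun _ => 0 := by
        ext d; simp only [hF, hterm_zero hk, mul_zero, norm_zero]
      rw [this, hterm_zero hk, norm_zero, mul_zero]; exact hasSum_zero
    · refine hasSum_of_eq ((hasSum_lamR_divisors hβ).mul_right ‖hterm k s β‖) fun d => ?_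
      simp only [hF, norm_mul]
      split_ifs
      · rw [norm_real, Real.norm_of_nonneg (lamR_nonneg d)]
      · simp
  have hS : Summable F := by
    refine Summable.of_norm ((summable_prod_of_nonneg fun _ => norm_nonneg _).2
      ⟨fun β => (hnorm β).summable, ?_⟩)
    simp only [(hnorm _).tsum_eq]
    refine of_nonneg_of_le
      (fun x => mul_nonneg (mul_nonneg two_pos.le (log_norm_nonneg x)) (norm_nonneg _)) (fun x => ?_)
      ((summable_log_mul_rpow (r := 2 * s.re) (by linarith)).mul_left 2)
    rw [mul_assoc]
    exact mul_le_mul_of_nonneg_left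
      (mul_le_mul_of_nonneg_left (norm_hterm_le hk s x) (log_norm_nonneg x)) two_pos.le
  have h1 : ∑' β : QInt, ∑' d, F (β, d) = ∑' β : QInt, 2 * (ln (β.norm : ℝ) : ℂ) * hterm k s β :=
    tsum_congr fun β => (hin β).tsum_eq
  have h2 : ∑' d, ∑' β, F (β, d) = ∑' β, ∑' d, F (β, d) := hS.tsum_comm
  rw [← h1, ← h2, ← tsum_mul_right]
  refine tsum_congr fun d => ?_
  by_cases hd : d = 0
  · subst hd
    simp [hF, lamR_zero]
  · have hinj : Injective fun e : QInt => d * e := mul_right_injective₀ hd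
    rw [← tsum_mul_left]
    refine (tsum_congr ?_).trans (hinj.tsum_eq (f := fun β => F (β, d)) ?_)
    · intro e
      simp only [hF, dvd_mul_right, if_true, hterm_mul]; ring
    · intro β hβ
      by_contra hcon
      apply hβ
      have : ¬ d ∣ β := fun ⟨e, he⟩ => hcon ⟨e, he.symm⟩
      simp [hF, this]

lemma hasDerivAt_hterm {k : ℕ} (hk : k ≠ 0) (s : ℂ) (x : QInt) :
    HasDerivAt (fun s => hterm k s x) (-(ln (x.norm : ℝ) : ℂ) * hterm k s x) s := by
  by_cases hx : x = 0
  · subst hx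
    simp only [hterm_zero hk, mul_zero]; exact hasDerivAt_const s 0
  · have h1 := one_le_norm hx
    have h0 : (x.norm : ℂ) ≠ 0 := mod_cast (by omega : x.norm ≠ 0)
    have hl : Complex.log (x.norm : ℂ) = (ln (x.norm : ℝ) : ℂ) := by
      have := (ofReal_log (x := (x.norm : ℝ)) (mod_cast norm_nonneg' x)).symm
      simpa using this
    simp only [hterm, normForm_vec, div_eq_mul_inv, ← cpow_neg]
    have h2 : HasDerivAt (fun s : ℂ => -(s + (k : ℂ) * 2⁻¹)) (-1) s :=
      ((hasDerivAt_id s).add_const _).neg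
    have h3 := (h2.const_cpow (c := (x.norm : ℂ)) (Or.inl h0)).const_mul (heckeChar x.vec ^ k)
    refine h3.congr_deriv ?_
    rw [hl]; ring

lemma deriv_heckeSeries {k : ℕ} (hk : k ≠ 0) {s : ℂ} (hs : 1 < s.re) :
    deriv (heckeSeries k) s = -lamSeries k s * heckeSeries k s := by
  set a := (1 + s.re) / 2 with ha
  have hU : IsOpen {w : ℂ | a < w.re} := isOpen_lt_re _
  have hsU : s ∈ {w : ℂ | a < w.re} := by simp only [mem_ofPred_eq, ha]; linarith
  have h1 := hasSum_deriv_of_summable_norm (F := fun (x : QInt) s => hterm k s x)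
    (summable_norm_emb_rpow (r := 2 * a) (by linarith))
    (fun x w _ => (hasDerivAt_hterm hk w x).differentiableAt.differentiableWithinAt) hU
    (fun x w hw => by
      refine (norm_hterm_le hk w x).trans ?_
      by_cases hx : x = 0
      · subst hx
        have hw' : a < w.re := hw
        rw [map_zero, norm_zero, zero_rpow (by linarith), zero_rpow (by linarith)]
      · have hw' : a < w.re := hw
        exact rpow_le_rpow_of_exponent_le (one_le_norm_emb hx) (by linarith)) hsU
  have h2 : heckeSeries k = fun s => 1 / 2 * ∑' x : QInt, hterm k s x :=
    funext fun s => heckeSeries_eq_tsum k s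
  have hd : deriv (fun s => ∑' x : QInt, hterm k s x) s =
      -(1 / 2) * ∑' x : QInt, 2 * (ln (x.norm : ℝ) : ℂ) * hterm k s x := by
    rw [← h1.tsum_eq, ← tsum_mul_left]
    refine tsum_congr fun x => ?_
    rw [(hasDerivAt_hterm hk s x).deriv]; ring
  rw [h2, deriv_const_mul_field, hd, ← tsum_lamR_mul_tsum hk hs, lamSeries]; ring

lemma hterm_one (k : ℕ) (s : ℂ) : hterm k s 1 = 1 := by
  have : (1 : QInt).vec = (1, 0) := rfl
  rw [hterm, this, heckeChar, epsSign_eq, legendreSym_seven, normForm]; norm_num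

lemma hterm_neg_one {k : ℕ} (hk : Odd k) (s : ℂ) : hterm k s (-1) = 1 := by
  have : (-1 : QInt).vec = (-1, 0) := rfl
  rw [hterm, this, heckeChar, epsSign_eq, legendreSym_seven, normForm]; norm_num

lemma exists_heckeSeries_ne_zero {k : ℕ} (hk : Odd k) : ∃ s : ℂ, 1 < s.re ∧ heckeSeries k s ≠ 0 := by
  classical
  set S := ∑' x : QInt, ‖emb x‖ ^ (-4 : ℝ) with hS
  have hS4 := summable_norm_emb_rpow (r := 4) (by norm_num)
  have hS0 : 0 ≤ S := tsum_nonneg fun x => by positivity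
  obtain ⟨m, hm⟩ := exists_nat_gt S
  have hm2 : S < 2 ^ m := hm.trans (mod_cast Nat.lt_two_pow_self)
  have hk0 : k ≠ 0 := hk.pos.ne'
  refine ⟨((2 + m : ℕ) : ℂ), by simp; norm_cast; omega, ?_⟩
  set s : ℂ := ((2 + m : ℕ) : ℂ) with hs
  have hsre : s.re = 2 + m := by simp [hs]
  have hs1 : 1 < s.re := by rw [hsre]; linarith [(Nat.cast_nonneg m : (0 : ℝ) ≤ m)]
  intro h0
  rw [heckeSeries_eq_tsum] at h0
  have h0' : ∑' x : QInt, hterm k s x = 0 := by simpa using h0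
  have hneg : (1 : QInt) ≠ -1 := by
    intro h
    have := congrArg QuadraticAlgebra.re h
    simp [QuadraticAlgebra.re_one] at this
  have hsum := (summable_norm_hterm hk0 hs1).of_norm.hasSum
  rw [h0'] at hsum
  have hdelta : HasSum (fun d : QInt => if d = 1 ∨ d = -1 then hterm k s d else 0) 2 := by
    have h1 : HasSum (fun d : QInt => if d = 1 ∨ d = -1 then hterm k s d else 0)
        (∑ d ∈ {1, -1}, if d = 1 ∨ d = -1 then hterm k s d else 0) :=
      hasSum_sum_of_ne_finset_zero (fun d hd => by
        simp only [mem_insert, Finset.mem_singleton] at hd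
        rw [if_neg hd])
    rw [Finset.sum_pair hneg, if_pos (Or.inl rfl), if_pos (Or.inr rfl), hterm_one,
      hterm_neg_one hk] at h1
    rwa [show (2 : ℂ) = 1 + 1 by norm_num]
  have hrest := hsum.sub hdelta
  have hle : ‖(0 - 2 : ℂ)‖ ≤ (2 : ℝ)⁻¹ ^ m * S := by
    rw [← hrest.tsum_eq]
    refine tsum_of_norm_bounded (hS4.hasSum.mul_left _) fun x => ?_
    by_cases hx : x = 1 ∨ x = -1
    · rw [if_pos hx, sub_self, norm_zero]; positivity
    · rw [if_neg hx, sub_zero]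
      refine (norm_hterm_le hk0 s x).trans ?_
      by_cases hx0 : x = 0
      · subst hx0
        rw [map_zero, norm_zero, zero_rpow (by linarith), zero_rpow (by norm_num)]; simp
      have h2 : 2 ≤ x.norm := by
        have h1 := one_le_norm hx0
        by_contra hlt
        have h3 : x.norm = 1 := by omega
        have hu : IsUnit x := by rw [QuadraticAlgebra.isUnit_iff_norm_isUnit, h3]; exact isUnit_one
        exact hx (QInt.eq_one_or_of_isUnit hu)
      have h2' : (2 : ℝ) ≤ ‖emb x‖ ^ 2 := by rw [← norm_eq_norm_emb_sq]; exact_mod_cast h2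
      have hpos : 0 < ‖emb x‖ := by linarith [one_le_norm_emb hx0]
      rw [hsre, show -(2 * (2 + (m : ℝ))) = -4 + -((2 * m : ℕ) : ℝ) by push_cast; ring,
        rpow_add hpos, mul_comm, rpow_neg hpos.le ((2 * m : ℕ) : ℝ), rpow_natCast,
        pow_mul, inv_pow]
      gcongr
  have h3 : ‖(0 - 2 : ℂ)‖ = 2 := by norm_num
  rw [h3, inv_pow, inv_mul_eq_div, le_div_iff₀ (by positivity)] at hle
  have : (0 : ℝ) < 2 ^ m := by positivity
  linarith

lemma continuousOn_lamSeries {k : ℕ} (hk : k ≠ 0) :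
    ContinuousOn (lamSeries k) {s : ℂ | 1 < s.re} := by
  intro s hs
  have hs' : 1 < s.re := hs
  set a := (1 + s.re) / 2 with ha
  have h1 : ContinuousOn (lamSeries k) {w : ℂ | a < w.re} := by
    refine continuousOn_const.mul (continuousOn_tsum (fun x w _ => ?_)
      (summable_log_mul_rpow (r := 2 * a) (by linarith)) fun x w hw => ?_)
    · exact ((hasDerivAt_hterm hk w x).continuousAt.const_mul _).continuousWithinAt
    · have hw' : a < w.re := hw
      rw [norm_mul, norm_real, Real.norm_of_nonneg (lamR_nonneg x)]
      refine mul_le_mul (lamR_le x) ((norm_hterm_le hk w x).trans ?_) (norm_nonneg _)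
        (log_norm_nonneg x)
      by_cases hx : x = 0
      · subst hx
        rw [map_zero, norm_zero, zero_rpow (by linarith), zero_rpow (by linarith)]
      · exact rpow_le_rpow_of_exponent_le (one_le_norm_emb hx) (by linarith)
  exact (h1.continuousAt ((isOpen_lt_re _).mem_nhds
    (show a < s.re by linarith))).continuousWithinAt

lemma ne_zero_of_deriv_eq_mul {f V : ℂ → ℂ} (hf : Differentiable ℂ f) {z₀ : ℂ} (h0 : f z₀ ≠ 0)
    {U : Set ℂ} (hU : IsOpen U) (hV : ContinuousOn V U) (hd : ∀ z ∈ U, deriv f z = V z * f z)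
    {ρ : ℂ} (hρ : ρ ∈ U) : f ρ ≠ 0 := by
  intro hzero
  have htop := analyticOrderAt_ne_top_of_entire hf h0 ρ
  obtain ⟨m, hm⟩ := ENat.ne_top_iff_exists.1 htop
  obtain ⟨g, hg, hfg, hgρ⟩ := exists_eq_pow_mul_of_analyticOrderAt hf ρ m hm.symm
  have hm0 : m ≠ 0 := by
    rintro rfl
    have := hfg ρ
    rw [pow_zero, one_mul, hzero] at this; exact hgρ this.symm
  have hev : ∀ᶠ z in nhdsWithin ρ {ρ}ᶜ, (m : ℂ) * g z = (z - ρ) * (V z * g z - deriv g z) := by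
    have h1 : ∀ᶠ z in nhdsWithin ρ {ρ}ᶜ, z ∈ U := mem_nhdsWithin_of_mem_nhds (hU.mem_nhds hρ)
    filter_upwards [h1, self_mem_nhdsWithin] with z hz hzρ
    have hne : z - ρ ≠ 0 := sub_ne_zero.2 hzρ
    have hder : deriv f z = m * (z - ρ) ^ (m - 1) * g z + (z - ρ) ^ m * deriv g z := by
      have e : f = fun z => (z - ρ) ^ m * g z := funext hfg
      rw [e]
      have h2 := (((hasDerivAt_id z).sub_const ρ).pow m).mul (hg z).hasDerivAt
      have h3 := h2.deriv
      simp only [id, mul_one] at h3; exact h3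
    have h4 := hd z hz
    rw [hder, hfg] at h4
    obtain ⟨j, rfl⟩ : ∃ j, m = j + 1 := ⟨m - 1, by omega⟩
    have h5 : (z - ρ) ^ j ≠ 0 := pow_ne_zero _ hne
    apply mul_left_cancel₀ h5
    rw [Nat.add_sub_cancel] at h4
    rw [pow_succ] at h4
    linear_combination h4
  have hl : Tendsto (fun z => (m : ℂ) * g z) (nhdsWithin ρ {ρ}ᶜ) (nhds (m * g ρ)) :=
    ((hg.continuous.tendsto ρ).const_mul _).mono_left nhdsWithin_le_nhds
  have hr : Tendsto (fun z => (z - ρ) * (V z * g z - deriv g z)) (nhdsWithin ρ {ρ}ᶜ)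
      (nhds ((ρ - ρ) * (V ρ * g ρ - deriv g ρ))) := by
    have hVc := hV.continuousAt (hU.mem_nhds hρ)
    have hgd : Continuous (deriv g) := (hg.contDiff (n := 1)).continuous_deriv_one
    have hc : ContinuousAt (fun z => (z - ρ) * (V z * g z - deriv g z)) ρ :=
      (continuousAt_id.sub continuousAt_const).mul
        ((hVc.mul hg.continuous.continuousAt).sub hgd.continuousAt)
    exact hc.tendsto.mono_left nhdsWithin_le_nhds
  have := tendsto_nhds_unique (hl.congr' hev) hr
  rw [sub_self, zero_mul] at this; exact mul_ne_zero (Nat.cast_ne_zero.2 hm0) hgρ this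

lemma deriv_familyL {n : ℕ} (hn : 1 ≤ n) {s : ℂ} (hs : 1 < s.re) :
    deriv (familyL n) s = -lamSeries (4 * n - 3) s * familyL n s := by
  have hev : familyL n =ᶠ[nhds s] heckeSeries (4 * n - 3) := by
    filter_upwards [(isOpen_lt_re _).mem_nhds hs] with w hw
    exact familyL_eq_series hn hw
  rw [hev.deriv_eq, deriv_heckeSeries (by omega) hs, familyL_eq_series hn hs]

lemma odd_weight {n : ℕ} (hn : 1 ≤ n) : Odd (4 * n - 3) := Nat.odd_iff.2 (by omega)

lemma familyL_ne_zero {n : ℕ} (hn : 1 ≤ n) {s : ℂ} (hs : 1 < s.re) : familyL n s ≠ 0 := by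
  obtain ⟨z₀, hz₀, h0⟩ := exists_heckeSeries_ne_zero (odd_weight hn)
  rw [← familyL_eq_series hn hz₀] at h0
  exact ne_zero_of_deriv_eq_mul (differentiable_familyL hn) h0
    (isOpen_lt_re _)
    ((continuousOn_lamSeries (by omega)).neg) (fun z hz => deriv_familyL hn hz) hs

lemma logDeriv_familyL {n : ℕ} (hn : 1 ≤ n) {s : ℂ} (hs : 1 < s.re) :
    logDeriv (familyL n) s = -lamSeries (4 * n - 3) s := by
  rw [logDeriv_apply, deriv_familyL hn hs, mul_div_assoc, div_self (familyL_ne_zero hn hs), mul_one]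

/-! ### Averaging over the family -/

lemma hterm_eq {k : ℕ} (hk : Odd k) (s : ℂ) {x : QInt} (hx : x ≠ 0) :
    hterm k s x = (epsSign x.vec : ℂ) * (emb x / ‖emb x‖) ^ k * ((x.norm : ℂ) ^ s)⁻¹ := by
  have h1 : 0 < ‖emb x‖ := by linarith [one_le_norm_emb hx]
  have hN : (x.norm : ℂ) = ((‖emb x‖ ^ 2 : ℝ) : ℂ) := by rw [← norm_eq_norm_emb_sq]; simp
  have hN0 : (x.norm : ℂ) ≠ 0 := by rw [hN]; exact ofReal_ne_zero.2 (by positivity)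
  have hhalf : (x.norm : ℂ) ^ ((k : ℂ) / 2) = (‖emb x‖ : ℂ) ^ k := by
    have : ((k : ℂ) / 2) = ((k / 2 : ℝ) : ℂ) := by push_cast; ring
    rw [hN, this, ← ofReal_cpow (by positivity), ← rpow_natCast, ← rpow_mul h1.le]
    have e : ((2 : ℕ) : ℝ) * (k / 2) = (k : ℕ) := by push_cast; ring
    rw [e, rpow_natCast, ofReal_pow]
  have he : (epsSign x.vec : ℂ) ^ k = epsSign x.vec := mod_cast epsSign_pow x.vec hk
  rw [hterm, normForm_vec, cpow_add _ _ hN0, hhalf, heckeChar_eq, ← emb_eq_alg, mul_pow, he,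
    div_pow]
  have h3 : (‖emb x‖ : ℂ) ≠ 0 := ofReal_ne_zero.2 h1.ne'
  field_simp

lemma geom_sum_weight (z : ℂ) (N : ℕ) :
    (1 - z ^ 4) * ∑ n ∈ Icc 1 N, z ^ (4 * n - 3) = z * (1 - z ^ (4 * N)) := by
  induction N with
  | zero => simp
  | succ N ih =>
    rw [Finset.sum_Icc_succ_top (by omega), mul_add, ih]
    have e1 : 4 * (N + 1) - 3 = 4 * N + 1 := by omega
    have e2 : 4 * (N + 1) = 4 * N + 4 := by omega
    rw [e1, e2, pow_add, pow_add]; ring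

lemma norm_one_sub_pow_four {x : QInt} (hx : x ≠ 0) :
    ‖1 - (emb x / ‖emb x‖) ^ 4‖ * (x.norm : ℝ) = 4 * (|(emb x).re| * |(emb x).im|) := by
  set z := emb x with hz
  have h1 : 0 < ‖z‖ := by linarith [one_le_norm_emb hx]
  have h3 : (‖z‖ : ℂ) ≠ 0 := ofReal_ne_zero.2 h1.ne'
  have hzz : z * (starRingEnd ℂ) z = (‖z‖ : ℂ) ^ 2 := by
    rw [mul_conj, normSq_eq_norm_sq]; push_cast; ring
  have e : (1 - (z / ‖z‖) ^ 4) * (‖z‖ : ℂ) ^ 4 =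
      -(z ^ 2 * ((z - (starRingEnd ℂ) z) * (z + (starRingEnd ℂ) z))) := by
    have : (‖z‖ : ℂ) ^ 4 = (z * (starRingEnd ℂ) z) ^ 2 := by rw [hzz]; ring
    rw [sub_mul, div_pow, div_mul_cancel₀ _ (pow_ne_zero 4 h3), this]; ring
  have h4 := congrArg norm e
  rw [norm_neg, norm_mul, norm_mul, norm_mul, norm_pow, norm_pow, norm_real, sub_conj,
    add_conj, norm_norm, norm_mul, norm_I, norm_real, norm_real] at h4
  rw [norm_eq_norm_emb_sq, ← hz]
  have h5 : ‖z‖ ^ 2 ≠ 0 := by positivity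
  apply mul_left_cancel₀ h5
  rw [norm_eq_abs, norm_eq_abs, abs_mul, abs_mul, abs_two] at h4
  linear_combination h4

lemma norm_geom_sum_le {x : QInt} (hre : 2 * x.re + x.im ≠ 0) (him : x.im ≠ 0) (N : ℕ) :
    ‖∑ n ∈ Icc 1 N, (emb x / ‖emb x‖) ^ (4 * n - 3)‖ ≤ ‖emb x‖ ^ (2 : ℝ) := by
  have hx : x ≠ 0 := by rintro rfl; exact him rfl
  have h1 : 0 < ‖emb x‖ := by linarith [one_le_norm_emb hx]
  have h3 : (‖emb x‖ : ℂ) ≠ 0 := ofReal_ne_zero.2 h1.ne'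
  set z := emb x / ‖emb x‖ with hz
  have hz1 : ‖z‖ = 1 := by rw [hz, norm_div, norm_real, norm_norm, div_self h1.ne']
  have hg := congrArg norm (geom_sum_weight z N)
  rw [norm_mul, norm_mul, hz1, one_mul] at hg
  have hle : ‖1 - z ^ (4 * N)‖ ≤ 2 := by
    refine (norm_sub_le _ _).trans ?_
    rw [norm_pow, hz1, one_pow, norm_one]; norm_num
  have hlow := norm_one_sub_pow_four hx
  rw [← hz] at hlow
  have hxre : 1 / 2 ≤ |(emb x).re| := by
    rw [emb_eq_alg, alg_re]
    have : (1 : ℝ) ≤ |2 * (x.re : ℝ) + x.im| := by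
      have : (1 : ℤ) ≤ |2 * x.re + x.im| := Int.one_le_abs hre
      exact_mod_cast this
    have e : ((x.vec.1 : ℤ) : ℝ) + (x.vec.2 : ℤ) / 2 = (2 * (x.re : ℝ) + x.im) / 2 := by
      simp only [QInt.vec]; ring
    rw [e, abs_div, abs_two]; linarith
  have hxim : 1 ≤ |(emb x).im| := by
    rw [emb_eq_alg, alg_im]
    have h4 : (1 : ℝ) ≤ |(x.im : ℝ)| := by
      have : (1 : ℤ) ≤ |x.im| := Int.one_le_abs him
      exact_mod_cast this
    have h5 : 2 ≤ √7 := Real.le_sqrt_of_sq_le (by norm_num)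
    have e : ((x.vec.2 : ℤ) : ℝ) * √7 / 2 = x.im * (√7 / 2) := by simp only [QInt.vec]; ring
    rw [e, abs_mul, abs_of_pos (by positivity : 0 < √7 / 2)]; nlinarith
  have hprod : 1 / 2 ≤ |(emb x).re| * |(emb x).im| := by nlinarith [abs_nonneg (emb x).re]
  have hNp : (0 : ℝ) < x.norm := mod_cast (by linarith [one_le_norm hx] : 0 < x.norm)
  rw [rpow_two, ← norm_eq_norm_emb_sq]
  set G := ‖∑ n ∈ Icc 1 N, z ^ (4 * n - 3)‖ with hG
  have hG0 : 0 ≤ G := norm_nonneg _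
  have h6 : 2 * G ≤ ‖1 - z ^ 4‖ * (x.norm : ℝ) * G := by
    rw [hlow]; exact mul_le_mul_of_nonneg_right (by linarith) hG0
  have h7 : ‖1 - z ^ 4‖ * (x.norm : ℝ) * G = (x.norm : ℝ) * ‖1 - z ^ (4 * N)‖ := by rw [← hg]; ring
  rw [h7] at h6; nlinarith

lemma hterm_eq_zero {k : ℕ} (hk : k ≠ 0) (s : ℂ) {x : QInt} (hre : 2 * x.re + x.im = 0) :
    hterm k s x = 0 := by
  have : epsSign x.vec = 0 := by
    rw [epsSign_eq]; simp only [QInt.vec]; rw [hre, legendreSym_seven]; simp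
  rw [hterm, heckeChar_eq, this]; simp [hk]

lemma hterm_int {k : ℕ} (hk : Odd k) (s : ℂ) (m : ℤ) :
    hterm k s (m : QInt) = (legendreSym 7 |m| : ℂ) * (((|m| : ℤ) : ℂ) ^ (2 * s))⁻¹ := by
  by_cases hm : m = 0
  · subst hm
    rw [Int.cast_zero, hterm_zero hk.pos.ne', abs_zero, legendreSym_seven]; simp
  have hx : (m : QInt) ≠ 0 := by
    intro h
    have := congrArg QuadraticAlgebra.re h
    simp at this; exact hm this
  have hemb : emb (m : QInt) = m := map_intCast emb m
  have hpos : (0 : ℝ) < |(m : ℝ)| := abs_pos.2 (mod_cast hm)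
  have hnm : (m : QInt).norm = m ^ 2 := by rw [QuadraticAlgebra.norm_intCast]; simp
  rw [hterm_eq hk s hx, hemb, hnm, norm_intCast]
  have hN : ((m ^ 2 : ℤ) : ℂ) ^ s = ((|m| : ℤ) : ℂ) ^ (2 * s) := by
    have e1 : ((m ^ 2 : ℤ) : ℂ) = ((|(m : ℝ)| : ℝ) : ℂ) ^ 2 := by
      rw [← ofReal_pow, sq_abs]; push_cast; ring
    have e2 : ((|m| : ℤ) : ℂ) = ((|(m : ℝ)| : ℝ) : ℂ) := by rw [← Int.cast_abs, ofReal_intCast]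
    rw [e1, e2, show (2 * s : ℂ) = ((2 : ℕ) : ℂ) * s by push_cast; ring]
    rw [cpow_nat_mul', ]
    · rw [arg_ofReal_of_nonneg hpos.le]; simp [pi_pos]
    · rw [arg_ofReal_of_nonneg hpos.le]; simp [pi_pos.le]
  rw [hN]
  congr 1
  have heps : epsSign (m : QInt).vec = legendreSym 7 m := by
    rw [epsSign_eq]
    have e : 2 * (m : QInt).vec.1 + (m : QInt).vec.2 = 2 * m := by simp [QInt.vec]
    have h2 : legendreSym 7 2 = 1 := by rw [legendreSym_seven]; rfl
    rw [e, legendreSym.mul, h2, one_mul]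
  rw [heps]
  have hneg : legendreSym 7 (-m) = -legendreSym 7 m := by
    have h2 : legendreSym 7 (-1) = -1 := by rw [legendreSym_seven]; rfl
    rw [← neg_one_mul, legendreSym.mul, h2, neg_one_mul]
  have hmC : (m : ℂ) ≠ 0 := mod_cast hm
  rcases lt_or_gt_of_ne hm with h | h
  · rw [abs_of_neg h, hneg, abs_of_neg (mod_cast h : (m : ℝ) < 0)]
    push_cast
    rw [div_neg, div_self hmC, hk.neg_one_pow]; ring
  · rw [abs_of_pos h, abs_of_pos (mod_cast h : (0 : ℝ) < m)]
    push_cast; rw [div_self hmC, one_pow, mul_one]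

/-- The rational part of the Dirichlet series, which survives the averaging. -/
def diagSeries (s : ℂ) : ℂ :=
  ∑' m : ℕ, (lamR (m : QInt) : ℂ) * ((legendreSym 7 m : ℂ) * ((m : ℂ) ^ (2 * s))⁻¹)

lemma lamR_neg (x : QInt) : lamR (-x) = lamR x := by
  by_cases h : lamR x = 0
  · rw [h]
    by_contra hne
    obtain ⟨p, j, hp, hj, hd⟩ := exists_of_lamR_ne_zero hne
    have hd' : Associated (p ^ j) x := hd.trans (associated_neg x).symm
    rw [lamR_eq hp hj hd'] at h
    rw [lamR_eq hp hj hd] at hne; exact hne h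
  · obtain ⟨p, j, hp, hj, hd⟩ := exists_of_lamR_ne_zero h
    rw [lamR_eq hp hj hd, lamR_eq hp hj (hd.trans (associated_neg x))]

lemma tsum_rational {k : ℕ} (hk : Odd k) {s : ℂ} (hs : 1 < s.re) :
    (1 / 2) * ∑' x : QInt, (if x.im = 0 then (lamR x : ℂ) * hterm k s x else 0) = diagSeries s := by
  have hk0 := hk.pos.ne'
  have hinj : Injective (fun m : ℤ => (m : QInt)) := by
    intro a b h
    have := congrArg QuadraticAlgebra.re h
    simpa using this
  have h1 : ∑' x : QInt, (if x.im = 0 then (lamR x : ℂ) * hterm k s x else 0) =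
      ∑' m : ℤ, (lamR (m : QInt) : ℂ) * hterm k s (m : QInt) := by
    rw [← hinj.tsum_eq]
    · refine tsum_congr fun m => ?_
      simp
    · intro x hx
      by_contra hcon
      apply hx
      have : x.im ≠ 0 := by
        intro h
        exact hcon ⟨x.re, by ext <;> simp [h]⟩
      simp [this]
  have hsum : Summable fun m : ℤ => (lamR (m : QInt) : ℂ) * hterm k s (m : QInt) :=
    (summable_norm_lamR_hterm hk0 hs).of_norm.comp_injective hinj
  have hnat : Summable fun m : ℕ => (lamR ((m : ℤ) : QInt) : ℂ) * hterm k s ((m : ℤ) : QInt) :=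
    hsum.comp_injective Nat.cast_injective
  have hnatval : ∑' m : ℕ, (lamR ((m : ℤ) : QInt) : ℂ) * hterm k s ((m : ℤ) : QInt) =
      diagSeries s := by
    rw [diagSeries]
    refine tsum_congr fun m => ?_
    rw [hterm_int hk]; simp
  have hA := hnat.hasSum
  rw [hnatval] at hA
  have hB : HasSum (fun m : ℕ => (lamR ((-(m + 1 : ℕ) : ℤ) : QInt) : ℂ) *
      hterm k s ((-(m + 1 : ℕ) : ℤ) : QInt)) (diagSeries s) := by
    have h2 := (hasSum_nat_add_iff' 1).2 hA
    simp only [Finset.range_one, Finset.sum_singleton] at h2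
    have e0 : (lamR (((0 : ℕ) : ℤ) : QInt) : ℂ) * hterm k s (((0 : ℕ) : ℤ) : QInt) = 0 := by
      simp [hterm_zero hk0]
    rw [e0, sub_zero] at h2
    refine hasSum_of_eq h2 fun m => ?_
    rw [hterm_int hk, hterm_int hk, abs_neg, Int.cast_neg, lamR_neg]
  have hAB := HasSum.of_nat_of_neg_add_one (f := fun m : ℤ => (lamR (m : QInt) : ℂ) *
    hterm k s (m : QInt)) hA (by
      refine hasSum_of_eq hB fun m => ?_
      push_cast; rfl)
  rw [h1, hAB.tsum_eq]; ring

lemma average_lamSeries : ∃ C : ℝ, ∀ (N : ℕ) (s : ℂ), s.re = 12 / 5 →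
    ‖(∑ n ∈ Icc 1 N, lamSeries (4 * n - 3) s) - N * diagSeries s‖ ≤ C := by
  refine ⟨1 / 2 * ∑' x : QInt, ln (x.norm : ℝ) * ‖emb x‖ ^ (-(14 / 5) : ℝ), fun N s hs => ?_⟩
  have hs1 : 1 < s.re := by rw [hs]; norm_num
  have hsm := fun n : ℕ => fun hn : 1 ≤ n =>
    (summable_norm_lamR_hterm (k := 4 * n - 3) (by omega) hs1).of_norm
  have hsm0 : ∀ n : ℕ, 1 ≤ n → Summable fun x : QInt =>
      (if x.im = 0 then (lamR x : ℂ) * hterm (4 * n - 3) s x else 0) := by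
    intro n hn
    refine of_norm_bounded (hsm n hn).norm fun x => ?_
    split_ifs
    · exact le_rfl
    · rw [norm_zero]; exact norm_nonneg _
  have h1 : ∀ n ∈ Icc 1 N, lamSeries (4 * n - 3) s - diagSeries s =
      1 / 2 * ∑' x : QInt, (if x.im = 0 then 0 else (lamR x : ℂ) * hterm (4 * n - 3) s x) := by
    intro n hn
    have hn1 : 1 ≤ n := (mem_Icc.1 hn).1
    rw [← tsum_rational (odd_weight hn1) hs1, lamSeries, ← mul_sub,
      ← (hsm n hn1).tsum_sub (hsm0 n hn1)]
    congr 1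
    refine tsum_congr fun x => ?_
    split_ifs <;> ring
  have h2 : (∑ n ∈ Icc 1 N, lamSeries (4 * n - 3) s) - N * diagSeries s =
      1 / 2 * ∑' x : QInt, ∑ n ∈ Icc 1 N,
        (if x.im = 0 then 0 else (lamR x : ℂ) * hterm (4 * n - 3) s x) := by
    have : (N : ℂ) * diagSeries s = ∑ n ∈ Icc 1 N, diagSeries s := by rw [sum_const, card_Icc]; simp
    rw [this, ← sum_sub_distrib, sum_congr rfl h1, ← mul_sum, tsum_finsetSum]
    intro n hn
    have hn1 : 1 ≤ n := (mem_Icc.1 hn).1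
    refine of_norm_bounded (hsm n hn1).norm fun x => ?_
    split_ifs
    · rw [norm_zero]; exact norm_nonneg _
    · exact le_rfl
  rw [h2, norm_mul, show ‖(1 / 2 : ℂ)‖ = 1 / 2 by norm_num]
  refine mul_le_mul_of_nonneg_left ?_ (by norm_num)
  refine tsum_of_norm_bounded (summable_log_mul_rpow (by norm_num)).hasSum fun x => ?_
  have hnn : 0 ≤ ln (x.norm : ℝ) * ‖emb x‖ ^ (-(14 / 5) : ℝ) :=
    mul_nonneg (log_norm_nonneg x) (by positivity)
  by_cases him : x.im = 0
  · simp only [him, if_true, Finset.sum_const_zero, norm_zero]; exact hnn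
  by_cases hre : 2 * x.re + x.im = 0
  · have : ∑ n ∈ Icc 1 N, (if x.im = 0 then 0 else (lamR x : ℂ) * hterm (4 * n - 3) s x) =
        0 := by
      refine Finset.sum_eq_zero fun n hn => ?_
      have hn1 : 1 ≤ n := (mem_Icc.1 hn).1
      rw [if_neg him, hterm_eq_zero (by omega) s hre, mul_zero]
    rw [this, norm_zero]; exact hnn
  have hx : x ≠ 0 := by rintro rfl; exact him rfl
  have h3 : ∑ n ∈ Icc 1 N, (if x.im = 0 then 0 else (lamR x : ℂ) * hterm (4 * n - 3) s x) =
      (lamR x : ℂ) * ((epsSign x.vec : ℂ) * ((x.norm : ℂ) ^ s)⁻¹ *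
        ∑ n ∈ Icc 1 N, (emb x / ‖emb x‖) ^ (4 * n - 3)) := by
    rw [mul_sum, mul_sum]
    refine sum_congr rfl fun n hn => ?_
    have hn1 : 1 ≤ n := (mem_Icc.1 hn).1
    rw [if_neg him, hterm_eq (odd_weight hn1) s hx]; ring
  have h1e := one_le_norm_emb hx
  rw [h3, norm_mul, norm_real, Real.norm_of_nonneg (lamR_nonneg x)]
  refine mul_le_mul (lamR_le x) ?_ (norm_nonneg _) (log_norm_nonneg x)
  rw [norm_mul, norm_mul, norm_inv, ← normForm_vec, norm_normForm_cpow (v := x.vec) (QInt.mk_ne_zero hx),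
    ← emb_eq_alg, hs]
  have h5 : ‖emb x‖ ^ (-(14 / 5) : ℝ) = 1 * (‖emb x‖ ^ (2 * (12 / 5) : ℝ))⁻¹ * ‖emb x‖ ^ (2 : ℝ) := by
    rw [one_mul, ← rpow_neg (by linarith), ← rpow_add (by linarith)]; norm_num
  rw [h5]
  refine mul_le_mul (mul_le_mul_of_nonneg_right (norm_epsSign_le _) (by positivity))
    (norm_geom_sum_le hre him N) (norm_nonneg _) (by positivity)

/-! ### Rational primes in `ℤ[η]` -/

lemma star_prime {q : QInt} (hq : Prime q) : Prime (star q) :=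
  (MulEquiv.prime_iff (starRingAut (R := QInt)).toMulEquiv).2 hq

lemma isUnit_of_norm_eq_one {x : QInt} (hx : x.norm = 1) : IsUnit x :=
  QuadraticAlgebra.isUnit_iff_norm_isUnit.2 (by rw [hx]; exact isUnit_one)

lemma natCast_eq_one_of_isUnit {x : ℕ} (hx : IsUnit (x : QInt)) : x = 1 := by
  have h := QuadraticAlgebra.isUnit_iff_norm_isUnit.1 hx
  rw [QuadraticAlgebra.norm_natCast, Int.isUnit_iff] at h
  have h2 : (x : ℤ) ^ 2 = 1 := by rcases h with h | h <;> nlinarith [sq_nonneg (x : ℤ)]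
  exact_mod_cast (pow_eq_one_iff_of_nonneg (by positivity) two_ne_zero).1 h2

lemma prime_of_prime_natCast {p : ℕ} (hp : Prime (p : QInt)) : p.Prime := by
  rw [← Nat.irreducible_iff_nat_prime, irreducible_iff]
  refine ⟨fun h => hp.not_isUnit ?_, fun a b hab => ?_⟩
  · rw [Nat.isUnit_iff.1 h]; simp
  · have := hp.irreducible.isUnit_or_isUnit (a := (a : QInt)) (b := (b : QInt))
      (by rw [hab]; push_cast; rfl)
    rcases this with h | h
    · left; exact Nat.isUnit_iff.2 (natCast_eq_one_of_isUnit h)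
    · right; exact Nat.isUnit_iff.2 (natCast_eq_one_of_isUnit h)

lemma exists_prime_pow_of_lamR_ne_zero {m : ℕ} (h7 : ¬ 7 ∣ m) (h : lamR (m : QInt) ≠ 0) :
    ∃ p j : ℕ, p.Prime ∧ 0 < j ∧ m = p ^ j ∧ Prime (p : QInt) := by
  obtain ⟨q, j, hq, hj, hqm⟩ := exists_of_lamR_ne_zero h
  have hqd : q ∣ (m : QInt) := (dvd_pow_self q hj.ne').trans hqm.dvd
  have hsd : star q ∣ (m : QInt) := by
    obtain ⟨c, hc⟩ := hqd
    refine ⟨star c, ?_⟩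
    have := congrArg star hc
    rw [star_natCast, star_mul'] at this; exact this
  have hss : star q ∣ q := (star_prime hq).dvd_of_dvd_pow (hsd.trans hqm.symm.dvd)
  have has : Associated (star q) q := (star_prime hq).associated_of_dvd hq hss
  have hnorm : q.norm ∣ (m : ℤ) ^ 2 := by
    have := map_dvd (QuadraticAlgebra.norm (R := ℤ) (a := -2) (b := 1)) hqd
    rwa [QuadraticAlgebra.norm_natCast] at this
  rcases QInt.eq_or_eq_neg_of_associated has with e | e
  · have him : q.im = 0 := by
      have := congrArg QuadraticAlgebra.im e
      simp at this; omega
    have hqa : q = (q.re : QInt) := by ext <;> simp [him]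
    have hassoc : Associated ((q.re.natAbs : ℕ) : QInt) q := by
      rcases Int.natAbs_eq q.re with h' | h'
      · have : ((q.re.natAbs : ℕ) : QInt) = q := by conv_rhs => rw [hqa, h', Int.cast_natCast]
        rw [this]
      · have : ((q.re.natAbs : ℕ) : QInt) = -q := by
          conv_rhs => rw [hqa, h', Int.cast_neg, Int.cast_natCast, neg_neg]
        rw [this]; exact (associated_neg q).symm
    have hp := hassoc.symm.prime hq
    refine ⟨q.re.natAbs, j, prime_of_prime_natCast hp, hj, ?_, hp⟩
    have h1 := norm_eq_of_associated ((hassoc.pow_pow (n := j)).trans hqm)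
    rw [map_pow, QuadraticAlgebra.norm_natCast, QuadraticAlgebra.norm_natCast] at h1
    have h2 : (q.re.natAbs ^ j) ^ 2 = m ^ 2 := by
      have : ((q.re.natAbs : ℤ) ^ 2) ^ j = (m : ℤ) ^ 2 := mod_cast h1
      have h3 : ((q.re.natAbs : ℤ) ^ j) ^ 2 = (m : ℤ) ^ 2 := by rw [← this]; ring
      exact_mod_cast h3
    exact (Nat.pow_left_injective (two_ne_zero) h2).symm
  · exfalso
    apply h7
    have him : q.im = -2 * q.re := by
      have := congrArg QuadraticAlgebra.re e
      simp at this; omega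
    have hn : q.norm = 7 * q.re ^ 2 := by rw [norm_eq_normForm, normForm, him]; ring
    have : (7 : ℤ) ∣ (m : ℤ) ^ 2 := (Dvd.intro _ hn.symm).trans hnorm
    have h7' : (7 : ℤ) ∣ (m : ℤ) := Int.Prime.dvd_pow' (p := 7) (by norm_num) this
    exact_mod_cast h7'

lemma natCast_not_isUnit {p : ℕ} (hp : p.Prime) : ¬ IsUnit (p : QInt) := fun h =>
  hp.one_lt.ne' (natCast_eq_one_of_isUnit h)

lemma prime_natCast_of_inert {p : ℕ} (hp : p.Prime) (h : p % 7 = 3 ∨ p % 7 = 5 ∨ p % 7 = 6) :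
    Prime (p : QInt) := by
  apply Irreducible.prime
  rw [irreducible_iff]
  refine ⟨natCast_not_isUnit hp, fun x y hxy => ?_⟩
  have hn : x.norm * y.norm = (p : ℤ) ^ 2 := by rw [← map_mul, ← hxy, QuadraticAlgebra.norm_natCast]
  have hx0 := norm_nonneg' x
  have hy0 := norm_nonneg' y
  have hn' : x.norm.natAbs * y.norm.natAbs = p ^ 2 := by
    have : ((x.norm.natAbs * y.norm.natAbs : ℕ) : ℤ) = ((p ^ 2 : ℕ) : ℤ) := by
      push_cast; rw [abs_of_nonneg hx0, abs_of_nonneg hy0, hn]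
    exact_mod_cast this
  obtain ⟨i, hi, hxi⟩ := (Nat.dvd_prime_pow hp).1 (Dvd.intro _ hn')
  have hxn : x.norm = ((p ^ i : ℕ) : ℤ) := by rw [← hxi]; simp [abs_of_nonneg hx0]
  interval_cases i
  · left; exact isUnit_of_norm_eq_one (by rw [hxn]; simp)
  · exfalso
    rw [norm_eq_normForm, normForm, pow_one] at hxn
    simp only at hxn
    have h4 : (2 * x.re + x.im) ^ 2 + 7 * x.im ^ 2 = 4 * (p : ℤ) := by rw [← hxn]; ring
    have h5 : ((2 * x.re + x.im) % 7) ^ 2 % 7 = 4 * (p % 7) % 7 := by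
      have e1 := ((Int.mod_modEq (2 * x.re + x.im) 7).pow 2)
      have e2 : (4 * (p : ℤ)) % 7 = 4 * (p % 7) % 7 := by omega
      rw [e1, ← e2, ← h4]; omega
    have h1 : 0 ≤ (2 * x.re + x.im) % 7 := Int.emod_nonneg _ (by norm_num)
    have h2 : (2 * x.re + x.im) % 7 < 7 := Int.emod_lt_of_pos _ (by norm_num)
    generalize (2 * x.re + x.im) % 7 = u at *
    interval_cases u <;> norm_num at h5 <;> omega
  · right
    apply isUnit_of_norm_eq_one
    have hp0 : (p : ℤ) ^ 2 ≠ 0 := by have := hp.pos; positivity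
    rw [hxn] at hn
    push_cast at hn
    exact mul_left_cancel₀ hp0 (by rw [hn, mul_one])

lemma exists_dvd_of_split {p : ℕ} (hp : p.Prime) (h : p % 7 = 1 ∨ p % 7 = 2 ∨ p % 7 = 4) :
    ∃ c : ℤ, (p : ℤ) ∣ c ^ 2 - c + 2 := by
  by_cases h2 : p = 2
  · exact ⟨0, by simp [h2]⟩
  have : Fact p.Prime := ⟨hp⟩
  have hodd : p % 2 = 1 := Nat.odd_iff.1 (hp.odd_of_ne_two h2)
  have h7 : ((7 : ℤ) : ZMod p) ≠ 0 := by
    intro h0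
    have : (p : ℤ) ∣ 7 := (ZMod.intCast_zmod_eq_zero_iff_dvd 7 p).1 h0
    have h' : p ∣ 7 := mod_cast this
    have := (Nat.prime_dvd_prime_iff_eq hp (by norm_num)).1 h'
    omega
  have hne : ((-7 : ℤ) : ZMod p) ≠ 0 := by push_cast at h7 ⊢; exact neg_ne_zero.2 h7
  have hl : legendreSym p (-7) = 1 := by
    rw [show (-7 : ℤ) = -1 * ((7 : ℕ) : ℤ) by norm_num, legendreSym.mul,
      legendreSym.at_neg_one h2, ZMod.χ₄_eq_neg_one_pow hodd,
      legendreSym.quadratic_reciprocity' (p := 7) (q := p) (by norm_num) h2, ← mul_assoc, ← pow_add,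
      legendreSym_seven]
    have e1 : p / 2 + 7 / 2 * (p / 2) = 2 * (2 * (p / 2)) := by omega
    have hc : ((p : ℤ) % 7 = 1 ∨ (p : ℤ) % 7 = 2 ∨ (p : ℤ) % 7 = 4) := by omega
    rw [e1, pow_mul, if_neg (by omega), if_pos hc]; norm_num
  obtain ⟨t, ht⟩ := (legendreSym.eq_one_iff p hne).1 hl
  have h2' : (2 : ZMod p) ≠ 0 := by
    have : ((2 : ℕ) : ZMod p) ≠ 0 := by
      rw [Ne, ZMod.natCast_eq_zero_iff]
      intro hd; exact h2 ((Nat.prime_dvd_prime_iff_eq hp Nat.prime_two).1 hd)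
    exact_mod_cast this
  obtain ⟨c, hc⟩ := ZMod.intCast_surjective ((1 + t) / 2)
  refine ⟨c, (ZMod.intCast_zmod_eq_zero_iff_dvd _ p).1 ?_⟩
  push_cast at ht ⊢
  rw [hc]; field_simp
  linear_combination -ht

lemma not_prime_natCast_of_split {p : ℕ} (hp : p.Prime)
    (h : p % 7 = 1 ∨ p % 7 = 2 ∨ p % 7 = 4) : ¬ Prime (p : QInt) := by
  intro hP
  obtain ⟨c, d, hd⟩ := exists_dvd_of_split hp h
  have hp1 := hp.one_lt
  have hdv : (p : QInt) ∣ (⟨c, -1⟩ : QInt) * ⟨c - 1, 1⟩ := by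
    refine ⟨(d : QInt), ?_⟩
    ext
    · simp [QuadraticAlgebra.re_mul]; linarith
    · simp [QuadraticAlgebra.im_mul]
  have key : ∀ a b : ℤ, b = 1 ∨ b = -1 → ¬ (p : QInt) ∣ (⟨a, b⟩ : QInt) := by
    rintro a b hb ⟨z, hz⟩
    have := congrArg QuadraticAlgebra.im hz
    simp [QuadraticAlgebra.im_mul] at this
    have hpd : (p : ℤ) ∣ 1 := by
      rcases hb with rfl | rfl
      · exact Dvd.intro _ this.symm
      · exact (Dvd.intro _ this.symm : (p : ℤ) ∣ -1).trans (by norm_num)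
    have : p ∣ 1 := mod_cast hpd
    exact hp1.ne' (Nat.dvd_one.1 this)
  rcases hP.dvd_or_dvd hdv with h | h
  · exact key _ _ (Or.inr rfl) h
  · exact key _ _ (Or.inl rfl) h

lemma lamR_pow_of_inert {p j : ℕ} (hp : p.Prime) (h : p % 7 = 3 ∨ p % 7 = 5 ∨ p % 7 = 6)
    (hj : 0 < j) : lamR ((p ^ j : ℕ) : QInt) = 2 * ln p := by
  rw [lamR_eq (prime_natCast_of_inert hp h) hj (by push_cast; rfl), QuadraticAlgebra.norm_natCast]
  push_cast
  rw [Real.log_pow]; norm_num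

lemma lamR_pow_of_split {p j : ℕ} (hp : p.Prime) (h : p % 7 = 1 ∨ p % 7 = 2 ∨ p % 7 = 4) :
    lamR ((p ^ j : ℕ) : QInt) = 0 := by
  by_contra hne
  have h7 : ¬ 7 ∣ p ^ j := by
    intro h7
    have := (Nat.prime_dvd_prime_iff_eq (by norm_num) hp).1 ((by norm_num : Nat.Prime 7).dvd_of_dvd_pow h7)
    omega
  obtain ⟨q, i, hq, hi, he, hQ⟩ := exists_prime_pow_of_lamR_ne_zero h7 hne
  have : p = q := by
    have hd : q ∣ p ^ j := he ▸ dvd_pow_self q hi.ne'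
    exact ((Nat.prime_dvd_prime_iff_eq hq hp).1 (hq.dvd_of_dvd_pow hd)).symm
  exact not_prime_natCast_of_split hp h (this ▸ hQ)

/-! ### The rational part of the Dirichlet series -/

lemma chiNegSeven_natCast (m : ℕ) : chiNegSeven (m : ZMod 7) = (legendreSym 7 m : ℂ) := by
  simp [chiNegSeven, legendreSym]

/-- The contribution of the prime `p` to `-A'(r, r)`, in terms of `w = 1 + 2 r`. -/
def diagTerm (p : ℕ) (w : ℂ) : ℂ := if p % 7 = 3 ∨ p % 7 = 5 ∨ p % 7 = 6 then
    2 * ln p * ((p : ℂ) ^ (-w)) ^ 2 / (1 - ((p : ℂ) ^ (-w)) ^ 2)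
  else if p % 7 = 0 then ln p * (p : ℂ) ^ (-w) / (1 - (p : ℂ) ^ (-w)) else 0

lemma summable_lamR_natCast {s : ℂ} (hs : 1 < s.re) : Summable fun m : ℕ =>
    (lamR (m : QInt) : ℂ) * ((legendreSym 7 m : ℂ) * ((m : ℂ) ^ (2 * s))⁻¹) := by
  have hinj : Injective (fun m : ℕ => (m : QInt)) := by
    intro a b h
    have := congrArg QuadraticAlgebra.re h
    simpa using this
  refine ((summable_norm_lamR_hterm one_ne_zero hs).of_norm.comp_injective hinj).congr fun m => ?_
  have := hterm_int odd_one s (m : ℤ)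
  simp only [Function.comp]
  rw [Int.cast_natCast] at this; rw [this]; simp

lemma natCast_pow_cpow (p k : ℕ) (w : ℂ) : (((p ^ k : ℕ) : ℂ) ^ w)⁻¹ = ((p : ℂ) ^ (-w)) ^ k := by
  rw [cpow_neg, inv_pow]
  congr 1
  induction k with
  | zero => simp
  | succ k ih => rw [pow_succ, pow_succ, ← ih, Nat.cast_mul, natCast_mul_natCast_cpow]

lemma norm_prime_cpow_lt_one {p : ℕ} (hp : 2 ≤ p) {w : ℂ} (hw : 0 < w.re) :
    ‖(p : ℂ) ^ (-w)‖ < 1 := by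
  rw [norm_natCast_cpow_of_pos (by omega), neg_re]
  exact Real.rpow_lt_one_of_one_lt_of_neg (mod_cast (by omega : 1 < p)) (by linarith)

open ArithmeticFunction in
/-- The coefficients of the Dirichlet series of `-A'(r, r)`. -/
def diagCoeff (m : ℕ) : ℂ :=
  (vonMangoldt m : ℂ) - chiNegSeven m * (vonMangoldt m : ℂ) + (lamR (m : QInt) : ℂ) * legendreSym 7 m

lemma hasSum_geometric_shift {y : ℂ} (hy : ‖y‖ < 1) :
    HasSum (fun k : ℕ => y ^ (k + 1)) (y / (1 - y)) := by
  have := (hasSum_geometric_of_norm_lt_one hy).mul_left y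
  refine hasSum_of_eq (by simpa [div_eq_mul_inv] using this) fun k => ?_
  rw [pow_succ]; ring

lemma hasSum_diagTerm {p : ℕ} (hp : p.Prime) {w : ℂ} (hw : 0 < w.re) :
    HasSum (fun k : ℕ => diagCoeff (p ^ (k + 1)) * (((p ^ (k + 1) : ℕ) : ℂ) ^ w)⁻¹)
      (diagTerm p w) := by
  have hy := norm_prime_cpow_lt_one hp.two_le hw
  simp only [natCast_pow_cpow]
  have hΛ : ∀ k : ℕ, ArithmeticFunction.vonMangoldt (p ^ (k + 1)) = ln p := fun k => by
    rw [ArithmeticFunction.vonMangoldt_apply_pow k.succ_ne_zero,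
      ArithmeticFunction.vonMangoldt_apply_prime hp]
  have hχ : ∀ k : ℕ, chiNegSeven ((p ^ (k + 1) : ℕ) : ZMod 7) = (legendreSym 7 p : ℂ) ^ (k + 1) := by
    intro k; rw [Nat.cast_pow, map_pow, chiNegSeven_natCast]
  have hl : ∀ k : ℕ, (legendreSym 7 ((p ^ (k + 1) : ℕ) : ℤ) : ℂ) = (legendreSym 7 p : ℂ) ^ (k + 1) := by
    intro k; rw [← chiNegSeven_natCast, hχ]
  simp only [diagCoeff, hΛ, hχ, hl]; rw [diagTerm]
  generalize hyd : (p : ℂ) ^ (-w) = y at *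
  by_cases hi : p % 7 = 3 ∨ p % 7 = 5 ∨ p % 7 = 6
  · rw [if_pos hi]
    have hleg : legendreSym 7 p = -1 := by
      rw [legendreSym_seven, if_neg (by omega), if_neg (by omega)]
    have h1 := (hasSum_geometric_shift hy).mul_left (ln p : ℂ)
    have h2 := (hasSum_geometric_shift (y := -y) (by rwa [norm_neg])).mul_left (ln p : ℂ)
    have hne1 : 1 - y ≠ 0 := fun h => by
      rw [← sub_eq_zero.1 h, norm_one] at hy; exact lt_irrefl _ hy
    have hne2 : 1 + y ≠ 0 := fun h => by
      rw [← neg_eq_of_add_eq_zero_right h, norm_neg, norm_one] at hy; exact lt_irrefl _ hy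
    have e : 2 * (ln p : ℂ) * y ^ 2 / (1 - y ^ 2) =
        ln p * (y / (1 - y)) + ln p * (-y / (1 - -y)) := by
      rw [sub_neg_eq_add, show 1 - y ^ 2 = (1 - y) * (1 + y) by ring]
      field_simp; ring
    rw [e]
    refine hasSum_of_eq (h1.add h2) fun k => ?_
    rw [lamR_pow_of_inert hp hi k.succ_pos, hleg]; push_cast; rw [neg_pow y]; ring
  rw [if_neg hi]
  by_cases h7 : p % 7 = 0
  · rw [if_pos h7]
    have hleg : legendreSym 7 p = 0 := by rw [legendreSym_seven, if_pos (by omega)]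
    refine hasSum_of_eq (by
      simpa [mul_div_assoc] using (hasSum_geometric_shift hy).mul_left (ln p : ℂ)) fun k => ?_
    rw [hleg]; simp
  · rw [if_neg h7]
    have hs : p % 7 = 1 ∨ p % 7 = 2 ∨ p % 7 = 4 := by omega
    have hleg : legendreSym 7 p = 1 := by
      rw [legendreSym_seven, if_neg (by omega), if_pos (by omega)]
    refine hasSum_of_eq hasSum_zero fun k => ?_
    rw [lamR_pow_of_split hp hs, hleg]; simp

lemma legendreSym_seven_eq_zero_of_dvd {m : ℕ} (h : 7 ∣ m) : legendreSym 7 m = 0 := by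
  rw [legendreSym_seven, if_pos (by omega)]

lemma hasSum_primes_diagTerm {w : ℂ} (hw : 2 < w.re) : HasSum (fun p : Primes => diagTerm p w)
      (-deriv riemannZeta w / riemannZeta w + deriv dirichletL w / dirichletL w +
        diagSeries (w / 2)) := by
  have hw1 : 1 < w.re := by linarith
  have h1 := (ArithmeticFunction.LSeriesSummable_vonMangoldt hw1).LSeriesHasSum
  rw [ArithmeticFunction.LSeries_vonMangoldt_eq_deriv_riemannZeta_div hw1] at h1
  have h2 := (DirichletCharacter.LSeriesSummable_twist_vonMangoldt chiNegSeven hw1).LSeriesHasSum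
  rw [DirichletCharacter.LSeries_twist_vonMangoldt_eq _ hw1,
    ← DirichletCharacter.deriv_LFunction_eq_deriv_LSeries _ hw1,
    ← LFunction_eq_LSeries _ hw1] at h2
  have h3 := (summable_lamR_natCast (s := w / 2) (by
    rw [show (w / 2 : ℂ) = w / ((2 : ℝ) : ℂ) by norm_num, div_ofReal_re]; linarith)).hasSum
  rw [show 2 * (w / 2) = w by ring] at h3
  have hF : HasSum (fun m : ℕ => diagCoeff m * ((m : ℂ) ^ w)⁻¹)
      (-deriv riemannZeta w / riemannZeta w + deriv dirichletL w / dirichletL w +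
        diagSeries (w / 2)) := by
    have h := HasSum.add (HasSum.sub h1 h2) h3
    have e : -deriv riemannZeta w / riemannZeta w + deriv dirichletL w / dirichletL w +
        diagSeries (w / 2) = -deriv riemannZeta w / riemannZeta w -
        -deriv (LFunction chiNegSeven) w / LFunction chiNegSeven w +
        ∑' m : ℕ, (lamR (m : QInt) : ℂ) * ((legendreSym 7 m : ℂ) * ((m : ℂ) ^ w)⁻¹) := by
      have e0 : dirichletL = LFunction chiNegSeven := rfl
      rw [diagSeries, show 2 * (w / 2) = w by ring, e0, neg_div (LFunction _ _), sub_neg_eq_add]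
    rw [e]
    refine hasSum_of_eq h fun m => ?_
    rcases Nat.eq_zero_or_pos m with rfl | hm
    · simp [diagCoeff]
    · rw [LSeries.term_of_ne_zero hm.ne', LSeries.term_of_ne_zero hm.ne', diagCoeff, Pi.mul_apply,
        div_eq_mul_inv, div_eq_mul_inv]
      ring
  set φ : Primes × ℕ → ℕ := fun x => (x.1 : ℕ) ^ (x.2 + 1) with hφ
  have hval : ∀ x, φ x = (Primes.prodNatEquiv x : ℕ) := fun x => by
    obtain ⟨p, k⟩ := x
    rw [Primes.coe_prodNatEquiv_apply]
  have hinj : Injective φ := by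
    intro x y h
    rw [hval, hval] at h; exact Primes.prodNatEquiv.injective (Subtype.ext h)
  have hsupp : ∀ m ∉ Set.range φ, diagCoeff m * ((m : ℂ) ^ w)⁻¹ = 0 := by
    intro m hm
    have hnp : ¬ IsPrimePow m := by
      intro hp
      apply hm
      refine ⟨Primes.prodNatEquiv.symm ⟨m, hp⟩, ?_⟩
      rw [hval, Equiv.apply_symm_apply]
    have hΛ : ArithmeticFunction.vonMangoldt m = 0 :=
      ArithmeticFunction.vonMangoldt_eq_zero_iff.2 hnp
    have hl : (lamR (m : QInt) : ℂ) * legendreSym 7 m = 0 := by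
      by_cases h7 : 7 ∣ m
      · rw [legendreSym_seven_eq_zero_of_dvd h7]; simp
      · by_cases h0 : lamR (m : QInt) = 0
        · rw [h0]; simp
        · obtain ⟨p, j, hp, hj, he, -⟩ := exists_prime_pow_of_lamR_ne_zero h7 h0
          exact absurd ((isPrimePow_nat_iff m).2 ⟨p, j, hp, hj, he.symm⟩) hnp
    rw [diagCoeff, hΛ, hl]; simp
  have hprod := (hinj.hasSum_iff hsupp).2 hF
  exact hprod.prod_fiberwise fun p => hasSum_diagTerm p.2 (by linarith)

/-! ### The arithmetic factor -/

/-- `E` such that the local factor of `A(α, γ)` is `1 + E`, for `u = α + γ` and `v = 2 γ`. -/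
def localError (p : ℕ) (u v : ℂ) : ℂ := if p % 7 = 3 ∨ p % 7 = 5 ∨ p % 7 = 6 then
    (((p : ℂ) ^ (-(1 + u))) ^ 2 - ((p : ℂ) ^ (-(1 + v))) ^ 2) / (1 - ((p : ℂ) ^ (-(1 + u))) ^ 2)
  else if p % 7 = 0 then
    ((p : ℂ) ^ (-(1 + u)) - (p : ℂ) ^ (-(1 + v))) / (1 - (p : ℂ) ^ (-(1 + u)))
  else -(((p : ℂ) ^ (-(1 + u)) - (p : ℂ) ^ (-(1 + v))) / (1 - (p : ℂ) ^ (-(1 + u)))) ^ 2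

/-- The arithmetic factor in terms of `u = α + γ` and `v = 2 γ`. -/
def arithB (u v : ℂ) : ℂ := ∏' p : Primes, (1 + localError p u v)

lemma one_sub_ne_zero_of_norm_lt {x : ℂ} (hx : ‖x‖ < 1) : 1 - x ≠ 0 := fun h => by
  rw [← sub_eq_zero.1 h, norm_one] at hx; exact lt_irrefl _ hx

lemma one_sub_sq_ne_zero_of_norm_lt {x : ℂ} (hx : ‖x‖ < 1) : 1 - x ^ 2 ≠ 0 := by
  apply one_sub_ne_zero_of_norm_lt
  rw [norm_pow]; exact pow_lt_one₀ (norm_nonneg _) hx two_ne_zero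

lemma arithLocal_eq {p : ℕ} (hp : p.Prime) {α γ : ℂ} (hα : -(1 / 2) < α.re)
    (hαγ : -1 < (α + γ).re) : arithLocal p α γ = 1 + localError p (α + γ) (2 * γ) := by
  have hx := norm_prime_cpow_lt_one hp.two_le (w := 1 + α + γ) (by
    rw [add_re] at hαγ; rw [add_re, add_re, one_re]; linarith)
  have hy := norm_prime_cpow_lt_one hp.two_le (w := 1 + 2 * α) (by simp; linarith)
  have hpow : ∀ m : ℕ, (p : ℂ) ^ (-((1 + 2 * α) * m)) = ((p : ℂ) ^ (-(1 + 2 * α))) ^ m := by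
    intro m
    rw [← cpow_nat_mul]; congr 1; ring
  rw [arithLocal, localError]
  simp only [hpow]; rw [← add_assoc 1 α γ]
  generalize (p : ℂ) ^ (-(1 + α + γ)) = x at *
  generalize (p : ℂ) ^ (-(1 + 2 * α)) = y at *
  generalize (p : ℂ) ^ (-(1 + 2 * γ)) = q at *
  have h1 := one_sub_ne_zero_of_norm_lt hx
  have h2 := one_sub_ne_zero_of_norm_lt hy
  have h1' : 1 + x ≠ 0 := by
    have := one_sub_ne_zero_of_norm_lt (x := -x) (by rwa [norm_neg]); rwa [sub_neg_eq_add] at this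
  have h2' : 1 + y ≠ 0 := by
    have := one_sub_ne_zero_of_norm_lt (x := -y) (by rwa [norm_neg]); rwa [sub_neg_eq_add] at this
  by_cases hs : p % 7 = 1 ∨ p % 7 = 2 ∨ p % 7 = 4
  · rw [if_pos hs, if_neg (by omega), if_neg (by omega), tsum_geometric_of_norm_lt_one hy]
    field_simp; ring
  rw [if_neg hs]
  by_cases hi : p % 7 = 3 ∨ p % 7 = 5 ∨ p % 7 = 6
  · rw [if_pos hi, if_pos hi]
    have : ∀ m : ℕ, (-1 : ℂ) ^ m * y ^ m = (-y) ^ m := fun m => by rw [← mul_pow]; simp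
    simp only [this]
    rw [tsum_geometric_of_norm_lt_one (by rwa [norm_neg]), sub_neg_eq_add,
      show 1 - x ^ 2 = (1 - x) * (1 + x) by ring]
    field_simp; ring
  · rw [if_neg hi, if_neg hi, if_pos (by omega)]
    field_simp; ring

lemma arithA_eq_arithB {α γ : ℂ} (hα : -(1 / 2) < α.re) (hαγ : -1 < (α + γ).re) :
    arithA α γ = arithB (α + γ) (2 * γ) :=
  tprod_congr fun p => arithLocal_eq p.2 hα hαγ

lemma norm_prime_cpow_le {p : ℕ} (hp : 0 < p) {u : ℂ} {σ : ℝ} (hu : σ ≤ u.re) :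
    ‖(p : ℂ) ^ (-u)‖ ≤ (p : ℝ) ^ (-σ) := by
  rw [norm_natCast_cpow_of_pos hp, neg_re]
  exact rpow_le_rpow_of_exponent_le (mod_cast hp) (by linarith)

lemma rpow_neg_seven_eighths_le {p : ℕ} (hp : 2 ≤ p) : (p : ℝ) ^ (-(7 / 8) : ℝ) ≤ 11 / 20 := by
  have h1 : (p : ℝ) ^ (-(7 / 8) : ℝ) ≤ (2 : ℝ) ^ (-(7 / 8) : ℝ) :=
    rpow_le_rpow_of_nonpos (by norm_num) (mod_cast hp) (by norm_num)
  refine h1.trans ?_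
  refine le_of_pow_le_pow_left₀ (n := 8) (by norm_num) (by norm_num) ?_
  rw [← rpow_natCast, ← rpow_mul (by norm_num),
    show (-(7 / 8) : ℝ) * (8 : ℕ) = ((-7 : ℤ) : ℝ) by norm_num, Real.rpow_intCast]
  norm_num

lemma norm_one_sub_ge {x : ℂ} (hx : ‖x‖ ≤ 11 / 20) : 9 / 20 ≤ ‖1 - x‖ := by
  have := norm_sub_norm_le (1 : ℂ) x
  rw [norm_one] at this; linarith

lemma norm_one_sub_sq_ge {x : ℂ} (hx : ‖x‖ ≤ 11 / 20) : 9 / 20 ≤ ‖1 - x ^ 2‖ := by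
  apply norm_one_sub_ge
  rw [norm_pow]; nlinarith [norm_nonneg x]

lemma norm_localError_le {p : ℕ} (hp : p.Prime) {u v : ℂ} (hu : -(1 / 8) ≤ u.re)
    (hv : -(1 / 8) ≤ v.re) : ‖localError p u v‖ ≤ 50 * (p : ℝ) ^ (-(7 / 4) : ℝ) := by
  have hx := norm_prime_cpow_le hp.pos (u := 1 + u) (σ := 7 / 8) (by simp; linarith)
  have hq := norm_prime_cpow_le hp.pos (u := 1 + v) (σ := 7 / 8) (by simp; linarith)
  have h0 := rpow_neg_seven_eighths_le hp.two_le
  have hr0 : 0 < (p : ℝ) ^ (-(7 / 8) : ℝ) := by have := hp.pos; positivity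
  have e : (p : ℝ) ^ (-(7 / 4) : ℝ) = ((p : ℝ) ^ (-(7 / 8) : ℝ)) ^ 2 := by
    rw [← rpow_natCast, ← rpow_mul (by positivity)]; norm_num
  have h7r : p = 7 → 1 / 7 ≤ (p : ℝ) ^ (-(7 / 8) : ℝ) := by
    rintro rfl
    rw [show (1 / 7 : ℝ) = ((7 : ℕ) : ℝ) ^ (-1 : ℝ) by rw [Real.rpow_neg_one]; norm_num]
    exact rpow_le_rpow_of_exponent_le (by norm_num) (by norm_num)
  rw [localError, e]
  generalize (p : ℂ) ^ (-(1 + u)) = x at *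
  generalize (p : ℂ) ^ (-(1 + v)) = q at *
  generalize (p : ℝ) ^ (-(7 / 8) : ℝ) = r at *
  have hA := norm_one_sub_ge (hx.trans h0)
  have hB := norm_one_sub_sq_ge (hx.trans h0)
  have hxq : ‖x - q‖ ≤ 2 * r := (norm_sub_le _ _).trans (by linarith)
  have hdiv : ‖(x - q) / (1 - x)‖ ≤ 40 / 9 * r := by
    rw [norm_div, div_le_iff₀ (by linarith)]; nlinarith
  split_ifs with h1 h2
  · rw [norm_div, div_le_iff₀ (by linarith)]
    have : ‖x ^ 2 - q ^ 2‖ ≤ 2 * r ^ 2 := by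
      refine (norm_sub_le _ _).trans ?_
      rw [norm_pow, norm_pow]
      nlinarith [norm_nonneg x, norm_nonneg q]
    nlinarith [sq_nonneg r]
  · have hp7 : p = 7 := ((Nat.prime_dvd_prime_iff_eq (by norm_num) hp).1
      (Nat.dvd_of_mod_eq_zero h2)).symm
    have := h7r hp7
    nlinarith
  · rw [norm_neg, norm_pow]
    nlinarith [norm_nonneg ((x - q) / (1 - x))]

lemma summable_primes_rpow {r : ℝ} (hr : r < -1) : Summable fun p : Primes => ((p : ℕ) : ℝ) ^ r :=
  Primes.summable_rpow.2 hr

lemma localError_self (p : ℕ) (u : ℂ) : localError p u u = 0 := by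
  rw [localError]; split_ifs <;> simp

lemma arithB_self (u : ℂ) : arithB u u = 1 := by simp [arithB, localError_self]

lemma summable_localError_bound : Summable fun p : Primes => 50 * ((p : ℕ) : ℝ) ^ (-(7 / 4) : ℝ) :=
  (summable_primes_rpow (by norm_num)).mul_left _

lemma summable_norm_localError {u v : ℂ} (hu : -(1 / 8) ≤ u.re) (hv : -(1 / 8) ≤ v.re) :
    Summable fun p : Primes => ‖localError p u v‖ :=
  of_nonneg_of_le (fun _ => norm_nonneg _) (fun p => norm_localError_le p.2 hu hv)
    summable_localError_bound

lemma norm_arithB_le : ∃ C : ℝ, ∀ u v : ℂ, -(1 / 8) ≤ u.re → -(1 / 8) ≤ v.re →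
    ‖arithB u v‖ ≤ C := by
  refine ⟨Real.exp (∑' p : Primes, 50 * ((p : ℕ) : ℝ) ^ (-(7 / 4) : ℝ)), fun u v hu hv => ?_⟩
  have hm : Multipliable fun p : Primes => 1 + localError p u v :=
    multipliable_one_add_of_summable (summable_norm_localError hu hv)
  refine le_of_tendsto hm.hasProd.norm (Eventually.of_forall fun s => ?_)
  calc ∏ p ∈ s, ‖1 + localError p u v‖ ≤
      ∏ p ∈ s, Real.exp (50 * ((p : ℕ) : ℝ) ^ (-(7 / 4) : ℝ)) := by
        refine Finset.prod_le_prod (fun _ _ => norm_nonneg _) fun p _ => ?_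
        refine (norm_add_le _ _).trans ?_
        rw [norm_one, add_comm]
        exact (add_le_add_left (norm_localError_le p.2 hu hv) 1).trans (Real.add_one_le_exp _)
    _ = Real.exp (∑ p ∈ s, 50 * ((p : ℕ) : ℝ) ^ (-(7 / 4) : ℝ)) := (Real.exp_sum _ _).symm
    _ ≤ _ := exp_le_exp.2 (summable_localError_bound.sum_le_tsum s
        (fun p _ => by positivity))

lemma differentiableOn_localError {p : ℕ} (hp : p.Prime) {S : Set ℂ} {u v : ℂ → ℂ}
    (hu : DifferentiableOn ℂ u S) (hv : DifferentiableOn ℂ v S)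
    (hu' : ∀ z ∈ S, -(1 / 8) ≤ (u z).re) :
    DifferentiableOn ℂ (fun z => localError p (u z) (v z)) S := by
  have hp0 : (p : ℂ) ≠ 0 := mod_cast hp.ne_zero
  have hX : DifferentiableOn ℂ (fun z => (p : ℂ) ^ (-(1 + u z))) S :=
    DifferentiableOn.const_cpow (hu.const_add 1).neg (Or.inl hp0)
  have hQ : DifferentiableOn ℂ (fun z => (p : ℂ) ^ (-(1 + v z))) S :=
    DifferentiableOn.const_cpow (hv.const_add 1).neg (Or.inl hp0)
  have hlt : ∀ z ∈ S, ‖(p : ℂ) ^ (-(1 + u z))‖ < 1 := fun z hz =>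
    norm_prime_cpow_lt_one hp.two_le (by have := hu' z hz; simp; linarith)
  unfold localError
  split_ifs
  · exact ((hX.pow 2).sub (hQ.pow 2)).div ((differentiableOn_const 1).sub (hX.pow 2))
      fun z hz => one_sub_sq_ne_zero_of_norm_lt (hlt z hz)
  · exact (hX.sub hQ).div ((differentiableOn_const 1).sub hX)
      fun z hz => one_sub_ne_zero_of_norm_lt (hlt z hz)
  · exact (((hX.sub hQ).div ((differentiableOn_const 1).sub hX)
      fun z hz => one_sub_ne_zero_of_norm_lt (hlt z hz)).pow 2).neg

lemma hasProdLocallyUniformlyOn_arithB {S : Set ℂ} (hS : IsOpen S) {u v : ℂ → ℂ}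
    (hu : DifferentiableOn ℂ u S) (hv : DifferentiableOn ℂ v S)
    (hu' : ∀ z ∈ S, -(1 / 8) ≤ (u z).re) (hv' : ∀ z ∈ S, -(1 / 8) ≤ (v z).re) :
    HasProdLocallyUniformlyOn (fun (p : Primes) z => 1 + localError p (u z) (v z))
      (fun z => arithB (u z) (v z)) S :=
  summable_localError_bound.hasProdLocallyUniformlyOn_one_add hS
    (Eventually.of_forall fun p z hz => norm_localError_le p.2 (hu' z hz) (hv' z hz))
    fun p => (differentiableOn_localError p.2 hu hv hu').continuousOn

lemma differentiableOn_arithB {S : Set ℂ} (hS : IsOpen S) {u v : ℂ → ℂ}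
    (hu : DifferentiableOn ℂ u S) (hv : DifferentiableOn ℂ v S)
    (hu' : ∀ z ∈ S, -(1 / 8) ≤ (u z).re) (hv' : ∀ z ∈ S, -(1 / 8) ≤ (v z).re) :
    DifferentiableOn ℂ (fun z => arithB (u z) (v z)) S := by
  have h := hasProdLocallyUniformlyOn_arithB hS hu hv hu' hv'
  refine TendstoLocallyUniformlyOn.differentiableOn h ?_ hS
  refine Eventually.of_forall fun s => DifferentiableOn.fun_finsetProd fun p _ => ?_
  exact (differentiableOn_localError p.2 hu hv hu').const_add 1

lemma norm_diagTerm_le {p : ℕ} (hp : p.Prime) {w : ℂ} (hw : 7 / 8 ≤ w.re) :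
    ‖diagTerm p w‖ ≤ 400 * (p : ℝ) ^ (-(3 / 2) : ℝ) := by
  have hx := norm_prime_cpow_le hp.pos hw
  have h0 := rpow_neg_seven_eighths_le hp.two_le
  have hp1 : (1 : ℝ) ≤ p := mod_cast hp.one_lt.le
  have hr0 : 0 < (p : ℝ) ^ (-(7 / 8) : ℝ) := by positivity
  have hlog0 : 0 ≤ ln p := log_nonneg hp1
  have hlog : ln p ≤ 4 * (p : ℝ) ^ (1 / 4 : ℝ) := by
    have := log_le_rpow_div (x := p) (by positivity) (ε := 1 / 4) (by norm_num)
    linarith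
  have e : (p : ℝ) ^ (-(3 / 2) : ℝ) = (p : ℝ) ^ (1 / 4 : ℝ) * ((p : ℝ) ^ (-(7 / 8) : ℝ)) ^ 2 := by
    rw [← rpow_natCast, ← rpow_mul (by positivity), ← rpow_add (by linarith)]; norm_num
  have h7r : p = 7 → 1 / 7 ≤ (p : ℝ) ^ (-(7 / 8) : ℝ) := by
    rintro rfl
    rw [show (1 / 7 : ℝ) = ((7 : ℕ) : ℝ) ^ (-1 : ℝ) by rw [Real.rpow_neg_one]; norm_num]
    exact rpow_le_rpow_of_exponent_le (by norm_num) (by norm_num)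
  have hl0 : 0 < (p : ℝ) ^ (1 / 4 : ℝ) := by positivity
  rw [diagTerm, e]
  generalize (p : ℂ) ^ (-w) = x at *
  generalize (p : ℝ) ^ (-(7 / 8) : ℝ) = r at *
  generalize (p : ℝ) ^ (1 / 4 : ℝ) = l at *
  generalize ln p = L at *
  have hA := norm_one_sub_ge (hx.trans h0)
  have hB := norm_one_sub_sq_ge (hx.trans h0)
  split_ifs with h1 h2
  · rw [norm_div, div_le_iff₀ (by linarith), norm_mul, norm_mul, norm_pow, norm_real,
      Real.norm_of_nonneg hlog0, show ‖(2 : ℂ)‖ = 2 by simp]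
    have h2 : ‖x‖ ^ 2 ≤ r ^ 2 := pow_le_pow_left₀ (norm_nonneg _) hx 2
    have h3 : 2 * L * ‖x‖ ^ 2 ≤ 8 * l * r ^ 2 :=
      mul_le_mul (by linarith) h2 (by positivity) (by positivity)
    have h4 : 0 ≤ l * r ^ 2 := by positivity
    nlinarith
  · have hp7 : p = 7 := ((Nat.prime_dvd_prime_iff_eq (by norm_num) hp).1
      (Nat.dvd_of_mod_eq_zero h2)).symm
    have h7 := h7r hp7
    rw [norm_div, div_le_iff₀ (by linarith), norm_mul, norm_real, Real.norm_of_nonneg hlog0]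
    have h3 : L * ‖x‖ ≤ 4 * l * r := mul_le_mul hlog hx (by positivity) (by positivity)
    have h4 : 4 * l * r ≤ 28 * (l * r ^ 2) := by
      have : 0 ≤ l * r := by positivity
      nlinarith
    have h5 : 0 ≤ l * r ^ 2 := by positivity
    nlinarith
  · rw [norm_zero]; positivity

lemma summable_diagTerm_bound : Summable fun p : Primes => 400 * ((p : ℕ) : ℝ) ^ (-(3 / 2) : ℝ) :=
  (summable_primes_rpow (by norm_num)).mul_left _

lemma differentiableOn_diagTerm {p : ℕ} (hp : p.Prime) :
    DifferentiableOn ℂ (fun w => diagTerm p w) {w : ℂ | 0 < w.re} := by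
  have hp0 : (p : ℂ) ≠ 0 := mod_cast hp.ne_zero
  have hX : DifferentiableOn ℂ (fun w : ℂ => (p : ℂ) ^ (-w)) {w : ℂ | 0 < w.re} :=
    DifferentiableOn.const_cpow differentiableOn_id.neg (Or.inl hp0)
  have hlt : ∀ z ∈ {w : ℂ | 0 < w.re}, ‖(p : ℂ) ^ (-z)‖ < 1 := fun z hz =>
    norm_prime_cpow_lt_one hp.two_le hz
  unfold diagTerm
  split_ifs
  · exact ((hX.pow 2).const_mul _).div ((differentiableOn_const 1).sub (hX.pow 2))
      fun z hz => one_sub_sq_ne_zero_of_norm_lt (hlt z hz)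
  · exact (hX.const_mul _).div ((differentiableOn_const 1).sub hX)
      fun z hz => one_sub_ne_zero_of_norm_lt (hlt z hz)
  · exact differentiableOn_const 0

lemma hasDerivAt_localError {p : ℕ} (hp : p.Prime) {r : ℂ} (hr : -(1 / 16) < r.re) :
    HasDerivAt (fun α => localError p (α + r) (2 * r)) (-diagTerm p (1 + 2 * r)) r := by
  have hp0 : (p : ℂ) ≠ 0 := mod_cast hp.ne_zero
  have hx := norm_prime_cpow_lt_one hp.two_le (w := 1 + 2 * r) (by simp; linarith)
  have hX : HasDerivAt (fun α : ℂ => (p : ℂ) ^ (-(1 + (α + r))))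
      ((p : ℂ) ^ (-(1 + 2 * r)) * Complex.log p * (-1)) r := by
    have h1 : HasDerivAt (fun α : ℂ => -(1 + (α + r))) (-1) r :=
      (((hasDerivAt_id r).add_const r).const_add 1).neg
    have := h1.const_cpow (c := (p : ℂ)) (Or.inl hp0)
    rwa [show r + r = 2 * r by ring] at this
  have hlog : Complex.log p = (ln p : ℂ) := by simp
  have hQ := hasDerivAt_const r ((p : ℂ) ^ (-(1 + 2 * r)))
  have hval : (p : ℂ) ^ (-(1 + (r + r))) = (p : ℂ) ^ (-(1 + 2 * r)) := by ring_nf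
  have h1 := one_sub_ne_zero_of_norm_lt hx
  have h2 := one_sub_sq_ne_zero_of_norm_lt hx
  rw [hlog] at hX
  unfold localError diagTerm
  generalize (p : ℂ) ^ (-(1 + 2 * r)) = x at *
  split_ifs
  · have := ((hX.pow 2).sub (hQ.pow 2)).div ((hX.pow 2).const_sub 1) (by
      simp only [Pi.pow_apply, hval]; exact h2)
    refine this.congr_deriv ?_
    simp only [Pi.pow_apply, Pi.sub_apply, hval]
    field_simp; ring
  · have := (hX.sub hQ).div (hX.const_sub 1) (by rw [hval]; exact h1)
    refine this.congr_deriv ?_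
    simp only [Pi.sub_apply, hval]
    field_simp; ring
  · have := (((hX.sub hQ).div (hX.const_sub 1) (by rw [hval]; exact h1)).pow 2).neg
    refine this.congr_deriv ?_
    simp only [Pi.div_apply, Pi.sub_apply, hval, sub_self, zero_div]; simp

lemma arithADiag_eq {r : ℂ} (hr : -(1 / 16) < r.re) :
    arithADiag r = -∑' p : Primes, diagTerm p (1 + 2 * r) := by
  set S : Set ℂ := {α | -(1 / 8) - r.re < α.re} with hSdef
  have hS : IsOpen S := isOpen_lt continuous_const continuous_re
  have hrS : r ∈ S := by simp only [hSdef, mem_ofPred_eq]; linarith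
  have hu : DifferentiableOn ℂ (fun α => α + r) S := by fun_prop
  have hv : DifferentiableOn ℂ (fun _ : ℂ => 2 * r) S := by fun_prop
  have hu' : ∀ z ∈ S, -(1 / 8) ≤ (z + r).re := fun z hz => by
    simp only [hSdef, mem_ofPred_eq] at hz; rw [add_re]; linarith
  have hv' : ∀ z ∈ S, -(1 / 8) ≤ (2 * r).re := fun z hz => by simp; linarith
  have hloc : (fun α => arithA α r) =ᶠ[nhds r] fun α => arithB (α + r) (2 * r) := by
    have hT : IsOpen {α : ℂ | max (-(1 / 2)) (-1 - r.re) < α.re} :=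
      isOpen_lt continuous_const continuous_re
    filter_upwards [hT.mem_nhds (show max (-(1 / 2)) (-1 - r.re) < r.re from
      max_lt (by linarith) (by linarith))] with α hα
    have := max_lt_iff.1 hα
    exact arithA_eq_arithB this.1 (by rw [add_re]; linarith [this.2])
  have h1 : ∀ p : Primes, 1 + localError p (r + r) (2 * r) = 1 := fun p => by
    rw [show r + r = 2 * r by ring, localError_self, add_zero]
  have hd : ∀ p : Primes, logDeriv (fun α => 1 + localError p (α + r) (2 * r)) r =
      -diagTerm p (1 + 2 * r) := fun p => by
    rw [logDeriv_apply, h1, div_one]; exact ((hasDerivAt_localError p.2 hr).const_add 1).deriv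
  have hB1 : arithB (r + r) (2 * r) = 1 := by rw [show r + r = 2 * r by ring, arithB_self]
  have key := logDeriv_tprod_eq_tsum (ι := Primes) hS hrS
    (f := fun p α => 1 + localError p (α + r) (2 * r)) (fun p => by rw [h1]; exact one_ne_zero)
    (fun p => (differentiableOn_localError p.2 hu hv hu').const_add 1)
    (by
      simp only [hd]
      refine Summable.neg (of_norm_bounded summable_diagTerm_bound fun p => ?_)
      exact norm_diagTerm_le p.2 (by simp; linarith))
    (hasProdLocallyUniformlyOn_arithB hS hu hv hu' hv').multipliableLocallyUniformlyOn
    (by change arithB (r + r) (2 * r) ≠ 0; rw [hB1]; exact one_ne_zero)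
  simp only [hd, tsum_neg] at key; rw [arithADiag, hloc.deriv_eq, ← key]
  change _ = logDeriv (fun α => arithB (α + r) (2 * r)) r
  rw [logDeriv_apply, hB1, div_one]

lemma norm_arithADiag_le : ∃ C : ℝ, ∀ r : ℂ, -(1 / 16) < r.re → ‖arithADiag r‖ ≤ C := by
  refine ⟨∑' p : Primes, 400 * ((p : ℕ) : ℝ) ^ (-(3 / 2) : ℝ), fun r hr => ?_⟩
  rw [arithADiag_eq hr, norm_neg]
  exact tsum_of_norm_bounded summable_diagTerm_bound.hasSum
    fun p => norm_diagTerm_le p.2 (by simp; linarith)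

lemma differentiableOn_arithADiag : DifferentiableOn ℂ arithADiag {r : ℂ | -(1 / 16) < r.re} := by
  have hS : IsOpen {r : ℂ | -(1 / 16) < r.re} := isOpen_lt continuous_const continuous_re
  have h : DifferentiableOn ℂ (fun r => ∑' p : Primes, diagTerm p (1 + 2 * r))
      {r : ℂ | -(1 / 16) < r.re} := by
    refine differentiableOn_tsum_of_summable_norm summable_diagTerm_bound (fun p => ?_) hS
      fun p r hr => norm_diagTerm_le p.2 (by simp only [mem_ofPred_eq] at hr; simp; linarith)
    refine (differentiableOn_diagTerm p.2).comp (by fun_prop) fun r hr => ?_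
    simp only [mem_ofPred_eq] at hr ⊢
    simp; linarith
  exact h.neg.congr fun r hr => arithADiag_eq hr

lemma neg_diagSeries_eq {α : ℂ} (hα : 1 / 2 < α.re) : -diagSeries (1 / 2 + α) =
    -(deriv riemannZeta (1 + 2 * α) / riemannZeta (1 + 2 * α)) +
      deriv dirichletL (1 + 2 * α) / dirichletL (1 + 2 * α) + arithADiag α := by
  have h := (hasSum_primes_diagTerm (w := 1 + 2 * α) (by simp; linarith)).tsum_eq
  rw [arithADiag_eq (by linarith), h, show (1 + 2 * α) / 2 = 1 / 2 + α by ring]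
  ring

/-! ### Bounds for Dirichlet `L`-functions near the line `re s = 1` -/

/-- The difference between `b ^ (-s)` and the mean of `x ^ (-s)` over `[b, b + h]`. -/
def meanDefect (b h : ℝ) (s : ℂ) : ℂ :=
  (b : ℂ) ^ (-s) - ((b : ℂ) ^ (1 - s) - ((b + h : ℝ) : ℂ) ^ (1 - s)) / (h * (s - 1))

lemma norm_meanDefect_le_of_deriv {b h : ℝ} (hb : 0 < b) (hh : 0 < h) {s : ℂ} (hs : s ≠ 1) {C : ℝ}
    (hC : ∀ x ∈ Set.Ico b (b + h), ‖(b : ℂ) ^ (-s) - (x : ℂ) ^ (-s)‖ ≤ C) :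
    ‖meanDefect b h s‖ ≤ C := by
  have hs1 : s - 1 ≠ 0 := sub_ne_zero.2 hs
  have hs2 : -s + 1 ≠ 0 := by intro h0; apply hs1; linear_combination -h0
  have hhC : (h : ℂ) ≠ 0 := ofReal_ne_zero.2 hh.ne'
  set φ : ℝ → ℂ := fun x => (x : ℂ) * (b : ℂ) ^ (-s) - (x : ℂ) ^ (-s + 1) / (-s + 1) with hφ
  have hd : ∀ x : ℝ, 0 < x → HasDerivAt φ ((b : ℂ) ^ (-s) - (x : ℂ) ^ (-s)) x := by
    intro x hx
    have h1 : HasDerivAt (fun x : ℝ => (x : ℂ) * (b : ℂ) ^ (-s)) (1 * (b : ℂ) ^ (-s)) x :=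
      (hasDerivAt_id x).ofReal_comp.mul_const _
    have h2 := hasDerivAt_ofReal_cpow_const' (x := x) hx.ne' (r := -s) (by
      intro h0; apply hs; linear_combination -h0)
    have := h1.sub h2
    rwa [one_mul] at this
  have hmv := norm_image_sub_le_of_norm_deriv_le_segment' (f := φ) (a := b) (b := b + h) (C := C)
    (fun x hx => (hd x (hb.trans_le hx.1)).hasDerivWithinAt) hC (b + h)
    (Set.right_mem_Icc.2 (by linarith))
  have e : φ (b + h) - φ b = h * meanDefect b h s := by
    simp only [hφ, meanDefect]
    rw [show -s + 1 = -(s - 1) by ring, show -(s - 1) = 1 - s by ring]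
    have hs3 : 1 - s ≠ 0 := by rwa [show 1 - s = -s + 1 by ring]
    push_cast
    generalize ((b : ℂ) + h) ^ (1 - s) = u
    generalize (b : ℂ) ^ (1 - s) = v
    generalize (b : ℂ) ^ (-s) = w
    rw [show (s - 1) = -(1 - s) by ring]
    field_simp; ring
  rw [e, norm_mul, norm_real, Real.norm_of_nonneg hh.le, add_sub_cancel_left, mul_comm] at hmv
  exact le_of_mul_le_mul_right hmv hh

lemma norm_meanDefect_le {b h : ℝ} (hb : 1 ≤ b) (hh : 1 ≤ h) {s : ℂ} (hs : s ≠ 1)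
    {σ₀ lam : ℝ} (hσ₀ : 0 ≤ σ₀) (hσ : σ₀ ≤ s.re) (hl0 : 0 < lam) (hl1 : lam ≤ 1) :
    ‖meanDefect b h s‖ ≤ 2 * h * ‖s‖ ^ lam * b ^ (-(σ₀ + lam)) := by
  have hb0 : 0 < b := by linarith
  have hσ0 : 0 ≤ s.re := hσ₀.trans hσ
  have hmono : ∀ x : ℝ, b ≤ x → ‖(x : ℂ) ^ (-s)‖ ≤ b ^ (-s.re) := by
    intro x hx; rw [norm_cpow_eq_rpow_re_of_pos (by linarith), neg_re]
    exact rpow_le_rpow_of_nonpos hb0 hx (by linarith)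
  have hA : ‖meanDefect b h s‖ ≤ 2 * b ^ (-s.re) := by
    refine norm_meanDefect_le_of_deriv hb0 (by linarith) hs fun x hx => ?_
    refine (norm_sub_le _ _).trans ?_
    linarith [hmono b le_rfl, hmono x hx.1]
  have hB : ‖meanDefect b h s‖ ≤ ‖s‖ * b ^ (-s.re - 1) * h := by
    refine norm_meanDefect_le_of_deriv hb0 (by linarith) hs fun x hx => ?_
    by_cases h0 : s = 0
    · simp [h0]
    have h1 := norm_image_sub_le_of_norm_deriv_le_segment' (f := fun y : ℝ => (y : ℂ) ^ (-s))
      (f' := fun y : ℝ => -s * (y : ℂ) ^ (-s - 1)) (a := b) (b := b + h)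
      (C := ‖s‖ * b ^ (-s.re - 1))
      (fun y hy => (hasDerivAt_ofReal_cpow_const (hb0.trans_le hy.1).ne'
        (neg_ne_zero.2 h0)).hasDerivWithinAt) (fun y hy => by
        rw [norm_mul, norm_neg, norm_cpow_eq_rpow_re_of_pos (hb0.trans_le hy.1)]
        refine mul_le_mul_of_nonneg_left ?_ (norm_nonneg _)
        simp only [sub_re, neg_re, one_re]
        exact rpow_le_rpow_of_nonpos hb0 hy.1 (by linarith)) x (Set.Ico_subset_Icc_self hx)
    rw [norm_sub_rev]
    refine h1.trans (mul_le_mul_of_nonneg_left (by linarith [hx.2]) (by positivity))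
  have hfin : ‖meanDefect b h s‖ ≤ 2 * h * ‖s‖ ^ lam * b ^ (-(s.re + lam)) := by
    set q : ℝ := h * ‖s‖ / b with hq
    have hq0 : 0 ≤ q := by positivity
    have e : q ^ lam * b ^ (-s.re) ≤ h * ‖s‖ ^ lam * b ^ (-(s.re + lam)) := by
      rw [hq, Real.div_rpow (by positivity) hb0.le, mul_rpow (by linarith) (norm_nonneg _),
        neg_add, rpow_add hb0, rpow_neg hb0.le lam]
      have h1 : h ^ lam ≤ h := by
        conv_rhs => rw [← rpow_one h]
        exact rpow_le_rpow_of_exponent_le hh hl1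
      have : h ^ lam * ‖s‖ ^ lam / b ^ lam * b ^ (-s.re) =
        h ^ lam * (‖s‖ ^ lam * (b ^ (-s.re) * (b ^ lam)⁻¹)) := by ring
      rw [this, mul_assoc]; exact mul_le_mul_of_nonneg_right h1 (by positivity)
    by_cases hq1 : 1 ≤ q
    · have := one_le_rpow hq1 hl0.le
      have h2 : b ^ (-s.re) ≤ q ^ lam * b ^ (-s.re) := le_mul_of_one_le_left (by positivity) this
      linarith
    · have h1 : q ≤ q ^ lam := by
        rcases hq0.eq_or_lt with h0 | h0
        · rw [← h0]; exact rpow_nonneg le_rfl _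
        · conv_lhs => rw [← rpow_one q]
          exact Real.rpow_le_rpow_of_exponent_ge h0 (by linarith) hl1
      have h2 : ‖s‖ * b ^ (-s.re - 1) * h = q * b ^ (-s.re) := by
        rw [rpow_sub hb0, rpow_one, hq]; ring
      have h3 : q * b ^ (-s.re) ≤ q ^ lam * b ^ (-s.re) :=
        mul_le_mul_of_nonneg_right h1 (by positivity)
      have h4 : 0 ≤ h * ‖s‖ ^ lam * b ^ (-(s.re + lam)) := by positivity
      linarith
  refine hfin.trans (mul_le_mul_of_nonneg_left ?_ (by positivity))
  exact rpow_le_rpow_of_exponent_le hb (by linarith)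

lemma differentiableAt_meanDefect {b h : ℝ} (hb : 0 < b) (hh : 0 < h) {s : ℂ} (hs : s ≠ 1) :
    DifferentiableAt ℂ (meanDefect b h) s := by
  have hbC : (b : ℂ) ≠ 0 := ofReal_ne_zero.2 hb.ne'
  have hbC' : ((b + h : ℝ) : ℂ) ≠ 0 := ofReal_ne_zero.2 (by linarith)
  have hhC : (h : ℂ) ≠ 0 := ofReal_ne_zero.2 hh.ne'
  have h1 : DifferentiableAt ℂ (fun s : ℂ => (1 - s)) s := by fun_prop
  have h2 : DifferentiableAt ℂ (fun s : ℂ => (h : ℂ) * (s - 1)) s := by fun_prop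
  exact (differentiableAt_id.neg.const_cpow (Or.inl hbC)).sub
    (((h1.const_cpow (Or.inl hbC)).sub (h1.const_cpow (Or.inl hbC'))).div h2
      (mul_ne_zero hhC (sub_ne_zero.2 hs)))

section LFunction

variable {N : ℕ} [NeZero N]

/-- The base points of the residue class of `j + 1`. -/
def classPoint (N : ℕ) (j : ZMod N) (m : ℕ) : ℕ := j.val + N * m + 1

lemma le_classPoint (j : ZMod N) (m : ℕ) : (m : ℝ) + 1 ≤ classPoint N j m := by
  have h : m ≤ N * m := Nat.le_mul_of_pos_left _ (NeZero.pos N)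
  have : m + 1 ≤ classPoint N j m := by unfold classPoint; omega
  exact_mod_cast this

lemma one_le_classPoint (j : ZMod N) (m : ℕ) : (1 : ℝ) ≤ classPoint N j m := by
  have := le_classPoint j m
  have h0 : (0 : ℝ) ≤ m := m.cast_nonneg
  linarith

lemma one_le_modulus : (1 : ℝ) ≤ N := mod_cast NeZero.one_le

/-- The regularised sum over a residue class. -/
def classSum (N : ℕ) (j : ZMod N) (s : ℂ) : ℂ := ∑' m : ℕ, meanDefect (classPoint N j m) N s

lemma norm_meanDefect_classPoint_le (j : ZMod N) (m : ℕ) {s : ℂ} (hs : s ≠ 1)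
    {σ₀ lam : ℝ} (hσ₀ : 0 ≤ σ₀) (hσ : σ₀ ≤ s.re) (hl0 : 0 < lam) (hl1 : lam ≤ 1) :
    ‖meanDefect (classPoint N j m) N s‖ ≤
      2 * N * ‖s‖ ^ lam * ((m : ℝ) + 1) ^ (-(σ₀ + lam)) := by
  refine (norm_meanDefect_le (one_le_classPoint j m) one_le_modulus hs hσ₀ hσ hl0 hl1).trans ?_
  refine mul_le_mul_of_nonneg_left ?_ (by positivity)
  exact rpow_le_rpow_of_nonpos (by positivity) (le_classPoint j m) (by linarith)

lemma summable_add_one_rpow {r : ℝ} (hr : 1 < r) :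
    Summable fun m : ℕ => ((m : ℝ) + 1) ^ (-r) := by
  have := (summable_nat_add_iff 1).2 (Real.summable_nat_rpow.2 (by linarith : -r < -1))
  exact this.congr fun m => by push_cast; rfl

lemma norm_classSum_le {σ₀ lam : ℝ} (hσ₀ : 0 ≤ σ₀) (hl0 : 0 < lam) (hl1 : lam ≤ 1)
    (hsum : 1 < σ₀ + lam) (j : ZMod N) {s : ℂ} (hs : s ≠ 1) (hσ : σ₀ ≤ s.re) :
    ‖classSum N j s‖ ≤ 2 * N * ‖s‖ ^ lam * ∑' m : ℕ, ((m : ℝ) + 1) ^ (-(σ₀ + lam)) := by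
  rw [← tsum_mul_left]
  exact tsum_of_norm_bounded ((summable_add_one_rpow hsum).mul_left _).hasSum
    fun m => norm_meanDefect_classPoint_le j m hs hσ₀ hσ hl0 hl1

lemma differentiableOn_classSum (j : ZMod N) {S : Set ℂ} (hS : IsOpen S) {δ R : ℝ} (hδ : 0 < δ)
    (h1 : ∀ s ∈ S, s ≠ 1) (hre : ∀ s ∈ S, δ ≤ s.re) (hR : ∀ s ∈ S, ‖s‖ ≤ R) :
    DifferentiableOn ℂ (classSum N j) S := by
  refine differentiableOn_tsum_of_summable_norm (u := fun m : ℕ =>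
      2 * N * R * ((m : ℝ) + 1) ^ (-(δ + 1))) ((summable_add_one_rpow (by linarith)).mul_left _)
    (fun m s hs => ?_) hS fun m s hs => ?_
  · have := one_le_classPoint j m
    have h2 := one_le_modulus (N := N)
    exact (differentiableAt_meanDefect (by linarith) (by linarith)
      (h1 s hs)).differentiableWithinAt
  · refine (norm_meanDefect_classPoint_le j m (h1 s hs) hδ.le (hre s hs) one_pos le_rfl).trans ?_
    rw [rpow_one]
    exact mul_le_mul_of_nonneg_right (mul_le_mul_of_nonneg_left (hR s hs) (by positivity))
      (by positivity)

lemma hasSum_classSum_of_one_lt {s : ℂ} (hs : 1 < s.re) (j : ZMod N) :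
    HasSum (fun m : ℕ => ((classPoint N j m : ℕ) : ℂ) ^ (-s))
      (classSum N j s + ((j.val + 1 : ℕ) : ℂ) ^ (1 - s) / (N * (s - 1))) := by
  have hs1 : s ≠ 1 := by rintro rfl; simp at hs
  have h1 : HasSum (fun m : ℕ => meanDefect (classPoint N j m) N s) (classSum N j s) := by
    refine Summable.hasSum (of_norm_bounded
      ((summable_add_one_rpow (r := 1 + 1) (by norm_num)).mul_left (2 * N * ‖s‖ ^ (1 : ℝ)))
      fun m => norm_meanDefect_classPoint_le j m hs1 zero_le_one hs.le one_pos le_rfl)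
  have htend : Tendsto (fun m : ℕ => -(((classPoint N j m : ℕ) : ℂ) ^ (1 - s) / (N * (s - 1))))
      atTop (nhds 0) := by
    rw [show (0 : ℂ) = -(0 / (N * (s - 1))) by simp]
    refine (Tendsto.div_const ?_ _).neg
    rw [tendsto_zero_iff_norm_tendsto_zero]
    have hb : Tendsto (fun m : ℕ => ((m : ℝ) + 1) ^ (-(s.re - 1))) atTop (nhds 0) :=
      (tendsto_rpow_neg_atTop (by linarith)).comp
        (tendsto_atTop_add_const_right _ _ tendsto_natCast_atTop_atTop)
    refine squeeze_zero (fun _ => norm_nonneg _) (fun m => ?_) hb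
    have hp : 0 < classPoint N j m := succ_pos _
    rw [norm_natCast_cpow_of_pos hp]
    have := le_classPoint j m
    rw [sub_re, one_re, neg_sub]; exact rpow_le_rpow_of_nonpos (by positivity) this (by linarith)
  have h2 : HasSum (fun m : ℕ => (((classPoint N j m : ℕ) : ℂ) ^ (1 - s) -
      ((classPoint N j (m + 1) : ℕ) : ℂ) ^ (1 - s)) / (N * (s - 1)))
      (((j.val + 1 : ℕ) : ℂ) ^ (1 - s) / (N * (s - 1))) := by
    have hsm : Summable fun m : ℕ => (((classPoint N j m : ℕ) : ℂ) ^ (1 - s) -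
        ((classPoint N j (m + 1) : ℕ) : ℂ) ^ (1 - s)) / (N * (s - 1)) := by
      have h3 : Summable fun m : ℕ => ((classPoint N j m : ℕ) : ℂ) ^ (-s) := by
        refine of_norm_bounded (summable_add_one_rpow hs) fun m => ?_
        have hp : 0 < classPoint N j m := succ_pos _
        rw [norm_natCast_cpow_of_pos hp, neg_re]
        exact rpow_le_rpow_of_nonpos (by positivity) (le_classPoint j m) (by linarith)
      refine (h3.sub h1.summable).congr fun m => ?_
      simp only [meanDefect, classPoint]; push_cast; ring_nf
    refine (hsm.hasSum_iff_tendsto_nat).2 ?_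
    have htele : ∀ M : ℕ, ∑ m ∈ range M, (((classPoint N j m : ℕ) : ℂ) ^ (1 - s) -
        ((classPoint N j (m + 1) : ℕ) : ℂ) ^ (1 - s)) / (N * (s - 1)) =
        ((j.val + 1 : ℕ) : ℂ) ^ (1 - s) / (N * (s - 1)) +
          -(((classPoint N j M : ℕ) : ℂ) ^ (1 - s) / (N * (s - 1))) := by
      intro M
      rw [← Finset.sum_div, Finset.sum_range_sub' (fun m => ((classPoint N j m : ℕ) : ℂ) ^ (1 - s))]
      simp only [classPoint, mul_zero, add_zero]; ring
    simp only [htele]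
    simpa using tendsto_const_nhds.add htend
  refine hasSum_of_eq (h1.add h2) fun m => ?_
  simp only [meanDefect, classPoint]; push_cast; ring_nf

/-- The continuation of a Dirichlet `L`-function to the right half plane without the real axis. -/
def classExpansion (χ : DirichletCharacter ℂ N) (s : ℂ) : ℂ := ∑ j : ZMod N, χ (j + 1) *
    (classSum N j s + ((j.val + 1 : ℕ) : ℂ) ^ (1 - s) / (N * (s - 1)))

lemma LFunction_eq_classExpansion_of_one_lt (χ : DirichletCharacter ℂ N) {s : ℂ}
    (hs : 1 < s.re) : LFunction χ s = classExpansion χ s := by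
  rw [LFunction_eq_LSeries χ hs, LSeries]
  have hsum : Summable (LSeries.term (fun n => χ n) s) :=
    DirichletCharacter.LSeriesSummable_of_one_lt_re χ hs
  have hshift := (summable_nat_add_iff 1).2 hsum
  rw [hsum.tsum_eq_zero_add, LSeries.term_zero, zero_add, Nat.sumByResidueClasses hshift N,
    classExpansion]
  refine sum_congr rfl fun j _ => ?_
  rw [← (hasSum_classSum_of_one_lt hs j).tsum_eq, ← tsum_mul_left]
  refine tsum_congr fun m => ?_
  rw [LSeries.term_of_ne_zero (succ_ne_zero _), cpow_neg, div_eq_mul_inv]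
  congr 2
  push_cast; simp

lemma LFunction_eq_classExpansion (χ : DirichletCharacter ℂ N) {s : ℂ} (hs : 0 < s.re)
    (hs' : s.im ≠ 0) : LFunction χ s = classExpansion χ s := by
  set S : Set ℂ := {z : ℂ | s.re / 2 < z.re} ∩ {z : ℂ | 0 < s.im * z.im} ∩
    ball 0 (‖s‖ + 3) with hSdef
  have hopen : IsOpen S := ((isOpen_lt_re _).inter
    (isOpen_lt continuous_const (continuous_const.mul continuous_im))).inter isOpen_ball
  have hconv : Convex ℝ S := by
    refine (Convex.inter ?_ ?_).inter (convex_ball _ _)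
    · exact convex_halfSpace_re_gt _
    · have : {z : ℂ | 0 < s.im * z.im} = {z : ℂ | 0 < (s.im • imLm) z} := by ext z; simp
      rw [this]; exact convex_halfSpace_gt (LinearMap.isLinear _) 0
  have hne : ∀ z ∈ S, z ≠ 1 := by
    rintro z hz rfl
    have := hz.1.2
    simp at this
  have hsS : s ∈ S := by
    refine ⟨⟨?_, ?_⟩, ?_⟩
    · simp only [mem_ofPred_eq]; linarith
    · exact mul_self_pos.2 hs'
    · simp [mem_ball]
  have hL : AnalyticOnNhd ℂ (LFunction χ) S :=
    DifferentiableOn.analyticOnNhd (fun z hz => (differentiableAt_LFunction χ z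
      (Or.inl (hne z hz))).differentiableWithinAt) hopen
  have hE : AnalyticOnNhd ℂ (classExpansion χ) S := by
    refine DifferentiableOn.analyticOnNhd ?_ hopen
    unfold classExpansion
    refine DifferentiableOn.fun_sum fun j _ => DifferentiableOn.const_mul ?_ _
    refine (differentiableOn_classSum j hopen (δ := s.re / 2) (R := ‖s‖ + 3) (by linarith) hne
      (fun z hz => le_of_lt hz.1.1) fun z hz => ?_).add fun z hz => ?_
    · have := hz.2; rw [mem_ball_zero_iff] at this; exact this.le
    · have h1 : DifferentiableAt ℂ (fun z : ℂ => 1 - z) z := by fun_prop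
      have h2 : DifferentiableAt ℂ (fun z : ℂ => (N : ℂ) * (z - 1)) z := by fun_prop
      exact ((h1.const_cpow (Or.inl (Nat.cast_ne_zero.2 (succ_ne_zero _)))).div h2
        (mul_ne_zero (mod_cast NeZero.ne N)
          (sub_ne_zero.2 (hne z hz)))).differentiableWithinAt
  have hw : s + 2 ∈ S ∩ {z : ℂ | 1 < z.re} := by
    refine ⟨⟨⟨?_, ?_⟩, ?_⟩, ?_⟩
    · simp only [mem_ofPred_eq]; simp; linarith
    · simp only [mem_ofPred_eq]; simp; exact hs'
    · rw [mem_ball_zero_iff]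
      refine (norm_add_le _ _).trans_lt ?_
      norm_num
    · simp only [mem_ofPred_eq]; simp; linarith
  refine hL.eqOn_of_preconnected_of_eventuallyEq hE hconv.isPreconnected hw.1 ?_ hsS
  have h1 : IsOpen {z : ℂ | 1 < z.re} := isOpen_lt_re _
  filter_upwards [h1.mem_nhds hw.2] with z hz
  exact LFunction_eq_classExpansion_of_one_lt χ hz

lemma norm_LFunction_le (χ : DirichletCharacter ℂ N) {σ₀ lam : ℝ} (hσ₀ : 0 < σ₀) (hl0 : 0 < lam)
    (hl1 : lam ≤ 1) (hsum : 1 < σ₀ + lam) : ∃ C : ℝ, 0 < C ∧ ∀ s : ℂ, σ₀ ≤ s.re → 1 / 2 ≤ |s.im| →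
      ‖LFunction χ s‖ ≤ C * ‖s‖ ^ lam := by
  set T := ∑' m : ℕ, ((m : ℝ) + 1) ^ (-(σ₀ + lam)) with hT
  have hT0 : 0 ≤ T := tsum_nonneg fun m => by positivity
  have hN := one_le_modulus (N := N)
  refine ⟨N * (2 * N * T + 4 * N), by positivity, fun s hs him => ?_⟩
  have him0 : s.im ≠ 0 := by rintro h; rw [h] at him; norm_num at him
  have hs1 : s ≠ 1 := by rintro rfl; simp at him0
  have hns : 1 / 2 ≤ ‖s‖ := him.trans (abs_im_le_norm s)
  have hns1 : 1 / 2 ≤ ‖s - 1‖ := by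
    have := abs_im_le_norm (s - 1); rw [sub_im, one_im, sub_zero] at this; linarith
  have hlam : 1 / 2 ≤ ‖s‖ ^ lam := by
    calc (1 / 2 : ℝ) = (1 / 2 : ℝ) ^ (1 : ℝ) := by rw [rpow_one]
      _ ≤ (1 / 2 : ℝ) ^ lam := Real.rpow_le_rpow_of_exponent_ge (by norm_num) (by norm_num) hl1
      _ ≤ _ := rpow_le_rpow (by norm_num) hns hl0.le
  rw [LFunction_eq_classExpansion χ (hσ₀.trans_le hs) him0, classExpansion]
  have hterm : ∀ j : ZMod N, ‖χ (j + 1) * (classSum N j s + ((j.val + 1 : ℕ) : ℂ) ^ (1 - s) /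
      (N * (s - 1)))‖ ≤ (2 * N * T + 4 * N) * ‖s‖ ^ lam := by
    intro j; rw [norm_mul]
    refine (mul_le_of_le_one_left (norm_nonneg _) (DirichletCharacter.norm_le_one χ _)).trans ?_
    refine (norm_add_le _ _).trans ?_
    have h1 := norm_classSum_le hσ₀.le hl0 hl1 hsum j hs1 hs
    have h2 : ‖((j.val + 1 : ℕ) : ℂ) ^ (1 - s) / (N * (s - 1))‖ ≤ 2 * N := by
      rw [norm_div, norm_mul, Complex.norm_natCast, norm_natCast_cpow_of_pos (succ_pos _)]
      have h3 : ((j.val + 1 : ℕ) : ℝ) ^ (1 - s).re ≤ N := by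
        have hj1 : (1 : ℝ) ≤ ((j.val + 1 : ℕ) : ℝ) := mod_cast succ_pos _
        have hj2 : ((j.val + 1 : ℕ) : ℝ) ≤ N := mod_cast ZMod.val_lt j
        refine le_trans ?_ hj2
        conv_rhs => rw [← rpow_one ((j.val + 1 : ℕ) : ℝ)]
        refine rpow_le_rpow_of_exponent_le hj1 ?_
        rw [sub_re, one_re]; linarith
      rw [div_le_iff₀ (by positivity)]
      have h5 : (N : ℝ) * 1 ≤ N * (N * (2 * ‖s - 1‖)) :=
        mul_le_mul_of_nonneg_left (by nlinarith) (by positivity)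
      calc _ ≤ (N : ℝ) := h3
        _ ≤ _ := by linarith
    have h4 : 2 * (N : ℝ) ≤ 4 * N * ‖s‖ ^ lam := by nlinarith
    rw [← hT] at h1; nlinarith
  refine (norm_sum_le _ _).trans ((Finset.sum_le_card_nsmul _ _ _ fun j _ => hterm j).trans ?_)
  rw [Finset.card_univ, ZMod.card, nsmul_eq_mul]; linarith

end LFunction

section LFunction

variable {N : ℕ} [NeZero N]

lemma norm_LFunctionTrivChar_le (N : ℕ) [NeZero N] : ∃ C : ℝ, 0 < C ∧ ∀ x : ℝ, 0 < x → x ≤ 5 →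
    ‖LFunctionTrivChar N (1 + x)‖ ≤ C / x := by
  have hc : ContinuousOn (fun x : ℝ => LFunctionTrivChar₁ N (1 + x))
      (Set.Icc 0 5) := by
    refine Continuous.continuousOn ?_
    exact (DirichletCharacter.differentiable_LFunctionTrivChar₁ N).continuous.comp
      (by fun_prop : Continuous fun x : ℝ => (1 : ℂ) + x)
  obtain ⟨C, hC⟩ := isCompact_Icc.exists_bound_of_continuousOn hc
  refine ⟨max C 1, lt_max_of_lt_right one_pos, fun x hx hx5 => ?_⟩
  have h := hC x ⟨hx.le, hx5⟩
  have hne : (1 + x : ℂ) ≠ 1 := by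
    intro h0
    have : (x : ℂ) = 0 := by linear_combination h0
    exact hx.ne' (ofReal_eq_zero.1 this)
  rw [LFunctionTrivChar₁, Function.update_of_ne hne, norm_mul,
    add_sub_cancel_left, norm_real, Real.norm_of_nonneg hx.le] at h
  rw [le_div_iff₀ hx, mul_comm]; exact h.trans (le_max_left _ _)

lemma rpow_tenth_le_two_mul {x y : ℝ} (hx : 0 ≤ x) (hy : 0 ≤ y) (h : x ≤ 2 * y) :
    x ^ (1 / 10 : ℝ) ≤ 2 * y ^ (1 / 10 : ℝ) := by
  refine (rpow_le_rpow hx h (by norm_num)).trans ?_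
  rw [mul_rpow (by norm_num) hy]
  refine mul_le_mul_of_nonneg_right ?_ (by positivity)
  conv_rhs => rw [← rpow_one 2]
  exact rpow_le_rpow_of_exponent_le (by norm_num) (by norm_num)

lemma norm_LFunction_deriv_le (χ : DirichletCharacter ℂ N) : ∃ C : ℝ, 0 < C ∧ ∀ s : ℂ,
    1 ≤ s.re → 1 ≤ |s.im| →
      ‖deriv (LFunction χ) s‖ ≤ C * ‖s‖ ^ (1 / 10 : ℝ) := by
  obtain ⟨C, hC0, hC⟩ := norm_LFunction_le χ (σ₀ := 19 / 20) (lam := 1 / 10) (by norm_num)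
    (by norm_num) (by norm_num) (by norm_num)
  refine ⟨40 * C, by positivity, fun s hs him => ?_⟩
  have hns : 1 ≤ ‖s‖ := hs.trans (re_le_norm s)
  have hball : ∀ z ∈ closedBall s (1 / 20), 19 / 20 ≤ z.re ∧ 1 / 2 ≤ |z.im| ∧
      ‖z‖ ≤ 2 * ‖s‖ := by
    intro z hz
    rw [mem_closedBall, dist_eq_norm] at hz
    have h1 := abs_le.1 ((abs_re_le_norm (z - s)).trans hz)
    have h2 := (abs_im_le_norm (z - s)).trans hz
    rw [sub_re] at h1
    rw [sub_im] at h2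
    have h3 : |s.im| ≤ |z.im| + |z.im - s.im| := by
      have := abs_sub_abs_le_abs_sub s.im z.im
      rw [abs_sub_comm] at this; linarith
    refine ⟨by linarith [h1.1], by linarith, ?_⟩
    have := norm_sub_norm_le z s
    linarith
  have hd : DiffContOnCl ℂ (LFunction χ) (ball s (1 / 20)) := by
    refine DifferentiableOn.diffContOnCl fun z hz => ?_
    rw [closure_ball _ (by norm_num)] at hz
    refine (differentiableAt_LFunction χ z
      (Or.inl ?_)).differentiableWithinAt
    rintro rfl
    have := (hball 1 hz).2.1
    norm_num at this
  have h := norm_deriv_le_of_forall_mem_sphere_norm_le (C := 2 * C * ‖s‖ ^ (1 / 10 : ℝ))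
    (by norm_num : (0 : ℝ) < 1 / 20) hd fun z hz => by
      obtain ⟨h1, h2, h3⟩ := hball z (Metric.sphere_subset_closedBall hz)
      refine (hC z h1 h2).trans ?_
      have h4 := rpow_tenth_le_two_mul (norm_nonneg _) (norm_nonneg _) h3
      nlinarith
  refine h.trans (le_of_eq ?_)
  ring

lemma norm_logDeriv_LFunction_le {χ : DirichletCharacter ℂ N} (hχ : χ ^ 2 = 1) :
    ∃ C : ℝ, 0 < C ∧ ∀ s : ℂ, 1 ≤ s.re → s.re ≤ 5 → 1 ≤ |s.im| →
      ‖deriv (LFunction χ) s / LFunction χ s‖ ≤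
        C * ‖s‖ ^ (1 / 2 : ℝ) := by
  obtain ⟨C₁, hC₁0, hC₁⟩ := norm_LFunction_le (1 : DirichletCharacter ℂ N) (σ₀ := 1)
    (lam := 1 / 10) (by norm_num) (by norm_num) (by norm_num) (by norm_num)
  obtain ⟨C₂, hC₂0, hC₂⟩ := norm_LFunction_deriv_le χ
  obtain ⟨C₃, hC₃0, hC₃⟩ := norm_LFunctionTrivChar_le N
  set F := LFunction χ with hF
  have h341 : ∀ s : ℂ, 1 < s.re → s.re ≤ 6 → 1 ≤ |s.im| →
      (s.re - 1) ^ 3 ≤ 2 * C₁ * C₃ ^ 3 * ‖s‖ ^ (1 / 10 : ℝ) * ‖F s‖ ^ 4 := by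
    intro s hs hs6 him
    set x := s.re - 1 with hx
    have hx0 : 0 < x := by linarith
    have h := DirichletCharacter.norm_LFunction_product_ge_one χ hx0 s.im
    have es : (1 + x + I * s.im : ℂ) = s := by rw [hx]; push_cast; rw [mul_comm I]; simp
    rw [es, hχ, norm_mul, norm_mul, norm_pow, norm_pow] at h
    have h3 : ‖(1 + x + 2 * I * s.im : ℂ)‖ ≤ 2 * ‖s‖ := by
      rw [show (1 + x + 2 * I * s.im : ℂ) = s + I * s.im by linear_combination es]
      refine (norm_add_le _ _).trans ?_
      rw [norm_mul, norm_I, norm_real, one_mul, norm_eq_abs]; linarith [abs_im_le_norm s]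
    have h2 := (hC₁ (1 + x + 2 * I * s.im) (by simp; linarith) (by simp; linarith)).trans
      (mul_le_mul_of_nonneg_left (rpow_tenth_le_two_mul (norm_nonneg _) (norm_nonneg _) h3) hC₁0.le)
    have h6 : 1 ≤ (C₃ / x) ^ 3 * ‖F s‖ ^ 4 * (C₁ * (2 * ‖s‖ ^ (1 / 10 : ℝ))) :=
      h.trans (mul_le_mul (mul_le_mul_of_nonneg_right (pow_le_pow_left₀ (norm_nonneg _)
        (hC₃ x hx0 (by linarith)) 3) (by positivity)) h2 (norm_nonneg _) (by positivity))
    rw [div_pow, div_mul_eq_mul_div, div_mul_eq_mul_div, one_le_div (by positivity)] at h6; linarith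
  set C₄ := 2 * C₁ * C₃ ^ 3 with hC₄
  have hC₄0 : 0 < C₄ := by positivity
  set c : ℝ := min 1 (1 / (512 * C₂ ^ 4 * C₄)) with hc
  have hc0 : 0 < c := lt_min one_pos (by positivity)
  refine ⟨1 / (2 * c), by positivity, fun s hs hs5 him => ?_⟩
  have hns : 1 ≤ ‖s‖ := hs.trans (re_le_norm s)
  set V : ℝ := ‖s‖ ^ (1 / 10 : ℝ) with hV
  have hV1 : 1 ≤ V := one_le_rpow hns (by norm_num)
  have hV5 : ‖s‖ ^ (1 / 2 : ℝ) = V ^ 5 := by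
    rw [hV, ← rpow_natCast, ← rpow_mul (norm_nonneg _)]; norm_num
  set η : ℝ := c / V ^ 5 with hη
  have hη0 : 0 < η := by positivity
  have hη1 : η ≤ 1 := by
    rw [hη, div_le_one (by positivity)]; exact (min_le_left _ _).trans (one_le_pow₀ hV1)
  have hpow : ∀ z : ℂ, ‖z‖ ≤ 2 * ‖s‖ → ‖z‖ ^ (1 / 10 : ℝ) ≤ 2 * V := fun z =>
    rpow_tenth_le_two_mul (norm_nonneg _) (norm_nonneg _)
  set T : Set ℂ := {z : ℂ | 1 ≤ z.re} ∩ {z : ℂ | z.im = s.im} ∩ closedBall s η with hTdef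
  have hTc : Convex ℝ T := by
    refine ((convex_halfSpace_re_ge 1).inter ?_).inter (convex_closedBall _ _)
    exact convex_hyperplane (f := imLm) (LinearMap.isLinear _) _
  have hTim : ∀ z ∈ T, 1 ≤ |z.im| := fun z hz => by rw [hz.1.2]; exact him
  have hTn : ∀ z ∈ T, ‖z‖ ≤ 2 * ‖s‖ := fun z hz => by
    have h1 := hz.2
    rw [mem_closedBall, dist_eq_norm] at h1
    have := norm_sub_norm_le z s
    linarith
  have hsT : s ∈ T := ⟨⟨hs, rfl⟩, by simp [hη0.le]⟩
  have hs'T : s + η ∈ T := by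
    refine ⟨⟨?_, ?_⟩, ?_⟩
    · simp only [mem_ofPred_eq]; simp; linarith
    · simp
    · simp [mem_closedBall, dist_eq_norm, abs_of_pos hη0]
  have hmv := hTc.norm_image_sub_le_of_norm_deriv_le (f := F) (C := 2 * C₂ * V)
    (fun z hz => differentiableAt_LFunction χ z (Or.inl (by
      rintro rfl
      have := hTim 1 hz
      norm_num at this)))
    (fun z hz => by
      refine (hC₂ z hz.1.1 (hTim z hz)).trans ?_
      have := hpow z (hTn z hz)
      nlinarith) hsT hs'T
  rw [add_sub_cancel_left, norm_real, Real.norm_of_nonneg hη0.le] at hmv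
  have hlow := h341 (s + η) (by simp; linarith) (by simp; linarith) (by simpa using him)
  have hlow2 : η ^ 3 ≤ C₄ * (2 * V) * ‖F (s + η)‖ ^ 4 := by
    have h1 : η ^ 3 ≤ ((s + η : ℂ).re - 1) ^ 3 := by
      refine pow_le_pow_left₀ hη0.le ?_ 3
      simp; linarith
    refine h1.trans (hlow.trans ?_)
    refine mul_le_mul_of_nonneg_right ?_ (by positivity)
    exact mul_le_mul_of_nonneg_left (hpow _ (hTn _ hs'T)) hC₄0.le
  have hFs' : 4 * C₂ * c / V ^ 4 ≤ ‖F (s + η)‖ := by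
    refine le_of_pow_le_pow_left₀ (n := 4) (by norm_num) (norm_nonneg _) ?_
    have hcle : c * (512 * C₂ ^ 4 * C₄) ≤ 1 :=
      (le_div_iff₀ (by positivity)).1 (min_le_right 1 (1 / (512 * C₂ ^ 4 * C₄)))
    have h1 : C₄ * (2 * V) * (4 * C₂ * c / V ^ 4) ^ 4 ≤ η ^ 3 := by
      rw [show C₄ * (2 * V) * (4 * C₂ * c / V ^ 4) ^ 4 =
        (c * (512 * C₂ ^ 4 * C₄)) * η ^ 3 by rw [hη]; field_simp; ring]
      exact mul_le_of_le_one_left (by positivity) hcle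
    exact le_of_mul_le_mul_left (h1.trans hlow2) (by positivity)
  have hηV : 2 * C₂ * V * η = 2 * C₂ * c / V ^ 4 := by rw [hη]; field_simp
  have hFs : 2 * C₂ * c / V ^ 4 ≤ ‖F s‖ := by
    have h1 := norm_sub_norm_le (F (s + η)) (F s)
    rw [hηV] at hmv
    have h2 : 4 * C₂ * c / V ^ 4 = 2 * (2 * C₂ * c / V ^ 4) := by ring
    linarith
  have hpos : 0 < 2 * C₂ * c / V ^ 4 := by positivity
  rw [norm_div, div_le_iff₀ (hpos.trans_le hFs), hV5]
  refine (hC₂ s hs him).trans ?_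
  calc C₂ * V = 1 / (2 * c) * V ^ 5 * (2 * C₂ * c / V ^ 4) := by field_simp
    _ ≤ _ := mul_le_mul_of_nonneg_left hFs (by positivity)

end LFunction

/-! ### The digamma function -/

lemma norm_log_add_one_sub_le {w : ℂ} (hw : 0 < w.re) :
    ‖log (w + 1) - log w - 1 / w‖ ≤ 1 / ‖w‖ ^ 2 := by
  have hw0 : w ≠ 0 := by rintro rfl; simp at hw
  have hre : ∀ t : ℝ, 0 ≤ t → 0 < (w + t).re := fun t ht => by simp; linarith
  have hge : ∀ t : ℝ, 0 ≤ t → ‖w‖ ≤ ‖w + t‖ := fun t ht => by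
    rw [← sqrt_sq (norm_nonneg w), ← sqrt_sq (norm_nonneg (w + t))]
    apply Real.sqrt_le_sqrt
    rw [← normSq_eq_norm_sq, ← normSq_eq_norm_sq, normSq_apply, normSq_apply]
    simp only [add_re, ofReal_re, add_im, ofReal_im, add_zero]; nlinarith
  have h := norm_image_sub_le_of_norm_deriv_le_segment' (f := fun t : ℝ => log (w + t) - t * (1 / w))
    (f' := fun t : ℝ => 1 / (w + t) - 1 / w) (a := 0) (b := 1) (C := 1 / ‖w‖ ^ 2)
    (fun t ht => by
      refine HasDerivAt.hasDerivWithinAt ?_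
      have h1 : HasDerivAt (fun t : ℝ => w + (t : ℂ)) 1 t := (hasDerivAt_id t).ofReal_comp.const_add w
      have h2 := h1.clog_real (Or.inl (hre t ht.1))
      have h3 : HasDerivAt (fun t : ℝ => (t : ℂ) * (1 / w)) (1 * (1 / w)) t :=
        (hasDerivAt_id t).ofReal_comp.mul_const _
      simpa using h2.fun_sub h3)
    (fun t ht => by
      have hwt : w + (t : ℂ) ≠ 0 := by intro h0; have := hre t ht.1; rw [h0] at this; simp at this
      have e : 1 / (w + t) - 1 / w = -t / ((w + t) * w) := by field_simp; ring
      rw [e, norm_div, norm_mul, norm_neg, norm_real, Real.norm_of_nonneg ht.1]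
      have h0 : 0 < ‖w‖ := norm_pos_iff.2 hw0
      refine div_le_div₀ zero_le_one ht.2.le (by positivity) ?_
      rw [sq]; exact mul_le_mul_of_nonneg_right (hge t ht.1) h0.le) 1 (by simp)
  rw [ofReal_one, ofReal_zero, one_mul, zero_mul, add_zero, sub_zero, sub_zero, mul_one] at h
  rwa [show log (w + 1) - 1 / w - log w = log (w + 1) - log w - 1 / w by ring] at h

/-- The terms of the logarithm of the product for `Γ (1 + z)`. -/
def logGammaTerm (j : ℕ) (z : ℂ) : ℂ :=
  z * (log ((j : ℂ) + 1 + 1) - log ((j : ℂ) + 1)) - (log (z + (j + 1)) - log ((j : ℂ) + 1))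

/-- The derivative of `logGammaTerm`. -/
def digammaTerm (j : ℕ) (z : ℂ) : ℂ := log ((j : ℂ) + 1 + 1) - log ((j : ℂ) + 1) - 1 / (z + (j + 1))

lemma hasDerivAt_logGammaTerm (j : ℕ) {z : ℂ} (hz : 0 < z.re) :
    HasDerivAt (logGammaTerm j) (digammaTerm j z) z := by
  have h1 : HasDerivAt (fun z : ℂ => z + ((j : ℂ) + 1)) 1 z := (hasDerivAt_id z).add_const _
  have h2 := h1.clog (Or.inl (by simp; positivity))
  have h3 := (hasDerivAt_id z).mul_const (log ((j : ℂ) + 1 + 1) - log ((j : ℂ) + 1))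
  have := h3.fun_sub (h2.sub_const (log ((j : ℂ) + 1)))
  refine HasDerivAt.congr_deriv (f := logGammaTerm j) this ?_
  rw [digammaTerm, one_mul]

lemma le_norm_add_natCast {z : ℂ} (hz : 0 < z.re) (j : ℕ) : (j : ℝ) + 1 ≤ ‖z + (j + 1)‖ := by
  refine le_trans ?_ (re_le_norm _)
  simp; linarith

lemma norm_digammaTerm_le (j : ℕ) {z : ℂ} (hz : 0 < z.re) :
    ‖digammaTerm j z‖ ≤ (1 + ‖z‖) * ((j : ℝ) + 1) ^ (-(2 : ℝ)) := by
  have hj : (0 : ℝ) < (j : ℝ) + 1 := by positivity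
  have hn : ‖(j : ℂ) + 1‖ = (j : ℝ) + 1 := by
    have : (j : ℂ) + 1 = ((j + 1 : ℝ) : ℂ) := by push_cast; rfl
    rw [this, norm_real, Real.norm_of_nonneg hj.le]
  have h1 := norm_log_add_one_sub_le (w := (j : ℂ) + 1) (by simp; positivity)
  have h2 := le_norm_add_natCast hz j
  have hj0 : (j : ℂ) + 1 ≠ 0 := mod_cast succ_ne_zero j
  have hz0 : z + ((j : ℂ) + 1) ≠ 0 := norm_pos_iff.1 (hj.trans_le h2)
  have e : digammaTerm j z = (log ((j : ℂ) + 1 + 1) - log ((j : ℂ) + 1) - 1 / ((j : ℂ) + 1)) +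
      z / (((j : ℂ) + 1) * (z + (j + 1))) := by
    rw [digammaTerm]; field_simp; ring
  rw [e, rpow_neg hj.le, rpow_two, add_mul (1 : ℝ), one_mul]
  refine (norm_add_le _ _).trans (add_le_add ?_ ?_)
  · rw [hn] at h1; simpa using h1
  · rw [norm_div, norm_mul, hn, div_eq_mul_inv]
    refine mul_le_mul_of_nonneg_left ?_ (norm_nonneg _)
    rw [sq]; exact inv_anti₀ (by positivity) (mul_le_mul_of_nonneg_left h2 hj.le)

lemma exp_sum_logGammaTerm {z : ℂ} (hz : 0 < z.re) (n : ℕ) :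
    exp (∑ j ∈ range n, logGammaTerm j z) * (((n : ℂ) + 1) ^ 2 /
      ((z + 1 + n) * (z + 2 + n))) = GammaSeq (z + 1) (n + 1) := by
  have hne : ∀ j : ℕ, z + ((j : ℂ) + 1) ≠ 0 := fun j => by
    have h1 := le_norm_add_natCast hz j
    exact norm_pos_iff.1 (lt_of_lt_of_le (by positivity) h1)
  have hj0 : ∀ j : ℕ, (j : ℂ) + 1 ≠ 0 := fun j => mod_cast succ_ne_zero j
  have key : ∀ n : ℕ, exp (∑ j ∈ range n, logGammaTerm j z) =
      ((n : ℂ) + 1) ^ z * (n.factorial / ∏ j ∈ range n, (z + 1 + j)) := by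
    intro n
    induction n with
    | zero => simp
    | succ n ih =>
      rw [sum_range_succ, exp_add, ih, logGammaTerm, exp_sub, exp_sub, exp_log (hne n),
        exp_log (hj0 n), mul_sub, exp_sub, Finset.prod_range_succ, Nat.factorial_succ,
        cpow_def_of_ne_zero (hj0 n), cpow_def_of_ne_zero (hj0 (n + 1))]
      have e0 : ((n + 1 : ℕ) : ℂ) = (n : ℂ) + 1 := by push_cast; rfl
      rw [Nat.cast_mul, e0, mul_comm (log ((n : ℂ) + 1)) z, mul_comm (log ((n : ℂ) + 1 + 1)) z,
        show z + ((n : ℂ) + 1) = z + 1 + n by ring]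
      have h1 : z + 1 + (n : ℂ) ≠ 0 := by have := hne n; rwa [show z + ((n : ℂ) + 1) = z + 1 + n by ring] at this
      have h2 : ∏ j ∈ range n, (z + 1 + (j : ℂ)) ≠ 0 := prod_ne_zero_iff.2 fun j _ => by
        have := hne j; rwa [show z + ((j : ℂ) + 1) = z + 1 + j by ring] at this
      have h3 := exp_ne_zero (z * log ((n : ℂ) + 1))
      have h4 := hj0 n
      field_simp
  rw [key, GammaSeq, Finset.prod_range_succ, Finset.prod_range_succ, Nat.factorial_succ]
  have h2 : ∏ j ∈ range n, (z + 1 + (j : ℂ)) ≠ 0 := prod_ne_zero_iff.2 fun j _ => by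
    have := hne j; rwa [show z + ((j : ℂ) + 1) = z + 1 + j by ring] at this
  have h1 : z + 1 + (n : ℂ) ≠ 0 := by have := hne n; rwa [show z + ((n : ℂ) + 1) = z + 1 + n by ring] at this
  have h3 : z + 2 + (n : ℂ) ≠ 0 := by
    have := hne (n + 1); push_cast at this; rwa [show z + ((n : ℂ) + 1 + 1) = z + 2 + n by ring] at this
  have e0 : ((n + 1 : ℕ) : ℂ) = (n : ℂ) + 1 := by push_cast; rfl
  rw [Nat.cast_mul, e0, cpow_add _ _ (hj0 n), cpow_one, show z + 1 + ((n : ℂ) + 1) = z + 2 + n by ring]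
  field_simp

lemma tendsto_linear_div (a b : ℂ) :
    Tendsto (fun n : ℕ => ((n : ℂ) + a) / ((n : ℂ) + b)) atTop (nhds 1) := by
  have h := tendsto_add_mul_div_add_mul_atTop_nhds (𝕜 := ℂ) a b 1 (d := 1) one_ne_zero
  simp only [one_mul, div_one] at h
  exact h.congr fun n => by ring

lemma exists_hasDerivAt_logGamma {z : ℂ} (hz : 0 < z.re) : Summable (fun j => logGammaTerm j z) ∧
    HasDerivAt (fun z => ∑' j, logGammaTerm j z) (∑' j, digammaTerm j z) z := by
  set S : Set ℂ := {z : ℂ | 0 < z.re} ∩ ball 0 (‖z‖ + 2) with hS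
  have hopen : IsOpen S := (isOpen_lt_re _).inter isOpen_ball
  have hconn : IsPreconnected S :=
    ((convex_halfSpace_re_gt 0).inter (convex_ball _ _)).isPreconnected
  have hsum : Summable fun j : ℕ => (1 + (‖z‖ + 2)) * ((j : ℝ) + 1) ^ (-(2 : ℝ)) :=
    (summable_add_one_rpow (by norm_num)).mul_left _
  have hb : ∀ (j : ℕ) (y : ℂ), y ∈ S →
      ‖digammaTerm j y‖ ≤ (1 + (‖z‖ + 2)) * ((j : ℝ) + 1) ^ (-(2 : ℝ)) := fun j y hy => by
    refine (norm_digammaTerm_le j hy.1).trans (mul_le_mul_of_nonneg_right ?_ (by positivity))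
    have := hy.2; rw [mem_ball_zero_iff] at this; linarith
  have h1S : (1 : ℂ) ∈ S := ⟨by simp, by rw [mem_ball_zero_iff, norm_one]; linarith [norm_nonneg z]⟩
  have hzS : z ∈ S := ⟨hz, by rw [mem_ball_zero_iff]; linarith⟩
  have h10 : ∀ j : ℕ, logGammaTerm j 1 = 0 := fun j => by
    rw [logGammaTerm, show (1 : ℂ) + ((j : ℂ) + 1) = (j : ℂ) + 1 + 1 by ring]; ring
  have hs1 : Summable fun j => logGammaTerm j 1 := by simp only [h10]; exact summable_zero
  exact ⟨summable_of_summable_hasDerivAt_of_isPreconnected hsum hopen hconn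
      (fun j y hy => hasDerivAt_logGammaTerm j hy.1) hb h1S hs1 hzS,
    hasDerivAt_tsum_of_isPreconnected hsum hopen hconn
      (fun j y hy => hasDerivAt_logGammaTerm j hy.1) hb h1S hs1 hzS⟩

lemma Gamma_add_one_eq_exp {z : ℂ} (hz : 0 < z.re) :
    Gamma (z + 1) = exp (∑' j, logGammaTerm j z) := by
  have h1 := (exists_hasDerivAt_logGamma hz).1.hasSum.tendsto_sum_nat
  have h2 : Tendsto (fun n : ℕ => exp (∑ j ∈ range n, logGammaTerm j z) *
      (((n : ℂ) + 1) ^ 2 / ((z + 1 + n) * (z + 2 + n)))) atTop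
      (nhds (exp (∑' j, logGammaTerm j z) * (1 * 1))) := by
    refine ((continuous_exp.tendsto _).comp h1).mul ?_
    refine ((tendsto_linear_div 1 (z + 1)).mul (tendsto_linear_div 1 (z + 2))).congr fun n => ?_
    rw [div_mul_div_comm, ← sq, add_comm (z + 1), add_comm (z + 2)]
  rw [mul_one, mul_one] at h2
  have h3 : Tendsto (fun n : ℕ => GammaSeq (z + 1) (n + 1)) atTop (nhds (Gamma (z + 1))) :=
    (GammaSeq_tendsto_Gamma (z + 1)).comp (tendsto_add_atTop_nat 1)
  exact tendsto_nhds_unique h3 (h2.congr fun n => exp_sum_logGammaTerm hz n)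

lemma digamma_add_one_eq {z : ℂ} (hz : 0 < z.re) : digamma (z + 1) = ∑' j, digammaTerm j z := by
  have hev : (fun z => Gamma (z + 1)) =ᶠ[nhds z] fun z => exp (∑' j, logGammaTerm j z) := by
    have hopen : IsOpen {z : ℂ | 0 < z.re} := isOpen_lt_re _
    filter_upwards [hopen.mem_nhds hz] with y hy using Gamma_add_one_eq_exp hy
  have h := (exists_hasDerivAt_logGamma hz).2.cexp
  have hd : deriv (fun z => Gamma (z + 1)) z =
      exp (∑' j, logGammaTerm j z) * ∑' j, digammaTerm j z := by
    rw [hev.deriv_eq]; exact h.deriv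
  rw [deriv_comp_add_const] at hd
  rw [digamma_def, logDeriv_apply, hd, Gamma_add_one_eq_exp hz,
    mul_div_cancel_left₀ _ (exp_ne_zero _)]

lemma norm_digamma_add_one_sub_log_le : ∃ C : ℝ, ∀ z : ℂ, 0 < z.re →
    ‖digamma (z + 1) - log (z + 1)‖ ≤ C := by
  refine ⟨∑' j : ℕ, ((j : ℝ) + 1) ^ (-(2 : ℝ)), fun z hz => ?_⟩
  have hsumd : Summable fun j => digammaTerm j z :=
    of_norm_bounded ((summable_add_one_rpow (r := 2) (by norm_num)).mul_left (1 + ‖z‖))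
      fun j => norm_digammaTerm_le j hz
  set e : ℕ → ℂ := fun j => log (z + (j + 1) + 1) - log (z + (j + 1)) - 1 / (z + (j + 1)) with he
  have heb : ∀ j : ℕ, ‖e j‖ ≤ ((j : ℝ) + 1) ^ (-(2 : ℝ)) := fun j => by
    refine (norm_log_add_one_sub_le (w := z + (j + 1)) (by simp; positivity)).trans ?_
    rw [rpow_neg (by positivity), rpow_two, one_div]
    exact inv_anti₀ (by positivity) (pow_le_pow_left₀ (by positivity) (le_norm_add_natCast hz j) 2)
  have hse : Summable e := of_norm_bounded (summable_add_one_rpow (by norm_num)) heb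
  have hpart : ∀ n : ℕ, ∑ j ∈ range n, digammaTerm j z =
      ∑ j ∈ range n, e j + log (z + 1) + (log ((n : ℂ) + 1) - log (z + (n + 1))) := by
    intro n
    induction n with
    | zero => simp
    | succ n ih =>
      rw [sum_range_succ, sum_range_succ, ih, digammaTerm, he]; push_cast
      rw [show z + ((n : ℂ) + 1 + 1) = z + (n + 1) + 1 by ring]
      ring
  have hlog : Tendsto (fun n : ℕ => log ((n : ℂ) + 1) - log (z + (n + 1))) atTop (nhds 0) := by
    have h1 : Tendsto (fun n : ℕ => ((n : ℂ) + (z + 1)) / ((n : ℂ) + 1)) atTop (nhds 1) :=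
      tendsto_linear_div _ _
    have h2 := ((continuousAt_clog (x := 1) (by simp)).tendsto.comp h1).neg
    rw [log_one, neg_zero] at h2
    refine h2.congr fun n => ?_
    simp only [Function.comp]
    have hn : (0 : ℝ) < (n : ℝ) + 1 := by positivity
    have e1 : z + ((n : ℂ) + 1) = (((n : ℝ) + 1 : ℝ) : ℂ) * (((n : ℂ) + (z + 1)) / ((n : ℂ) + 1)) := by
      have : (n : ℂ) + 1 ≠ 0 := mod_cast succ_ne_zero n
      push_cast; field_simp; ring
    have hne : ((n : ℂ) + (z + 1)) / ((n : ℂ) + 1) ≠ 0 := by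
      have h3 := le_norm_add_natCast hz n
      have h4 : z + ((n : ℂ) + 1) ≠ 0 := norm_pos_iff.1 (hn.trans_le h3)
      rw [e1] at h4; exact right_ne_zero_of_mul h4
    rw [e1, log_ofReal_mul hn hne, ofReal_log hn.le]
    push_cast; ring
  have hlim := tendsto_nhds_unique hsumd.hasSum.tendsto_sum_nat
    (((hse.hasSum.tendsto_sum_nat.add_const (log (z + 1))).add hlog).congr fun n => (hpart n).symm)
  rw [digamma_add_one_eq hz, hlim, add_zero, add_sub_cancel_right]
  exact tsum_of_norm_bounded (summable_add_one_rpow (by norm_num)).hasSum heb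

lemma norm_digamma_sub_log_le : ∃ C : ℝ, 0 < C ∧ ∀ z : ℂ, 1 / 2 ≤ z.re →
    ‖digamma z - log z‖ ≤ C := by
  obtain ⟨C, hC⟩ := norm_digamma_add_one_sub_log_le
  refine ⟨max C 0 + 8, by positivity, fun z hz => ?_⟩
  have hz0 : 0 < z.re := by linarith
  have hne : ∀ m : ℕ, z ≠ -m := fun m h => by
    have : (0 : ℝ) ≤ m := m.cast_nonneg
    rw [h] at hz0; simp at hz0; linarith
  have hzn : 1 / 2 ≤ ‖z‖ := hz.trans (re_le_norm z)
  have h1 := hC z hz0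
  rw [digamma_apply_add_one z hne] at h1
  have h2 := norm_log_add_one_sub_le hz0
  have h3 : 1 / ‖z‖ ^ 2 ≤ 4 := by rw [div_le_iff₀ (by positivity)]; nlinarith
  have h4 : ‖z⁻¹‖ ≤ 2 := by rw [norm_inv, inv_le_comm₀ (by linarith) (by norm_num)]; linarith
  have e : digamma z - log z = (digamma z + z⁻¹ - log (z + 1)) + (log (z + 1) - log z - 1 / z) := by
    ring
  have h5 : C ≤ max C 0 := le_max_left _ _
  rw [e]
  refine (norm_add_le _ _).trans ?_
  have h6 : ‖digamma z + z⁻¹ - log (z + 1)‖ ≤ C := by simpa [one_div] using h1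
  linarith

/-! ### The factor of the functional equation -/

lemma norm_GammaSeq_mul_le {a b : ℝ} (ha : 0 < a) (hab : a ≤ b) (y : ℝ) {n : ℕ} (hn : 0 < n) :
    ‖GammaSeq (a + y * I) n‖ * ‖GammaSeq b n‖ ≤ ‖GammaSeq (b + y * I) n‖ * ‖GammaSeq a n‖ := by
  have hb : 0 < b := ha.trans_le hab
  have hfac : ∀ j : ℕ, ‖(b + y * I + j : ℂ)‖ * ‖(a + j : ℂ)‖ ≤ ‖(a + y * I + j : ℂ)‖ * ‖(b + j : ℂ)‖ := by
    intro j
    refine le_of_pow_le_pow_left₀ (n := 2) two_ne_zero (by positivity) ?_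
    rw [mul_pow, mul_pow, ← normSq_eq_norm_sq, ← normSq_eq_norm_sq, ← normSq_eq_norm_sq,
      ← normSq_eq_norm_sq, normSq_apply, normSq_apply, normSq_apply, normSq_apply]
    simp
    have hj : (0 : ℝ) ≤ j := j.cast_nonneg
    have h1 : (a + j) * (a + j) ≤ (b + j) * (b + j) := by nlinarith
    nlinarith [mul_self_nonneg y]
  have hnorm : ∀ s : ℂ, 0 < s.re → ‖GammaSeq s n‖ = (n : ℝ) ^ s.re * n.factorial /
      ∏ j ∈ range (n + 1), ‖s + j‖ := by
    intro s hs
    rw [GammaSeq, norm_div, norm_mul, norm_natCast_cpow_of_pos hn, Complex.norm_natCast, norm_prod]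
  have hpos : ∀ s : ℂ, 0 < s.re → 0 < ∏ j ∈ range (n + 1), ‖s + j‖ := fun s hs =>
    Finset.prod_pos fun j _ => norm_pos_iff.2 fun h0 => by
      have : (s + j).re = 0 := by rw [h0]; simp
      have hj : (0 : ℝ) ≤ j := j.cast_nonneg
      simp at this; linarith
  have h1 : 0 < (a + y * I : ℂ).re := by simpa using ha
  have h2 : 0 < (b + y * I : ℂ).re := by simpa using hb
  have h3 : 0 < (a : ℂ).re := by simpa using ha
  have h4 : 0 < (b : ℂ).re := by simpa using hb
  rw [hnorm _ h1, hnorm _ h2, hnorm _ h3, hnorm _ h4]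
  have e1 : (a + y * I : ℂ).re = a := by simp
  have e2 : (b + y * I : ℂ).re = b := by simp
  rw [e1, e2, ofReal_re, ofReal_re, div_mul_div_comm, div_mul_div_comm,
    mul_comm ((n : ℝ) ^ b * _) ((n : ℝ) ^ a * _)]
  refine div_le_div_of_nonneg_left (by positivity) (mul_pos (hpos _ h2) (hpos _ h3)) ?_
  rw [← Finset.prod_mul_distrib, ← Finset.prod_mul_distrib]
  exact Finset.prod_le_prod (fun _ _ => by positivity) fun j _ => hfac j

lemma norm_Gamma_mul_le {a b : ℝ} (ha : 0 < a) (hab : a ≤ b) (y : ℝ) :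
    ‖Gamma (a + y * I)‖ * Real.Gamma b ≤ ‖Gamma (b + y * I)‖ * Real.Gamma a := by
  have hb : 0 < b := ha.trans_le hab
  have h := le_of_tendsto_of_tendsto
    ((GammaSeq_tendsto_Gamma (a + y * I)).norm.mul (GammaSeq_tendsto_Gamma (b : ℂ)).norm)
    ((GammaSeq_tendsto_Gamma (b + y * I)).norm.mul (GammaSeq_tendsto_Gamma (a : ℂ)).norm)
    ((eventually_gt_atTop 0).mono fun n hn => norm_GammaSeq_mul_le ha hab y hn)
  rwa [Gamma_ofReal, Gamma_ofReal, norm_real, norm_real,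
    Real.norm_of_nonneg (Gamma_pos_of_pos hb).le,
    Real.norm_of_nonneg (Gamma_pos_of_pos ha).le] at h

lemma real_Gamma_sub_le {k σ : ℝ} (hk : 1 ≤ k) (hσ : 0 ≤ σ) (hσ' : σ ≤ 1 / 4) :
    Real.Gamma (k - σ) ≤ 2 * (k + σ) ^ (-(2 * σ)) * Real.Gamma (k + σ) := by
  have hb : 0 < Real.Gamma (k + σ) := Gamma_pos_of_pos (by linarith)
  rcases hσ.eq_or_lt with h0 | h0
  · rw [← h0]
    simp only [sub_zero, add_zero, mul_zero, neg_zero, rpow_zero] at hb ⊢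
    rw [← h0, add_zero] at hb; linarith
  have h := Real.Gamma_mul_add_mul_le_rpow_Gamma_mul_rpow_Gamma (s := k + σ) (t := k + σ + 1)
    (a := 2 * σ) (b := 1 - 2 * σ) (by linarith) (by linarith) (by linarith) (by linarith) (by ring)
  rw [show 2 * σ * (k + σ) + (1 - 2 * σ) * (k + σ + 1) = k - σ + 1 by ring,
    Real.Gamma_add_one (by linarith : k - σ ≠ 0) , Real.Gamma_add_one (by linarith : k + σ ≠ 0),
    mul_rpow (by linarith) hb.le, mul_left_comm, ← rpow_add hb,
    show 2 * σ + (1 - 2 * σ) = 1 by ring, rpow_one,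
    show (1 - 2 * σ) = 1 + -(2 * σ) by ring, rpow_add (by linarith), rpow_one] at h
  have hp : 0 < (k + σ) ^ (-(2 * σ)) := Real.rpow_pos_of_pos (by linarith) _
  have h1 : (k + σ) ≤ 2 * (k - σ) := by linarith
  have h2 : (k + σ) * (k + σ) ^ (-(2 * σ)) * Real.Gamma (k + σ) ≤
      2 * (k - σ) * ((k + σ) ^ (-(2 * σ)) * Real.Gamma (k + σ)) := by
    rw [mul_assoc]; exact mul_le_mul_of_nonneg_right h1 (by positivity)
  refine le_of_mul_le_mul_left (a := k - σ) ?_ (by linarith)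
  linarith

lemma Gamma_cast_sub_ne {n : ℕ} (hn : 1 ≤ n) {α : ℂ} (hα : |α.re| < 1) :
    Gamma (2 * n - 1 + α) ≠ 0 := by
  refine Gamma_ne_zero_of_re_pos ?_
  have h1 : (1 : ℝ) ≤ n := mod_cast hn
  have := (abs_lt.1 hα).1
  simp; linarith

lemma norm_gammaRatio_le {n : ℕ} (hn : 1 ≤ n) {α : ℂ} (h0 : 0 ≤ α.re) (h1 : α.re ≤ 1 / 4) :
    ‖gammaRatio n α‖ ≤ 2 * (n : ℝ) ^ (-(2 * α.re)) := by
  have hn1 : (1 : ℝ) ≤ n := mod_cast hn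
  set k : ℝ := 2 * n - 1 with hk
  have hk1 : 1 ≤ k := by linarith
  have hG := norm_Gamma_mul_le (a := k - α.re) (b := k + α.re) (by linarith) (by linarith) α.im
  have e1 : ‖Gamma (2 * n - 1 - α)‖ = ‖Gamma ((k - α.re : ℝ) + α.im * I)‖ := by
    rw [← norm_conj (Gamma (2 * n - 1 - α)), ← Gamma_conj]
    congr 2
    apply Complex.ext <;> simp [hk]
  have e2 : (2 * n - 1 + α : ℂ) = ((k + α.re : ℝ) + α.im * I) := by apply Complex.ext <;> simp [hk]
  have hGb : 0 < Real.Gamma (k + α.re) := Gamma_pos_of_pos (by linarith)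
  have hne : 0 < ‖Gamma ((k + α.re : ℝ) + α.im * I)‖ := norm_pos_iff.2
    (Gamma_ne_zero_of_re_pos (by simp; linarith))
  have hpi : (1 : ℝ) ≤ 7 / (2 * π) := by rw [le_div_iff₀ (by positivity)]; linarith [pi_lt_d2]
  rw [gammaRatio, norm_mul, norm_cpow_eq_rpow_re_of_pos (by positivity), norm_div, e1, e2]
  have h2 : (7 / (2 * π)) ^ (-2 * α).re ≤ 1 := by
    refine Real.rpow_le_one_of_one_le_of_nonpos hpi ?_
    simp; linarith
  have h3 : ‖Gamma ((k - α.re : ℝ) + α.im * I)‖ / ‖Gamma ((k + α.re : ℝ) + α.im * I)‖ ≤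
      2 * (k + α.re) ^ (-(2 * α.re)) := by
    rw [div_le_iff₀ hne]
    refine le_of_mul_le_mul_right (hG.trans ?_) hGb
    calc ‖Gamma ((k + α.re : ℝ) + α.im * I)‖ * Real.Gamma (k - α.re)
        ≤ ‖Gamma ((k + α.re : ℝ) + α.im * I)‖ *
          (2 * (k + α.re) ^ (-(2 * α.re)) * Real.Gamma (k + α.re)) :=
          mul_le_mul_of_nonneg_left (real_Gamma_sub_le hk1 h0 h1) (norm_nonneg _)
      _ = _ := by ring
  have h4 : (k + α.re) ^ (-(2 * α.re)) ≤ (n : ℝ) ^ (-(2 * α.re)) :=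
    rpow_le_rpow_of_nonpos (by linarith) (by linarith) (by linarith)
  calc _ ≤ 1 * (2 * (k + α.re) ^ (-(2 * α.re))) := mul_le_mul h2 h3 (by positivity) zero_le_one
    _ ≤ _ := by linarith

lemma hasDerivAt_gammaRatio {n : ℕ} (hn : 1 ≤ n) {α : ℂ} (hα : |α.re| < 1) :
    HasDerivAt (gammaRatio n) (gammaRatio n α * (-2 * log ((7 / (2 * π) : ℝ) : ℂ) -
      digamma (2 * n - 1 - α) - digamma (2 * n - 1 + α))) α := by
  have hn1 : (1 : ℝ) ≤ n := mod_cast hn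
  have hα' := abs_lt.1 hα
  have hc : ((7 / (2 * π) : ℝ) : ℂ) ≠ 0 := ofReal_ne_zero.2 (by positivity)
  have hG : ∀ w : ℂ, 0 < w.re → HasDerivAt Gamma (Gamma w * digamma w) w := fun w hw => by
    have h1 : DifferentiableAt ℂ Gamma w := differentiableAt_Gamma w fun m h => by
      have : (0 : ℝ) ≤ m := m.cast_nonneg
      rw [h] at hw; simp at hw; linarith
    have h2 := h1.hasDerivAt
    rw [digamma_def, logDeriv_apply, mul_div_cancel₀ _ (Gamma_ne_zero_of_re_pos hw)]; exact h2
  have hm : HasDerivAt (fun α : ℂ => 2 * n - 1 - α) (-1) α := (hasDerivAt_id α).const_sub _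
  have hp : HasDerivAt (fun α : ℂ => 2 * n - 1 + α) 1 α := (hasDerivAt_id α).const_add _
  have hrm : 0 < (2 * n - 1 - α : ℂ).re := by simp; linarith
  have hrp : 0 < (2 * n - 1 + α : ℂ).re := by simp; linarith
  have h1 := (hG _ hrm).comp α hm
  have h2 := (hG _ hrp).comp α hp
  have h3 : HasDerivAt (fun α : ℂ => -2 * α) (-2) α := by
    simpa using (hasDerivAt_id α).const_mul (-2)
  have h4 := h3.const_cpow (c := ((7 / (2 * π) : ℝ) : ℂ)) (Or.inl hc)
  have hne : Gamma (2 * n - 1 + α) ≠ 0 := Gamma_ne_zero_of_re_pos hrp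
  have := h4.fun_mul (h1.fun_div h2 hne)
  refine HasDerivAt.congr_deriv (f := gammaRatio n) this ?_
  simp only [Function.comp]; rw [gammaRatio]; field_simp; ring

lemma gammaRatio_zero {n : ℕ} (hn : 1 ≤ n) : gammaRatio n 0 = 1 := by
  have := Gamma_cast_sub_ne hn (α := 0) (by simp)
  rw [add_zero] at this; rw [gammaRatio]; simp [div_self this]

lemma norm_log_sub_log_natCast_le {n : ℕ} (hn : 1 ≤ n) {w : ℂ} (h1 : (n : ℝ) / 3 ≤ ‖w‖)
    (h2 : ‖w‖ ≤ 3 * n) : ‖log w - ln n‖ ≤ 6 := by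
  have hn1 : (1 : ℝ) ≤ n := mod_cast hn
  have hw0 : w ≠ 0 := by rintro rfl; rw [norm_zero] at h1; linarith
  have hwn : 0 < ‖w‖ := norm_pos_iff.2 hw0
  have e : log w - ln n = (ln (‖w‖ / n) : ℂ) + arg w * I := by
    rw [Real.log_div hwn.ne' (by linarith), log]
    push_cast; ring
  rw [e]
  refine (norm_add_le _ _).trans ?_
  rw [norm_real, norm_mul, norm_I, norm_real, mul_one, norm_eq_abs, norm_eq_abs]
  have ha := abs_arg_le_pi w
  have hl : |ln (‖w‖ / n)| ≤ 2 := by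
    rw [abs_le]
    constructor
    · have : ln (1 / 3) ≤ ln (‖w‖ / n) := log_le_log (by norm_num) (by
        rw [le_div_iff₀ (by linarith)]; linarith)
      have h3 : ln (1 / 3) = -ln 3 := by rw [one_div, Real.log_inv]
      have h4 : ln 3 ≤ 3 - 1 := Real.log_le_sub_one_of_pos (by norm_num)
      linarith
    · have : ln (‖w‖ / n) ≤ ln 3 := log_le_log (by positivity) (by
        rw [div_le_iff₀ (by linarith)]; linarith)
      have h4 : ln 3 ≤ 3 - 1 := Real.log_le_sub_one_of_pos (by norm_num)
      linarith
  linarith [pi_lt_d2]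

lemma norm_digamma_sub_log_natCast_le : ∃ C : ℝ, 0 < C ∧ ∀ n : ℕ, 1 ≤ n → ∀ α : ℂ, ‖α‖ ≤ 1 / 4 →
    ‖digamma (2 * n - 1 + α) - ln n‖ ≤ C := by
  obtain ⟨C, hC0, hC⟩ := norm_digamma_sub_log_le
  refine ⟨C + 6, by linarith, fun n hn α hα => ?_⟩
  have hn1 : (1 : ℝ) ≤ n := mod_cast hn
  have hre := abs_le.1 ((abs_re_le_norm α).trans hα)
  have h1 := hC (2 * n - 1 + α) (by simp; linarith)
  have hk : ‖(2 * n - 1 : ℂ)‖ = 2 * n - 1 := by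
    have : (2 * n - 1 : ℂ) = ((2 * n - 1 : ℝ) : ℂ) := by push_cast; rfl
    rw [this, norm_real, Real.norm_of_nonneg (by linarith)]
  have h2 := norm_log_sub_log_natCast_le hn (w := 2 * n - 1 + α)
    (by have := norm_sub_norm_le (2 * n - 1 : ℂ) (-α)
        rw [sub_neg_eq_add, norm_neg, hk] at this; linarith)
    (by have := norm_add_le (2 * n - 1 : ℂ) α
        rw [hk] at this; linarith)
  have := norm_add_le (digamma (2 * n - 1 + α) - log (2 * n - 1 + α))
    (log (2 * n - 1 + α) - ln n)
  rw [sub_add_sub_cancel] at this; linarith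

lemma norm_gammaRatio_sub_le : ∃ C : ℝ, 0 < C ∧ ∀ n : ℕ, 1 ≤ n → ∀ α : ℂ, 0 ≤ α.re → ‖α‖ ≤ 1 / 4 →
    ‖gammaRatio n α - (n : ℂ) ^ (-2 * α)‖ ≤ C * ‖α‖ := by
  obtain ⟨C, hC0, hC⟩ := norm_digamma_sub_log_natCast_le
  set D : ℝ := 2 * (2 * ‖log ((7 / (2 * π) : ℝ) : ℂ)‖ + 2 * C) with hD
  refine ⟨D, by positivity, fun n hn α h0 hα => ?_⟩
  have hn1 : (1 : ℝ) ≤ n := mod_cast hn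
  have hnC : (n : ℂ) ≠ 0 := mod_cast (by omega : n ≠ 0)
  set S : Set ℂ := {z : ℂ | 0 ≤ z.re} ∩ closedBall 0 (1 / 4) with hS
  have hconv : Convex ℝ S := (convex_halfSpace_re_ge 0).inter (convex_closedBall _ _)
  have hSn : ∀ z ∈ S, ‖z‖ ≤ 1 / 4 := fun z hz => by simpa using hz.2
  set Y : ℂ → ℂ := fun z => gammaRatio n z * (n : ℂ) ^ (2 * z) with hY
  have hder : ∀ z ∈ S, HasDerivWithinAt Y (Y z * (-2 * log ((7 / (2 * π) : ℝ) : ℂ) -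
      (digamma (2 * n - 1 + -z) - ln n) - (digamma (2 * n - 1 + z) - ln n))) S z := by
    intro z hz
    have hz4 := (abs_re_le_norm z).trans (hSn z hz)
    have h1 := hasDerivAt_gammaRatio hn (α := z) (by linarith)
    have h2 : HasDerivAt (fun z : ℂ => 2 * z) 2 z := by simpa using (hasDerivAt_id z).const_mul 2
    have h3 := h2.const_cpow (c := (n : ℂ)) (Or.inl hnC)
    refine ((h1.fun_mul h3).congr_deriv ?_).hasDerivWithinAt
    have : log (n : ℂ) = (ln n : ℂ) := by simp
    rw [this, hY]
    simp only
    ring_nf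
  have hYb : ∀ z ∈ S, ‖Y z‖ ≤ 2 := by
    intro z hz
    have h1 := norm_gammaRatio_le hn hz.1 ((re_le_norm z).trans (hSn z hz))
    rw [hY]
    simp only
    rw [norm_mul, norm_natCast_cpow_of_pos (by omega)]
    have e : (n : ℝ) ^ (2 * z).re = (n : ℝ) ^ (2 * z.re) := by simp
    rw [e]
    calc _ ≤ 2 * (n : ℝ) ^ (-(2 * z.re)) * (n : ℝ) ^ (2 * z.re) :=
          mul_le_mul_of_nonneg_right h1 (by positivity)
      _ = 2 := by rw [mul_assoc, ← rpow_add (by linarith), neg_add_cancel, rpow_zero, mul_one]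
  have hmv := hconv.norm_image_sub_le_of_norm_hasDerivWithin_le (C := D) hder (fun z hz => by
    rw [norm_mul]
    have h1 := hC n hn z (hSn z hz)
    have h2 := hC n hn (-z) (by rw [norm_neg]; exact hSn z hz)
    have h3 : ‖-2 * log ((7 / (2 * π) : ℝ) : ℂ) -
      (digamma (2 * n - 1 + -z) - ln n) - (digamma (2 * n - 1 + z) - ln n)‖ ≤
        2 * ‖log ((7 / (2 * π) : ℝ) : ℂ)‖ + 2 * C := by
      refine (norm_sub_le _ _).trans ?_
      have h4 := norm_sub_le (-2 * log ((7 / (2 * π) : ℝ) : ℂ))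
        (digamma (2 * n - 1 + -z) - ln n)
      rw [norm_mul, norm_neg, show ‖(2 : ℂ)‖ = 2 by simp] at h4
      linarith
    rw [hD]; exact mul_le_mul (hYb z hz) h3 (norm_nonneg _) (by norm_num))
    (x := 0) (y := α) ⟨by simp, by simp⟩ ⟨h0, by simpa using hα⟩
  have hY0 : Y 0 = 1 := by simp [hY, gammaRatio_zero hn]
  rw [hY0, sub_zero] at hmv
  have e : gammaRatio n α - (n : ℂ) ^ (-2 * α) = (n : ℂ) ^ (-2 * α) * (Y α - 1) := by
    have : (n : ℂ) ^ (-2 * α) * (n : ℂ) ^ (2 * α) = 1 := by rw [← cpow_add _ _ hnC]; simp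
    rw [hY]
    simp only
    linear_combination (-gammaRatio n α) * this
  rw [e, norm_mul, norm_natCast_cpow_of_pos (by omega)]
  refine (mul_le_of_le_one_left (norm_nonneg _) ?_).trans hmv
  refine Real.rpow_le_one_of_one_le_of_nonpos hn1 ?_
  simp; linarith

/-! ### The main terms on the right half plane -/

/-- The entire function `(s - 1) ζ(s)`. -/
def zetaReg : ℂ → ℂ := LFunctionTrivChar₁ 1

lemma differentiable_zetaReg : Differentiable ℂ zetaReg :=
  DirichletCharacter.differentiable_LFunctionTrivChar₁ 1

lemma zetaReg_of_ne {s : ℂ} (hs : s ≠ 1) : zetaReg s = (s - 1) * riemannZeta s := by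
  rw [zetaReg, LFunctionTrivChar₁, Function.update_of_ne hs, LFunctionTrivChar, LFunction_modOne_eq]

lemma zetaReg_one : zetaReg 1 = 1 := by
  rw [zetaReg, LFunctionTrivChar₁, Function.update_self]; simp

lemma zetaReg_ne_zero {s : ℂ} (hs : 1 ≤ s.re) : zetaReg s ≠ 0 := by
  by_cases h : s = 1
  · rw [h, zetaReg_one]; exact one_ne_zero
  · rw [zetaReg_of_ne h]
    exact mul_ne_zero (sub_ne_zero.2 h) (riemannZeta_ne_zero_of_one_le_re hs)

lemma logDeriv_zetaReg {s : ℂ} (hs : s ≠ 1) (hre : 1 ≤ s.re) :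
    logDeriv zetaReg s = 1 / (s - 1) + deriv riemannZeta s / riemannZeta s := by
  have hev : zetaReg =ᶠ[nhds s] fun s => (s - 1) * riemannZeta s := by
    filter_upwards [isOpen_ne.mem_nhds hs] with z hz using zetaReg_of_ne hz
  have hd : DifferentiableAt ℂ (fun s : ℂ => s - 1) s := by fun_prop
  rw [logDeriv_apply, hev.deriv_eq, hev.eq_of_nhds,
    deriv_fun_mul hd (differentiableAt_riemannZeta hs), deriv_sub_const, deriv_id'']
  have h1 := sub_ne_zero.2 hs
  have h2 := riemannZeta_ne_zero_of_one_le_re hre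
  field_simp

lemma zetaInv_eq (s : ℂ) : zetaInv s = (s - 1) / zetaReg s := by
  rw [zetaInv]
  split_ifs with h
  · simp [h]
  · rw [zetaReg_of_ne h]
    have := sub_ne_zero.2 h
    rw [div_mul_eq_div_div, div_self this, one_div]

lemma chiNegSeven_ne_one : chiNegSeven ≠ 1 := by
  intro h
  have h3 := chiNegSeven_natCast 3
  rw [h, MulChar.one_apply (by decide), legendreSym_seven] at h3
  norm_num at h3

lemma chiNegSeven_sq : chiNegSeven ^ 2 = 1 := by
  ext a; rw [MulChar.pow_apply_coe, MulChar.one_apply_coe]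
  simp only [chiNegSeven, MulChar.ringHomComp_apply]
  rw [← map_pow, quadraticChar_sq_one a.ne_zero, map_one]

lemma differentiable_dirichletL : Differentiable ℂ dirichletL :=
  DirichletCharacter.differentiable_LFunction chiNegSeven_ne_one

lemma dirichletL_ne_zero {s : ℂ} (hs : 1 ≤ s.re) : dirichletL s ≠ 0 :=
  DirichletCharacter.LFunction_ne_zero_of_one_le_re _ (Or.inl chiNegSeven_ne_one) hs

/-- A function on a vertical strip that is bounded by a power for large imaginary part. -/
lemma exists_bound_strip {F : ℂ → ℂ} {a b T r C : ℝ} (hr : 0 ≤ r)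
    (hc : ContinuousOn F {z | a ≤ z.re ∧ z.re ≤ b})
    (hb : ∀ z : ℂ, a ≤ z.re → z.re ≤ b → T ≤ |z.im| → ‖F z‖ ≤ C * (1 + |z.im|) ^ r) :
    ∃ C' : ℝ, 0 < C' ∧ ∀ z : ℂ, a ≤ z.re → z.re ≤ b → ‖F z‖ ≤ C' * (1 + |z.im|) ^ r := by
  have hK : IsCompact (Set.Icc a b ×ℂ Set.Icc (-T) T) := isCompact_Icc.reProdIm isCompact_Icc
  obtain ⟨C₁, hC₁⟩ := hK.exists_bound_of_continuousOn (hc.mono fun z hz => (mem_reProdIm.1 hz).1)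
  refine ⟨max (max C₁ C) 1, lt_max_of_lt_right one_pos, fun z h1 h2 => ?_⟩
  have hp : 1 ≤ (1 + |z.im|) ^ r := one_le_rpow (by linarith [abs_nonneg z.im]) hr
  by_cases hT : T ≤ |z.im|
  · refine (hb z h1 h2 hT).trans (mul_le_mul_of_nonneg_right ?_ (by linarith))
    exact (le_max_right _ _).trans (le_max_left _ _)
  · push Not at hT
    have h3 := hC₁ z (mem_reProdIm.2 ⟨⟨h1, h2⟩, abs_le.1 hT.le⟩)
    have h4 : C₁ ≤ max (max C₁ C) 1 := (le_max_left _ _).trans (le_max_left _ _)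
    have h5 : (0 : ℝ) < max (max C₁ C) 1 := lt_max_of_lt_right one_pos
    nlinarith

/-- The part of the logarithmic derivative of the first main term that is regular at `0`. -/
def densityReg (α : ℂ) : ℂ :=
  -logDeriv zetaReg (1 + 2 * α) + logDeriv dirichletL (1 + 2 * α) + arithADiag α

/-- The derivative of the first main term on the diagonal. -/
def densityMain (α : ℂ) : ℂ := -(deriv riemannZeta (1 + 2 * α) / riemannZeta (1 + 2 * α)) +
      deriv dirichletL (1 + 2 * α) / dirichletL (1 + 2 * α) + arithADiag α

lemma densityMain_eq {α : ℂ} (hα : α ≠ 0) (h0 : 0 ≤ α.re) :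
    densityMain α = 1 / (2 * α) + densityReg α := by
  have h1 : 1 + 2 * α ≠ 1 := by simpa using hα
  rw [densityMain, densityReg, logDeriv_zetaReg h1 (by simp; linarith), logDeriv_apply,
    add_sub_cancel_left]
  ring

lemma differentiableAt_densityReg {α : ℂ} (h0 : 0 ≤ α.re) :
    DifferentiableAt ℂ densityReg α := by
  have hlin : DifferentiableAt ℂ (fun α : ℂ => 1 + 2 * α) α := by fun_prop
  have hre : 1 ≤ (1 + 2 * α).re := by simp; linarith
  have hlog : ∀ F : ℂ → ℂ, Differentiable ℂ F → F (1 + 2 * α) ≠ 0 →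
      DifferentiableAt ℂ (fun α : ℂ => logDeriv F (1 + 2 * α)) α := fun F hF hne => by
    have hd : Differentiable ℂ (deriv F) := hF.deriv
    have : DifferentiableAt ℂ (logDeriv F) (1 + 2 * α) := (hd _).div (hF _) hne
    exact this.comp α hlin
  have hS : IsOpen {r : ℂ | -(1 / 16) < r.re} := isOpen_lt continuous_const continuous_re
  have hA : DifferentiableAt ℂ arithADiag α :=
    differentiableOn_arithADiag.differentiableAt (hS.mem_nhds (by
      simp only [mem_ofPred_eq]; linarith))
  exact ((hlog _ differentiable_zetaReg (zetaReg_ne_zero hre)).neg.add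
    (hlog _ differentiable_dirichletL (dirichletL_ne_zero hre))).add hA

lemma norm_one_add_two_mul_le {α : ℂ} (h0 : |α.re| ≤ 2) :
    ‖1 + 2 * α‖ ≤ 5 * (1 + |α.im|) := by
  refine (norm_add_le _ _).trans ?_
  rw [norm_one, norm_mul, show ‖(2 : ℂ)‖ = 2 by simp]
  have := norm_le_abs_re_add_abs_im α
  linarith [abs_nonneg α.im]

lemma rpow_five_mul_le {x r : ℝ} (hx : 0 ≤ x) (hr1 : r ≤ 1) :
    (5 * x) ^ r ≤ 5 * x ^ r := by
  rw [mul_rpow (by norm_num) hx]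
  refine mul_le_mul_of_nonneg_right ?_ (by positivity)
  conv_rhs => rw [← rpow_one 5]
  exact rpow_le_rpow_of_exponent_le (by norm_num) hr1

lemma norm_densityReg_le : ∃ C : ℝ, 0 < C ∧ ∀ α : ℂ, 0 ≤ α.re → α.re ≤ 2 →
    ‖densityReg α‖ ≤ C * (1 + |α.im|) ^ (1 / 2 : ℝ) := by
  obtain ⟨C₁, hC₁0, hC₁⟩ := norm_logDeriv_LFunction_le (χ := (1 : DirichletCharacter ℂ 1)) (by simp)
  obtain ⟨C₂, hC₂0, hC₂⟩ := norm_logDeriv_LFunction_le chiNegSeven_sq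
  obtain ⟨C₃, hC₃⟩ := norm_arithADiag_le
  rw [LFunction_modOne_eq] at hC₁
  refine exists_bound_strip (C := 1 + C₁ * 5 + C₂ * 5 + C₃) (T := 1) (by norm_num)
    (fun α hα => (differentiableAt_densityReg hα.1).continuousAt.continuousWithinAt)
    fun α h0 h2 him => ?_
  have hre : 1 ≤ (1 + 2 * α).re := by simp; linarith
  have hre5 : (1 + 2 * α).re ≤ 5 := by simp; linarith
  have him' : 1 ≤ |(1 + 2 * α).im| := by simp; linarith
  have hne : 1 + 2 * α ≠ 1 := by intro h; rw [h] at him'; norm_num at him'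
  have hP : 1 ≤ (1 + |α.im|) ^ (1 / 2 : ℝ) :=
    one_le_rpow (by linarith [abs_nonneg α.im]) (by norm_num)
  have hw : ‖1 + 2 * α‖ ^ (1 / 2 : ℝ) ≤ 5 * (1 + |α.im|) ^ (1 / 2 : ℝ) :=
    (rpow_le_rpow (norm_nonneg _) (norm_one_add_two_mul_le (abs_le.2 ⟨by linarith, h2⟩))
      (by norm_num)).trans (rpow_five_mul_le (by positivity) (by norm_num))
  have hinv : ‖1 / (1 + 2 * α - 1)‖ ≤ 1 := by
    rw [norm_div, norm_one, div_le_one (by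
      rw [add_sub_cancel_left]; have := abs_im_le_norm (2 * α)
      simp only [mul_im, re_ofNat, im_ofNat, zero_mul, add_zero, abs_mul, abs_two] at this
      linarith)]
    have := abs_im_le_norm (1 + 2 * α - 1)
    rw [sub_im, one_im, sub_zero] at this; linarith
  have hA := hC₁ _ hre hre5 him'
  have hB := hC₂ _ hre hre5 him'
  have hD := hC₃ α (by linarith)
  rw [densityReg, logDeriv_zetaReg hne hre, logDeriv_apply]
  change ‖_ + deriv dirichletL _ / dirichletL _ + _‖ ≤ _
  have hB' : ‖deriv dirichletL (1 + 2 * α) / dirichletL (1 + 2 * α)‖ ≤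
      C₂ * ‖1 + 2 * α‖ ^ (1 / 2 : ℝ) := hB
  have hC30 : 0 ≤ C₃ := (norm_nonneg _).trans hD
  refine (norm_add_le _ _).trans ((add_le_add_left (norm_add_le _ _) _).trans ?_)
  rw [norm_neg]
  have := norm_add_le (1 / (1 + 2 * α - 1)) (deriv riemannZeta (1 + 2 * α) / riemannZeta (1 + 2 * α))
  nlinarith

/-- The second main term is `X_n(α) / (2 α)` times this function. -/
def swapFactor (α : ℂ) : ℂ :=
  zetaReg (1 + 2 * α) * dirichletL (1 - 2 * α) / dirichletL 1 * arithB 0 (2 * α)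

lemma swapFactor_zero : swapFactor 0 = 1 := by
  have : dirichletL 1 ≠ 0 := dirichletL_ne_zero (by simp)
  simp [swapFactor, zetaReg_one, arithB_self, this]

lemma differentiableOn_swapFactor : DifferentiableOn ℂ swapFactor {α : ℂ | -(1 / 16) < α.re} := by
  have hS : IsOpen {r : ℂ | -(1 / 16) < r.re} := isOpen_lt continuous_const continuous_re
  have hB : DifferentiableOn ℂ (fun α : ℂ => arithB 0 (2 * α)) {α : ℂ | -(1 / 16) < α.re} :=
    differentiableOn_arithB hS (u := fun _ => 0) (v := fun α => 2 * α) (by fun_prop) (by fun_prop)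
      (fun z _ => by simp) (fun z hz => by simp only [mem_ofPred_eq] at hz; simp; linarith)
  refine DifferentiableOn.mul (Differentiable.differentiableOn ?_) hB
  exact ((differentiable_zetaReg.comp (by fun_prop)).mul
    (differentiable_dirichletL.comp (by fun_prop))).div_const _

lemma norm_swapFactor_le : ∃ C : ℝ, 0 < C ∧ ∀ α : ℂ, 0 ≤ α.re → α.re ≤ 1 / 4 →
    ‖swapFactor α‖ ≤ C * (1 + |α.im|) ^ (17 / 10 : ℝ) := by
  obtain ⟨C₁, hC₁0, hC₁⟩ := norm_LFunction_le (1 : DirichletCharacter ℂ 1) (σ₀ := 1)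
    (lam := 1 / 10) (by norm_num) (by norm_num) (by norm_num) (by norm_num)
  obtain ⟨C₂, hC₂0, hC₂⟩ := norm_LFunction_le chiNegSeven (σ₀ := 1 / 2)
    (lam := 6 / 10) (by norm_num) (by norm_num) (by norm_num) (by norm_num)
  obtain ⟨C₃, hC₃⟩ := norm_arithB_le
  rw [LFunction_modOne_eq] at hC₁
  have hL1 : 0 < ‖dirichletL 1‖ := norm_pos_iff.2 (dirichletL_ne_zero (by simp))
  have hS : IsOpen {r : ℂ | -(1 / 16) < r.re} := isOpen_lt continuous_const continuous_re
  refine exists_bound_strip (C := 10 * (C₁ * 5) * (C₂ * 5) / ‖dirichletL 1‖ * C₃) (T := 1)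
    (by norm_num) (differentiableOn_swapFactor.continuousOn.mono fun α hα => by
      simp only [mem_ofPred_eq] at hα ⊢; linarith [hα.1]) fun α h0 h2 him => ?_
  have hP0 : 0 < 1 + |α.im| := by linarith [abs_nonneg α.im]
  have him' : 1 ≤ |(1 + 2 * α).im| := by simp; linarith
  have hne : 1 + 2 * α ≠ 1 := by intro h; rw [h] at him'; norm_num at him'
  have habs : |α.re| ≤ 2 := abs_le.2 ⟨by linarith, by linarith⟩
  have hw := norm_one_add_two_mul_le habs
  have hw' : ‖1 - 2 * α‖ ≤ 5 * (1 + |α.im|) := by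
    have := norm_one_add_two_mul_le (α := -α) (by rwa [neg_re, abs_neg])
    rwa [mul_neg, ← sub_eq_add_neg, neg_im, abs_neg] at this
  have h1 := hC₁ (1 + 2 * α) (by simp; linarith) (by linarith)
  have h2' : ‖dirichletL (1 - 2 * α)‖ ≤ C₂ * ‖1 - 2 * α‖ ^ (6 / 10 : ℝ) :=
    hC₂ (1 - 2 * α) (by simp; linarith) (by simp; linarith)
  have h3 := hC₃ 0 (2 * α) (by simp) (by simp; linarith)
  have hp1 : ‖1 + 2 * α‖ ^ (1 / 10 : ℝ) ≤ 5 * (1 + |α.im|) ^ (1 / 10 : ℝ) :=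
    (rpow_le_rpow (norm_nonneg _) hw (by norm_num)).trans
      (rpow_five_mul_le (by positivity) (by norm_num))
  have hp2 : ‖1 - 2 * α‖ ^ (6 / 10 : ℝ) ≤ 5 * (1 + |α.im|) ^ (6 / 10 : ℝ) :=
    (rpow_le_rpow (norm_nonneg _) hw' (by norm_num)).trans
      (rpow_five_mul_le (by positivity) (by norm_num))
  have hz : ‖zetaReg (1 + 2 * α)‖ ≤ (10 * (1 + |α.im|)) * (C₁ * (5 * (1 + |α.im|) ^ (1 / 10 : ℝ))) := by
    rw [zetaReg_of_ne hne, norm_mul, add_sub_cancel_left]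
    refine mul_le_mul ?_ (h1.trans (mul_le_mul_of_nonneg_left hp1 hC₁0.le)) (norm_nonneg _)
      (by positivity)
    rw [norm_mul, show ‖(2 : ℂ)‖ = 2 by simp]
    have := norm_le_abs_re_add_abs_im α
    linarith
  have hL := h2'.trans (mul_le_mul_of_nonneg_left hp2 hC₂0.le)
  have hC30 : 0 ≤ C₃ := (norm_nonneg _).trans h3
  rw [swapFactor, norm_mul, norm_div, norm_mul]
  have e : (1 + |α.im|) ^ (17 / 10 : ℝ) =
      (1 + |α.im|) * (1 + |α.im|) ^ (1 / 10 : ℝ) * (1 + |α.im|) ^ (6 / 10 : ℝ) := by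
    conv_rhs => rw [← rpow_one (1 + |α.im|)]
    rw [← rpow_mul hP0.le, ← rpow_mul hP0.le, ← rpow_add hP0, ← rpow_add hP0]; norm_num
  calc ‖zetaReg (1 + 2 * α)‖ * ‖dirichletL (1 - 2 * α)‖ / ‖dirichletL 1‖ * ‖arithB 0 (2 * α)‖
      ≤ (10 * (1 + |α.im|)) * (C₁ * (5 * (1 + |α.im|) ^ (1 / 10 : ℝ))) *
        (C₂ * (5 * (1 + |α.im|) ^ (6 / 10 : ℝ))) / ‖dirichletL 1‖ * C₃ := by
        refine mul_le_mul ?_ h3 (norm_nonneg _) (by positivity)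
        exact div_le_div_of_nonneg_right (mul_le_mul hz hL (norm_nonneg _) (by positivity)) hL1.le
    _ = _ := by rw [e]; ring

/-- The second main term, differentiated on the diagonal. -/
lemma gammaRatio_mul_eq {n : ℕ} {α : ℂ} (hα : α ≠ 0) (h1 : α.re ≤ 1 / 4) :
    gammaRatio n α * (riemannZeta (1 + 2 * α) * dirichletL (1 - 2 * α) / dirichletL 1) *
      arithA (-α) α = gammaRatio n α * swapFactor α / (2 * α) := by
  have hne : 1 + 2 * α ≠ 1 := by simpa using hα
  rw [arithA_eq_arithB (by simp; linarith) (by simp), neg_add_cancel, swapFactor,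
    zetaReg_of_ne hne, add_sub_cancel_left]
  field_simp

/-- The full main term of `L'/L`, regular at `0`. -/
def densityFull (n : ℕ) (α : ℂ) : ℂ :=
  densityReg α - (1 / 2) * dslope (fun α => gammaRatio n α * swapFactor α) 0 α

lemma densityFull_of_ne {n : ℕ} (hn : 1 ≤ n) {α : ℂ} (hα : α ≠ 0) :
    densityFull n α = densityReg α + (1 - gammaRatio n α * swapFactor α) / (2 * α) := by
  rw [densityFull, dslope_of_ne _ hα, slope_def_field, gammaRatio_zero hn, swapFactor_zero]
  field_simp; ring

lemma densityFull_eq_densityMain {n : ℕ} (hn : 1 ≤ n) {α : ℂ} (hα : α ≠ 0) (h0 : 0 ≤ α.re) :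
    densityFull n α = densityMain α - gammaRatio n α * swapFactor α / (2 * α) := by
  rw [densityFull_of_ne hn hα, densityMain_eq hα h0]; ring

lemma differentiableAt_densityFull {n : ℕ} (hn : 1 ≤ n) {α : ℂ} (h0 : 0 ≤ α.re)
    (h1 : α.re < 1) : DifferentiableAt ℂ (densityFull n) α := by
  set S : Set ℂ := {α : ℂ | -(1 / 16) < α.re} ∩ {α : ℂ | α.re < 1} with hSdef
  have hS : IsOpen S := (isOpen_lt continuous_const continuous_re).inter
    (isOpen_lt continuous_re continuous_const)
  have hd : DifferentiableOn ℂ (fun α => gammaRatio n α * swapFactor α) S := fun z hz => by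
    refine DifferentiableWithinAt.mul ?_ ((differentiableOn_swapFactor z hz.1).mono
      Set.inter_subset_left)
    have h3 := hz.1
    simp only [mem_ofPred_eq] at h3
    exact (hasDerivAt_gammaRatio hn (abs_lt.2 ⟨by linarith, hz.2⟩)).differentiableAt
      |>.differentiableWithinAt
  have hsl : DifferentiableOn ℂ (dslope (fun α => gammaRatio n α * swapFactor α) 0) S :=
    (differentiableOn_dslope (hS.mem_nhds ⟨by
      simp only [mem_ofPred_eq, zero_re]; norm_num, by simp⟩)).2 hd
  refine (differentiableAt_densityReg h0).sub (DifferentiableAt.const_mul ?_ _)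
  exact hsl.differentiableAt (hS.mem_nhds ⟨by simp only [mem_ofPred_eq]; linarith, h1⟩)

lemma norm_densityFull_le {n : ℕ} (hn : 1 ≤ n) : ∃ C : ℝ, 0 < C ∧ ∀ α : ℂ, 0 ≤ α.re →
    α.re ≤ 1 / 4 → ‖densityFull n α‖ ≤ C * (1 + |α.im|) ^ (7 / 10 : ℝ) := by
  obtain ⟨C₁, hC₁0, hC₁⟩ := norm_densityReg_le
  obtain ⟨C₂, hC₂0, hC₂⟩ := norm_swapFactor_le
  refine exists_bound_strip (C := C₁ + 1 + 2 * C₂) (T := 1) (by norm_num)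
    (fun α hα => (differentiableAt_densityFull hn hα.1
      (by linarith [hα.2])).continuousAt.continuousWithinAt) fun α h0 h1 him => ?_
  have hP0 : 0 < 1 + |α.im| := by linarith [abs_nonneg α.im]
  have hP1 : 1 ≤ 1 + |α.im| := by linarith [abs_nonneg α.im]
  have hα : α ≠ 0 := by rintro rfl; norm_num at him
  have hn1 : (1 : ℝ) ≤ n := mod_cast hn
  rw [densityFull_of_ne hn hα]
  have hreg := (hC₁ α h0 (by linarith)).trans (mul_le_mul_of_nonneg_left
    (rpow_le_rpow_of_exponent_le hP1 (by norm_num : (1 / 2 : ℝ) ≤ 7 / 10)) hC₁0.le)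
  have hX : ‖gammaRatio n α‖ ≤ 2 := by
    refine (norm_gammaRatio_le hn h0 h1).trans ?_
    have := Real.rpow_le_one_of_one_le_of_nonpos hn1 (by linarith : -(2 * α.re) ≤ 0)
    linarith
  have hαn : 1 + |α.im| ≤ ‖2 * α‖ := by
    rw [norm_mul, show ‖(2 : ℂ)‖ = 2 by simp]
    linarith [abs_im_le_norm α]
  have hP7 : 1 ≤ (1 + |α.im|) ^ (7 / 10 : ℝ) := one_le_rpow hP1 (by norm_num)
  have e : (1 + |α.im|) ^ (17 / 10 : ℝ) = (1 + |α.im|) ^ (7 / 10 : ℝ) * (1 + |α.im|) := by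
    conv_rhs => rw [← rpow_one (1 + |α.im|)]
    rw [← rpow_mul hP0.le, ← rpow_add hP0]; norm_num
  have h3 : ‖(1 - gammaRatio n α * swapFactor α) / (2 * α)‖ ≤
      (1 + 2 * C₂) * (1 + |α.im|) ^ (7 / 10 : ℝ) := by
    rw [norm_div, div_le_iff₀ (hP0.trans_le hαn)]
    refine (norm_sub_le _ _).trans ?_
    rw [norm_one, norm_mul]
    have h4 := hC₂ α h0 h1
    rw [e] at h4
    have h5 : ‖gammaRatio n α‖ * ‖swapFactor α‖ ≤
        2 * (C₂ * ((1 + |α.im|) ^ (7 / 10 : ℝ) * (1 + |α.im|))) :=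
      mul_le_mul hX h4 (norm_nonneg _) (by norm_num)
    calc 1 + ‖gammaRatio n α‖ * ‖swapFactor α‖
        ≤ (1 + 2 * C₂) * (1 + |α.im|) ^ (7 / 10 : ℝ) * (1 + |α.im|) := by nlinarith
      _ ≤ _ := mul_le_mul_of_nonneg_left hαn (by positivity)
  refine (norm_add_le _ _).trans ?_
  linarith

lemma densityTerm_eq {n : ℕ} (hn : 1 ≤ n) {t : ℝ} (ht : t ≠ 0) :
    densityTerm n t = 2 * ln (7 / (2 * π)) +
      digamma (2 * n - 1 + I * t) + digamma (2 * n - 1 - I * t) + 2 * densityFull n (I * t) := by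
  have hα : I * (t : ℂ) ≠ 0 := mul_ne_zero I_ne_zero (ofReal_ne_zero.2 ht)
  have hre : (I * (t : ℂ)).re = 0 := by simp
  rw [densityFull_eq_densityMain hn hα hre.ge, ← gammaRatio_mul_eq hα (by rw [hre]; norm_num),
    densityTerm, densityMain, mul_assoc 2 I (t : ℂ)]

/-! ### The completed `L`-functions and their zeros -/

lemma Gamma_weight_ne_zero {n : ℕ} (hn : 1 ≤ n) {z : ℂ} (hz : -1 < z.re) :
    Gamma (2 * n - 1 + z) ≠ 0 := by
  refine Gamma_ne_zero_of_re_pos ?_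
  have h1 : (1 : ℝ) ≤ n := mod_cast hn
  simp; linarith

lemma xi_eq_zero_iff {n : ℕ} (hn : 1 ≤ n) {z : ℂ} (hz : -1 < z.re) :
    xi n z = 0 ↔ familyL n (1 / 2 + z) = 0 := by
  rw [xi_eq_familyL hn (Gamma_weight_ne_zero hn hz), mul_eq_zero, mul_eq_zero, cpow_eq_zero_iff]
  simp only [two_pi_div_seven_ne, Gamma_weight_ne_zero hn hz, false_and, false_or]

lemma xi_two_ne_zero {n : ℕ} (hn : 1 ≤ n) : xi n 2 ≠ 0 := by
  rw [Ne, xi_eq_zero_iff hn (by norm_num)]; exact familyL_ne_zero hn (by norm_num)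

lemma abs_re_le_of_xi_eq_zero {n : ℕ} (hn : 1 ≤ n) {z : ℂ} (hz : xi n z = 0) :
    |z.re| ≤ 1 / 2 := by
  have key : ∀ w : ℂ, xi n w = 0 → w.re ≤ 1 / 2 := fun w hw => by
    by_contra h
    push Not at h
    rw [xi_eq_zero_iff hn (by linarith)] at hw; exact familyL_ne_zero hn (by simp; linarith) hw
  have h2 := key (-z) (by rwa [xi_neg hn])
  rw [neg_re] at h2
  exact abs_le.2 ⟨by linarith, key z hz⟩

lemma analyticOrderNatAt_xi {n : ℕ} (hn : 1 ≤ n) {z : ℂ} (hz : -1 < z.re) :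
    ordAt (xi n) z = ordAt (familyL n) (1 / 2 + z) := by
  have hopen : IsOpen {z : ℂ | -1 < z.re} := isOpen_lt_re _
  set u : ℂ → ℂ := fun z => ((2 * π / 7 : ℝ) : ℂ) ^ (-(2 * n - 1 + z)) *
    Gamma (2 * n - 1 + z) with hu
  have hua : AnalyticAt ℂ u z := by
    refine (DifferentiableOn.analyticAt (s := {z : ℂ | -1 < z.re}) (fun w hw => ?_)
      (hopen.mem_nhds hz))
    refine (DifferentiableAt.mul ?_ ?_).differentiableWithinAt
    · have : DifferentiableAt ℂ (fun z : ℂ => -(2 * n - 1 + z)) w := by fun_prop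
      exact this.const_cpow (Or.inl two_pi_div_seven_ne)
    · refine DifferentiableAt.comp w (differentiableAt_Gamma _ fun m hm => ?_) (by fun_prop)
      have h1 : (1 : ℝ) ≤ n := mod_cast hn
      have h2 : (0 : ℝ) ≤ m := m.cast_nonneg
      have h3 := congrArg re hm
      simp only [mem_ofPred_eq] at hw
      simp at h3; linarith
  have hu0 : u z ≠ 0 := mul_ne_zero (by
    rw [Ne, cpow_eq_zero_iff]; exact fun h => two_pi_div_seven_ne h.1) (Gamma_weight_ne_zero hn hz)
  have hF : AnalyticAt ℂ (familyL n ∘ fun z => 1 / 2 + z) z :=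
    ((differentiable_familyL hn).comp (by fun_prop)).analyticAt z
  have hev : xi n =ᶠ[nhds z] u * (familyL n ∘ fun z => 1 / 2 + z) := by
    filter_upwards [hopen.mem_nhds hz] with w hw
    exact xi_eq_familyL hn (Gamma_weight_ne_zero hn hw)
  rw [analyticOrderNatAt, analyticOrderNatAt, analyticOrderAt_congr hev, analyticOrderAt_mul hua hF,
    hua.analyticOrderAt_eq_zero.2 hu0, zero_add, analyticOrderAt_comp_of_deriv_ne_zero (by fun_prop)]
  simp

lemma logDeriv_xi {n : ℕ} (hn : 1 ≤ n) {z : ℂ} (hz : -1 < z.re)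
    (hL : familyL n (1 / 2 + z) ≠ 0) :
    logDeriv (xi n) z = ln (7 / (2 * π)) + digamma (2 * n - 1 + z) +
      logDeriv (familyL n) (1 / 2 + z) := by
  have hopen : IsOpen {z : ℂ | -1 < z.re} := isOpen_lt_re _
  have hev : xi n =ᶠ[nhds z] fun z => ((2 * π / 7 : ℝ) : ℂ) ^ (-(2 * n - 1 + z)) *
      Gamma (2 * n - 1 + z) * familyL n (1 / 2 + z) := by
    filter_upwards [hopen.mem_nhds hz] with w hw
    exact xi_eq_familyL hn (Gamma_weight_ne_zero hn hw)
  have h1 : (1 : ℝ) ≤ n := mod_cast hn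
  have hG0 := Gamma_weight_ne_zero hn hz
  have hGd : DifferentiableAt ℂ Gamma (2 * n - 1 + z) := differentiableAt_Gamma _ fun m hm => by
    have h2 : (0 : ℝ) ≤ m := m.cast_nonneg
    have h3 := congrArg re hm
    simp at h3; linarith
  have hlin : HasDerivAt (fun z : ℂ => 2 * n - 1 + z) 1 z := (hasDerivAt_id z).const_add _
  have hG : HasDerivAt (fun z : ℂ => Gamma (2 * n - 1 + z)) (deriv Gamma (2 * n - 1 + z)) z := by
    exact (hGd.hasDerivAt.comp z hlin).congr_deriv (mul_one _)
  have hP := hlin.fun_neg.const_cpow (c := ((2 * π / 7 : ℝ) : ℂ)) (Or.inl two_pi_div_seven_ne)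
  have hlin2 : HasDerivAt (fun z : ℂ => 1 / 2 + z) 1 z := (hasDerivAt_id z).const_add _
  have hF : HasDerivAt (fun z : ℂ => familyL n (1 / 2 + z)) (deriv (familyL n) (1 / 2 + z)) z := by
    exact (((differentiable_familyL hn) (1 / 2 + z)).hasDerivAt.comp z hlin2).congr_deriv (mul_one _)
  have hd := (hP.fun_mul hG).fun_mul hF
  have hP0 : ((2 * π / 7 : ℝ) : ℂ) ^ (-(2 * n - 1 + z) : ℂ) ≠ 0 := by
    rw [Ne, cpow_eq_zero_iff]; exact fun h => two_pi_div_seven_ne h.1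
  have hlog : (ln (7 / (2 * π)) : ℂ) = -log ((2 * π / 7 : ℝ) : ℂ) := by
    rw [← ofReal_log (by positivity), ← ofReal_neg, ← Real.log_inv, inv_div]
  rw [logDeriv_apply, hev.deriv_eq, hev.eq_of_nhds, hd.deriv, logDeriv_apply, digamma_def,
    logDeriv_apply, hlog]
  generalize familyL n (1 / 2 + z) = u at *
  generalize Gamma (2 * n - 1 + z) = v at *
  generalize ((2 * π / 7 : ℝ) : ℂ) ^ (-(2 * n - 1 + z) : ℂ) = w at *
  field_simp

lemma norm_lamSeries_le {σ : ℝ} (hσ : 1 < σ) : ∃ C : ℝ, 0 < C ∧ ∀ k : ℕ, k ≠ 0 → ∀ s : ℂ,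
    s.re = σ → ‖lamSeries k s‖ ≤ C := by
  refine ⟨1 / 2 * ∑' x : QInt, ln (x.norm : ℝ) * ‖emb x‖ ^ (-(2 * σ)) + 1, ?_, ?_⟩
  · have : 0 ≤ ∑' x : QInt, ln (x.norm : ℝ) * ‖emb x‖ ^ (-(2 * σ)) :=
      tsum_nonneg fun x => mul_nonneg (log_norm_nonneg x) (by positivity)
    linarith
  · intro k hk s hs
    rw [lamSeries, norm_mul, show ‖(1 / 2 : ℂ)‖ = 1 / 2 by norm_num]
    have h := tsum_of_norm_bounded (summable_log_mul_rpow (r := 2 * σ) (by linarith)).hasSum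
      (f := fun x : QInt => (lamR x : ℂ) * hterm k s x) fun x => by
        rw [norm_mul, norm_real, Real.norm_of_nonneg (lamR_nonneg x)]
        have := norm_hterm_le hk s x
        rw [hs] at this; exact mul_le_mul (lamR_le x) this (norm_nonneg _) (log_norm_nonneg x)
    linarith

lemma norm_digamma_weight_le : ∃ C : ℝ, 0 < C ∧ ∀ n : ℕ, 1 ≤ n → ∀ z : ℂ, 0 ≤ z.re → z.re ≤ 2 →
    ‖digamma (2 * n - 1 + z)‖ ≤ C * (1 + ln n) * (1 + |z.im|) ^ (1 / 8 : ℝ) := by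
  obtain ⟨C, hC0, hC⟩ := norm_digamma_sub_log_le
  refine ⟨C + 20, by linarith, fun n hn z h0 h2 => ?_⟩
  have hn1 : (1 : ℝ) ≤ n := mod_cast hn
  have hl0 : 0 ≤ ln n := log_nonneg hn1
  have hP : 1 ≤ (1 + |z.im|) ^ (1 / 8 : ℝ) :=
    one_le_rpow (by linarith [abs_nonneg z.im]) (by norm_num)
  set w : ℂ := 2 * n - 1 + z with hw
  have hwre : 1 ≤ w.re := by rw [hw]; simp; linarith
  have hw1 : 1 ≤ ‖w‖ := hwre.trans (re_le_norm w)
  have hwle : ‖w‖ ≤ 4 * (n * (1 + |z.im|)) := by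
    refine (norm_le_abs_re_add_abs_im w).trans ?_
    have e1 : w.re = 2 * n - 1 + z.re := by rw [hw]; simp
    have e2 : w.im = z.im := by rw [hw]; simp
    rw [e2, abs_of_nonneg (by linarith), e1]
    nlinarith [abs_nonneg z.im]
  have hlog : ‖log w‖ ≤ 3.15 + (3 + ln n + 8 * (1 + |z.im|) ^ (1 / 8 : ℝ)) := by
    have h1 : ‖log w‖ ≤ |(log w).re| + |(log w).im| := norm_le_abs_re_add_abs_im _
    rw [log_re, log_im, abs_of_nonneg (log_nonneg hw1)] at h1
    have h3 : ln ‖w‖ ≤ ln (4 * (n * (1 + |z.im|))) := log_le_log (by linarith) hwle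
    rw [Real.log_mul (by norm_num) (by positivity), Real.log_mul (by positivity) (by positivity)] at h3
    have h4 : ln 4 ≤ 4 - 1 := Real.log_le_sub_one_of_pos (by norm_num)
    have h5 := log_le_rpow_div (x := 1 + |z.im|) (by positivity) (ε := 1 / 8) (by norm_num)
    have h6 := abs_arg_le_pi w
    have h7 := pi_lt_d2
    linarith
  have h := hC w (by linarith)
  have h3 : ‖digamma w‖ ≤ C + ‖log w‖ := by
    have := norm_add_le (digamma w - log w) (log w)
    rw [sub_add_cancel] at this; linarith
  have h4 : 1 + ln n ≤ (1 + ln n) * (1 + |z.im|) ^ (1 / 8 : ℝ) :=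
    le_mul_of_one_le_right (by linarith) hP
  have h5 : (1 + |z.im|) ^ (1 / 8 : ℝ) ≤ (1 + ln n) * (1 + |z.im|) ^ (1 / 8 : ℝ) :=
    le_mul_of_one_le_left (by linarith) (by linarith)
  rw [mul_assoc]; nlinarith

lemma differentiableAt_digamma_weight {n : ℕ} (hn : 1 ≤ n) {z : ℂ} (hz : -1 < z.re) :
    DifferentiableAt ℂ (fun z => digamma (2 * n - 1 + z)) z := by
  have hopen : IsOpen {w : ℂ | 0 < w.re} := isOpen_lt_re _
  have hG : DifferentiableOn ℂ Gamma {w : ℂ | 0 < w.re} := fun w hw =>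
    (differentiableAt_Gamma w fun m hm => by
      have h2 : (0 : ℝ) ≤ m := m.cast_nonneg
      simp only [mem_ofPred_eq] at hw
      rw [hm] at hw; simp at hw; linarith).differentiableWithinAt
  have h1 : (1 : ℝ) ≤ n := mod_cast hn
  have hw : 0 < (2 * n - 1 + z).re := by simp; linarith
  have hmem := hopen.mem_nhds hw
  have hd : DifferentiableAt ℂ digamma (2 * n - 1 + z) := by
    rw [digamma_def]
    exact ((hG.deriv hopen).differentiableAt hmem).div (hG.differentiableAt hmem)
      (Gamma_ne_zero_of_re_pos hw)
  exact hd.comp z (by fun_prop)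

lemma norm_logDeriv_xi_le : ∃ C : ℝ, 0 < C ∧ ∀ n : ℕ, 1 ≤ n → ∀ z : ℂ, z.re = 1 →
    ‖logDeriv (xi n) z‖ ≤ C * (1 + ln n) * (1 + |z.im|) ^ (1 / 8 : ℝ) := by
  obtain ⟨C₁, hC₁0, hC₁⟩ := norm_lamSeries_le (σ := 3 / 2) (by norm_num)
  obtain ⟨C₂, hC₂0, hC₂⟩ := norm_digamma_weight_le
  refine ⟨|ln (7 / (2 * π))| + C₂ + C₁, by positivity, fun n hn z hz => ?_⟩
  have hl0 : 0 ≤ ln n := log_nonneg (mod_cast hn)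
  have hP : 1 ≤ (1 + |z.im|) ^ (1 / 8 : ℝ) :=
    one_le_rpow (by linarith [abs_nonneg z.im]) (by norm_num)
  have hre : (1 / 2 + z).re = 3 / 2 := by simp [hz]; norm_num
  have hre' : 1 < (1 / 2 + z).re := by rw [hre]; norm_num
  rw [logDeriv_xi hn (by rw [hz]; norm_num) (familyL_ne_zero hn hre'), logDeriv_familyL hn hre']
  have h1 := hC₁ (4 * n - 3) (by omega) (1 / 2 + z) hre
  have h2 := hC₂ n hn z (by rw [hz]; norm_num) (by rw [hz]; norm_num)
  refine (norm_add_le _ _).trans ((add_le_add_left (norm_add_le _ _) _).trans ?_)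
  rw [norm_neg, norm_real, norm_eq_abs]
  have h3 : 1 ≤ (1 + ln n) * (1 + |z.im|) ^ (1 / 8 : ℝ) := by nlinarith
  have h4 : 0 ≤ |ln (7 / (2 * π))| := abs_nonneg _
  nlinarith

lemma evenEntire_xi {n : ℕ} (hn : 1 ≤ n) : EvenEntire (xi n) :=
  ⟨differentiable_xi hn, xi_neg hn, xi_growth hn, fun _ => abs_re_le_of_xi_eq_zero hn⟩

lemma summable_xi_zeros {n : ℕ} (hn : 1 ≤ n) : Summable fun ρ : zeroSet (xi n) =>
    (ordAt (xi n) ρ : ℝ) * (1 + ‖(ρ : ℂ)‖) ^ (-(5 / 4) : ℝ) := by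
  obtain ⟨C, -, hC⟩ := norm_logDeriv_xi_le
  exact (evenEntire_xi hn).summable_zeros_rpow fun t => by simpa using hC n hn (1 + I * t) (by simp)

/-- The ordinates of the zeros, in terms of the zeros of the completed `L`-function. -/
def ordinatesEquiv {n : ℕ} (hn : 1 ≤ n) : ordinates n ≃ zeroSet (xi n) where
  toFun γ := ⟨I * γ, (xi_eq_zero_iff hn (by have := abs_le.1 γ.2.1; simp; linarith)).2 γ.2.2⟩
  invFun ρ := ⟨-I * ρ, by
    have h := abs_re_le_of_xi_eq_zero hn ρ.2
    refine ⟨by simpa using h, ?_⟩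
    rw [← mul_assoc, mul_neg, I_mul_I, neg_neg, one_mul]
    exact (xi_eq_zero_iff hn (by linarith [(abs_le.1 h).1])).1 ρ.2⟩
  left_inv γ := by
    ext
    simp only
    rw [← mul_assoc, neg_mul, I_mul_I, neg_neg, one_mul]
  right_inv ρ := by
    ext
    simp only
    rw [← mul_assoc, mul_neg, I_mul_I, neg_neg, one_mul]

lemma ordinatesEquiv_coe {n : ℕ} (hn : 1 ≤ n) (γ : ordinates n) :
    (ordinatesEquiv hn γ : ℂ) = I * γ := rfl

lemma zeroMult_eq {n : ℕ} (hn : 1 ≤ n) (γ : ordinates n) :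
    zeroMult n γ = ordAt (xi n) (ordinatesEquiv hn γ : ℂ) := by
  rw [ordinatesEquiv_coe, analyticOrderNatAt_xi hn (by
    have := abs_le.1 γ.2.1; simp; linarith), zeroMult]

/-! ### The one-level density -/

lemma tendsto_log_natCast : Tendsto (fun N : ℕ => ln N) atTop atTop :=
  tendsto_log_atTop.comp tendsto_natCast_atTop_atTop

lemma sum_Icc_const {R : Type*} [Semiring R] (N : ℕ) (c : R) : ∑ _n ∈ Icc 1 N, c = N * c := by simp

lemma integrable_one_add_abs_rpow : Integrable fun t : ℝ => (1 + |t|) ^ (-(13 / 10) : ℝ) := by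
  simpa using integrable_one_add_norm (E := ℝ) (μ := volume) (r := 13 / 10) (by simp; norm_num)

/-- The even test functions, in a vertical strip instead of a horizontal one. -/
structure IsTest (g : ℂ → ℂ) : Prop where
  diff : DifferentiableOn ℂ g {z | |z.re| < 2}
  even : ∀ z : ℂ, |z.re| < 2 → g (-z) = g z
  decay : ∀ σ : ℝ, σ < 2 → ∃ C : ℝ, ∀ z : ℂ, |z.re| ≤ σ → ‖g z‖ ≤ C / (1 + z.im ^ 2)

lemma IsTest.shift {g F : ℂ → ℂ} (hg : IsTest g) {a b C r : ℝ} (ha : 0 ≤ a) (hab : a ≤ b)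
    (hb : b < 2) (hr : r < 1) (hF : ∀ z : ℂ, a ≤ z.re → z.re ≤ b → DifferentiableAt ℂ F z)
    (hC : ∀ z : ℂ, a ≤ z.re → z.re ≤ b → ‖F z‖ ≤ C * (1 + |z.im|) ^ r) :
    Integrable (fun t : ℝ => g (a + I * t) * F (a + I * t)) ∧
    Integrable (fun t : ℝ => g (b + I * t) * F (b + I * t)) ∧
    ∫ t : ℝ, g (a + I * t) * F (a + I * t) = ∫ t : ℝ, g (b + I * t) * F (b + I * t) := by
  obtain ⟨K, hK⟩ := hg.decay b hb
  have hopen : IsOpen {z : ℂ | |z.re| < 2} := isOpen_lt (continuous_abs.comp continuous_re)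
    continuous_const
  have hd : ∀ z : ℂ, a ≤ z.re → z.re ≤ b → DifferentiableAt ℂ (fun z => g z * F z) z :=
    fun z h1 h2 => (hg.diff.differentiableAt (hopen.mem_nhds
      (show |z.re| < 2 from abs_lt.2 ⟨by linarith, by linarith⟩))).mul (hF z h1 h2)
  have hbd : ∀ z : ℂ, a ≤ z.re → z.re ≤ b →
      ‖g z * F z‖ ≤ 2 * K * C * (1 + |z.im|) ^ (-(2 - r)) := fun z h1 h2 => by
    have hk := decay_of_div_one_add_sq (hK z (abs_le.2 ⟨by linarith, h2⟩))
    rw [norm_mul, show -(2 - r) = -2 + r by ring, rpow_add (by positivity)]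
    calc _ ≤ _ := mul_le_mul hk (hC z h1 h2) (norm_nonneg _) ((norm_nonneg _).trans hk)
      _ = _ := by ring
  have hc : ContinuousOn (fun z => g z * F z) {z | a ≤ z.re ∧ z.re ≤ b} :=
    fun z hz => (hd z hz.1 hz.2).continuousAt.continuousWithinAt
  have hi : ∀ σ ∈ Set.Icc a b, Integrable fun t : ℝ => g (σ + I * t) * F (σ + I * t) :=
    fun σ hσ => integrable_of_continuous_of_decay (C := 2 * K * C) (T := 0) (r := 2 - r)
      (continuous_line hσ hc) (by linarith)
      fun t _ => by simpa using hbd (σ + I * t) (by simpa using hσ.1) (by simpa using hσ.2)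
  exact ⟨hi a ⟨le_rfl, hab⟩, hi b ⟨hab, le_rfl⟩, integral_line_eq hab hc
    (fun z hz => (hd z hz.1.le hz.2.le).differentiableWithinAt) (C := 2 * K * C) (T := 0)
    (r := 2 - r) (by linarith) fun z h1 h2 _ => hbd z h1 h2⟩

lemma IsTest.norm_integral_le {g : ℂ → ℂ} (hg : IsTest g) {σ : ℝ} (h0 : 0 ≤ σ) (hσ : σ < 2) :
    ∃ K : ℝ, 0 < K ∧ ∀ (h : ℝ → ℂ) (C r : ℝ), 0 ≤ C → r ≤ 7 / 10 →
      (∀ t, ‖h t‖ ≤ C * (1 + |t|) ^ r) → ‖∫ t : ℝ, g (σ + I * t) * h t‖ ≤ K * C := by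
  obtain ⟨K, hK⟩ := hg.decay σ hσ
  have hI : 0 ≤ ∫ t : ℝ, (1 + |t|) ^ (-(13 / 10) : ℝ) := integral_nonneg fun t => by positivity
  refine ⟨2 * |K| * (∫ t : ℝ, (1 + |t|) ^ (-(13 / 10) : ℝ)) + 1, by positivity,
    fun h C r hC hr hb => ?_⟩
  have h1 : ∀ t : ℝ, ‖g (σ + I * t) * h t‖ ≤ 2 * |K| * C * (1 + |t|) ^ (-(13 / 10) : ℝ) := by
    intro t
    have hk : ‖g (σ + I * t)‖ ≤ 2 * |K| * (1 + |t|) ^ (-(2 : ℝ)) := by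
      have := decay_of_div_one_add_sq (y := t) (by
        simpa using hK (σ + I * t) (by simp [abs_of_nonneg h0]))
      refine this.trans ?_
      have := le_abs_self K
      gcongr
    have hb' : ‖h t‖ ≤ C * (1 + |t|) ^ (7 / 10 : ℝ) := (hb t).trans (by
      have : 1 ≤ 1 + |t| := by linarith [abs_nonneg t]
      gcongr)
    rw [norm_mul, show (-(13 / 10) : ℝ) = -2 + 7 / 10 by norm_num, rpow_add (by positivity)]
    calc _ ≤ _ := mul_le_mul hk hb' (norm_nonneg _) ((norm_nonneg _).trans hk)
      _ = _ := by ring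
  have h2 := norm_integral_le_of_norm_le (integrable_one_add_abs_rpow.const_mul (2 * |K| * C)) (ae_of_all _ h1)
  rw [integral_const_mul] at h2; nlinarith

/-- The contribution of the archimedean place and the conductor to `ξ' / ξ`. -/
def archPart (n : ℕ) (α : ℂ) : ℂ := ln (7 / (2 * π)) + digamma (2 * n - 1 + α)

lemma differentiableAt_archPart {n : ℕ} (hn : 1 ≤ n) {z : ℂ} (hz : -1 < z.re) :
    DifferentiableAt ℂ (archPart n) z :=
  (differentiableAt_digamma_weight hn hz).const_add _

lemma norm_archPart_le_log : ∃ C : ℝ, 0 < C ∧ ∀ n : ℕ, 1 ≤ n → ∀ z : ℂ, 0 ≤ z.re → z.re ≤ 2 →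
    ‖archPart n z‖ ≤ C * (1 + ln n) * (1 + |z.im|) ^ (7 / 10 : ℝ) := by
  obtain ⟨C, hC0, hC⟩ := norm_digamma_weight_le
  refine ⟨|ln (7 / (2 * π))| + C, by positivity, fun n hn z h0 h2 => ?_⟩
  have hl0 : 0 ≤ ln n := log_nonneg (mod_cast hn)
  have h1 : 1 ≤ 1 + |z.im| := by linarith [abs_nonneg z.im]
  have hP : 1 ≤ (1 + |z.im|) ^ (7 / 10 : ℝ) := one_le_rpow h1 (by norm_num)
  have hQ : C * (1 + ln n) * (1 + |z.im|) ^ (1 / 8 : ℝ) ≤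
      C * (1 + ln n) * (1 + |z.im|) ^ (7 / 10 : ℝ) :=
    mul_le_mul_of_nonneg_left (rpow_le_rpow_of_exponent_le h1 (by norm_num)) (by positivity)
  refine (norm_add_le _ _).trans ?_
  rw [norm_real, norm_eq_abs]
  have h3 : 1 ≤ (1 + ln n) * (1 + |z.im|) ^ (7 / 10 : ℝ) := by nlinarith
  have := hC n hn z h0 h2
  nlinarith [abs_nonneg (ln (7 / (2 * π)))]

lemma norm_archPart_le {n : ℕ} (hn : 1 ≤ n) : ∃ C : ℝ, 0 < C ∧ ∀ z : ℂ, 0 ≤ z.re → z.re ≤ 2 →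
    ‖archPart n z‖ ≤ C * (1 + |z.im|) ^ (7 / 10 : ℝ) := by
  obtain ⟨C, hC0, hC⟩ := norm_archPart_le_log
  have hl0 : 0 ≤ ln n := log_nonneg (mod_cast hn)
  exact ⟨_, by positivity, hC n hn⟩

lemma differentiableAt_densityMain {z : ℂ} (hz : 0 < z.re) : DifferentiableAt ℂ densityMain z := by
  have hz0 : z ≠ 0 := by rintro rfl; simp at hz
  have hopen : IsOpen {w : ℂ | 0 < w.re} := isOpen_lt_re _
  have hev : densityMain =ᶠ[nhds z] fun w => 1 / (2 * w) + densityReg w := by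
    filter_upwards [hopen.mem_nhds hz] with w hw
    exact densityMain_eq (by rintro rfl; simp at hw) (le_of_lt hw)
  refine DifferentiableAt.congr_of_eventuallyEq ?_ hev
  have := differentiableAt_densityReg hz.le
  have h2 : (2 : ℂ) * z ≠ 0 := by simpa using hz0
  fun_prop (disch := assumption)

lemma norm_densityMain_le : ∃ C : ℝ, 0 < C ∧ ∀ z : ℂ, 1 / 4 ≤ z.re → z.re ≤ 2 →
    ‖densityMain z‖ ≤ C * (1 + |z.im|) ^ (7 / 10 : ℝ) := by
  obtain ⟨C, hC0, hC⟩ := norm_densityReg_le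
  refine ⟨2 + C, by positivity, fun z h1 h2 => ?_⟩
  have h3 : 1 ≤ 1 + |z.im| := by linarith [abs_nonneg z.im]
  have hP : 1 ≤ (1 + |z.im|) ^ (7 / 10 : ℝ) := one_le_rpow h3 (by norm_num)
  have hQ : C * (1 + |z.im|) ^ (1 / 2 : ℝ) ≤ C * (1 + |z.im|) ^ (7 / 10 : ℝ) :=
    mul_le_mul_of_nonneg_left (rpow_le_rpow_of_exponent_le h3 (by norm_num)) hC0.le
  have hz : 1 / 4 ≤ ‖z‖ := h1.trans (re_le_norm z)
  have h4 : ‖1 / (2 * z)‖ ≤ 2 := by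
    rw [norm_div, norm_mul, norm_one, show ‖(2 : ℂ)‖ = 2 by norm_num, div_le_iff₀ (by positivity)]
    linarith
  rw [densityMain_eq (by rintro rfl; norm_num at hz) (by linarith)]
  have := hC z (by linarith) h2
  refine (norm_add_le _ _).trans ?_
  linarith

lemma IsTest.integral_density {g : ℂ → ℂ} (hg : IsTest g) {n : ℕ} (hn : 1 ≤ n) :
    Integrable (fun t : ℝ => g (I * t) * densityTerm n t) ∧
    ∫ t : ℝ, g (I * t) * densityTerm n t = 2 * ∫ t : ℝ,
      g ((1 / 4 : ℝ) + I * t) * (archPart n ((1 / 4 : ℝ) + I * t) +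
        densityFull n ((1 / 4 : ℝ) + I * t)) := by
  obtain ⟨C₁, hC₁0, hC₁⟩ := norm_archPart_le hn
  obtain ⟨C₂, hC₂0, hC₂⟩ := norm_densityFull_le hn
  obtain ⟨i1, -, e1⟩ := hg.shift (F := fun z => archPart n z + densityFull n z) (a := 0)
    (b := 1 / 4) (C := C₁ + C₂) (r := 7 / 10) le_rfl (by norm_num) (by norm_num) (by norm_num)
    (fun z h0 h1 => (differentiableAt_archPart hn (by linarith)).add
      (differentiableAt_densityFull hn h0 (by linarith)))
    (fun z h0 h1 => (norm_add_le _ _).trans (by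
      have := hC₁ z h0 (by linarith)
      have := hC₂ z h0 h1
      linarith))
  obtain ⟨i2, -, -⟩ := hg.shift (F := fun z => archPart n z) (a := 0)
    (b := 0) (C := C₁) (r := 7 / 10) le_rfl (by norm_num) (by norm_num) (by norm_num)
    (fun z h0 h1 => differentiableAt_archPart hn (by linarith))
    (fun z h0 h1 => hC₁ z h0 (by linarith))
  simp only [ofReal_zero, zero_add] at i1 e1 i2
  have i3 := i2.comp_neg
  have hg0 : ∀ t : ℝ, g (-(I * t)) = g (I * t) := fun t => hg.even _ (by simp)
  simp only [ofReal_neg, mul_neg, hg0] at i3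
  have hae : (fun t : ℝ => g (I * t) * densityTerm n t) =ᵐ[volume]
      fun t => 2 * (g (I * t) * (archPart n (I * t) + densityFull n (I * t))) +
        (g (I * t) * archPart n (-(I * t)) - g (I * t) * archPart n (I * t)) := by
    have h0 : ∀ᵐ t : ℝ, t ≠ 0 := by simp [ae_iff]
    filter_upwards [h0] with t ht
    rw [densityTerm_eq hn ht, archPart, archPart, sub_eq_add_neg (2 * (n : ℂ) - 1) (I * t)]; ring
  have hodd : ∫ t : ℝ, (g (I * t) * archPart n (-(I * t)) - g (I * t) * archPart n (I * t)) = 0 :=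
    integral_odd_eq_zero fun t => by simp only [ofReal_neg, mul_neg, neg_neg, hg0]; ring
  have i4 : Integrable fun t : ℝ => g (I * t) * archPart n (-(I * t)) -
    g (I * t) * archPart n (I * t) := i3.sub i2
  refine ⟨((i1.const_mul 2).add i4).congr hae.symm, ?_⟩
  rw [integral_congr_ae hae, integral_add (i1.const_mul 2) i4, hodd, add_zero,
    integral_const_mul, e1]

lemma IsTest.norm_integral_density_sub_le {g : ℂ → ℂ} (hg : IsTest g) :
    ∃ C : ℝ, 0 < C ∧ ∀ n : ℕ, 1 ≤ n →
    ‖(∫ t : ℝ, g ((19 / 10 : ℝ) + I * t) * (archPart n ((19 / 10 : ℝ) + I * t) +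
        densityMain ((19 / 10 : ℝ) + I * t))) - 1 / 2 * ∫ t : ℝ, g (I * t) * densityTerm n t‖
      ≤ C * (n : ℝ) ^ (-(1 / 2) : ℝ) := by
  obtain ⟨C₂, hC₂0, hC₂⟩ := norm_densityMain_le
  obtain ⟨C₃, hC₃0, hC₃⟩ := norm_swapFactor_le
  obtain ⟨K, hK0, hK⟩ := hg.norm_integral_le (σ := 1 / 4) (by norm_num) (by norm_num)
  refine ⟨K * (16 * C₃), by positivity, fun n hn => ?_⟩
  obtain ⟨C₁, hC₁0, hC₁⟩ := norm_archPart_le hn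
  obtain ⟨C₄, hC₄0, hC₄⟩ := norm_densityFull_le hn
  obtain ⟨i1, -, e1⟩ := hg.shift (F := fun z => archPart n z + densityMain z) (a := 1 / 4)
    (b := 19 / 10) (C := C₁ + C₂) (r := 7 / 10) (by norm_num) (by norm_num) (by norm_num)
    (by norm_num)
    (fun z h0 h1 => (differentiableAt_archPart hn (by linarith)).add
      (differentiableAt_densityMain (by linarith)))
    (fun z h0 h1 => (norm_add_le _ _).trans (by
      have := hC₁ z (by linarith) (by linarith)
      have := hC₂ z h0 (by linarith)
      linarith))
  obtain ⟨-, i2, -⟩ := hg.shift (F := fun z => archPart n z + densityFull n z) (a := 0)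
    (b := 1 / 4) (C := C₁ + C₄) (r := 7 / 10) le_rfl (by norm_num) (by norm_num) (by norm_num)
    (fun z h0 h1 => (differentiableAt_archPart hn (by linarith)).add
      (differentiableAt_densityFull hn h0 (by linarith)))
    (fun z h0 h1 => (norm_add_le _ _).trans (by
      have := hC₁ z h0 (by linarith)
      have := hC₄ z h0 h1
      linarith))
  rw [← e1, (hg.integral_density hn).2, ← mul_assoc, show (1 / 2 * 2 : ℂ) = 1 by norm_num, one_mul,
    ← integral_sub i1 i2]
  have h1 := hK (fun t : ℝ => gammaRatio n ((1 / 4 : ℝ) + I * t) *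
    swapFactor ((1 / 4 : ℝ) + I * t) / (2 * ((1 / 4 : ℝ) + I * t)))
    (16 * C₃ * (n : ℝ) ^ (-(1 / 2) : ℝ)) (7 / 10) (by positivity) le_rfl fun t => by
      have hre : ((1 / 4 : ℝ) + I * t : ℂ).re = 1 / 4 := by simp
      have him : ((1 / 4 : ℝ) + I * t : ℂ).im = t := by simp
      generalize ((1 / 4 : ℝ) + I * t : ℂ) = α at hre him
      have a1 := norm_gammaRatio_le hn (α := α) (by rw [hre]; norm_num) hre.le
      have a2 := hC₃ α (by rw [hre]; norm_num) hre.le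
      rw [hre, show -(2 * (1 / 4) : ℝ) = -(1 / 2) by norm_num] at a1
      rw [him] at a2
      have a3 : 1 / 4 * (1 + |t|) ≤ ‖2 * α‖ := by
        rw [norm_mul, show ‖(2 : ℂ)‖ = 2 by norm_num]
        have := abs_im_le_norm α
        have := re_le_norm α
        rw [hre] at this
        rw [him] at *
        linarith
      have hp : 0 < 1 + |t| := by linarith [abs_nonneg t]
      rw [norm_div, norm_mul, div_le_iff₀ (by linarith)]
      calc _ ≤ 2 * (n : ℝ) ^ (-(1 / 2) : ℝ) * (C₃ * (1 + |t|) ^ (17 / 10 : ℝ)) :=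
            mul_le_mul a1 a2 (norm_nonneg _) (by positivity)
        _ = 8 * C₃ * (n : ℝ) ^ (-(1 / 2) : ℝ) * (1 + |t|) ^ (7 / 10 : ℝ) *
            (1 / 4 * (1 + |t|)) := by
          rw [show (17 / 10 : ℝ) = 7 / 10 + 1 by norm_num, rpow_add hp, rpow_one]; ring
        _ ≤ 16 * C₃ * (n : ℝ) ^ (-(1 / 2) : ℝ) * (1 + |t|) ^ (7 / 10 : ℝ) * ‖2 * α‖ := by
          gcongr; norm_num
  calc _ = _ := congrArg _ (integral_congr_ae (ae_of_all _ fun t => ?_))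
    _ ≤ _ := h1
    _ = _ := by ring
  have h2 : ((1 / 4 : ℝ) + I * t : ℂ) ≠ 0 := fun h => by
    have := congrArg re h
    simp at this
  rw [densityFull_eq_densityMain hn h2 (by simp)]; ring

lemma differentiableAt_logDeriv_xi {n : ℕ} (hn : 1 ≤ n) {z : ℂ} (hz : xi n z ≠ 0) :
    DifferentiableAt ℂ (logDeriv (xi n)) z :=
  ((differentiable_xi hn).contDiff.differentiable_deriv_two z).div (differentiable_xi hn z) hz

lemma IsTest.hasSum_ordinates {g : ℂ → ℂ} (hg : IsTest g) {n : ℕ} (hn : 1 ≤ n) :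
    HasSum (fun γ : ordinates n => (zeroMult n γ : ℂ) * g (I * γ))
      ((1 / π) * ∫ t : ℝ, g ((19 / 10 : ℝ) + I * t) *
        logDeriv (xi n) ((19 / 10 : ℝ) + I * t)) := by
  obtain ⟨K, hK⟩ := hg.decay (19 / 10) (by norm_num)
  have h := (evenEntire_xi hn).hasSum_explicit_formula (summable_xi_zeros hn) (σ := 19 / 10) (σ₀ := 2)
    (d := 1) (by norm_num) (by norm_num) (by norm_num) one_pos (fun ρ hρ => by
      have := (abs_le.1 (abs_re_le_of_xi_eq_zero hn hρ)).2
      exact le_trans (by linarith) (le_abs_self _)) hg.diff hg.even hK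
  refine hasSum_of_eq ((ordinatesEquiv hn).hasSum_iff.2 h) fun γ => ?_
  rw [comp_apply, zeroMult_eq hn, if_pos, ordinatesEquiv_coe]
  exact (abs_re_le_of_xi_eq_zero hn (ordinatesEquiv hn γ).2).trans_lt (by norm_num)

lemma sum_rpow_neg_half_le (N : ℕ) :
    ∑ n ∈ Icc 1 N, (n : ℝ) ^ (-(1 / 2) : ℝ) ≤ 2 * (N : ℝ) ^ (1 / 2 : ℝ) := by
  induction N with
  | zero => simp
  | succ N ih =>
    rw [Finset.sum_Icc_succ_top (by omega), rpow_neg (by positivity)]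
    rw [← Real.sqrt_eq_rpow] at ih ⊢
    have hb : 0 < √((N + 1 : ℕ) : ℝ) := Real.sqrt_pos.2 (by positivity)
    have h1 := sq_sqrt (x := (N : ℝ)) (by positivity)
    have h2 := sq_sqrt (x := ((N + 1 : ℕ) : ℝ)) (by positivity)
    have h3 : (√((N + 1 : ℕ) : ℝ))⁻¹ ≤ 2 * (√((N + 1 : ℕ) : ℝ) - √(N : ℝ)) := by
      rw [inv_le_iff_one_le_mul₀ hb]
      push_cast at *
      nlinarith [sq_nonneg (√((N : ℝ) + 1) - √(N : ℝ))]
    linarith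

lemma IsTest.norm_sum_ordinates_sub_le {g : ℂ → ℂ} (hg : IsTest g) :
    ∃ C : ℝ, 0 < C ∧ ∀ N : ℕ, 1 ≤ N →
    ‖∑ n ∈ Icc 1 N, ∑' γ : ordinates n, (zeroMult n γ : ℂ) * g (I * γ) -
      1 / (2 * π) * ∑ n ∈ Icc 1 N, ∫ t : ℝ, g (I * t) * densityTerm n t‖
      ≤ C * (N : ℝ) ^ (1 / 2 : ℝ) := by
  obtain ⟨C₁, hC₁0, hC₁⟩ := hg.norm_integral_density_sub_le
  obtain ⟨C₂, hC₂⟩ := average_lamSeries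
  obtain ⟨K, hK0, hK⟩ := hg.norm_integral_le (σ := 19 / 10) (by norm_num) (by norm_num)
  obtain ⟨C₃, hC₃0, hC₃⟩ := norm_lamSeries_le (σ := 12 / 5) (by norm_num)
  obtain ⟨C₄, hC₄0, hC₄⟩ := norm_densityMain_le
  have hC₂0 : 0 ≤ C₂ := (norm_nonneg _).trans (hC₂ 0 (12 / 5 : ℂ) (by norm_num))
  refine ⟨2 * C₁ + K * C₂, by positivity, fun N hN => ?_⟩
  have hre : ∀ z : ℂ, z.re = 19 / 10 → 1 < (1 / 2 + z).re := fun z hz => by simp [hz]; norm_num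
  have hxi : ∀ n ∈ Icc 1 N, ∀ z : ℂ, z.re = 19 / 10 →
      logDeriv (xi n) z = archPart n z - lamSeries (4 * n - 3) (1 / 2 + z) := fun n hn z hz => by
    have hn := (mem_Icc.1 hn).1
    rw [logDeriv_xi hn (by rw [hz]; norm_num) (familyL_ne_zero hn (hre z hz)),
      logDeriv_familyL hn (hre z hz), archPart, ← sub_eq_add_neg]
  have i1 : ∀ n ∈ Icc 1 N, Integrable fun t : ℝ => g ((19 / 10 : ℝ) + I * t) *
      logDeriv (xi n) ((19 / 10 : ℝ) + I * t) := fun n hn => by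
    have hn' := (mem_Icc.1 hn).1
    obtain ⟨C₅, hC₅0, hC₅⟩ := norm_archPart_le hn'
    refine (hg.shift (a := 19 / 10) (b := 19 / 10) (C := C₅ + C₃) (r := 7 / 10) (by norm_num) le_rfl
      (by norm_num) (by norm_num) (fun z h1 h2 => differentiableAt_logDeriv_xi hn' fun h => ?_)
      fun z h1 h2 => ?_).1
    · have := (abs_le.1 (abs_re_le_of_xi_eq_zero hn' h)).2
      linarith
    · have hz := le_antisymm h2 h1
      have hP : 1 ≤ (1 + |z.im|) ^ (7 / 10 : ℝ) :=
        one_le_rpow (by linarith [abs_nonneg z.im]) (by norm_num)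
      rw [hxi n hn z hz]
      have a1 := hC₃ (4 * n - 3) (by omega) (1 / 2 + z) (by simp [hz]; norm_num)
      have a2 := hC₅ z (by linarith) (by linarith)
      refine (norm_sub_le _ _).trans ?_
      nlinarith
  have i2 : ∀ n ∈ Icc 1 N, Integrable fun t : ℝ => g ((19 / 10 : ℝ) + I * t) *
      (archPart n ((19 / 10 : ℝ) + I * t) + densityMain ((19 / 10 : ℝ) + I * t)) := fun n hn => by
    have hn := (mem_Icc.1 hn).1
    obtain ⟨C₅, hC₅0, hC₅⟩ := norm_archPart_le hn
    exact (hg.shift (F := fun z => archPart n z + densityMain z) (a := 19 / 10) (b := 19 / 10)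
      (C := C₅ + C₄) (r := 7 / 10) (by norm_num) le_rfl (by norm_num) (by norm_num)
      (fun z h1 h2 => (differentiableAt_archPart hn (by linarith)).add
        (differentiableAt_densityMain (by linarith)))
      fun z h1 h2 => (norm_add_le _ _).trans (by
        have := hC₅ z (by linarith) (by linarith)
        have := hC₄ z (by linarith) (by linarith)
        linarith)).1
  have h1 : ‖∑ n ∈ Icc 1 N, (∫ t : ℝ, g ((19 / 10 : ℝ) + I * t) *
      logDeriv (xi n) ((19 / 10 : ℝ) + I * t)) - ∑ n ∈ Icc 1 N, ∫ t : ℝ,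
      g ((19 / 10 : ℝ) + I * t) * (archPart n ((19 / 10 : ℝ) + I * t) +
        densityMain ((19 / 10 : ℝ) + I * t))‖ ≤ K * C₂ := by
    rw [← integral_finsetSum _ i1, ← integral_finsetSum _ i2,
      ← integral_sub (integrable_finsetSum _ i1) (integrable_finsetSum _ i2)]
    refine le_trans (le_of_eq (congrArg _ (integral_congr_ae (ae_of_all _ fun t => ?_))))
      (hK (fun t => -((∑ n ∈ Icc 1 N, lamSeries (4 * n - 3) (1 / 2 +
        ((19 / 10 : ℝ) + I * t))) - N * diagSeries (1 / 2 + ((19 / 10 : ℝ) + I * t)))) C₂ 0 hC₂0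
        (by norm_num) fun t => ?_)
    · have hz : ((19 / 10 : ℝ) + I * t : ℂ).re = 19 / 10 := by simp
      simp only
      generalize ((19 / 10 : ℝ) + I * t : ℂ) = z at hz
      have hd : densityMain z = -diagSeries (1 / 2 + z) :=
        (neg_diagSeries_eq (by rw [hz]; norm_num)).symm
      rw [← mul_sum, ← mul_sum, ← mul_sub, ← sum_sub_distrib, hd,
        sum_congr rfl fun n hn => show _ = -lamSeries (4 * n - 3) (1 / 2 + z) +
          diagSeries (1 / 2 + z) by rw [hxi n hn z hz]; ring, sum_add_distrib,
        Finset.sum_neg_distrib, sum_Icc_const]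
      ring
    · rw [norm_neg, rpow_zero, mul_one]
      exact hC₂ N _ (by simp; norm_num)
  have h2 : ‖∑ n ∈ Icc 1 N, (∫ t : ℝ, g ((19 / 10 : ℝ) + I * t) *
      (archPart n ((19 / 10 : ℝ) + I * t) + densityMain ((19 / 10 : ℝ) + I * t))) -
      1 / 2 * ∑ n ∈ Icc 1 N, ∫ t : ℝ, g (I * t) * densityTerm n t‖ ≤
      C₁ * (2 * (N : ℝ) ^ (1 / 2 : ℝ)) := by
    rw [mul_sum, ← sum_sub_distrib]
    refine (norm_sum_le_of_le _ fun n hn => hC₁ n (mem_Icc.1 hn).1).trans ?_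
    rw [← mul_sum]; exact mul_le_mul_of_nonneg_left (sum_rpow_neg_half_le N) hC₁0.le
  have hN1 : 1 ≤ (N : ℝ) ^ (1 / 2 : ℝ) := one_le_rpow (mod_cast hN) (by norm_num)
  rw [sum_congr rfl fun n hn => (hg.hasSum_ordinates (mem_Icc.1 hn).1).tsum_eq,
    ← mul_sum, show (1 / (2 * π) : ℂ) = 1 / π * (1 / 2) by ring, mul_assoc,
    ← mul_sub, norm_mul]
  have hpi : ‖(1 / π : ℂ)‖ ≤ 1 := by
    rw [norm_div, norm_one, norm_real, Real.norm_of_nonneg pi_pos.le, div_le_one pi_pos]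
    linarith [pi_gt_three]
  refine (mul_le_of_le_one_left (norm_nonneg _) hpi).trans ?_
  have h3 := norm_add_le_of_le h1 h2
  rw [sub_add_sub_cancel] at h3
  have : 0 ≤ K * C₂ := by positivity
  nlinarith

/-! ### Consequences of the ratios conjecture -/

lemma zetaReg_eventually_ne_zero : ∀ᶠ z in nhds (1 : ℂ), zetaReg z ≠ 0 :=
  differentiable_zetaReg.continuous.continuousAt.eventually_ne (zetaReg_ne_zero (by simp))

lemma dirichletL_eventually_ne_zero : ∀ᶠ z in nhds (1 : ℂ), dirichletL z ≠ 0 :=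
  differentiable_dirichletL.continuous.continuousAt.eventually_ne (dirichletL_ne_zero (by simp))

lemma ratioMain_eq {α r : ℂ} (hα : -(1 / 2) < α.re) (h : -1 < (α + r).re) :
    ratioMain α r = riemannZeta (1 + 2 * r) * dirichletL (1 + 2 * α) *
      ((α + r) / zetaReg (1 + α + r)) / dirichletL (1 + α + r) * arithB (α + r) (2 * r) := by
  rw [ratioMain, zetaInv_eq, arithA_eq_arithB hα h, show 1 + α + r - 1 = α + r by ring]

lemma differentiableAt_ratioMain {α r : ℂ} (hα : -(1 / 16) < α.re) (hr : 0 ≤ r.re)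
    (hZ : zetaReg (1 + α + r) ≠ 0) (hL : dirichletL (1 + α + r) ≠ 0) :
    DifferentiableAt ℂ (fun α => ratioMain α r) α := by
  have hopen : IsOpen {α : ℂ | -(1 / 16) < α.re} := isOpen_lt_re _
  have hev : (fun α => ratioMain α r) =ᶠ[nhds α] fun α => riemannZeta (1 + 2 * r) *
      dirichletL (1 + 2 * α) * ((α + r) / zetaReg (1 + α + r)) / dirichletL (1 + α + r) *
      arithB (α + r) (2 * r) := by
    filter_upwards [hopen.mem_nhds hα] with w hw
    exact ratioMain_eq (by linarith) (by simp; linarith)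
  have hB : DifferentiableAt ℂ (fun α => arithB (α + r) (2 * r)) α :=
    (differentiableOn_arithB hopen (u := fun α => α + r) (v := fun _ => 2 * r) (by fun_prop)
      (by fun_prop) (fun z hz => by simp only [mem_ofPred_eq] at hz; simp; linarith)
      (fun z _ => by simp; linarith)).differentiableAt (hopen.mem_nhds hα)
  have h1 := differentiable_dirichletL
  have h2 := differentiable_zetaReg
  refine DifferentiableAt.congr_of_eventuallyEq ?_ hev
  fun_prop (disch := assumption)

lemma hasDerivAt_ratioMain {r : ℂ} (hr : 0 < r.re) :
    HasDerivAt (fun α => ratioMain α r) (densityMain r) r := by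
  have hr0 : r ≠ 0 := by rintro rfl; simp at hr
  have hx : 1 ≤ (1 + r + r).re := by simp; linarith
  have hZ := zetaReg_ne_zero hx
  have hL := dirichletL_ne_zero hx
  have hopen : IsOpen {α : ℂ | -(1 / 16) < α.re} := isOpen_lt_re _
  have hrm := hopen.mem_nhds (show -(1 / 16) < r.re by linarith)
  have hev : (fun α => arithA α r) =ᶠ[nhds r] fun α => arithB (α + r) (2 * r) := by
    filter_upwards [hrm] with w hw
    exact arithA_eq_arithB (by linarith) (by simp; linarith)
  have hA : HasDerivAt (fun α => arithA α r) (arithADiag r) r := by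
    have h := (differentiableOn_arithB hopen (u := fun α => α + r) (v := fun _ => 2 * r)
      (by fun_prop) (by fun_prop)
      (fun z hz => by simp only [mem_ofPred_eq] at hz; simp; linarith)
      (fun z _ => by simp; linarith)).differentiableAt hrm
    exact (h.congr_of_eventuallyEq hev).hasDerivAt
  have hA1 : arithA r r = 1 := by rw [hev.eq_of_nhds, ← two_mul, arithB_self]
  have e1 : HasDerivAt (fun α : ℂ => 1 + 2 * α) 2 r := by
    simpa using ((hasDerivAt_id r).const_mul 2).const_add 1
  have e2 : HasDerivAt (fun α : ℂ => 1 + α + r) 1 r := ((hasDerivAt_id r).const_add 1).add_const r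
  have e3 : HasDerivAt (fun α : ℂ => α + r) 1 r := (hasDerivAt_id r).add_const r
  have d1 := (differentiable_dirichletL (1 + 2 * r)).hasDerivAt.comp r e1
  have d2 := (differentiable_dirichletL (1 + r + r)).hasDerivAt.comp r (h := fun α : ℂ => 1 + α + r) e2
  have d3 := (differentiable_zetaReg (1 + r + r)).hasDerivAt.comp r (h := fun α : ℂ => 1 + α + r) e2
  have h := ((((d1.const_mul (riemannZeta (1 + 2 * r))).mul (e3.fun_div d3 hZ)).div d2 hL)).mul hA
  have hz : riemannZeta (1 + 2 * r) = zetaReg (1 + r + r) / (2 * r) := by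
    rw [eq_div_iff (by simpa using hr0), show 1 + r + r = 1 + 2 * r by ring,
      zetaReg_of_ne (by simpa using hr0)]
    ring
  refine (h.congr_of_eventuallyEq (Eventually.of_forall fun α => ?_)).congr_deriv ?_
  · simp only [ratioMain, Pi.mul_apply, Pi.div_apply, comp_apply, zetaInv_eq,
      show 1 + α + r - 1 = α + r by ring]
  · simp only [Pi.mul_apply, Pi.div_apply, comp_apply, hA1]
    rw [densityMain_eq hr0 hr.le, densityReg, logDeriv_apply, logDeriv_apply, hz]
    rw [show 1 + 2 * r = 1 + r + r by ring]
    generalize zetaReg (1 + r + r) = Z at *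
    generalize dirichletL (1 + r + r) = l at *
    generalize deriv zetaReg (1 + r + r) = Z' at *
    generalize deriv dirichletL (1 + r + r) = l' at *
    field_simp; ring

lemma hasDerivAt_gammaRatio_mul_ratioMain {n : ℕ} (hn : 1 ≤ n) {r : ℂ} (hr : 0 < r.re)
    (hr1 : r.re < 1 / 16) :
    HasDerivAt (fun α => gammaRatio n α * ratioMain (-α) r)
      (-(gammaRatio n r * swapFactor r / (2 * r))) r := by
  have hr0 : r ≠ 0 := by rintro rfl; simp at hr
  have hopen : IsOpen {α : ℂ | -(1 / 2) < (-α).re ∧ -1 < (-α + r).re ∧ -(1 / 16) < (-α).re} :=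
    (isOpen_lt continuous_const (continuous_re.comp continuous_neg)).inter
      ((isOpen_lt continuous_const (continuous_re.comp (continuous_neg.add continuous_const))).inter
        (isOpen_lt continuous_const (continuous_re.comp continuous_neg)))
  have hm := hopen.mem_nhds (x := r) ⟨by simp; linarith, by simp, by simp; linarith⟩
  set q : ℂ → ℂ := fun α => gammaRatio n α * (riemannZeta (1 + 2 * r) * dirichletL (1 + 2 * -α) /
    zetaReg (1 + -α + r) / dirichletL (1 + -α + r) * arithB (-α + r) (2 * r)) with hq
  have hev : (fun α => gammaRatio n α * ratioMain (-α) r) =ᶠ[nhds r] fun α => (-α + r) * q α := by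
    filter_upwards [hm] with w hw
    rw [ratioMain_eq hw.1 hw.2.1]; ring
  have h1 : (1 + -r + r : ℂ) = 1 := by ring
  have hZ : zetaReg (1 + -r + r) ≠ 0 := by rw [h1]; exact zetaReg_ne_zero (by simp)
  have hL : dirichletL (1 + -r + r) ≠ 0 := by rw [h1]; exact dirichletL_ne_zero (by simp)
  have hB : DifferentiableAt ℂ (fun α => arithB (-α + r) (2 * r)) r :=
    (differentiableOn_arithB hopen (u := fun α => -α + r) (v := fun _ => 2 * r) (by fun_prop)
      (by fun_prop) (fun z hz => by
        have := hz.2.2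
        simp at this ⊢; linarith)
      (fun z _ => by simp; linarith)).differentiableAt hm
  have hqd : DifferentiableAt ℂ q r := by
    have h1 := differentiable_dirichletL
    have h2 := differentiable_zetaReg
    have h3 := (hasDerivAt_gammaRatio hn (α := r)
      (abs_lt.2 ⟨by linarith, by linarith⟩)).differentiableAt
    fun_prop (disch := assumption)
  have e3 : HasDerivAt (fun α : ℂ => -α + r) (-1) r := (hasDerivAt_neg r).add_const r
  refine ((e3.fun_mul hqd.hasDerivAt).congr_of_eventuallyEq hev).congr_deriv ?_
  rw [neg_add_cancel, zero_mul, add_zero, hq]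
  simp only [h1, neg_add_cancel, zetaReg_one]
  rw [swapFactor, zetaReg_of_ne (by simpa using hr0), show 1 + 2 * -r = 1 - 2 * r by ring]
  have := dirichletL_ne_zero (s := 1) (by simp)
  field_simp; ring

/-- The ratios conjecture gives the average of the logarithmic derivatives near the critical
line. -/
lemma RatiosConjecture.norm_sum_logDeriv_sub_le {a : ℝ} (ha' : a ≤ 0) (hR : RatiosConjecture a) :
    ∃ C : ℝ, ∃ N₀ : ℕ, ∀ N : ℕ, N₀ ≤ N → ∀ r : ℂ, r.re = 1 / ln N →
    |r.im| ≤ (N : ℝ) ^ (1 / 2 : ℝ) →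
    ‖∑ n ∈ Icc 1 N, logDeriv (familyL n) (1 / 2 + r) -
      ∑ n ∈ Icc 1 N, densityFull n r‖ ≤ C * (N : ℝ) ^ (3 / 4 : ℝ) * ln N := by
  obtain ⟨C, N₀, h⟩ := hR (1 / 4) (by norm_num) 1 one_pos
  obtain ⟨ε, hε0, hε⟩ := Metric.eventually_nhds_iff.1
    (zetaReg_eventually_ne_zero.and dirichletL_eventually_ne_zero)
  have hlog := tendsto_log_natCast
  have hpow : Tendsto (fun N : ℕ => (N : ℝ) ^ (1 / 4 : ℝ)) atTop atTop :=
    (tendsto_rpow_atTop (by norm_num)).comp tendsto_natCast_atTop_atTop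
  obtain ⟨N₁, hN₁⟩ := eventually_atTop.1 ((hlog.eventually_ge_atTop (1 / ε + 100)).and
    (hpow.eventually_ge_atTop 2))
  refine ⟨2 * C, max N₀ N₁, fun N hN r hr hi => ?_⟩
  obtain ⟨hl, hp⟩ := hN₁ N (le_trans (le_max_right _ _) hN)
  have hε1 : 0 < 1 / ε := by positivity
  set l := ln N with hldef
  have hl0 : 0 < l := by linarith
  have hδ : 1 / l ≤ 1 / 100 := one_div_le_one_div_of_le (by norm_num) (by linarith)
  have hδε : 1 / l < ε := by rw [div_lt_comm₀ hl0 hε0]; linarith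
  have hδ0 : 0 < 1 / l := by positivity
  have hN0 : (0 : ℝ) ≤ N := N.cast_nonneg
  have hN1 : 1 ≤ (N : ℝ) ^ (1 / 2 : ℝ) := by
    rw [show (1 / 2 : ℝ) = 1 / 4 + 1 / 4 by norm_num, Real.rpow_add_of_nonneg hN0
      (by norm_num) (by norm_num)]
    nlinarith
  have hT : (N : ℝ) ^ (1 / 2 : ℝ) + 1 ≤ (N : ℝ) ^ (1 - 1 / 4 : ℝ) := by
    rw [show (1 - 1 / 4 : ℝ) = 1 / 2 + 1 / 4 by norm_num, Real.rpow_add_of_nonneg hN0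
      (by norm_num) (by norm_num)]
    nlinarith
  set D : ℂ → ℂ := fun α => (∑ n ∈ Icc 1 N, familyL n (1 / 2 + α) / familyL n (1 / 2 + r)) -
    ∑ n ∈ Icc 1 N, (ratioMain α r + gammaRatio n α * ratioMain (-α) r) with hD
  have hball : ∀ α ∈ closedBall r (1 / l / 2), |α.re - r.re| ≤ 1 / l / 2 ∧
      |α.im - r.im| ≤ 1 / l / 2 ∧ ‖α - r‖ ≤ 1 / l / 2 := fun α hα => by
    rw [mem_closedBall, dist_eq_norm] at hα
    exact ⟨by simpa using (abs_re_le_norm (α - r)).trans hα,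
      by simpa using (abs_im_le_norm (α - r)).trans hα, hα⟩
  have hDd : DifferentiableOn ℂ D (closedBall r (1 / l / 2)) := fun α hα => by
    obtain ⟨h1, -, h3⟩ := hball α hα
    rw [abs_le, hr] at h1
    have hre : 1 ≤ (1 + α + r).re := by rw [add_re, add_re, one_re, hr]; linarith
    have hne := @hε (1 + -α + r) (by
      rw [dist_eq_norm, show 1 + -α + r - 1 = -(α - r) by ring, norm_neg]; linarith)
    refine (DifferentiableAt.sub (DifferentiableAt.fun_sum fun n hn => ?_)
      (DifferentiableAt.fun_sum fun n hn => ?_)).differentiableWithinAt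
    · have := differentiable_familyL (mem_Icc.1 hn).1
      fun_prop
    · refine (differentiableAt_ratioMain (by linarith) (by linarith) (zetaReg_ne_zero hre)
        (dirichletL_ne_zero hre)).add ((hasDerivAt_gammaRatio (mem_Icc.1 hn).1
          (abs_lt.2 ⟨by linarith, by linarith⟩)).differentiableAt.mul ?_)
      exact (differentiableAt_ratioMain (by rw [neg_re]; linarith) (by linarith) hne.1
        hne.2).comp α differentiableAt_id.neg
  have hDr : HasDerivAt D (∑ n ∈ Icc 1 N, logDeriv (familyL n) (1 / 2 + r) -
      ∑ n ∈ Icc 1 N, densityFull n r) r := by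
    refine HasDerivAt.sub (HasDerivAt.fun_sum fun n hn => ?_) (HasDerivAt.fun_sum fun n hn => ?_)
    · exact (((differentiable_familyL (mem_Icc.1 hn).1 _).hasDerivAt.comp r
        ((hasDerivAt_id r).const_add (1 / 2))).congr_deriv (mul_one _)).div_const _
    · rw [densityFull_eq_densityMain (mem_Icc.1 hn).1
        (by rintro rfl; rw [zero_re] at hr; linarith) (by linarith), sub_eq_add_neg]
      exact (hasDerivAt_ratioMain (by linarith)).add (hasDerivAt_gammaRatio_mul_ratioMain
        (mem_Icc.1 hn).1 (by linarith) (by linarith))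
  have hDb : ∀ α ∈ Metric.sphere r (1 / l / 2), ‖D α‖ ≤ C * (N : ℝ) ^ (1 / 2 + 1 / 4 : ℝ) :=
    fun α hα => by
      obtain ⟨h1, h2, -⟩ := hball α (Metric.sphere_subset_closedBall hα)
      rw [abs_le, hr] at h1
      refine h N (le_trans (le_max_left _ _) hN) α r (by linarith) (by linarith) hr.ge
        (by linarith) ?_ (by linarith)
      have := abs_sub_abs_le_abs_sub α.im r.im
      linarith
  have hfin := norm_deriv_le_of_forall_mem_sphere_norm_le (half_pos hδ0)
    (hDd.diffContOnCl_ball subset_rfl) hDb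
  rw [hDr.deriv] at hfin
  refine hfin.trans (le_of_eq ?_)
  rw [show (1 / 2 + 1 / 4 : ℝ) = 3 / 4 by norm_num]
  field_simp

lemma linearIndependent_familyL {N : ℕ} {c : ℕ → ℂ}
    (h : ∀ s, ∑ n ∈ Icc 1 N, c n * familyL n s = 0) : ∀ n ∈ Icc 1 N, c n = 0 := by
  by_contra! hc
  obtain ⟨m₀, hm₀⟩ := hc
  obtain ⟨m, hm, hmax⟩ := ((Icc 1 N).filter fun n => c n ≠ 0).exists_max_image id
    ⟨m₀, by simpa using hm₀⟩
  rw [Finset.mem_filter] at hm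
  have hm1 := (mem_Icc.1 hm.1).1
  have key : ∀ z : ℂ, xi m z ≠ 0 → Gamma (2 * m - 1 + z) ≠ 0 →
      (∀ n, 1 ≤ n → n < m → familyL n (1 / 2 + z) = 0) → False := fun z hz hG hlt => by
    have h1 := h (1 / 2 + z)
    rw [Finset.sum_eq_single_of_mem m hm.1 fun n hn hne => ?_] at h1
    · refine (mul_ne_zero hm.2 ?_) h1
      rw [familyL_eq_xi hm1]
      refine mul_ne_zero (mul_ne_zero ?_ (inv_ne_zero hG)) hz
      rw [Ne, cpow_eq_zero_iff]; exact fun h => two_pi_div_seven_ne h.1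
    · by_cases hcn : c n = 0
      · rw [hcn, zero_mul]
      · have := hmax n (Finset.mem_filter.2 ⟨hn, hcn⟩)
        rw [hlt n (mem_Icc.1 hn).1 (lt_of_le_of_ne this hne), mul_zero]
  obtain rfl | hm2 : m = 1 ∨ 2 ≤ m := by omega
  · exact key 2 (xi_two_ne_zero le_rfl) (Gamma_ne_zero_of_re_pos (by norm_num)) (by omega)
  · have hm2' : (2 : ℝ) ≤ m := mod_cast hm2
    refine key (-(2 * m - 2)) (fun h0 => ?_) ?_ fun n h1 h2 => ?_
    · have := (abs_le.1 (abs_re_le_of_xi_eq_zero hm1 h0)).1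
      simp at this
      linarith
    · rw [show (2 * m - 1 + -(2 * m - 2) : ℂ) = 1 by ring, Gamma_one]
      exact one_ne_zero
    · obtain ⟨k, rfl⟩ : ∃ k, m = n + 1 + k := ⟨m - n - 1, by omega⟩
      rw [familyL_eq_xi h1, show (2 * n - 1 + -(2 * ((n + 1 + k : ℕ) : ℂ) - 2) : ℂ) =
        -((2 * k + 1 : ℕ) : ℂ) by push_cast; ring, Gamma_neg_nat_eq_zero]
      simp

lemma continuousAt_ratioMain {β γ₀ : ℂ} (hβ : -(1 / 2) < β.re) (h : 0 < (β + γ₀).re)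
    (hγ : 0 < γ₀.re) : ContinuousAt (fun γ => ratioMain β γ) γ₀ := by
  have hopen : IsOpen {γ : ℂ | 0 < (β + γ).re ∧ 0 < γ.re} :=
    (isOpen_lt continuous_const (continuous_re.comp (continuous_const.add continuous_id))).inter
      (isOpen_lt_re _)
  have hm := hopen.mem_nhds (show γ₀ ∈ {γ : ℂ | 0 < (β + γ).re ∧ 0 < γ.re} from ⟨h, hγ⟩)
  have hev : (fun γ => ratioMain β γ) =ᶠ[nhds γ₀] fun γ => riemannZeta (1 + 2 * γ) *
      dirichletL (1 + 2 * β) * ((β + γ) / zetaReg (1 + β + γ)) / dirichletL (1 + β + γ) *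
      arithB (β + γ) (2 * γ) := by
    filter_upwards [hm] with w hw
    exact ratioMain_eq hβ (by linarith [hw.1])
  have hB : DifferentiableAt ℂ (fun γ => arithB (β + γ) (2 * γ)) γ₀ :=
    (differentiableOn_arithB hopen (u := fun γ => β + γ) (v := fun γ => 2 * γ) (by fun_prop)
      (by fun_prop) (fun z hz => by linarith [hz.1])
      (fun z hz => by have := hz.2; simp; linarith)).differentiableAt hm
  have hre : 1 ≤ (1 + β + γ₀).re := by rw [add_assoc, add_re, one_re]; linarith
  have hZ := zetaReg_ne_zero hre
  have hL := dirichletL_ne_zero hre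
  have h1 := differentiable_dirichletL
  have h2 := differentiable_zetaReg
  have h3 : DifferentiableAt ℂ (fun γ : ℂ => riemannZeta (1 + 2 * γ)) γ₀ :=
    (differentiableAt_riemannZeta (s := 1 + 2 * γ₀) (by
      rintro h; rw [add_eq_left] at h
      have : γ₀ = 0 := by simpa using h
      simp [this] at hγ)).comp γ₀ (f := fun γ : ℂ => 1 + 2 * γ) (by fun_prop)
  refine ContinuousAt.congr (DifferentiableAt.continuousAt (𝕜 := ℂ) ?_) hev.symm
  fun_prop (disch := assumption)

lemma exists_familyL_eq_pow_mul {n : ℕ} (hn : 1 ≤ n) (ρ : ℂ) : ∃ (k : ℕ) (u : ℂ → ℂ),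
    Differentiable ℂ u ∧ (∀ s, familyL n s = (s - ρ) ^ k * u s) ∧ u ρ ≠ 0 := by
  obtain ⟨k, hk⟩ := ENat.ne_top_iff_exists.1 (analyticOrderAt_ne_top_of_entire
    (differentiable_familyL hn) (familyL_ne_zero hn (s := 2) (by norm_num)) ρ)
  exact ⟨k, exists_eq_pow_mul_of_analyticOrderAt (differentiable_familyL hn) ρ k hk.symm⟩

/-- The ratios conjecture excludes zeros off the critical line, within its range. -/
lemma RatiosConjecture.familyL_ne_zero {a : ℝ} (ha' : a ≤ 0) (hR : RatiosConjecture a) {n : ℕ}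
    (hn : 1 ≤ n) {γ₀ : ℂ} (h0 : 0 < γ₀.re) (h1 : γ₀.re < 1 / 4) :
    familyL n (1 / 2 + γ₀) ≠ 0 := by
  intro hzero
  obtain ⟨C, N₀, h⟩ := hR (1 / 4) (by norm_num) 1 one_pos
  have hpow : Tendsto (fun N : ℕ => (N : ℝ) ^ (1 - 1 / 4 : ℝ)) atTop atTop :=
    (tendsto_rpow_atTop (by norm_num)).comp tendsto_natCast_atTop_atTop
  obtain ⟨N, hlN, hpN, hN₀, hNn⟩ := ((tendsto_log_natCast.eventually_ge_atTop (2 / γ₀.re)).and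
    ((hpow.eventually_ge_atTop (|γ₀.im| + 1)).and ((eventually_ge_atTop N₀).and
      (eventually_ge_atTop n)))).exists
  have hl0 : 0 < ln N := lt_of_lt_of_le (by positivity) hlN
  have hδ : 1 / ln N ≤ γ₀.re / 2 := by
    rw [div_le_iff₀ h0] at hlN
    rw [div_le_iff₀ hl0]; linarith
  choose! k u hud hu hu0 using fun (m : ℕ) (hm : 1 ≤ m) => exists_familyL_eq_pow_mul hm (1 / 2 + γ₀)
  obtain ⟨m₁, hm₁, hmax⟩ := (Icc 1 N).exists_max_image k ⟨n, mem_Icc.2 ⟨hn, hNn⟩⟩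
  have hk : k m₁ ≠ 0 := fun hk0 => by
    have hkn : k n = 0 := by
      have := hmax n (mem_Icc.2 ⟨hn, hNn⟩)
      omega
    have := hu n hn (1 / 2 + γ₀)
    rw [hkn, pow_zero, one_mul, hzero] at this; exact hu0 n hn this.symm
  set c : ℕ → ℂ := fun m => if k m = k m₁ then (u m (1 / 2 + γ₀))⁻¹ else 0 with hc
  have hev : ∀ α : ℂ, 0 < α.re → α.re < γ₀.re / 2 → |α.im| ≤ 1 →
      ∑ m ∈ Icc 1 N, c m * familyL m (1 / 2 + α) = 0 := fun α ha0 ha1 hai => by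
    have hp : Tendsto (fun γ : ℂ => γ - γ₀) (nhdsWithin γ₀ {γ₀}ᶜ) (nhds 0) := by
      have : ContinuousAt (fun γ : ℂ => γ - γ₀) γ₀ := by fun_prop
      simpa using this.tendsto.mono_left nhdsWithin_le_nhds
    have hlim : Tendsto (fun γ : ℂ => (γ - γ₀) ^ k m₁ *
        ∑ m ∈ Icc 1 N, familyL m (1 / 2 + α) / familyL m (1 / 2 + γ))
        (nhdsWithin γ₀ {γ₀}ᶜ) (nhds (∑ m ∈ Icc 1 N, c m * familyL m (1 / 2 + α))) := by
      simp_rw [mul_sum]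
      refine tendsto_finsetSum _ fun m hm => ?_
      have hm1 := (mem_Icc.1 hm).1
      have hui : Tendsto (fun γ : ℂ => (u m (1 / 2 + γ))⁻¹) (nhdsWithin γ₀ {γ₀}ᶜ)
          (nhds (u m (1 / 2 + γ₀))⁻¹) := by
        have : ContinuousAt (fun γ : ℂ => u m (1 / 2 + γ)) γ₀ :=
          (hud m hm1).continuous.continuousAt.comp (f := fun γ : ℂ => 1 / 2 + γ) (by fun_prop)
        exact (this.inv₀ (hu0 m hm1)).tendsto.mono_left nhdsWithin_le_nhds
      have hck : Tendsto (fun γ : ℂ => (γ - γ₀) ^ (k m₁ - k m) * (u m (1 / 2 + γ))⁻¹)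
          (nhdsWithin γ₀ {γ₀}ᶜ) (nhds (c m)) := by
        have h2 := (hp.pow (k m₁ - k m)).mul hui
        by_cases hkm : k m = k m₁
        · simpa [hc, hkm] using h2
        · have h3 : k m₁ - k m ≠ 0 := by
            have := hmax m hm
            omega
          simpa [hc, hkm, zero_pow h3] using h2
      refine (hck.mul_const (familyL m (1 / 2 + α))).congr' ?_
      filter_upwards [self_mem_nhdsWithin] with γ hγ
      have hγ' : γ - γ₀ ≠ 0 := sub_ne_zero.2 hγ
      rw [hu m hm1 (1 / 2 + γ), add_sub_add_left_eq_sub, ← Nat.sub_add_cancel (hmax m hm), pow_add,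
        Nat.add_sub_cancel]
      generalize familyL m (1 / 2 + α) = A
      rw [div_eq_mul_inv A, mul_inv]; field_simp
    have hmain : ContinuousAt (fun γ : ℂ => ∑ n ∈ Icc 1 N,
        (ratioMain α γ + gammaRatio n α * ratioMain (-α) γ)) γ₀ := by
      have c1 := continuousAt_ratioMain (β := α) (γ₀ := γ₀) (by linarith)
        (by rw [add_re]; linarith) h0
      have c2 := continuousAt_ratioMain (β := -α) (γ₀ := γ₀) (by rw [neg_re]; linarith)
        (by rw [add_re, neg_re]; linarith) h0
      fun_prop
    refine tendsto_nhds_unique hlim (squeeze_zero_norm' (a := fun γ : ℂ => ‖γ - γ₀‖ ^ k m₁ *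
      (C * (N : ℝ) ^ (1 / 2 + 1 / 4 : ℝ) + ‖∑ n ∈ Icc 1 N,
        (ratioMain α γ + gammaRatio n α * ratioMain (-α) γ)‖)) ?_ ?_)
    · have hre : ∀ᶠ γ : ℂ in nhds γ₀, γ₀.re / 2 < γ.re ∧ γ.re < 1 / 4 ∧ ‖γ - γ₀‖ < 1 :=
        (continuous_re.continuousAt.eventually_const_lt (by linarith)).and
          ((continuous_re.continuousAt.eventually_lt_const h1).and
            (Metric.eventually_nhds_iff.2 ⟨1, one_pos, fun y hy => by rwa [← dist_eq_norm]⟩))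
      filter_upwards [hre.filter_mono nhdsWithin_le_nhds] with γ hγ
      rw [norm_mul, norm_pow]
      refine mul_le_mul_of_nonneg_left ?_ (by positivity)
      have hi := (abs_im_le_norm (γ - γ₀)).trans hγ.2.2.le
      rw [sub_im] at hi
      have hi2 := abs_sub_abs_le_abs_sub γ.im γ₀.im
      have := h N hN₀ α γ (by linarith) (by linarith) (by linarith) hγ.2.1
        (by linarith [abs_nonneg γ₀.im]) (by linarith)
      have h3 := norm_add_le_of_le this (le_refl ‖∑ n ∈ Icc 1 N,
        (ratioMain α γ + gammaRatio n α * ratioMain (-α) γ)‖)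
      rwa [sub_add_cancel] at h3
    · have h2 := (hp.norm.pow (k m₁)).mul (tendsto_const_nhds (x := C * (N : ℝ) ^
        (1 / 2 + 1 / 4 : ℝ)) |>.add (hmain.tendsto.mono_left
          (nhdsWithin_le_nhds (s := {γ₀}ᶜ))).norm)
      rwa [norm_zero, zero_pow hk, zero_mul] at h2
  have hall : ∀ s, ∑ m ∈ Icc 1 N, c m * familyL m s = 0 := by
    have hd : Differentiable ℂ fun s => ∑ m ∈ Icc 1 N, c m * familyL m s :=
      Differentiable.fun_sum fun m hm => (differentiable_familyL (mem_Icc.1 hm).1).const_mul _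
    have hE : (fun s => ∑ m ∈ Icc 1 N, c m * familyL m s)
        =ᶠ[nhds (1 / 2 + (γ₀.re / 4 : ℝ) : ℂ)] 0 := by
      refine Metric.eventually_nhds_iff.2 ⟨γ₀.re / 4, by positivity, fun s hs => ?_⟩
      rw [dist_eq_norm, ← sub_sub] at hs
      have hr := abs_lt.1 ((abs_re_le_norm _).trans_lt hs)
      have hi := (abs_im_le_norm _).trans_lt hs
      rw [sub_re _ (ofReal _), ofReal_re] at hr
      rw [sub_im _ (ofReal _), ofReal_im, sub_zero] at hi
      have := hev (s - 1 / 2) (by linarith) (by linarith) (by linarith)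
      rwa [add_sub_cancel] at this
    exact congrFun (AnalyticOnNhd.eq_of_eventuallyEq (fun z _ => hd.analyticAt z)
      (fun z _ => analyticAt_const) hE)
  have := linearIndependent_familyL hall m₁ hm₁
  simp only [hc, if_true, inv_eq_zero] at this; exact hu0 m₁ (mem_Icc.1 hm₁).1 this

lemma RatiosConjecture.re_of_xi_eq_zero {a : ℝ} (ha' : a ≤ 0) (hR : RatiosConjecture a) {n : ℕ}
    (hn : 1 ≤ n) {ρ : ℂ} (hρ : xi n ρ = 0) : ρ.re = 0 ∨ 1 / 4 ≤ |ρ.re| := by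
  have key : ∀ w : ℂ, xi n w = 0 → 0 < w.re → 1 / 4 ≤ w.re := fun w hw h0 => by
    by_contra! h
    exact hR.familyL_ne_zero ha' hn h0 h ((xi_eq_zero_iff hn (by linarith)).1 hw)
  rcases lt_trichotomy ρ.re 0 with h | h | h
  · have := key (-ρ) (by rwa [xi_neg hn]) (by rw [neg_re]; linarith)
    rw [neg_re] at this; exact Or.inr (this.trans (neg_le_abs _))
  · exact Or.inl h
  · exact Or.inr ((key ρ hρ h).trans (le_abs_self _))

lemma RatiosConjecture.le_abs_re_sub {a : ℝ} (ha' : a ≤ 0) (hR : RatiosConjecture a) {n : ℕ}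
    (hn : 1 ≤ n) {ρ : ℂ} (hρ : xi n ρ = 0) {δ : ℝ} (h0 : 0 < δ) (hδ : δ ≤ 1 / 8) :
    δ ≤ |δ - ρ.re| := by
  obtain h | h := hR.re_of_xi_eq_zero ha' hn hρ
  · rw [h, sub_zero, abs_of_pos h0]
  · have := abs_sub_abs_le_abs_sub ρ.re δ
    rw [abs_sub_comm, abs_of_pos h0] at this; linarith

/-- The zeros on the critical line, among the zeros of the completed `L`-function. -/
def realOrdinatesEmb {n : ℕ} (hn : 1 ≤ n) (γ : realOrdinates n) : zeroSet (xi n) :=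
  ordinatesEquiv hn ⟨(γ : ℝ), γ.2⟩

lemma realOrdinatesEmb_injective {n : ℕ} (hn : 1 ≤ n) :
    Injective (realOrdinatesEmb hn) := fun γ γ' h => by
  have := congrArg Subtype.val ((ordinatesEquiv hn).injective h)
  exact Subtype.ext (ofReal_injective this)

lemma IsTest.summable_realOrdinates {g : ℂ → ℂ} (hg : IsTest g) {n : ℕ} (hn : 1 ≤ n) {c : ℝ}
    (hc : 0 < c) : Summable fun γ : realOrdinates n =>
      (zeroMult n ((γ : ℝ) : ℂ) : ℂ) * g (I * ((γ : ℝ) * c : ℝ)) := by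
  obtain ⟨K, hK⟩ := hg.decay 0 (by norm_num)
  have hK0 : 0 ≤ K := by simpa using (norm_nonneg _).trans (hK 0 (by simp))
  set M := max 1 (1 / c ^ 2) with hM
  have hM1 : 1 ≤ M := le_max_left _ _
  have hM2 : 1 ≤ M * c ^ 2 := by
    have : 1 / c ^ 2 ≤ M := le_max_right _ _
    rwa [div_le_iff₀ (by positivity)] at this
  refine of_norm_bounded (((summable_xi_zeros hn).comp_injective
    (realOrdinatesEmb_injective hn)).mul_left (2 * (K * M))) fun γ => ?_
  have h1 : ‖(realOrdinatesEmb hn γ : ℂ)‖ = |(γ : ℝ)| := by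
    rw [realOrdinatesEmb, ordinatesEquiv_coe]; simp
  have h2 : (zeroMult n ((γ : ℝ) : ℂ)) = ordAt (xi n) (realOrdinatesEmb hn γ) :=
    zeroMult_eq hn ⟨(γ : ℝ), γ.2⟩
  have h3 : ‖g (I * ((γ : ℝ) * c : ℝ))‖ ≤ K * M / (1 + (γ : ℝ) ^ 2) := by
    refine (hK _ (by simp)).trans ?_
    have e : (I * ((γ : ℝ) * c : ℝ) : ℂ).im = γ * c := by simp
    rw [e, div_le_div_iff₀ (by positivity) (by positivity), mul_assoc]
    refine mul_le_mul_of_nonneg_left ?_ hK0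
    nlinarith [sq_nonneg (γ : ℝ), mul_nonneg (sub_nonneg.2 hM2) (sq_nonneg (γ : ℝ))]
  have h4 := decay_of_div_one_add_sq h3
  have h5 : (1 + |(γ : ℝ)|) ^ (-(2 : ℝ)) ≤ (1 + |(γ : ℝ)|) ^ (-(5 / 4) : ℝ) :=
    rpow_le_rpow_of_exponent_le (by linarith [abs_nonneg (γ : ℝ)]) (by norm_num)
  rw [comp_apply, h1, norm_mul, h2, Complex.norm_natCast]
  calc _ ≤ (ordAt (xi n) (realOrdinatesEmb hn γ) : ℝ) *
        (2 * (K * M) * (1 + |(γ : ℝ)|) ^ (-(5 / 4) : ℝ)) :=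
        mul_le_mul_of_nonneg_left (h4.trans (by gcongr)) (Nat.cast_nonneg _)
    _ = _ := by ring

lemma RatiosConjecture.hasSum_realOrdinates {a : ℝ} (ha' : a ≤ 0) (hR : RatiosConjecture a)
    {g : ℂ → ℂ} (hg : IsTest g) {n : ℕ} (hn : 1 ≤ n) {l : ℝ} (hl : 8 ≤ l) :
    HasSum (fun γ : realOrdinates n => (zeroMult n ((γ : ℝ) : ℂ) : ℂ) *
        g (I * ((γ : ℝ) * (l / π) : ℝ)))
      ((1 / l : ℂ) * ∫ v : ℝ, g ((1 / π : ℝ) + I * v) *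
        logDeriv (xi n) ((1 + I * (π * v)) / l)) := by
  obtain ⟨K, hK⟩ := hg.decay 1 (by norm_num)
  have hK0 : 0 ≤ K := by simpa using (norm_nonneg _).trans (hK 0 (by simp))
  have hpi := pi_pos
  have hpi4 := Real.pi_lt_four
  have hpi3 := pi_gt_three
  have hl0 : 0 < l := by linarith
  have hδ0 : 0 < 1 / l := by positivity
  have hδ : 1 / l ≤ 1 / 8 := one_div_le_one_div_of_le (by norm_num) hl
  have hc1 : 1 ≤ l / π := by rw [le_div_iff₀ hpi]; linarith
  have hre : ∀ z : ℂ, (z * (l / π : ℝ)).re = z.re * (l / π) := fun z => re_mul_ofReal _ _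
  have him : ∀ z : ℂ, (z * (l / π : ℝ)).im = z.im * (l / π) := fun z => im_mul_ofReal _ _
  have hmap : ∀ z : ℂ, |z.re| < 2 / l → |(z * (l / π : ℝ)).re| < 2 := fun z hz => by
    rw [hre, abs_mul, abs_of_pos (by positivity : 0 < l / π), ← mul_div_assoc, div_lt_iff₀ hpi]
    rw [lt_div_iff₀ hl0] at hz; linarith
  have h := (evenEntire_xi hn).hasSum_explicit_formula (summable_xi_zeros hn)
    (g := fun z => g (z * (l / π : ℝ))) (σ := 1 / l) (σ₀ := 2 / l) (d := 1 / l)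
    hδ0 (by linarith) (by gcongr; norm_num) hδ0 (fun ρ hρ => hR.le_abs_re_sub ha' hn hρ hδ0 hδ)
    (hg.diff.comp (by fun_prop) fun z hz => hmap z hz)
    (fun z hz => by rw [neg_mul]; exact hg.even _ (hmap z hz)) (C := K) fun z hz => by
      refine (hK _ ?_).trans ?_
      · rw [hre, abs_mul, abs_of_pos (by positivity : 0 < l / π), ← mul_div_assoc, div_le_iff₀ hpi]
        rw [le_div_iff₀ hl0] at hz; linarith
      · rw [him, mul_pow]
        gcongr
        exact le_mul_of_one_le_right (sq_nonneg _) (one_le_pow₀ hc1)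
  rw [← (realOrdinatesEmb_injective hn).hasSum_iff] at h
  · have e2 := Measure.integral_comp_mul_left (fun v : ℝ => g ((1 / π : ℝ) + I * v) *
      logDeriv (xi n) ((1 + I * (π * v)) / l)) (l / π)
    rw [inv_div, abs_of_pos (by positivity)] at e2
    have hlc : (l : ℂ) ≠ 0 := ofReal_ne_zero.2 hl0.ne'
    have hpc : (π : ℂ) ≠ 0 := ofReal_ne_zero.2 hpi.ne'
    have e3 : (1 / π : ℂ) * ∫ t : ℝ, g (((1 / l : ℝ) + I * t) * (l / π : ℝ)) *
        logDeriv (xi n) ((1 / l : ℝ) + I * t) = (1 / l : ℂ) * ∫ v : ℝ,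
        g ((1 / π : ℝ) + I * v) * logDeriv (xi n) ((1 + I * (π * v)) / l) := by
      rw [show (∫ t : ℝ, g (((1 / l : ℝ) + I * t) * (l / π : ℝ)) *
        logDeriv (xi n) ((1 / l : ℝ) + I * t)) = (π / l) • ∫ v : ℝ,
        g ((1 / π : ℝ) + I * v) * logDeriv (xi n) ((1 + I * (π * v)) / l) from ?_]
      · rw [real_smul]
        push_cast; field_simp
      · rw [← e2]
        congr 1
        ext t
        congr 2 <;> (push_cast; field_simp)
    rw [← e3]
    refine hasSum_of_eq h fun γ => ?_
    have e4 : (realOrdinatesEmb hn γ : ℂ) = I * (γ : ℝ) := ordinatesEquiv_coe hn _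
    have h2 : (zeroMult n ((γ : ℝ) : ℂ)) = ordAt (xi n) (realOrdinatesEmb hn γ) :=
      zeroMult_eq hn ⟨(γ : ℝ), γ.2⟩
    rw [comp_apply, h2, e4, if_pos (by simpa using hl0)]; push_cast; ring_nf
  · intro ρ hρ
    rw [if_neg, mul_zero]
    intro hlt
    obtain h0 | h0 := hR.re_of_xi_eq_zero ha' hn ρ.2
    · refine hρ ⟨⟨(ρ : ℂ).im, ?_⟩, ?_⟩
      · have h := ((ordinatesEquiv hn).symm ρ).2
        have e : (((ordinatesEquiv hn).symm ρ : ordinates n) : ℂ) = (((ρ : ℂ).im : ℝ) : ℂ) := by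
          change -I * (ρ : ℂ) = _
          apply Complex.ext <;> simp [h0]
        rwa [e] at h
      · refine Subtype.ext ?_
        rw [realOrdinatesEmb, ordinatesEquiv_coe]
        apply Complex.ext <;> simp [h0]
    · linarith

/-! ### The scaling limit -/

lemma sum_log_sub_log_le (N : ℕ) :
    ∑ n ∈ Icc 1 N, (ln N - ln n) ≤ N := by
  suffices h : N * ln N - N ≤ ∑ n ∈ Icc 1 N, ln n by
    rw [sum_sub_distrib, sum_Icc_const]; linarith
  induction N with
  | zero => simp
  | succ N ih =>
    rw [Finset.sum_Icc_succ_top (by omega)]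
    rcases N.eq_zero_or_pos with rfl | hN
    · simp
    have h0 : (0 : ℝ) < N := mod_cast hN
    have h := Real.log_le_sub_one_of_pos (x := ((N : ℝ) + 1) / N) (by positivity)
    rw [Real.log_div (by positivity) h0.ne', le_sub_iff_add_le, le_div_iff₀ h0] at h; push_cast
    nlinarith

lemma norm_exp_sub_exp_le {x y : ℂ} (hx : x.re ≤ 0) (hy : y.re ≤ 0) :
    ‖exp x - exp y‖ ≤ ‖x - y‖ := by
  have := (convex_halfSpace_re_le 0).norm_image_sub_le_of_norm_deriv_le (𝕜 := ℂ) (f := exp)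
    (C := 1) (fun z _ => differentiable_exp z) (fun z hz => by
      rw [Complex.deriv_exp, norm_exp]; exact Real.exp_le_one_iff.2 hz) hy hx
  rwa [one_mul] at this

lemma norm_gammaRatio_sub_exp_le : ∃ C : ℝ, 0 < C ∧ ∀ (N n : ℕ) (s : ℂ), 1 ≤ n → n ≤ N →
    0 ≤ s.re → 4 * ‖s‖ ≤ ln N → 0 < ln N →
    ‖exp (-2 * s) - gammaRatio n (s / ln N)‖ ≤
      2 * ‖s‖ * ((ln N - ln n) / ln N) + C * (‖s‖ / ln N) := by
  obtain ⟨C, hC0, hC⟩ := norm_gammaRatio_sub_le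
  refine ⟨C, hC0, fun N n s hn hN hs hsN hl => ?_⟩
  have hn1 : (1 : ℝ) ≤ n := mod_cast hn
  have hnorm : ‖s / ln N‖ = ‖s‖ / ln N := by rw [norm_div, norm_real, Real.norm_of_nonneg hl.le]
  have hre : (s / ln N).re = s.re / ln N := div_ofReal_re _ _
  have h1 := hC n hn (s / ln N) (by rw [hre]; positivity) (by rw [hnorm, div_le_iff₀ hl]; linarith)
  have hlc : (ln N : ℂ) ≠ 0 := ofReal_ne_zero.2 hl.ne'
  have hle : ln n ≤ ln N := log_le_log (by positivity) (mod_cast hN)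
  have hl0 : 0 ≤ ln n := log_nonneg hn1
  have e : (n : ℂ) ^ (-2 * (s / ln N)) = exp (((ln n / ln N : ℝ) : ℂ) * (-2 * s)) := by
    rw [cpow_def_of_ne_zero (mod_cast (by omega : n ≠ 0)), ← natCast_log]
    congr 1; push_cast; ring
  have h2 := norm_exp_sub_exp_le (x := -2 * s) (y := ((ln n / ln N : ℝ) : ℂ) * (-2 * s))
    (by simpa using hs) (by
      rw [re_ofReal_mul]
      refine mul_nonpos_of_nonneg_of_nonpos (by positivity) (by simpa using hs))
  rw [← e] at h2
  rw [show -2 * s - ((ln n / ln N : ℝ) : ℂ) * (-2 * s) =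
      ((ln N - ln n) / ln N : ℝ) * (-2 * s) by
        generalize ln N = l at hlc ⊢
        push_cast; field_simp
        ring, norm_mul, norm_real, Real.norm_of_nonneg (div_nonneg (by linarith) hl.le), norm_mul,
    norm_neg, norm_ofNat] at h2
  rw [hnorm, norm_sub_rev] at h1; rw [mul_comm (2 * ‖s‖)]
  exact (norm_sub_le_norm_sub_add_norm_sub _ _ _).trans (add_le_add h2 h1)

/-- The limiting density, on the line `re s = 1`. -/
def limitDensity (s : ℂ) : ℂ := 1 + (1 - exp (-2 * s)) / (2 * s)

/-- The two main terms approximate the limiting density. -/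
lemma norm_main_sub_limit_le : ∃ C : ℝ, 0 < C ∧ ∀ (N n : ℕ) (s : ℂ), 1 ≤ n → n ≤ N →
    s.re = 1 → 16 * ‖s‖ ≤ ln N →
    ‖archPart n (s / ln N) + densityFull n (s / ln N) - ln N * limitDensity s‖ ≤
      C + 2 * (ln N - ln n) + ln N * ‖1 - swapFactor (s / ln N)‖ := by
  obtain ⟨C₁, hC₁0, hC₁⟩ := norm_digamma_sub_log_natCast_le
  obtain ⟨C₂, hC₂0, hC₂⟩ := norm_gammaRatio_sub_exp_le
  obtain ⟨C₃, hC₃0, hC₃⟩ := norm_densityReg_le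
  refine ⟨|ln (7 / (2 * π))| + C₁ + 2 * C₃ + C₂, by positivity, fun N n s hn hN hs hsN => ?_⟩
  have hs1 : 1 ≤ ‖s‖ := hs ▸ re_le_norm s
  have hs0 : s ≠ 0 := by rintro rfl; simp at hs
  have hl : 0 < ln N := by linarith
  have hlc : (ln N : ℂ) ≠ 0 := ofReal_ne_zero.2 hl.ne'
  have hle : ln n ≤ ln N := log_le_log (mod_cast hn) (mod_cast hN)
  have hX := hC₂ N n s hn hN (by linarith) (by linarith) hl
  have hnorm : ‖s / ln N‖ = ‖s‖ / ln N := by rw [norm_div, norm_real, Real.norm_of_nonneg hl.le]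
  have hre : (s / ln N).re = 1 / ln N := by rw [div_ofReal_re, hs]
  have hr : ‖s‖ / ln N ≤ 1 / 16 := by rw [div_le_iff₀ hl]; linarith
  have hδ : 1 / ln N ≤ 1 / 16 := le_trans (by gcongr) hr
  have hδ0 : 0 < 1 / ln N := by positivity
  have hr0 : s / ln N ≠ 0 := div_ne_zero hs0 hlc
  have h1 := hC₁ n hn (s / ln N) (by rw [hnorm]; linarith)
  have h3 := hC₃ (s / ln N) (by rw [hre]; linarith) (by rw [hre]; linarith)
  have him : |(s / ln N).im| ≤ 1 := (abs_im_le_norm _).trans (by rw [hnorm]; linarith)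
  have h4 : (1 + |(s / ln N).im|) ^ (1 / 2 : ℝ) ≤ 2 := by
    refine (rpow_le_rpow_of_exponent_le (by linarith [abs_nonneg (s / ln N).im])
      (by norm_num : (1 / 2 : ℝ) ≤ 1)).trans ?_
    rw [rpow_one]; linarith
  have h5 := norm_gammaRatio_le hn (α := s / ln N) (by rw [hre]; linarith)
    (by rw [hre]; linarith)
  have h6 : (n : ℝ) ^ (-(2 * (s / ln N).re)) ≤ 1 :=
    Real.rpow_le_one_of_one_le_of_nonpos (mod_cast hn) (by rw [hre]; linarith)
  have e : archPart n (s / ln N) + densityFull n (s / ln N) -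
      ln N * limitDensity s = ln (7 / (2 * π)) +
      (digamma (2 * n - 1 + s / ln N) - ln n) - (ln N - ln n : ℝ) +
      densityReg (s / ln N) + ln N / (2 * s) * ( (exp (-2 * s) - gammaRatio n (s / ln N)) +
        gammaRatio n (s / ln N) * (1 - swapFactor (s / ln N))) := by
    rw [densityFull_of_ne hn hr0, archPart, limitDensity]; push_cast; field_simp; ring
  set σ := 1 - swapFactor (s / ln N)
  set l := ln N
  have h7 : ‖(exp (-2 * s) - gammaRatio n (s / l)) + gammaRatio n (s / l) * σ‖ ≤
      2 * ‖s‖ * ((l - ln n) / l) + C₂ * (‖s‖ / l) + 2 * ‖σ‖ := by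
    refine norm_add_le_of_le hX ?_
    rw [norm_mul]; exact mul_le_mul_of_nonneg_right (by linarith) (norm_nonneg _)
  have h8 : ‖(l / (2 * s) : ℂ)‖ = l / (2 * ‖s‖) := by
    rw [norm_div, norm_mul, norm_real, Real.norm_of_nonneg hl.le]; norm_num
  have h9 : l / (2 * ‖s‖) * (2 * ‖s‖ * ((l - ln n) / l) + C₂ * (‖s‖ / l) + 2 * ‖σ‖) ≤
      (l - ln n) + C₂ + l * ‖σ‖ := by
    rw [show l / (2 * ‖s‖) * (2 * ‖s‖ * ((l - ln n) / l) + C₂ * (‖s‖ / l) + 2 * ‖σ‖) =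
      (l - ln n) + C₂ / 2 + l * ‖σ‖ / ‖s‖ by field_simp]
    have : l * ‖σ‖ / ‖s‖ ≤ l * ‖σ‖ := div_le_self (by positivity) hs1
    linarith
  rw [e]
  refine (norm_add_le_of_le (norm_add_le_of_le (norm_sub_le_of_le (norm_add_le_of_le
    (norm_real _).le h1) (norm_real _).le) h3) (r₂ := (l - ln n) + C₂ + l * ‖σ‖) ?_).trans ?_
  · rw [norm_mul, h8]
    exact (mul_le_mul_of_nonneg_left h7 (by positivity)).trans h9
  · rw [norm_eq_abs, Real.norm_of_nonneg (sub_nonneg.2 hle)]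
    nlinarith

lemma norm_densityFull_le_mul : ∃ C : ℝ, 0 < C ∧ ∀ (n : ℕ) (l : ℝ) (r : ℂ), 1 ≤ n → 4 ≤ l →
    r.re = 1 / l → ‖densityFull n r‖ ≤ C * l * (1 + |r.im|) ^ (7 / 10 : ℝ) := by
  obtain ⟨C₁, hC₁0, hC₁⟩ := norm_densityReg_le
  obtain ⟨C₂, hC₂0, hC₂⟩ := norm_swapFactor_le
  refine ⟨C₁ + 1 + 2 * C₂, by positivity, fun n l r hn hl hr => ?_⟩
  have hl0 : 0 < l := by linarith
  have hδ : 1 / l ≤ 1 / 4 := one_div_le_one_div_of_le (by norm_num) hl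
  have hδ0 : 0 < 1 / l := by positivity
  have hr0 : r ≠ 0 := by rintro rfl; rw [zero_re] at hr; linarith
  have hrl : 1 ≤ l * ‖r‖ := by
    have := re_le_norm r
    rw [hr, div_le_iff₀ hl0] at this; linarith
  have hp : 1 ≤ 1 + |r.im| := by linarith [abs_nonneg r.im]
  set P := (1 + |r.im|) ^ (7 / 10 : ℝ) with hPdef
  have hP : 1 ≤ P := one_le_rpow hp (by norm_num)
  have hP2 : (1 + |r.im|) ^ (1 / 2 : ℝ) ≤ P := rpow_le_rpow_of_exponent_le hp (by norm_num)
  have h1 : ‖densityReg r‖ ≤ C₁ * l * P := by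
    refine (hC₁ r (by linarith) (by linarith)).trans ?_
    rw [mul_assoc]
    gcongr
    nlinarith
  have h2 : ‖gammaRatio n r * swapFactor r‖ ≤ 2 * (C₂ * (P * (2 * l * ‖r‖))) := by
    have h6 : (n : ℝ) ^ (-(2 * r.re)) ≤ 1 :=
      Real.rpow_le_one_of_one_le_of_nonpos (mod_cast hn) (by linarith)
    have h5 := norm_gammaRatio_le hn (α := r) (by linarith) (by linarith)
    have h7 := hC₂ r (by linarith) (by linarith)
    rw [show (17 / 10 : ℝ) = 7 / 10 + 1 by norm_num, rpow_add (by linarith), rpow_one] at h7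
    have h8 : 1 + |r.im| ≤ 2 * l * ‖r‖ := by nlinarith [abs_im_le_norm r, norm_nonneg r]
    rw [norm_mul]
    refine mul_le_mul (by linarith) (h7.trans ?_) (norm_nonneg _) (by norm_num)
    gcongr
  have h3 : ‖(1 - gammaRatio n r * swapFactor r) / (2 * r)‖ ≤ (1 + 2 * C₂) * l * P := by
    rw [norm_div, norm_mul, show ‖(2 : ℂ)‖ = 2 by norm_num, div_le_iff₀ (by positivity)]
    refine (norm_sub_le _ _).trans ?_
    rw [norm_one]; nlinarith
  rw [densityFull_of_ne hn hr0]; exact (norm_add_le_of_le h1 h3).trans (by linarith)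

lemma RatiosConjecture.norm_logDeriv_xi_le {a : ℝ} (ha' : a ≤ 0) (hR : RatiosConjecture a) :
    ∃ C : ℝ, 0 < C ∧ ∀ (n : ℕ) (l : ℝ) (r : ℂ), 1 ≤ n → 8 ≤ l → r.re = 1 / l →
    ‖logDeriv (xi n) r‖ ≤ C * l * (1 + ln n) * (1 + |r.im|) ^ (1 / 8 : ℝ) := by
  obtain ⟨C, hC0, hC⟩ := HeckeFamily.norm_logDeriv_xi_le
  refine ⟨5 * C, by positivity, fun n l r hn hl hr => ?_⟩
  have hl0 : 0 < l := by linarith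
  have hδ : 1 / l ≤ 1 / 8 := one_div_le_one_div_of_le (by norm_num) hl
  have hδ0 : 0 < 1 / l := by positivity
  have h := (evenEntire_xi hn).norm_logDeriv_le_of_dist (z := 1 + I * r.im) (w := r) (d := 1 / l)
    (by simp; norm_num) hδ0 fun ρ hρ => by
      refine le_trans ?_ (abs_re_le_norm _)
      rw [sub_re, hr]; exact hR.le_abs_re_sub ha' hn hρ hδ0 hδ
  have hz := hC n hn (1 + I * r.im) (by simp)
  have him : (1 + I * r.im : ℂ).im = r.im := by simp
  have hre : (1 + I * r.im : ℂ).re = 1 := by simp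
  have hd : ‖1 + I * r.im - r‖ = 1 - 1 / l := by
    rw [show 1 + I * r.im - r = ((1 - r.re : ℝ) : ℂ) by apply Complex.ext <;> simp, norm_real, hr,
      Real.norm_of_nonneg (by linarith)]
  rw [him] at hz
  rw [hd, hre, div_div_eq_mul_div, div_one] at h
  have h2 := re_le_norm (logDeriv (xi n) (1 + I * r.im))
  have h3 := norm_nonneg (logDeriv (xi n) (1 + I * r.im))
  set q := ‖logDeriv (xi n) (1 + I * r.im)‖
  have h4 : (1 - 1 / l) * (1 + (1 - 1 / l) * l) ≤ l := by
    have : 1 / l * l = 1 := by field_simp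
    nlinarith
  have h5 : (1 - 1 / l) * (1 + (1 - 1 / l) * l) *
      ((logDeriv (xi n) (1 + I * r.im)).re / (1 - 1 / 2)) ≤ l * (2 * q) :=
    (mul_le_mul_of_nonneg_left (by rw [div_le_iff₀ (by norm_num)]; linarith : _ ≤ 2 * q) (mul_nonneg (by linarith)
      (by nlinarith))).trans (mul_le_mul_of_nonneg_right h4 (by linarith))
  nlinarith

lemma RatiosConjecture.norm_sum_logDeriv_xi_sub_le {a : ℝ} (ha' : a ≤ 0)
    (hR : RatiosConjecture a) : ∃ C : ℝ, 0 < C ∧ ∃ N₀ : ℕ, ∀ N : ℕ, N₀ ≤ N → ∀ r : ℂ,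
    r.re = 1 / ln N → |r.im| ≤ (N : ℝ) ^ (1 / 2 : ℝ) →
    ‖∑ n ∈ Icc 1 N, logDeriv (xi n) r - ∑ n ∈ Icc 1 N, (archPart n r + densityFull n r)‖ ≤
      C * (N : ℝ) ^ (3 / 4 : ℝ) * ln N := by
  obtain ⟨C, N₀, h⟩ := hR.norm_sum_logDeriv_sub_le ha'
  obtain ⟨N₁, hN₁⟩ := eventually_atTop.1
    (tendsto_log_natCast.eventually_ge_atTop 8)
  refine ⟨|C| + 1, by positivity, max N₀ N₁, fun N hN r hr hi => ?_⟩
  have hl := hN₁ N (le_trans (le_max_right _ _) hN)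
  have hδ : 1 / ln N ≤ 1 / 8 := one_div_le_one_div_of_le (by norm_num) hl
  have hδ0 : 0 < 1 / ln N := by positivity
  have h1 := h N (le_trans (le_max_left _ _) hN) r hr hi
  rw [← sum_sub_distrib] at h1 ⊢
  rw [sum_congr rfl fun n hn => show logDeriv (xi n) r - (archPart n r + densityFull n r) =
    logDeriv (familyL n) (1 / 2 + r) - densityFull n r by
      have hn := (mem_Icc.1 hn).1
      rw [logDeriv_xi hn (by linarith) (hR.familyL_ne_zero ha' hn (by linarith) (by linarith)),
        archPart]
      ring]
  refine h1.trans ?_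
  have := le_abs_self C
  gcongr
  linarith

/-- The average of `ξ' / ξ` over the family, near the critical line, in the scaled variable. -/
def averageLogDeriv (N : ℕ) (v : ℝ) : ℂ :=
  1 / (N * ln N) * ∑ n ∈ Icc 1 N, logDeriv (xi n) ((1 + I * (π * v)) / ln N)

lemma scaled_re (N : ℕ) (v : ℝ) :
    ((1 + I * (π * v)) / ln N : ℂ).re = 1 / ln N := by
  rw [div_ofReal_re]; simp

lemma abs_scaled_im_le {N : ℕ} (hl : 8 ≤ ln N) (v : ℝ) :
    |((1 + I * (π * v)) / ln N : ℂ).im| ≤ |v| := by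
  have : (1 + I * (π * v) : ℂ).im = π * v := by simp
  rw [div_ofReal_im, this, abs_div, abs_mul, abs_of_pos pi_pos,
    abs_of_pos (by linarith : 0 < ln N), div_le_iff₀ (by linarith)]
  nlinarith [Real.pi_lt_four, abs_nonneg v]

lemma norm_averageLogDeriv_le_of {N : ℕ} (hN : 1 ≤ N) (hl : 8 ≤ ln N) {v B : ℝ}
    (h : ‖∑ n ∈ Icc 1 N, logDeriv (xi n) ((1 + I * (π * v)) / ln N)‖ ≤
      N * (ln N * B)) : ‖averageLogDeriv N v‖ ≤ B := by
  have hN0 : (0 : ℝ) < N := mod_cast hN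
  rw [averageLogDeriv, norm_mul, norm_div, norm_one, norm_mul, Complex.norm_natCast, norm_real,
    Real.norm_of_nonneg (by linarith), one_div, inv_mul_le_iff₀ (by positivity), mul_assoc]
  exact h

lemma RatiosConjecture.norm_averageLogDeriv_le {a : ℝ} (ha' : a ≤ 0) (hR : RatiosConjecture a) :
    ∃ C : ℝ, 0 < C ∧ ∃ N₀ : ℕ, ∀ N : ℕ, N₀ ≤ N → ∀ v : ℝ,
    ‖averageLogDeriv N v‖ ≤ C * (1 + |v|) ^ (7 / 10 : ℝ) := by
  obtain ⟨C₁, hC₁0, N₁, hC₁⟩ := hR.norm_sum_logDeriv_xi_sub_le ha'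
  obtain ⟨C₂, hC₂0, hC₂⟩ := norm_archPart_le_log
  obtain ⟨C₃, hC₃0, hC₃⟩ := norm_densityFull_le_mul
  obtain ⟨C₄, hC₄0, hC₄⟩ := hR.norm_logDeriv_xi_le ha'
  obtain ⟨N₂, hN₂⟩ := eventually_atTop.1
    (tendsto_log_natCast.eventually_ge_atTop 8)
  refine ⟨C₁ + 2 * C₂ + C₃ + 32 * C₄, by positivity, max 1 (max N₁ N₂), fun N hN v => ?_⟩
  simp only [max_le_iff] at hN
  have hl := hN₂ N hN.2.2
  have hN1 : (1 : ℝ) ≤ N := mod_cast hN.1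
  refine norm_averageLogDeriv_le_of hN.1 hl ?_
  have hr := scaled_re N v
  have hi := abs_scaled_im_le hl v
  set r : ℂ := (1 + I * (π * v)) / ln N
  set l := ln N
  have hδ : 1 / l ≤ 1 / 8 := one_div_le_one_div_of_le (by norm_num) hl
  have hδ0 : 0 < 1 / l := by positivity
  have hp : 1 ≤ 1 + |v| := by linarith [abs_nonneg v]
  have hP : 1 ≤ (1 + |v|) ^ (7 / 10 : ℝ) := one_le_rpow hp (by norm_num)
  have hPr : (1 + |r.im|) ^ (7 / 10 : ℝ) ≤ (1 + |v|) ^ (7 / 10 : ℝ) := by gcongr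
  set P := (1 + |v|) ^ (7 / 10 : ℝ)
  have hlog : ∀ n ∈ Icc 1 N, 1 ≤ n ∧ 0 ≤ ln n ∧ 1 + ln n ≤ 2 * l := fun n hn => by
    have hn := mem_Icc.1 hn
    have h1 : ln n ≤ l := log_le_log (mod_cast hn.1) (mod_cast hn.2)
    exact ⟨hn.1, log_nonneg (mod_cast hn.1), by linarith⟩
  rcases le_total |r.im| ((N : ℝ) ^ (1 / 2 : ℝ)) with hT | hT
  · have h1 := hC₁ N hN.2.1 r hr hT
    have h2 : ‖∑ n ∈ Icc 1 N, (archPart n r + densityFull n r)‖ ≤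
        N * ((2 * C₂ + C₃) * l * P) := by
      refine (norm_sum_le_of_le _ fun n hn => norm_add_le_of_le
        (r₁ := 2 * C₂ * l * P) (r₂ := C₃ * l * P) ?_ ?_).trans (le_of_eq ?_)
      · obtain ⟨hn1, hn0, hn2⟩ := hlog n hn
        refine (hC₂ n hn1 r (by linarith) (by linarith)).trans ?_
        calc _ ≤ C₂ * (2 * l) * P := by gcongr
          _ = _ := by ring
      · refine (hC₃ n l r (hlog n hn).1 (by linarith) hr).trans ?_
        gcongr
      · rw [sum_Icc_const]
        ring
    have h3 : C₁ * (N : ℝ) ^ (3 / 4 : ℝ) * l ≤ C₁ * N * l := by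
      have := rpow_le_rpow_of_exponent_le hN1 (by norm_num : (3 / 4 : ℝ) ≤ 1)
      rw [rpow_one] at this
      gcongr
    have h4 := norm_add_le_of_le h1 h2
    rw [sub_add_cancel] at h4
    have h5 : C₁ * N * l ≤ C₁ * N * l * P := le_mul_of_one_le_right (by positivity) hP
    have h6 : 0 ≤ 32 * C₄ * N * l * P := by positivity
    linarith
  · have hq : 1 ≤ 1 + |r.im| := by linarith [abs_nonneg r.im]
    have hl16 : l ≤ 16 * (1 + |r.im|) ^ (1 / 8 : ℝ) := by
      have h1 := log_le_rpow_div (x := N) (by positivity) (ε := 1 / 16) (by norm_num)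
      have h2 : (N : ℝ) ^ (1 / 16 : ℝ) ≤ (1 + |r.im|) ^ (1 / 8 : ℝ) := by
        rw [show (1 / 16 : ℝ) = 1 / 2 * (1 / 8) by norm_num, rpow_mul (by positivity)]
        gcongr
        linarith
      linarith
    have hQP : (1 + |r.im|) ^ (1 / 8 : ℝ) * (1 + |r.im|) ^ (1 / 8 : ℝ) ≤ P := by
      rw [← rpow_add (by linarith)]; exact (rpow_le_rpow_of_exponent_le hq (by norm_num)).trans hPr
    have h1 : ‖∑ n ∈ Icc 1 N, logDeriv (xi n) r‖ ≤ N * (C₄ * l * (32 * P)) := by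
      refine (norm_sum_le_of_le _ fun n hn => ?_).trans (le_of_eq (by rw [sum_Icc_const]))
      obtain ⟨hn1, hn0, hn2⟩ := hlog n hn
      refine (hC₄ n l r hn1 hl hr).trans ?_
      rw [mul_assoc (C₄ * l)]
      refine mul_le_mul_of_nonneg_left ?_ (by positivity)
      have h0 : 0 < (1 + |r.im|) ^ (1 / 8 : ℝ) := by positivity
      nlinarith
    have h2 : 0 ≤ N * l * P * (C₁ + 2 * C₂ + C₃) := by positivity
    linarith

lemma RatiosConjecture.tendsto_averageLogDeriv {a : ℝ} (ha' : a ≤ 0) (hR : RatiosConjecture a)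
    (v : ℝ) : Tendsto (fun N => averageLogDeriv N v) atTop
      (nhds (limitDensity (1 + I * (π * v)))) := by
  obtain ⟨C₁, hC₁0, N₁, hC₁⟩ := hR.norm_sum_logDeriv_xi_sub_le ha'
  obtain ⟨C₂, hC₂0, hC₂⟩ := norm_main_sub_limit_le
  have hlog := tendsto_log_natCast
  set s : ℂ := 1 + I * (π * v) with hs
  have hsre : s.re = 1 := by simp [hs]
  have hr0 : Tendsto (fun N : ℕ => s / (ln N : ℂ)) atTop (nhds 0) := by
    rw [tendsto_zero_iff_norm_tendsto_zero]
    refine (hlog.const_div_atTop ‖s‖).congr' ?_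
    filter_upwards [hlog.eventually_ge_atTop 1] with N hN
    rw [norm_div, norm_real, Real.norm_of_nonneg (by linarith)]
  have hsw : Tendsto (fun N : ℕ => ‖1 - swapFactor (s / ln N)‖) atTop (nhds 0) := by
    have hc : ContinuousAt swapFactor 0 := (differentiableOn_swapFactor.differentiableAt
      ((isOpen_lt_re _).mem_nhds (by change _ < (0 : ℂ).re; norm_num))).continuousAt
    have := (hc.tendsto.comp hr0).const_sub 1 |>.norm
    rwa [swapFactor_zero, sub_self, norm_zero] at this
  have hpow : Tendsto (fun N : ℕ => (N : ℝ) ^ (-(1 / 4) : ℝ)) atTop (nhds 0) :=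
    (tendsto_rpow_neg_atTop (by norm_num)).comp tendsto_natCast_atTop_atTop
  rw [tendsto_iff_norm_sub_tendsto_zero]
  refine squeeze_zero' (Eventually.of_forall fun N => norm_nonneg _) (g := fun N : ℕ =>
    C₁ * (N : ℝ) ^ (-(1 / 4) : ℝ) + (C₂ + 2) / ln N + ‖1 - swapFactor (s / ln N)‖) ?_ (by
      have := ((hpow.const_mul C₁).add (hlog.const_div_atTop (C₂ + 2))).add hsw
      simpa using this)
  filter_upwards [hlog.eventually_ge_atTop (16 * ‖s‖), hlog.eventually_ge_atTop 8,
    eventually_ge_atTop (max 1 N₁), (tendsto_rpow_atTop (by norm_num : (0 : ℝ) < 1 / 2)).comp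
    tendsto_natCast_atTop_atTop |>.eventually_ge_atTop |v|] with N hN hl hNN hNv
  simp only [comp_apply, max_le_iff] at hNN hNv
  have h1 := hC₁ N hNN.2 (s / ln N) (scaled_re N v) ((abs_scaled_im_le hl v).trans hNv)
  have hN0 : (0 : ℝ) < N := mod_cast hNN.1
  set l := ln N
  have hl0 : 0 < l := by linarith
  have h2 : ‖∑ n ∈ Icc 1 N, (archPart n (s / l) + densityFull n (s / l)) -
      N * (l * limitDensity s)‖ ≤ N * (C₂ + 2 + l * ‖1 - swapFactor (s / l)‖) := by
    have e : (N * (l * limitDensity s) : ℂ) = ∑ n ∈ Icc 1 N, l * limitDensity s := by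
      rw [sum_Icc_const]
    rw [e, ← sum_sub_distrib]
    refine (norm_sum_le_of_le _ fun n hn => hC₂ N n s (mem_Icc.1 hn).1
      (mem_Icc.1 hn).2 hsre hN).trans ?_
    rw [sum_add_distrib, sum_add_distrib, ← mul_sum, sum_Icc_const, sum_Icc_const]
    have := sum_log_sub_log_le N
    linarith
  have h3 := norm_add_le_of_le h1 h2
  rw [sub_add_sub_cancel] at h3
  have e2 : averageLogDeriv N v - limitDensity s = (1 / (N * l) : ℝ) *
      (∑ n ∈ Icc 1 N, logDeriv (xi n) (s / l) - N * (l * limitDensity s)) := by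
    have hNc : (N : ℂ) ≠ 0 := mod_cast hN0.ne'
    have hlc : (l : ℂ) ≠ 0 := ofReal_ne_zero.2 hl0.ne'
    rw [averageLogDeriv, ofReal_div, ofReal_mul, ofReal_one, ofReal_natCast, mul_sub]
    congr 1; field_simp
  rw [e2, norm_mul, norm_real, Real.norm_of_nonneg (by positivity), one_div,
    inv_mul_le_iff₀ (by positivity)]
  refine h3.trans (le_of_eq ?_)
  have e3 : (N : ℝ) ^ (3 / 4 : ℝ) = N * (N : ℝ) ^ (-(1 / 4) : ℝ) := by
    rw [← Real.rpow_one_add' hN0.le (by norm_num)]; norm_num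
  rw [e3]; field_simp; ring

lemma RatiosConjecture.tendsto_sum_realOrdinates {a : ℝ} (ha' : a ≤ 0) (hR : RatiosConjecture a)
    {g : ℂ → ℂ} (hg : IsTest g) :
    Tendsto (fun N : ℕ => (1 / (N : ℂ)) * ∑ n ∈ Icc 1 N, ∑' γ : realOrdinates n,
      (zeroMult n ((γ : ℝ) : ℂ) : ℂ) * g (I * ((γ : ℝ) * (ln N / π) : ℝ))) atTop
      (nhds (∫ v : ℝ, g ((1 / π : ℝ) + I * v) * limitDensity (1 + I * (π * v)))) := by
  obtain ⟨C₁, hC₁0, N₁, hC₁⟩ := hR.norm_averageLogDeriv_le ha'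
  obtain ⟨C₂, hC₂0, hC₂⟩ := hR.norm_logDeriv_xi_le ha'
  have hpi0 := pi_pos
  have hpi : 1 / π < 1 := by rw [div_lt_one hpi0]; linarith [pi_gt_three]
  obtain ⟨K, hK⟩ := hg.decay 1 (by norm_num)
  have hgd : ∀ v : ℝ, ‖g ((1 / π : ℝ) + I * v)‖ ≤ 2 * K * (1 + |v|) ^ (-(2 : ℝ)) := fun v =>
    decay_of_div_one_add_sq (by
      have := hK ((1 / π : ℝ) + I * v) (by
        rw [show ((1 / π : ℝ) + I * v : ℂ).re = 1 / π by simp, abs_of_pos (by positivity)]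
        exact hpi.le)
      simpa using this)
  have hgc : Continuous fun v : ℝ => g ((1 / π : ℝ) + I * v) := by
    refine continuous_line (a := 0) (b := 1) ⟨by positivity, hpi.le⟩ (hg.diff.continuousOn.mono
      fun z hz => ?_)
    exact show |z.re| < 2 from abs_lt.2 ⟨by linarith [hz.1], by linarith [hz.2]⟩
  have hcont : ∀ N n : ℕ, 1 ≤ n → 8 ≤ ln N → Continuous fun v : ℝ =>
      logDeriv (xi n) ((1 + I * (π * v)) / ln N) := fun N n hn hl => by
    have hδ : 1 / ln N ≤ 1 / 8 := one_div_le_one_div_of_le (by norm_num) hl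
    have hδ0 : 0 < 1 / ln N := by positivity
    refine continuous_iff_continuousAt.2 fun v => ContinuousAt.comp
      (f := fun v : ℝ => ((1 + I * (π * v)) / ln N : ℂ))
      (differentiableAt_logDeriv_xi hn fun h => ?_).continuousAt (by fun_prop)
    obtain h | h := hR.re_of_xi_eq_zero ha' hn h
    · rw [scaled_re] at h; linarith
    · rw [scaled_re, abs_of_pos hδ0] at h; linarith
  have hlog8 := tendsto_log_natCast.eventually_ge_atTop 8
  have hdct : Tendsto (fun N : ℕ => ∫ v : ℝ, g ((1 / π : ℝ) + I * v) * averageLogDeriv N v)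
      atTop (nhds (∫ v : ℝ, g ((1 / π : ℝ) + I * v) *
        limitDensity (1 + I * (π * v)))) := by
    refine tendsto_integral_filter_of_dominated_convergence
      (fun v => 2 * K * C₁ * (1 + |v|) ^ (-(13 / 10) : ℝ)) ?_ ?_ (integrable_one_add_abs_rpow.const_mul _) ?_
    · filter_upwards [hlog8] with N hl
      have : Continuous fun v : ℝ => g ((1 / π : ℝ) + I * v) * averageLogDeriv N v :=
        hgc.mul (continuous_const.mul (continuous_finsetSum _ fun n hn =>
          hcont N n (mem_Icc.1 hn).1 hl))
      exact this.aestronglyMeasurable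
    · filter_upwards [eventually_ge_atTop N₁] with N hN
      refine ae_of_all _ fun v => ?_
      rw [norm_mul, show (-(13 / 10) : ℝ) = -2 + 7 / 10 by norm_num, rpow_add (by positivity)]
      calc _ ≤ _ := mul_le_mul (hgd v) (hC₁ N hN v) (norm_nonneg _) ((norm_nonneg _).trans (hgd v))
        _ = _ := by ring
    · exact ae_of_all _ fun v => (hR.tendsto_averageLogDeriv ha' v).const_mul _
  refine hdct.congr' ?_
  filter_upwards [hlog8] with N hl
  have hint : ∀ n ∈ Icc 1 N, Integrable fun v : ℝ => g ((1 / π : ℝ) + I * v) *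
      logDeriv (xi n) ((1 + I * (π * v)) / ln N) := fun n hn => by
    have hn1 := (mem_Icc.1 hn).1
    have hl0 : 0 ≤ ln n := log_nonneg (mod_cast hn1)
    refine integrable_of_continuous_of_decay (hgc.mul (hcont N n hn1 hl))
      (C := 2 * K * (C₂ * ln N * (1 + ln n))) (T := 0) (r := 15 / 8) (by norm_num)
      fun v _ => ?_
    have h1 : ‖logDeriv (xi n) ((1 + I * (π * v)) / ln N)‖ ≤
        C₂ * ln N * (1 + ln n) * (1 + |v|) ^ (1 / 8 : ℝ) := by
      refine (hC₂ n _ _ hn1 hl (scaled_re N v)).trans ?_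
      have := abs_scaled_im_le hl v
      gcongr
    rw [norm_mul, show (-(15 / 8) : ℝ) = -2 + 1 / 8 by norm_num, rpow_add (by positivity)]
    calc _ ≤ _ := mul_le_mul (hgd v) h1 (norm_nonneg _) ((norm_nonneg _).trans (hgd v))
      _ = _ := by ring
  rw [sum_congr rfl fun n hn =>
    (hR.hasSum_realOrdinates ha' hg (mem_Icc.1 hn).1 hl).tsum_eq, ← mul_sum,
    ← integral_finsetSum _ hint, ← mul_assoc, ← integral_const_mul]
  congr 1
  ext v; rw [averageLogDeriv, ← mul_sum]; ring

lemma IsTest.integral_limitDensity {g : ℂ → ℂ} (hg : IsTest g) :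
    ∫ v : ℝ, g ((1 / π : ℝ) + I * v) * limitDensity (1 + I * (π * v)) =
      ∫ y : ℝ, g (I * y) * (1 + Real.sin (2 * π * y) / (2 * π * y) : ℝ) := by
  have hpi0 := pi_pos
  have hpi3 := pi_gt_three
  have hpc : (π : ℂ) ≠ 0 := ofReal_ne_zero.2 hpi0.ne'
  set F : ℂ → ℂ := fun z => 1 + dslope exp 0 (-2 * π * z) with hF
  have hFne : ∀ z : ℂ, z ≠ 0 → F z = 1 + (1 - exp (-2 * π * z)) / (2 * π * z) := fun z hz => by
      have h0 : -2 * π * z ≠ 0 := mul_ne_zero (mul_ne_zero (by norm_num) hpc) hz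
      rw [hF]
      simp only
      rw [dslope_of_ne _ h0, slope_def_field, exp_zero, sub_zero, ← neg_div_neg_eq]; ring_nf
  have hd : Differentiable ℂ (dslope exp 0) := differentiableOn_univ.1
    ((differentiableOn_dslope univ_mem).2 differentiable_exp.differentiableOn)
  have hFd : Differentiable ℂ F := by fun_prop
  obtain ⟨C, hC0, hC⟩ := exists_bound_strip (F := F) (a := 0) (b := 1 / π) (T := 1) (r := 0)
    (C := 2) le_rfl hFd.continuous.continuousOn fun z h0 _ h1 => by
      have hz1 : 1 ≤ ‖z‖ := h1.trans (abs_im_le_norm z)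
      have hz : z ≠ 0 := by rintro rfl; norm_num at hz1
      have h2 : ‖exp (-2 * π * z)‖ ≤ 1 := by
        rw [norm_exp, Real.exp_le_one_iff, mul_assoc, ← neg_mul_eq_neg_mul, neg_re,
          show (2 * (π * z) : ℂ) = ((2 * π : ℝ) : ℂ) * z by push_cast; ring,
          re_ofReal_mul]
        have : 0 ≤ 2 * π * z.re := by positivity
        linarith
      have h3 : ‖(1 - exp (-2 * π * z)) / (2 * π * z)‖ ≤ 1 := by
        rw [norm_div, norm_mul, norm_mul, norm_real, Real.norm_of_nonneg hpi0.le,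
          show ‖(2 : ℂ)‖ = 2 by norm_num, div_le_one (by positivity)]
        refine (norm_sub_le _ _).trans ?_
        rw [norm_one]; nlinarith
      rw [hFne z hz, rpow_zero]
      refine (norm_add_le _ _).trans ?_
      rw [norm_one]; linarith
  have hpi1 : 1 / π < 2 := by rw [div_lt_iff₀ hpi0]; linarith
  obtain ⟨i1, -, e1⟩ := hg.shift le_rfl (by positivity) hpi1 (by norm_num) (fun z _ _ => hFd z) hC
  simp only [ofReal_zero, zero_add] at i1 e1
  have hg0 : ∀ t : ℝ, g (-(I * t)) = g (I * t) := fun t => hg.even _ (by simp)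
  have i2 := i1.comp_neg
  have e2 := integral_neg_eq_self (fun t : ℝ => g (I * t) * F (I * t)) volume
  simp only [ofReal_neg, mul_neg, hg0] at i2 e2
  have hl : ∀ v : ℝ, limitDensity (1 + I * (π * v)) = F ((1 / π : ℝ) + I * v) := by
    intro v
    rw [hFne _ fun h => by simpa [hpi0.ne'] using congrArg re h, limitDensity]
    have : (2 * π * ((1 / π : ℝ) + I * v) : ℂ) = 2 * (1 + I * (π * v)) := by push_cast; field_simp
    rw [show -2 * π * ((1 / π : ℝ) + I * v) = -2 * (1 + I * (π * v)) by
      linear_combination -this, this]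
  simp_rw [hl]
  rw [← e1]
  have h2 : ∫ t : ℝ, g (I * t) * F (I * t) =
      ∫ t : ℝ, 1 / 2 * (g (I * t) * F (I * t) + g (I * t) * F (-(I * t))) := by
    rw [integral_const_mul, integral_add i1 i2, e2]; ring
  rw [h2]
  have h0 : ∀ᵐ t : ℝ, t ≠ 0 := by simp [ae_iff]
  refine integral_congr_ae ?_
  filter_upwards [h0] with t ht
  have hIt : I * (t : ℂ) ≠ 0 := mul_ne_zero I_ne_zero (ofReal_ne_zero.2 ht)
  have htc : (t : ℂ) ≠ 0 := ofReal_ne_zero.2 ht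
  rw [hFne _ hIt, hFne _ (neg_ne_zero.2 hIt)]; push_cast
  rw [sin, show -2 * π * (I * t) = -(2 * π * t) * I by ring,
    show -2 * π * -(I * t) = 2 * π * t * I by ring]
  field_simp
  linear_combination -(g (I * t)) * (exp (-(2 * I * t * π)) - exp (2 * I * t * π)) * I_sq

end

end HeckeFamily

theorem theorem4
    (a : ℝ) (ha : -(1 / 4) ≤ a) (ha' : a ≤ 0) (hR : HeckeFamily.RatiosConjecture a)
    (f : ℂ → ℂ)
    (hf_hol : DifferentiableOn ℂ f {z : ℂ | |z.im| < 2})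
    (hf_even : ∀ z : ℂ, |z.im| < 2 → f (-z) = f z)
    (hf_real : ∀ x : ℝ, (f x).im = 0)
    (hf_decay : ∀ σ : ℝ, σ < 2 → ∃ C : ℝ, ∀ z : ℂ, |z.im| ≤ σ → ‖f z‖ ≤ C / (1 + z.re ^ 2)) :
    -- the one-level density: the sums and integrals converge, and the formula holds
    (∀ n : ℕ, 1 ≤ n →
      Summable fun γ : HeckeFamily.ordinates n => (HeckeFamily.zeroMult n γ : ℂ) * f γ) ∧
    (∀ N : ℕ, 1 ≤ N →
      Integrable fun t : ℝ => f t * ∑ n ∈ Finset.Icc 1 N, HeckeFamily.densityTerm n t) ∧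
    (∀ ε : ℝ, 0 < ε →
      (fun N : ℕ =>
        (1 / (N : ℂ)) * (∑ n ∈ Finset.Icc 1 N,
            ∑' γ : HeckeFamily.ordinates n, (HeckeFamily.zeroMult n γ : ℂ) * f γ) -
          (1 / (2 * (Real.pi : ℂ) * N)) *
            ∫ t : ℝ, f t * ∑ n ∈ Finset.Icc 1 N, HeckeFamily.densityTerm n t)
        =O[atTop] fun N : ℕ => (N : ℝ) ^ (-(1 / 2) + ε)) ∧
    -- the scaling limit
    (∀ n N : ℕ, 1 ≤ n → 2 ≤ N →
      Summable fun γ : HeckeFamily.realOrdinates n =>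
        (HeckeFamily.zeroMult n ((γ : ℝ) : ℂ) : ℂ) *
          f (((γ : ℝ) * Real.log N / Real.pi : ℝ) : ℂ)) ∧
    Tendsto
      (fun N : ℕ => (1 / (N : ℂ)) * ∑ n ∈ Finset.Icc 1 N,
        ∑' γ : HeckeFamily.realOrdinates n,
          (HeckeFamily.zeroMult n ((γ : ℝ) : ℂ) : ℂ) *
            f (((γ : ℝ) * Real.log N / Real.pi : ℝ) : ℂ))
      atTop
      (nhds (∫ y : ℝ, f y * (1 + Real.sin (2 * Real.pi * y) / (2 * Real.pi * y) : ℝ))) := by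
  have hmap : ∀ z : ℂ, |z.re| < 2 → |(-I * z).im| < 2 := fun z hz => by simpa using hz
  have hg : HeckeFamily.IsTest fun z => f (-I * z) :=
    { diff := hf_hol.comp (by fun_prop) hmap
      even := fun z hz => by rw [mul_neg]; exact hf_even _ (hmap z hz)
      decay := fun σ hσ => by
        obtain ⟨C, hC⟩ := hf_decay σ hσ
        exact ⟨C, fun z hz => by simpa using hC (-I * z) (by simpa using hz)⟩ }
  have hI : ∀ z : ℂ, -I * (I * z) = z := fun z => by
    rw [← mul_assoc, neg_mul, I_mul_I, neg_neg, one_mul]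
  have hint : ∀ n : ℕ, 1 ≤ n → Integrable fun t : ℝ => f t * HeckeFamily.densityTerm n t :=
    fun n hn => by simpa only [hI] using (hg.integral_density hn).1
  have hreal : ∀ (N n : ℕ) (γ : HeckeFamily.realOrdinates n),
      (HeckeFamily.zeroMult n ((γ : ℝ) : ℂ) : ℂ) *
        f (-I * (I * ((γ : ℝ) * (Real.log N / Real.pi) : ℝ))) =
      (HeckeFamily.zeroMult n ((γ : ℝ) : ℂ) : ℂ) *
        f (((γ : ℝ) * Real.log N / Real.pi : ℝ) : ℂ) := fun N n γ => by
    rw [hI, mul_div_assoc]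
  refine ⟨fun n hn => ?_, fun N hN => ?_, fun ε hε => ?_, fun n N hn hN => ?_, ?_⟩
  · simpa only [hI] using (hg.hasSum_ordinates hn).summable
  · simp_rw [Finset.mul_sum]
    exact integrable_finsetSum _ fun n hn => hint n (Finset.mem_Icc.1 hn).1
  · obtain ⟨C, hC0, hC⟩ := hg.norm_sum_ordinates_sub_le
    refine IsBigO.of_bound C ?_
    filter_upwards [eventually_ge_atTop 1] with N hN
    have h := hC N hN
    simp only [hI] at h
    have hN1 : (1 : ℝ) ≤ N := by exact_mod_cast hN
    simp_rw [Finset.mul_sum (Finset.Icc 1 N)]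
    rw [integral_finsetSum _ fun n hn => hint n (Finset.mem_Icc.1 hn).1, ← Finset.mul_sum,
      show (1 / (2 * (Real.pi : ℂ) * N)) = 1 / N * (1 / (2 * Real.pi)) by
        rw [one_div_mul_one_div, mul_comm (N : ℂ)], mul_assoc, ← mul_sub, norm_mul, norm_div,
      norm_one, Complex.norm_natCast, Real.norm_of_nonneg (by positivity)]
    calc _ ≤ 1 / (N : ℝ) * (C * (N : ℝ) ^ (1 / 2 : ℝ)) := by gcongr
      _ = C * (N : ℝ) ^ (-(1 / 2) : ℝ) := by
        rw [show (-(1 / 2) : ℝ) = 1 / 2 - 1 by norm_num, Real.rpow_sub_one (by positivity)]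
        ring
      _ ≤ _ := by gcongr <;> linarith
  · have hl : 0 < Real.log N := Real.log_pos (by exact_mod_cast (by omega : 1 < N))
    simpa only [hreal] using hg.summable_realOrdinates hn (c := Real.log N / Real.pi)
      (div_pos hl Real.pi_pos)
  · have h := hR.tendsto_sum_realOrdinates ha' hg
    rw [hg.integral_limitDensity] at h
    simp only [hreal] at h
    simpa only [hI] using h
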